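/- Let $l$ and $D$ be positive integers with $D\equiv 0$ or $3 \pmod 4$, and let $S=\begin{bmatrix}a&b/2\\b/2&c\end{bmatrix}$ be $\begin{bmatrix}D/4&0\\0&1\end{bmatrix}$ if $D\equiv0\pmod 4$ and $\begin{bmatrix}(1+D)/4&1/2\\1/2&1\end{bmatrix}$ if $D\equiv3\pmod 4$; so $c=1$ and $4ac-b^2=D$. Let $J=\begin{bmatrix}0&1_2\\-1_2&0\end{bmatrix}$. *Groups.* Let $H=\mathrm{GSp}_4(\mathbb R)=\{h:{}^thJh=\mu(h)J,\ \mu(h)\in\mathbb R^\times\}$ and $G=\mathrm{GU}(2,2)=\{g\in\mathrm{GL}_4(\mathbb C):{}^t\bar gJg=\mu(g)J,\ \mu(g)\in\mathbb R^\times\}$. For $g=\begin{bmatrix}A&B\\C&E\end{bmatrix}$ put $g\langle Z\rangle=(AZ+B)(CZ+E)^{-1}$, $J(g,Z)=CZ+E$, and let $I=\mathrm{diag}(i,i)$, $K_\infty=\{k\in G:\mu(k)=1,\ k\langle I\rangle=I\}$, $K=K_\infty\cap H$. Let $T=\{t\in\mathrm{GL}_2(\mathbb R):{}^ttSt=\det(t)S\}$,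 embedded in $H$ by $t\mapsto\mathrm{diag}(t,\det(t)\,{}^tt^{-1})$, let $U=\{\begin{bmatrix}1&X\\&1\end{bmatrix}:{}^tX=X\}$ and $R=TU$. *Bessel function.* Let $B(h)=\mu(h)^l\,\overline{\det J(h,I)^{-l}}\,e^{-2\pi i\,\mathrm{tr}(S\overline{h\langle I\rangle})}$ if $\mu(h)>0$, and $B(h)=0$ otherwise. *Representation of $\mathrm{GL}_2(\mathbb R)$.* Let $\tau$ be a generic, irreducible, admissible representation of $\mathrm{GL}_2(\mathbb R)$, realized (as a $(\mathfrak g,\mathrm O(2))$-module) in its Whittaker model $V_\tau$ with respect to $x\mapsto e^{2\pi icx}$, a space of smooth, $\mathrm O(2)$-finite functions of moderate growth. Let $\omega_\tau$ be its central character, with $\omega_\tau(y)=y^q$ for $y>0$, $q\in\mathbb C$, and let $r\in\mathbb C$ be such that $\Delta=\frac14(H_0^2+2R_0L_0+2L_0R_0)$ acts on $V_\tau$ by $-(\frac14+(\frac r2)^2)$, where $H_0=\mathrm{diag}(1,-1)$, $R_0=\begin{bmatrix}0&1\\0&0\end{bmatrix}$, $L_0=\begin{bmatrix}0&0\\1&0\end{bmatrix}$.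 Let $W^{(0)}\in V_\tau$ have weight $l$, that is, $W^{(0)}\big(g\begin{bmatrix}\cos\theta&\sin\theta\\-\sin\theta&\cos\theta\end{bmatrix}\big)=e^{il\theta}W^{(0)}(g)$. Let $\chi_0$ be the character of $\mathbb C^\times$ with $\chi_0|_{\mathbb R^\times}=\omega_\tau$ and $\chi_0(\zeta)=\zeta^{-l}$ for $|\zeta|=1$, and let $\chi(\zeta)=\chi_0(\bar\zeta)^{-1}$. *The function $W^\#$.* Every $g\in G$ can be written $g=m_1m_2nk$ with $m_1=\mathrm{diag}(\zeta,1,\bar\zeta^{-1},1)$, $m_2=\begin{bmatrix}1\\&u\alpha&&u\beta\\&&|u|^2(\alpha\delta-\beta\gamma)\\&u\gamma&&u\delta\end{bmatrix}$, $n=\begin{bmatrix}1&z\\&1\\&&1\\&&-\bar z&1\end{bmatrix}\begin{bmatrix}1&&w&y\\&1&\bar y\\&&1\\&&&1\end{bmatrix}$, $k\in K_\infty$, where $\zeta,u\in\mathbb C^\times$, $A=\begin{bmatrix}\alpha&\beta\\\gamma&\delta\end{bmatrix}\in\mathrm{GL}_2(\mathbb R)$, $z,y\in\mathbb C$, $w\in\mathbb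 R$. Put $$W^\#(g,s)=\big(\,\big||\zeta|^2(|u|^2\det A)^{-1}\big|^{3}\big)^{s+1/2}\det(J(k,I))^{-l}\,\chi(\zeta)\,\chi_0(u)\,W^{(0)}(A).$$ *Measure.* Let $\eta=\begin{bmatrix}1\\\alpha_0&1\\&&1&-\bar\alpha_0\\&&&1\end{bmatrix}$ with $\alpha_0=\frac{b+i\sqrt D}{2c}$. Let $p=(4c^2/D)^{1/4}$, $t_0=\begin{bmatrix}p&0\\-\frac{b}{2c}p&p^{-1}\end{bmatrix}$ and $h(x,y)=\mathrm{diag}\big(x\,t_0\,\mathrm{diag}(y,y^{-1}),\ {}^tt_0^{-1}\mathrm{diag}(y^{-1},y)\big)$ for $x\in\mathbb R^\times$, $y\ge1$. Let $dh$ be the right $H$-invariant, locally finite Borel measure on $R\backslash H$ (unique up to a constant), normalized so that on right $K$-invariant functions it is $\pi\,(y-y^{-3})\,x^{-4}\,dy\,dx$ in the coordinates $R\,h(x,y)\,K$; equivalently, $\{R\,h(x,y)k:1\le x,y\le2,\ k\in K\}$ has volume $\pi\int_1^2\int_1^2(y-y^{-3})x^{-4}\,dy\,dx$. **Claim.** For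 every $s\in\mathbb C$ the function $h\mapsto W^\#(\eta h,s)B(h)$ on $H$ is left $R$-invariant. There are constants $a^+,a^-\in\mathbb C$ with $$W^{(0)}\Big(\begin{bmatrix}t&0\\0&1\end{bmatrix}\Big)=\begin{cases}a^+\,\omega_\tau((4\pi ct)^{1/2})\,W_{\frac l2,\frac{ir}2}(4\pi ct)&(t>0),\\ a^-\,\omega_\tau((-4\pi ct)^{1/2})\,W_{-\frac l2,\frac{ir}2}(-4\pi ct)&(t<0),\end{cases}$$ where $W_{k,m}$ is the classical Whittaker function, such that the following holds. The integral $$Z_\infty(s)=\int_{R\backslash H}W^\#(\eta h,s)\,B(h)\,dh$$ converges absolutely whenever $\mathrm{Re}(6s+l-q)>1$ and $\mathrm{Re}(3s+l-1\pm\frac{ir}2-\frac q2)>0$, and for these $s$ $$Z_\infty(s)=\frac{a^+}2\,\pi\,D^{-3s-\frac l2+\frac q2}\,(4\pi)^{-3s+\frac32-l+q}\,\frac{\Gamma(3s+l-1+\frac{ir}2-\frac q2)\,\Gamma(3s+l-1-\frac{ir}2-\frac q2)}{\Gamma(3s+\frac{l+1-q}2)}.\qquad(*)$$ The right-hand side of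 $(*)$ is meromorphic on $\mathbb C$, so that it is the meromorphic continuation of $Z_\infty$ (in particular to the half plane $\mathrm{Re}(6s+l-q)>0$). *Special cases* (with the same $a^+$). (i) If $\tau\cong\chi_1\times\chi_2$ is an irreducible principal series representation with $\chi_j(x)=\mathrm{sgn}(x)^{\varepsilon_j}|x|^{s_j}$, $\varepsilon_j\in\{0,1\}$, $s_j\in\mathbb C$, then for $\mathrm{Re}(6s+l-s_1-s_2)>1$ and $\mathrm{Re}(3s+l-1-s_j)>0$ ($j=1,2$) the integral converges absolutely and $$Z_\infty(s)=\frac{a^+}2\pi D^{-3s-\frac l2+\frac{s_1+s_2}2}(4\pi)^{-3s+\frac32-l+s_1+s_2}\frac{\Gamma(3s+l-1-s_1)\Gamma(3s+l-1-s_2)}{\Gamma(3s+\frac{l+1-s_1-s_2}2)}.$$ (ii) If $\tau$ is the discrete series (or limit of discrete series) representation with a lowest weight vector of weight $l_1\ge1$, then for $\mathrm{Re}(6s+l-q)>1$ and $\mathrm{Re}(3s+l-1-\frac{l_1-1}2-\frac q2)>0$ the integral converges absolutely and $$Z_\infty(s)=\frac{a^+}2\pi D^{-3s-\frac l2+\frac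 q2}(4\pi)^{-3s+\frac32-l+q}\frac{\Gamma(3s+l-1+\frac{l_1-1}2-\frac q2)\Gamma(3s+l-1-\frac{l_1-1}2-\frac q2)}{\Gamma(3s+\frac{l+1-q}2)}.$$ -/

import Mathlib

open Matrix MeasureTheory

noncomputable section

namespace BesselZeta

/-! ### The groups -/

/-- The index set of `4 × 4` matrices, split in blocks of size two. -/
abbrev I4 : Type := Fin 2 ⊕ Fin 2

/-- The skew form `J = [0, 1; -1, 0]`. -/
def formJ (R : Type) [CommRing R] : Matrix I4 I4 R := fromBlocks 0 1 (-1) 0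

/-- The group `H(ℝ) = GSp₄(ℝ)` of all `g` with `ᵗg J g = μ J` for some `μ ∈ ℝˣ`. -/
def GSp4 : Subgroup (GL I4 ℝ) where
  carrier := {g | ∃ m : ℝˣ, (g : Matrix I4 I4 ℝ)ᵀ * formJ ℝ * (g : Matrix I4 I4 ℝ)
    = (m : ℝ) • formJ ℝ}
  one_mem' := ⟨1, by simp⟩
  mul_mem' := by
    rintro g h ⟨m, hm⟩ ⟨n, hn⟩
    refine ⟨m * n, ?_⟩
    have e : ((g * h : GL I4 ℝ) : Matrix I4 I4 ℝ)ᵀ * formJ ℝ * ((g * h : GL I4 ℝ) : Matrix I4 I4 ℝ)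
        = (h : Matrix I4 I4 ℝ)ᵀ * ((g : Matrix I4 I4 ℝ)ᵀ * formJ ℝ * (g : Matrix I4 I4 ℝ))
          * (h : Matrix I4 I4 ℝ) := by
      simp only [Units.val_mul, transpose_mul, Matrix.mul_assoc]
    rw [e, hm, Matrix.mul_smul, Matrix.smul_mul, hn, smul_smul, Units.val_mul]
  inv_mem' := by
    rintro g ⟨m, hm⟩
    refine ⟨m⁻¹, ?_⟩
    have h1 : (g : Matrix I4 I4 ℝ) * ((g⁻¹ : GL I4 ℝ) : Matrix I4 I4 ℝ) = 1 := by
      rw [← Units.val_mul, mul_inv_cancel, Units.val_one]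
    have h2 : ((g⁻¹ : GL I4 ℝ) : Matrix I4 I4 ℝ)ᵀ * (g : Matrix I4 I4 ℝ)ᵀ = 1 := by
      rw [← transpose_mul, h1, transpose_one]
    have e : formJ ℝ = (m : ℝ) • (((g⁻¹ : GL I4 ℝ) : Matrix I4 I4 ℝ)ᵀ * formJ ℝ *
        ((g⁻¹ : GL I4 ℝ) : Matrix I4 I4 ℝ)) := by
      calc formJ ℝ = (((g⁻¹ : GL I4 ℝ) : Matrix I4 I4 ℝ)ᵀ * (g : Matrix I4 I4 ℝ)ᵀ) * formJ ℝ *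
              ((g : Matrix I4 I4 ℝ) * ((g⁻¹ : GL I4 ℝ) : Matrix I4 I4 ℝ)) := by
            rw [h1, h2]; simp
        _ = ((g⁻¹ : GL I4 ℝ) : Matrix I4 I4 ℝ)ᵀ * ((g : Matrix I4 I4 ℝ)ᵀ * formJ ℝ *
              (g : Matrix I4 I4 ℝ)) * ((g⁻¹ : GL I4 ℝ) : Matrix I4 I4 ℝ) := by
            simp only [Matrix.mul_assoc]
        _ = _ := by rw [hm, Matrix.mul_smul, Matrix.smul_mul]
    conv_rhs => rw [e]
    rw [smul_smul, ← Units.val_mul, inv_mul_cancel, Units.val_one, one_smul]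

/-- The multiplier `μ(h)`, read off from the entry of `ᵗh J h = μ(h) J` at which `J` is `1`. -/
def mult (h : Matrix I4 I4 ℝ) : ℝ := (hᵀ * formJ ℝ * h) (Sum.inl 0) (Sum.inr 0)

/-- Entrywise inclusion of real matrices in complex matrices. -/
def toC {n : Type} (g : Matrix n n ℝ) : Matrix n n ℂ := g.map Complex.ofReal

/-- The point `I = diag(i, i)` of the symmetric domain. -/
def basePoint : Matrix (Fin 2) (Fin 2) ℂ := Complex.I • 1

/-- The automorphy factor `J(g, Z) = C Z + D`. -/
def autFactor (g : Matrix I4 I4 ℂ) (Z : Matrix (Fin 2) (Fin 2) ℂ) : Matrix (Fin 2) (Fin 2) ℂ :=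
  g.toBlocks₂₁ * Z + g.toBlocks₂₂

/-- The action `g⟨Z⟩ = (A Z + B)(C Z + D)⁻¹`. -/
def act (g : Matrix I4 I4 ℂ) (Z : Matrix (Fin 2) (Fin 2) ℂ) : Matrix (Fin 2) (Fin 2) ℂ :=
  (g.toBlocks₁₁ * Z + g.toBlocks₁₂) * (autFactor g Z)⁻¹

/-- The maximal compact subgroup `K_∞` of `GU(2,2)⁺`: multiplier `1` and fixing `I`. -/
def KInf : Set (Matrix I4 I4 ℂ) :=
  {k | kᴴ * formJ ℂ * k = formJ ℂ ∧ act k basePoint = basePoint}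

/-! ### Bessel subgroup and Bessel function -/

/-- A real binary quadratic form, given by the matrix `S = [a, b/2; b/2, c]`. -/
structure BForm where
  /-- upper left entry -/
  a : ℝ
  /-- twice the off-diagonal entry -/
  b : ℝ
  /-- lower right entry -/
  c : ℝ

/-- The symmetric matrix `S`. -/
def BForm.S (f : BForm) : Matrix (Fin 2) (Fin 2) ℝ := !![f.a, f.b / 2; f.b / 2, f.c]

/-- `4ac - b²`, which is `D` for the forms below. -/
def BForm.D (f : BForm) : ℝ := 4 * f.a * f.c - f.b ^ 2

/-- The form `S(-D)`: `[D/4, 0; 0, 1]` if `4 ∣ D`, and `[(1+D)/4, 1/2; 1/2, 1]` otherwise. -/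
def formOf (D : ℕ) : BForm :=
  if D % 4 = 0 then ⟨D / 4, 0, 1⟩ else ⟨(1 + D) / 4, 1, 1⟩

/-- The group `T(ℝ) = {g ∈ GL₂(ℝ) : ᵗg S g = det(g) S}`. -/
def torus (f : BForm) : Subgroup (GL (Fin 2) ℝ) where
  carrier := {g | (g : Matrix (Fin 2) (Fin 2) ℝ)ᵀ * f.S * (g : Matrix (Fin 2) (Fin 2) ℝ)
    = (g : Matrix (Fin 2) (Fin 2) ℝ).det • f.S}
  one_mem' := by simp
  mul_mem' := by
    intro g h hg hh
    simp only [Set.mem_ofPred_eq] at hg hh ⊢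
    have e : ((g * h : GL (Fin 2) ℝ) : Matrix (Fin 2) (Fin 2) ℝ)ᵀ * f.S *
        ((g * h : GL (Fin 2) ℝ) : Matrix (Fin 2) (Fin 2) ℝ)
        = (h : Matrix (Fin 2) (Fin 2) ℝ)ᵀ * ((g : Matrix (Fin 2) (Fin 2) ℝ)ᵀ * f.S *
          (g : Matrix (Fin 2) (Fin 2) ℝ)) * (h : Matrix (Fin 2) (Fin 2) ℝ) := by
      simp only [Units.val_mul, transpose_mul, Matrix.mul_assoc]
    rw [e, hg, Matrix.mul_smul, Matrix.smul_mul, hh, smul_smul, Units.val_mul, det_mul]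
  inv_mem' := by
    intro g hg
    simp only [Set.mem_ofPred_eq] at hg ⊢
    have h1 : (g : Matrix (Fin 2) (Fin 2) ℝ) * ((g⁻¹ : GL (Fin 2) ℝ) : Matrix (Fin 2) (Fin 2) ℝ)
        = 1 := by
      rw [← Units.val_mul, mul_inv_cancel, Units.val_one]
    have h2 : ((g⁻¹ : GL (Fin 2) ℝ) : Matrix (Fin 2) (Fin 2) ℝ)ᵀ *
        (g : Matrix (Fin 2) (Fin 2) ℝ)ᵀ = 1 := by
      rw [← transpose_mul, h1, transpose_one]
    have h3 : ((g⁻¹ : GL (Fin 2) ℝ) : Matrix (Fin 2) (Fin 2) ℝ).det *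
        (g : Matrix (Fin 2) (Fin 2) ℝ).det = 1 := by
      rw [mul_comm, ← det_mul, h1, det_one]
    have e : f.S = (g : Matrix (Fin 2) (Fin 2) ℝ).det •
        (((g⁻¹ : GL (Fin 2) ℝ) : Matrix (Fin 2) (Fin 2) ℝ)ᵀ * f.S *
        ((g⁻¹ : GL (Fin 2) ℝ) : Matrix (Fin 2) (Fin 2) ℝ)) := by
      calc f.S = (((g⁻¹ : GL (Fin 2) ℝ) : Matrix (Fin 2) (Fin 2) ℝ)ᵀ *
              (g : Matrix (Fin 2) (Fin 2) ℝ)ᵀ) * f.S * ((g : Matrix (Fin 2) (Fin 2) ℝ) *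
              ((g⁻¹ : GL (Fin 2) ℝ) : Matrix (Fin 2) (Fin 2) ℝ)) := by
            rw [h1, h2]; simp
        _ = ((g⁻¹ : GL (Fin 2) ℝ) : Matrix (Fin 2) (Fin 2) ℝ)ᵀ *
              ((g : Matrix (Fin 2) (Fin 2) ℝ)ᵀ * f.S * (g : Matrix (Fin 2) (Fin 2) ℝ)) *
              ((g⁻¹ : GL (Fin 2) ℝ) : Matrix (Fin 2) (Fin 2) ℝ) := by
            simp only [Matrix.mul_assoc]
        _ = _ := by rw [hg, Matrix.mul_smul, Matrix.smul_mul]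
    conv_rhs => rw [e]
    rw [smul_smul, h3, one_smul]

/-- The embedding `g ↦ [g, 0; 0, det(g) ᵗg⁻¹]` of `GL₂` into `GSp₄`, on matrices. -/
def levi (t : GL (Fin 2) ℝ) : Matrix I4 I4 ℝ :=
  fromBlocks (t : Matrix (Fin 2) (Fin 2) ℝ) 0 0
    ((t : Matrix (Fin 2) (Fin 2) ℝ).det • ((t⁻¹ : GL (Fin 2) ℝ) : Matrix (Fin 2) (Fin 2) ℝ)ᵀ)

/-- The unipotent matrix `[1, X; 0, 1]`. -/
def unip (X : Matrix (Fin 2) (Fin 2) ℝ) : Matrix I4 I4 ℝ := fromBlocks 1 X 0 1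

theorem levi_one : levi 1 = 1 := by
  simp [levi]

theorem unip_zero : unip 0 = 1 := by
  simp [unip]

theorem levi_mul (s t : GL (Fin 2) ℝ) : levi (s * t) = levi s * levi t := by
  simp [levi, fromBlocks_multiply, smul_smul, mul_comm]

theorem unip_mul (X Y : Matrix (Fin 2) (Fin 2) ℝ) : unip X * unip Y = unip (Y + X) := by
  simp [unip, fromBlocks_multiply]

theorem unip_mul_levi (X : Matrix (Fin 2) (Fin 2) ℝ) (t : GL (Fin 2) ℝ) :
    unip X * levi t = levi t * unip ((t : Matrix (Fin 2) (Fin 2) ℝ).det •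
      (((t⁻¹ : GL (Fin 2) ℝ) : Matrix (Fin 2) (Fin 2) ℝ) * X *
        ((t⁻¹ : GL (Fin 2) ℝ) : Matrix (Fin 2) (Fin 2) ℝ)ᵀ)) := by
  have h1 : (t : Matrix (Fin 2) (Fin 2) ℝ) * ((t⁻¹ : GL (Fin 2) ℝ) : Matrix (Fin 2) (Fin 2) ℝ)
      = 1 := by
    rw [← Units.val_mul, mul_inv_cancel, Units.val_one]
  simp only [levi, unip, fromBlocks_multiply, Matrix.mul_smul, ← Matrix.mul_assoc, h1]
  simp

theorem symm_conj (X A : Matrix (Fin 2) (Fin 2) ℝ) (d : ℝ) (hX : Xᵀ = X) :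
    (d • (A * X * Aᵀ))ᵀ = d • (A * X * Aᵀ) := by
  simp [transpose_mul, hX, Matrix.mul_assoc]

/-- The Bessel subgroup `R(ℝ) = T(ℝ) U(ℝ)` of `GSp₄(ℝ)`. -/
def besselR (f : BForm) : Subgroup GSp4 where
  carrier := {h | ∃ t ∈ torus f, ∃ X : Matrix (Fin 2) (Fin 2) ℝ, Xᵀ = X ∧
    ((h : GL I4 ℝ) : Matrix I4 I4 ℝ) = levi t * unip X}
  one_mem' := ⟨1, one_mem _, 0, by simp, by simp [levi_one, unip_zero]⟩
  mul_mem' := by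
    rintro g h ⟨t, ht, X, hX, e⟩ ⟨t', ht', X', hX', e'⟩
    refine ⟨t * t', mul_mem ht ht', X' + (t' : Matrix (Fin 2) (Fin 2) ℝ).det •
      (((t'⁻¹ : GL (Fin 2) ℝ) : Matrix (Fin 2) (Fin 2) ℝ) * X *
        ((t'⁻¹ : GL (Fin 2) ℝ) : Matrix (Fin 2) (Fin 2) ℝ)ᵀ), ?_, ?_⟩
    rotate_left
    · rw [Subgroup.coe_mul, Units.val_mul, e, e', Matrix.mul_assoc, ← Matrix.mul_assoc (unip X),
        unip_mul_levi, Matrix.mul_assoc, unip_mul, ← Matrix.mul_assoc, ← levi_mul]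
    · rw [transpose_add, hX', symm_conj _ _ _ hX]
  inv_mem' := by
    rintro g ⟨t, ht, X, hX, e⟩
    refine ⟨t⁻¹, inv_mem ht, ((t⁻¹ : GL (Fin 2) ℝ) : Matrix (Fin 2) (Fin 2) ℝ).det •
      (((t⁻¹⁻¹ : GL (Fin 2) ℝ) : Matrix (Fin 2) (Fin 2) ℝ) * (-X) *
        ((t⁻¹⁻¹ : GL (Fin 2) ℝ) : Matrix (Fin 2) (Fin 2) ℝ)ᵀ), ?_, ?_⟩
    rotate_left
    · have e2 : ((g : GL I4 ℝ) : Matrix I4 I4 ℝ) * (unip (-X) * levi t⁻¹) = 1 := by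
        rw [e, Matrix.mul_assoc, ← Matrix.mul_assoc (unip X), unip_mul, neg_add_cancel, unip_zero,
          Matrix.one_mul, ← levi_mul, mul_inv_cancel, levi_one]
      have e3 : (((g⁻¹ : GSp4) : GL I4 ℝ) : Matrix I4 I4 ℝ) * ((g : GL I4 ℝ) : Matrix I4 I4 ℝ)
          = 1 := by
        rw [← Units.val_mul, ← Subgroup.coe_mul, inv_mul_cancel, Subgroup.coe_one, Units.val_one]
      rw [left_inv_eq_right_inv e3 e2, unip_mul_levi]
    · exact symm_conj _ _ _ (by rw [transpose_neg, hX])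

/-- The lowest weight Bessel function `B : GSp₄(ℝ) → ℂ` of weight `l`:
`μ(h)^l · conj(det J(h,I)^{-l}) · exp(-2πi tr(S conj(h⟨I⟩)))` if `μ(h) > 0`, and `0` otherwise. -/
def besselB (f : BForm) (l : ℕ) (h : Matrix I4 I4 ℝ) : ℂ :=
  open Classical in
  if 0 < mult h then
    (mult h : ℂ) ^ l * (starRingEnd ℂ) (((autFactor (toC h) basePoint).det) ^ (-(l : ℤ))) *
      Complex.exp (-2 * Real.pi * Complex.I *
        (toC f.S * (act (toC h) basePoint).map (starRingEnd ℂ)).trace)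
  else 0

/-- The element `η`, with `α = (b + √(b² - 4ac)) / (2c)` and `√(-D) = i √D`. -/
def eta (f : BForm) : Matrix I4 I4 ℂ :=
  let α : ℂ := (f.b + Complex.I * Real.sqrt f.D) / (2 * f.c)
  fromBlocks !![1, 0; α, 1] 0 0 !![1, -(starRingEnd ℂ) α; 0, 1]

/-! ### The homogeneous space `R(ℝ) \ H(ℝ)` -/

/-- The space `R(ℝ) \ H(ℝ)` of cosets `R(ℝ) h`. -/
def BesselQuot (f : BForm) : Type := Quotient (QuotientGroup.rightRel (besselR f))

instance (f : BForm) : TopologicalSpace (BesselQuot f) :=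
  inferInstanceAs (TopologicalSpace (Quotient (QuotientGroup.rightRel (besselR f))))

instance (f : BForm) : MeasurableSpace (BesselQuot f) := borel _

instance (f : BForm) : BorelSpace (BesselQuot f) := ⟨rfl⟩

/-- The coset `R(ℝ) h`. -/
def BesselQuot.mk (f : BForm) (h : GSp4) : BesselQuot f :=
  Quotient.mk (QuotientGroup.rightRel (besselR f)) h

/-- A representative of a coset. -/
def BesselQuot.rep {f : BForm} (x : BesselQuot f) : GSp4 := Quotient.out x

/-- The right translation `R(ℝ) x ↦ R(ℝ) x h`. -/
def BesselQuot.rightMul {f : BForm} (h : GSp4) : BesselQuot f → BesselQuot f :=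
  Quotient.map (fun x => x * h) (by
    intro x y hxy
    have hxy' := QuotientGroup.rightRel_apply.mp hxy
    exact QuotientGroup.rightRel_apply.mpr (by simpa [mul_assoc] using hxy'))

/-- A matrix `t₀ ∈ SL₂(ℝ)` with `ᵗt₀ S t₀` scalar, so that `T(ℝ) ∩ SL₂(ℝ) = t₀ SO(2) t₀⁻¹`. -/
def tZero (f : BForm) : Matrix (Fin 2) (Fin 2) ℝ :=
  let p : ℝ := Real.sqrt (2 * f.c / Real.sqrt f.D)
  !![p, 0; -(f.b / (2 * f.c)) * p, p⁻¹]

/-- The double coset representatives `[x t₀ diag(y, y⁻¹), 0; 0, ᵗt₀⁻¹ diag(y⁻¹, y)]`. -/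
def cartan (f : BForm) (x y : ℝ) : Matrix I4 I4 ℝ :=
  fromBlocks (x • (tZero f * !![y, 0; 0, y⁻¹])) 0 0 ((tZero f)⁻¹ᵀ * !![y⁻¹, 0; 0, y])

/-- The compact subset of `R(ℝ) \ H(ℝ)` of the cosets of `cartan x y * k`, where `1 ≤ x ≤ 2`,
`1 ≤ y ≤ 2` and `k` is in the maximal compact subgroup `K_∞ ∩ GSp₄(ℝ)`. -/
def unitBox (f : BForm) : Set (BesselQuot f) :=
  {z | ∃ h : GSp4, z = BesselQuot.mk f h ∧ ∃ x ∈ Set.Icc (1 : ℝ) 2, ∃ y ∈ Set.Icc (1 : ℝ) 2,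
    ∃ k : Matrix I4 I4 ℝ, toC k ∈ KInf ∧ ((h : GL I4 ℝ) : Matrix I4 I4 ℝ) = cartan f x y * k}

/-- `ν` is the `H(ℝ)`-invariant measure `dh` on `R(ℝ) \ H(ℝ)`. Such a measure is unique up to a
constant; the constant is fixed by the volume of one compact set, in such a way that `dh` is
`π (y - y⁻³) x⁻⁴ dy dx` in the coordinates `(x, y)` of `cartan`, with volume one on `K`. -/
structure IsInvariantMeasure (f : BForm) (ν : Measure (BesselQuot f)) : Prop where
  locallyFinite : IsLocallyFiniteMeasure ν
  invariant : ∀ h : GSp4, ν.map (BesselQuot.rightMul h) = ν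
  normalized : ν (unitBox f) =
    ENNReal.ofReal (Real.pi * ∫ x in (1 : ℝ)..2, ∫ y in (1 : ℝ)..2, (y - y⁻¹ ^ 3) * x⁻¹ ^ 4)

/-! ### Representations of `GL₂(ℝ)` -/

/-- The group `GL₂(ℝ)`. -/
abbrev GL2 : Type := GL (Fin 2) ℝ

/-- The matrix `[a, x; 0, d]`. -/
def upper (a d : ℝˣ) (x : ℝ) : GL2 :=
  Matrix.GeneralLinearGroup.mkOfDetNeZero !![(a : ℝ), x; 0, (d : ℝ)]
    (by simp [Matrix.det_fin_two])

/-- The rotation `r(θ) = [cos θ, sin θ; -sin θ, cos θ]`. -/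
def rot (θ : ℝ) : GL2 :=
  Matrix.GeneralLinearGroup.mkOfDetNeZero !![Real.cos θ, Real.sin θ; -Real.sin θ, Real.cos θ]
    (by
      have := Real.cos_sq_add_sin_sq θ
      simp only [Matrix.det_fin_two_of]
      nlinarith)

/-- `exp(X) ∈ GL₂(ℝ)` for `X` in the Lie algebra. -/
def expGL (X : Matrix (Fin 2) (Fin 2) ℝ) : GL2 := (Matrix.isUnit_exp X).unit

/-- The right regular action of the group. -/
def rho (k : GL2) (W : GL2 → ℂ) : GL2 → ℂ := fun g => W (g * k)

/-- The right regular action of the Lie algebra, `(X W)(g) = d/dt W(g exp(tX))` at `t = 0`. -/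
def lie (X : Matrix (Fin 2) (Fin 2) ℝ) (W : GL2 → ℂ) : GL2 → ℂ :=
  fun g => deriv (fun t : ℝ => W (g * expGL (t • X))) 0

/-- The element `R` of the Lie algebra. -/
def lieR : Matrix (Fin 2) (Fin 2) ℝ := !![0, 1; 0, 0]
/-- The element `L` of the Lie algebra. -/
def lieL : Matrix (Fin 2) (Fin 2) ℝ := !![0, 0; 1, 0]
/-- The element `H` of the Lie algebra. -/
def lieH : Matrix (Fin 2) (Fin 2) ℝ := !![1, 0; 0, -1]

/-- The action of `Δ = (H² + 2RL + 2LR) / 4`. -/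
def casimir (W : GL2 → ℂ) : GL2 → ℂ := fun g =>
  (1 / 4 : ℂ) * (lie lieH (lie lieH W) g + 2 * lie lieR (lie lieL W) g
    + 2 * lie lieL (lie lieR W) g)

/-- Smoothness of a function on the open subset `GL₂(ℝ)` of `ℝ⁴`. -/
def IsSmooth (W : GL2 → ℂ) : Prop :=
  ∃ F : (Fin 2 → Fin 2 → ℝ) → ℂ,
    ContDiffOn ℝ ((⊤ : ℕ∞) : WithTop ℕ∞) F {M | (Matrix.of M).det ≠ 0} ∧
    ∀ g : GL2, W g = F (fun i j => (g : Matrix (Fin 2) (Fin 2) ℝ) i j)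

/-- The maximal compact subgroup `O(2)`. -/
def O2 : Set GL2 :=
  {k | (k : Matrix (Fin 2) (Fin 2) ℝ)ᵀ * (k : Matrix (Fin 2) (Fin 2) ℝ) = 1}

/-- `W` lies in a finite-dimensional space containing all its right translates by `O(2)`. -/
def IsKFinite (W : GL2 → ℂ) : Prop :=
  ∃ E : Submodule ℂ (GL2 → ℂ), FiniteDimensional ℂ E ∧ ∀ k ∈ O2, rho k W ∈ E

/-- Moderate growth, in terms of the entries of `g` and `det(g)⁻¹`. -/
def IsModerateGrowth (W : GL2 → ℂ) : Prop :=
  ∃ (C : ℝ) (N : ℕ), ∀ g : GL2, ‖W g‖ ≤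
    C * (1 + (∑ i, ∑ j, |(g : Matrix (Fin 2) (Fin 2) ℝ) i j|)
      + |(g : Matrix (Fin 2) (Fin 2) ℝ).det|⁻¹) ^ N

/-- The space of functions of weight `n`, `W(g r(θ)) = e^{inθ} W(g)`. -/
def weightSpace (n : ℤ) : Submodule ℂ (GL2 → ℂ) where
  carrier := {W | ∀ g θ, W (g * rot θ) = Complex.exp (Complex.I * n * (θ : ℝ)) * W g}
  zero_mem' := by intro g θ; simp
  add_mem' := by
    intro V W hV hW g θ
    simp only [Pi.add_apply, hV g θ, hW g θ, mul_add]
  smul_mem' := by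
    intro a W hW g θ
    simp only [Pi.smul_apply, smul_eq_mul, hW g θ]
    ring

/-- A space of functions that is stable under `O(2)` and under the Lie algebra. -/
def IsGKStable (V : Submodule ℂ (GL2 → ℂ)) : Prop :=
  (∀ k ∈ O2, ∀ W ∈ V, rho k W ∈ V) ∧
  (∀ X : Matrix (Fin 2) (Fin 2) ℝ, ∀ W ∈ V, lie X W ∈ V)

/-- `V` is the Whittaker model, with respect to the character `x ↦ e^{2πicx}` (that is
`x ↦ ψ(-cx)` for `ψ(x) = e^{-2πix}`), of a generic irreducible admissible representation of
`GL₂(ℝ)`: a space of smooth, `K`-finite functions of moderate growth with the Whittaker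
transformation property, which is an irreducible admissible `(𝔤, K)`-module under right
translation. -/
structure IsWhittakerModel (c : ℝ) (V : Submodule ℂ (GL2 → ℂ)) : Prop where
  smooth : ∀ W ∈ V, IsSmooth W
  kFinite : ∀ W ∈ V, IsKFinite W
  moderate : ∀ W ∈ V, IsModerateGrowth W
  whittaker : ∀ W ∈ V, ∀ (x : ℝ) (g : GL2),
    W (upper 1 1 x * g) = Complex.exp (2 * Real.pi * Complex.I * (c * x : ℝ)) * W g
  stable : IsGKStable V
  nontrivial : V ≠ ⊥
  irreducible : ∀ V' : Submodule ℂ (GL2 → ℂ), V' ≤ V → IsGKStable V' → V' = ⊥ ∨ V' = V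
  admissible : ∀ n : ℤ, FiniteDimensional ℂ ↥(V ⊓ weightSpace n)

/-- `ω` is the central character of the representation on `V`. -/
def IsCentralChar (V : Submodule ℂ (GL2 → ℂ)) (ω : ℝˣ →* ℂˣ) : Prop :=
  ∀ W ∈ V, ∀ (z : ℝˣ) (g : GL2), W (upper z z 0 * g) = (ω z : ℂ) * W g

/-- The character `x ↦ sgn(x)^ε |x|^s` of `ℝˣ`, where `ε ∈ {0, 1}`. -/
def quasiChar (ε : Fin 2) (s : ℂ) (x : ℝˣ) : ℂ :=
  ((SignType.sign (x : ℝ) : ℝ) : ℂ) ^ (ε : ℕ) * ((|(x : ℝ)| : ℝ) : ℂ) ^ s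

/-- The space of the principal series representation `χ₁ × χ₂`: the smooth `K`-finite functions
with `f([a, x; 0, d] g) = χ₁(a) χ₂(d) |a/d|^{1/2} f(g)`. -/
def principalSeries (χ₁ χ₂ : ℝˣ → ℂ) : Set (GL2 → ℂ) :=
  {f | IsSmooth f ∧ IsKFinite f ∧ ∀ (a d : ℝˣ) (x : ℝ) (g : GL2),
    f (upper a d x * g) = χ₁ a * χ₂ d * (Real.sqrt |(a : ℝ) / (d : ℝ)| : ℂ) * f g}

/-- The representation on `V` is isomorphic, as a `(𝔤, K)`-module, to the one on `V'`. -/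
def IsGKIso (V : Submodule ℂ (GL2 → ℂ)) (V' : Set (GL2 → ℂ)) : Prop :=
  ∃ e : V →ₗ[ℂ] (GL2 → ℂ), Function.Injective e ∧ Set.range e = V' ∧
    (∀ k ∈ O2, ∀ W W₁ : V, (W₁ : GL2 → ℂ) = rho k W → e W₁ = rho k (e W)) ∧
    (∀ X : Matrix (Fin 2) (Fin 2) ℝ, ∀ W W₁ : V, (W₁ : GL2 → ℂ) = lie X W → e W₁ = lie X (e W))

/-- The irreducible representation on `V` is the (limit of) discrete series representation with
lowest weight `k`: there is a nonzero vector of weight `k` that is annihilated by the lowering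
operator `H - i (R + L)`. -/
def IsDiscreteSeries (k : ℕ) (V : Submodule ℂ (GL2 → ℂ)) : Prop :=
  ∃ W ∈ V, W ≠ 0 ∧ W ∈ weightSpace k ∧
    ∀ g, lie lieH W g - Complex.I * (lie lieR W g + lie lieL W g) = 0

/-! ### Whittaker functions -/

/-- `w` is, on `(0, ∞)`, the solution of Whittaker's differential equation
`w'' + (-1/4 + k/x + (1/4 - m²)/x²) w = 0` with `w(x) ~ e^{-x/2} x^k` as `x → ∞`. These
properties determine `w` on `(0, ∞)`. -/
def IsWhittakerFn (k m : ℂ) (w : ℝ → ℂ) : Prop :=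
  (∃ w' : ℝ → ℂ, ∀ x : ℝ, 0 < x → HasDerivAt w (w' x) x ∧
    HasDerivAt w' (-((-1 / 4 + k / x + (1 / 4 - m ^ 2) / (x : ℂ) ^ 2) * w x)) x) ∧
  Filter.Tendsto (fun x : ℝ => w x * Complex.exp ((x : ℂ) / 2) * (x : ℂ) ^ (-k))
    Filter.atTop (nhds 1)

/-- The classical Whittaker function `W_{k,m}` (used at positive arguments only). -/
def whittakerW (k m : ℂ) : ℝ → ℂ := Classical.epsilon (IsWhittakerFn k m)

/-! ### The function `W^#` and the zeta integral -/

/-- The element of `M⁽¹⁾(ℝ)` with parameter `ζ`. -/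
def leviOne (ζ : ℂˣ) : Matrix I4 I4 ℂ :=
  fromBlocks !![(ζ : ℂ), 0; 0, 1] 0 0 !![((starRingEnd ℂ) (ζ : ℂ))⁻¹, 0; 0, 1]

/-- The element of `M⁽²⁾(ℝ)` that is the image of `(u, A) ∈ ℂˣ × GL₂(ℝ)`. -/
def leviTwo (u : ℂˣ) (A : GL2) : Matrix I4 I4 ℂ :=
  fromBlocks
    !![1, 0; 0, (u : ℂ) * ((A : Matrix (Fin 2) (Fin 2) ℝ) 0 0 : ℝ)]
    !![0, 0; 0, (u : ℂ) * ((A : Matrix (Fin 2) (Fin 2) ℝ) 0 1 : ℝ)]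
    !![0, 0; 0, (u : ℂ) * ((A : Matrix (Fin 2) (Fin 2) ℝ) 1 0 : ℝ)]
    !![((Complex.normSq (u : ℂ) * (A : Matrix (Fin 2) (Fin 2) ℝ).det : ℝ) : ℂ), 0;
       0, (u : ℂ) * ((A : Matrix (Fin 2) (Fin 2) ℝ) 1 1 : ℝ)]

/-- The element of `N(ℝ)` with parameters `z, y ∈ ℂ` and `w ∈ ℝ`. -/
def unipN (z y : ℂ) (w : ℝ) : Matrix I4 I4 ℂ :=
  fromBlocks !![1, z; 0, 1] 0 0 !![1, 0; -(starRingEnd ℂ) z, 1] *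
    fromBlocks 1 !![(w : ℂ), y; (starRingEnd ℂ) y, 0] 0 1

/-- The data of a factorization `m₁ m₂ n k` in `M⁽¹⁾(ℝ) M⁽²⁾(ℝ) N(ℝ) K_∞`, where `m₂` is written as
the image of a pair `(u, A)`. -/
structure Factorization (g : Matrix I4 I4 ℂ) where
  /-- the parameter of `m₁` -/
  ζ : ℂˣ
  /-- the scalar part of `m₂` -/
  u : ℂˣ
  /-- the real part of `m₂` -/
  A : GL2
  /-- a parameter of `n` -/
  z : ℂ
  /-- a parameter of `n` -/
  y : ℂ
  /-- a parameter of `n` -/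
  w : ℝ
  /-- the compact component -/
  k : Matrix I4 I4 ℂ
  k_mem : k ∈ KInf
  eq : g = leviOne ζ * leviTwo u A * unipN z y w * k

/-- The modular factor `δ_P(m₁ m₂) = |N(ζ) μ⁻¹|³`, with `μ = N(u) det A`. -/
def Factorization.modulus {g : Matrix I4 I4 ℂ} (d : Factorization g) : ℝ :=
  |Complex.normSq (d.ζ : ℂ) *
    (Complex.normSq (d.u : ℂ) * (d.A : Matrix (Fin 2) (Fin 2) ℝ).det)⁻¹| ^ 3

/-- `W^#(g, s) = δ_P^{s+1/2}(m₁ m₂) det(J(k, I))^{-l} χ(m₁) W⁽⁰⁾(m₂)` for `g = m₁ m₂ n k`. Here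
`χ(ζ) = χ₀(conj ζ)⁻¹`, and `W⁽⁰⁾` is extended to `M⁽²⁾(ℝ)` by `W⁽⁰⁾(u A) = χ₀(u) W⁽⁰⁾(A)`. Every
element of `GU(2,2)` has such a factorization, and the value does not depend on its choice. -/
def WSharp (W₀ : GL2 → ℂ) (χ₀ : ℂˣ →* ℂˣ) (l : ℕ) (g : Matrix I4 I4 ℂ) (s : ℂ) : ℂ :=
  open Classical in
  if hg : Nonempty (Factorization g) then
    let d := Classical.choice hg
    (d.modulus : ℂ) ^ (s + 1 / 2) * ((autFactor d.k basePoint).det) ^ (-(l : ℤ)) *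
      ((χ₀ (Units.map (starRingEnd ℂ : ℂ →* ℂ) d.ζ))⁻¹ : ℂˣ) * (((χ₀ d.u : ℂˣ) : ℂ) * W₀ d.A)
  else 0

/-- The integrand `W^#(η h, s) B(h)`. -/
def integrand (f : BForm) (l : ℕ) (W₀ : GL2 → ℂ) (χ₀ : ℂˣ →* ℂˣ) (s : ℂ) (h : GSp4) : ℂ :=
  WSharp W₀ χ₀ l (eta f * toC ((h : GL I4 ℝ) : Matrix I4 I4 ℝ)) s *
    besselB f l ((h : GL I4 ℝ) : Matrix I4 I4 ℝ)

/-- The integral `Z_∞(s)` of `W^#(η h, s) B(h)` over `R(ℝ) \ H(ℝ)`. -/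
def zetaIntegral (f : BForm) (l : ℕ) (W₀ : GL2 → ℂ) (χ₀ : ℂˣ →* ℂˣ)
    (ν : Measure (BesselQuot f)) (s : ℂ) : ℂ :=
  ∫ x : BesselQuot f, integrand f l W₀ χ₀ s x.rep ∂ν

/-- Absolute convergence of `Z_∞(s)`. -/
def Converges (f : BForm) (l : ℕ) (W₀ : GL2 → ℂ) (χ₀ : ℂˣ →* ℂˣ)
    (ν : Measure (BesselQuot f)) (s : ℂ) : Prop :=
  Integrable (fun x : BesselQuot f => integrand f l W₀ χ₀ s x.rep) ν

/-- The common factor `(a/2) π D^{-3s-l/2+q/2} (4π)^{-3s+3/2-l+q}`. -/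
def zetaFactor (a : ℂ) (D l : ℕ) (q s : ℂ) : ℂ :=
  a / 2 * Real.pi * (D : ℂ) ^ (-3 * s - (l : ℂ) / 2 + q / 2) *
    ((4 * Real.pi : ℝ) : ℂ) ^ (-3 * s + 3 / 2 - (l : ℂ) + q)

/-- The value of a character `ω` of `ℝˣ` at a nonzero real number. -/
def charAt (ω : ℝˣ →* ℂˣ) (x : ℝ) : ℂ :=
  open Classical in if hx : x ≠ 0 then (ω (Units.mk0 x hx) : ℂ) else 0

end BesselZeta

end

/-!
# The archimedean zeta integral of a Bessel function against a Whittaker function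

For `h` of positive multiplier let `Y = Im h⟨I⟩`, `x = √det Y` and `t = tr(SY)`. The evaluation of the
integral rests on the fact that both the integrand and the measure live on these two coordinates.

*The integrand.* An element `g` of `GU(2,2)` is determined up to `K_∞` by its multiplier and by `g⟨I⟩`.
This gives the Iwasawa decomposition (`exists_factorization`), and expresses `W^#(g)` by `g⟨I⟩` and the
automorphy factor (`WSharp_eq`). For `g = ηh` the relevant entry of `g⟨I⟩` is `tr(S h⟨I⟩)`, the automorphy
factors of `W^#` and of `B` combine to a power of `|det J(h, I)|`, the phases in `Re tr(S h⟨I⟩)` cancel,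
and what remains is the function `zetaKernel` of `x` and `t`:
`x^{6s+3+l-q} t^{-3s-3/2} e^{-2πt} W⁰(diag(t, 1))` (`integrand_eq`). As `R` preserves `x` and `t`, the
integrand is left invariant under `R`.

*The measure.* On functions of `x` and `t` the invariant measure is `(π/√D) x⁻⁵ dx dt` on the cone
`0 < √D x < t` (`lintegral_invariantFn`). To see this, integrate over the cosets of `R` to obtain a right
invariant measure on `GSp₄(ℝ)` (`unfolding`). Elements that are conjugate to their inverses have modular
character one, so this measure is also invariant under left translation by the triangular group `Tri`
of the Iwasawa decomposition (`map_mul_left_of_conj_inv`), and by uniqueness of Haar measure it is a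
multiple of `Tri.haar` in the Iwasawa coordinates (`exists_map_coord_eq`). In this way neither the
unimodularity of `GSp₄(ℝ)` nor a Cartan integration formula is needed. The variables other than `x`
and `t` are integrated out by `lintegral_radial`. The constant is found by comparing the volumes of one
set, whose description in terms of `x` and `t` comes from the Cartan decomposition (`mem_unitBox_iff`).

*The integral.* In the coordinates `v = x / t` and `t` the measure is a product (`map_cosetCoord`), and so
is the integrand. The integral over `0 < v < 1/√D` is elementary, and contributes `1 / (6s+l-q-1)`. The
integral over `t` is the Mellin transform of `e^{-x/2} W_{l/2, ir/2}(x)`, a quotient of Gamma functions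
with the denominator `Γ(z)`, `z = 3s + (l-1-q)/2`; since `6s+l-q-1 = 2z`, the two combine to
`1 / (2 Γ(z+1))` (`zeta_evaluation`).

*Whittaker functions.* On `diag(t, 1)` the Casimir operator acts on a vector of weight `l` by Whittaker's
differential operator (`casimir_diagOne`). A solution of moderate growth is a multiple of the Whittaker
function (`WhittakerPair.eq_const_mul`), which gives the constants `a⁺` and `a⁻` (`exists_whittaker_eq`).
Existence of the Whittaker function and its Mellin transform come from Tricomi's integral when
`Re(m + 1/2 - k) > 0`, and extend to all `k` by the raising recurrence (`WhittakerPair.raise`).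

*Special cases.* The Casimir eigenvalue determines `r` up to sign. It is computed on functions in the
principal series (`principalSeries_parameters`), and on a lowest weight vector
(`IsDiscreteSeries.eigenvalue`).
-/

noncomputable section

namespace BesselZeta

/-! ### Differentiation along the Lie algebra of `GL₂(ℝ)` -/

section

open Filter Topology Set

/-- The normed space of `2 × 2` arrays, on which smoothness is tested. -/
abbrev Arr2 : Type := Fin 2 → Fin 2 → ℝ

theorem isOpen_det_ne_zero : IsOpen {M : Arr2 | (Matrix.of M).det ≠ 0} := by
  have : Continuous fun M : Arr2 => (Matrix.of M).det := by
    simp only [Matrix.det_fin_two, Matrix.of_apply]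
    fun_prop
  exact this.isOpen_preimage _ isOpen_ne

theorem GL2.mem_det_ne_zero (g : GL2) :
    (fun i j => (g : Matrix (Fin 2) (Fin 2) ℝ) i j) ∈ {M : Arr2 | (Matrix.of M).det ≠ 0} :=
  ((Matrix.isUnit_iff_isUnit_det _).1 g.isUnit).ne_zero

/-- Right multiplication by `X`. -/
def rightMulArr (X : Matrix (Fin 2) (Fin 2) ℝ) : Arr2 →L[ℝ] Arr2 :=
  LinearMap.toContinuousLinearMap
    { toFun := fun M i j => ((Matrix.of M) * X) i j
      map_add' := by
        intro M N; ext i j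
        simp [Matrix.mul_apply, add_mul, Fin.sum_univ_two]; ring
      map_smul' := by
        intro a M; ext i j
        simp [Matrix.mul_apply, Fin.sum_univ_two]; ring }

section expCurve

attribute [local instance] Matrix.linftyOpNormedRing Matrix.linftyOpNormedAlgebra

/-- The curve `t ↦ g exp(tX)` has the velocity `g X` at `0`, entry by entry. -/
theorem hasDerivAt_mul_expGL (g : GL2) (X : Matrix (Fin 2) (Fin 2) ℝ) (i j : Fin 2) :
    HasDerivAt (fun t : ℝ => ((g * expGL (t • X) : GL2) : Matrix (Fin 2) (Fin 2) ℝ) i j)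
      (((g : Matrix (Fin 2) (Fin 2) ℝ) * X) i j) 0 := by
  have h1 : HasDerivAt (fun t : ℝ => NormedSpace.exp (t • X))
      (NormedSpace.exp ((0 : ℝ) • X) * X) 0 := hasDerivAt_exp_smul_const X (0 : ℝ)
  rw [zero_smul, NormedSpace.exp_zero, one_mul] at h1
  let φ : Matrix (Fin 2) (Fin 2) ℝ →ₗ[ℝ] ℝ :=
    { toFun := fun M => ((g : Matrix (Fin 2) (Fin 2) ℝ) * M) i j
      map_add' := by intro M N; simp [Matrix.mul_add]
      map_smul' := by intro a M; simp }
  exact (LinearMap.toContinuousLinearMap φ).hasFDerivAt.comp_hasDerivAt 0 h1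

end expCurve

theorem expGL_zero : expGL 0 = 1 := by
  ext1
  simp [expGL, NormedSpace.exp_zero]

/-- The chain rule along a curve in `GL₂(ℝ)`. -/
theorem hasDerivAt_comp_curve {W : GL2 → ℂ} {F : Arr2 → ℂ} {f' : Arr2 →L[ℝ] ℂ}
    (hW : ∀ g : GL2, W g = F (fun i j => (g : Matrix (Fin 2) (Fin 2) ℝ) i j))
    {c : ℝ → GL2} {t₀ : ℝ} {X : Arr2}
    (hF : HasFDerivAt F f' (fun i j => (c t₀ : Matrix (Fin 2) (Fin 2) ℝ) i j))
    (hc : ∀ i j, HasDerivAt (fun t => (c t : Matrix (Fin 2) (Fin 2) ℝ) i j) (X i j) t₀) :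
    HasDerivAt (fun t => W (c t)) (f' X) t₀ := by
  have h1 : HasDerivAt (fun t => (fun i j => (c t : Matrix (Fin 2) (Fin 2) ℝ) i j : Arr2)) X t₀ :=
    hasDerivAt_pi.2 fun i => hasDerivAt_pi.2 fun j => hc i j
  have := HasFDerivAt.comp_hasDerivAt (x := t₀) hF h1
  refine this.congr_of_eventuallyEq (Eventually.of_forall fun t => hW _)

/-- The first two derivatives of a smooth function, and the Lie algebra action in terms of them. -/
theorem IsSmooth.exists_lie {W : GL2 → ℂ} (hW : IsSmooth W) :
    (∀ X, IsSmooth (lie X W)) ∧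
    ∃ (d₁ : GL2 → Arr2 →L[ℝ] ℂ) (d₂ : GL2 → Arr2 →L[ℝ] Arr2 →L[ℝ] ℂ),
      (∀ (c : ℝ → GL2) (t₀ : ℝ) (X : Arr2),
        (∀ i j, HasDerivAt (fun t => (c t : Matrix (Fin 2) (Fin 2) ℝ) i j) (X i j) t₀) →
        HasDerivAt (fun t => W (c t)) (d₁ (c t₀) X) t₀) ∧
      (∀ g X, lie X W g = d₁ g (fun i j => ((g : Matrix (Fin 2) (Fin 2) ℝ) * X) i j)) ∧
      (∀ g X Y, lie Y (lie X W) g =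
        d₂ g (fun i j => ((g : Matrix (Fin 2) (Fin 2) ℝ) * Y) i j)
          (fun i j => ((g : Matrix (Fin 2) (Fin 2) ℝ) * X) i j) +
        d₁ g (fun i j => ((g : Matrix (Fin 2) (Fin 2) ℝ) * (Y * X)) i j)) ∧
      ∀ g A B, d₂ g A B = d₂ g B A := by
  obtain ⟨F, hF, hWF⟩ := hW
  have hopen := isOpen_det_ne_zero
  have hdiff : ∀ M ∈ {M : Arr2 | (Matrix.of M).det ≠ 0}, HasFDerivAt F (fderiv ℝ F M) M := by
    intro M hM
    exact ((hF.contDiffAt (hopen.mem_nhds hM)).differentiableAt (by simp)).hasFDerivAt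
  have hF1 : ContDiffOn ℝ ((⊤ : ℕ∞) : WithTop ℕ∞) (fderiv ℝ F) {M : Arr2 | (Matrix.of M).det ≠ 0} :=
    hF.fderiv_of_isOpen hopen (by simp)
  have hdiff1 : ∀ M ∈ {M : Arr2 | (Matrix.of M).det ≠ 0},
      HasFDerivAt (fderiv ℝ F) (fderiv ℝ (fderiv ℝ F) M) M := by
    intro M hM
    exact ((hF1.contDiffAt (hopen.mem_nhds hM)).differentiableAt (by simp)).hasFDerivAt
  have hcurve : ∀ (c : ℝ → GL2) (t₀ : ℝ) (X : Arr2),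
        (∀ i j, HasDerivAt (fun t => (c t : Matrix (Fin 2) (Fin 2) ℝ) i j) (X i j) t₀) →
        HasDerivAt (fun t => W (c t))
          (fderiv ℝ F (fun i j => (c t₀ : Matrix (Fin 2) (Fin 2) ℝ) i j) X) t₀ :=
    fun c t₀ X hc => hasDerivAt_comp_curve hWF (hdiff _ (GL2.mem_det_ne_zero _)) hc
  have hlie : ∀ g X, lie X W g = fderiv ℝ F (fun i j => (g : Matrix (Fin 2) (Fin 2) ℝ) i j)
      (fun i j => ((g : Matrix (Fin 2) (Fin 2) ℝ) * X) i j) := by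
    intro g X
    have h := hcurve (fun t => g * expGL (t • X)) 0 _ (hasDerivAt_mul_expGL g X)
    rw [lie, h.deriv]
    simp [expGL_zero]
  have hlie' : ∀ X g, lie X W g = (fun M : Arr2 => fderiv ℝ F M (rightMulArr X M))
      (fun i j => (g : Matrix (Fin 2) (Fin 2) ℝ) i j) := fun X g => hlie g X
  refine ⟨fun X => ⟨fun M => fderiv ℝ F M (rightMulArr X M), ?_, hlie' X⟩,
    fun g => fderiv ℝ F (fun i j => (g : Matrix (Fin 2) (Fin 2) ℝ) i j),
    fun g => fderiv ℝ (fderiv ℝ F) (fun i j => (g : Matrix (Fin 2) (Fin 2) ℝ) i j),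
    hcurve, hlie, ?_, ?_⟩
  · exact hF1.clm_apply (rightMulArr X).contDiff.contDiffOn
  · intro g X Y
    set M : Arr2 := fun i j => (g : Matrix (Fin 2) (Fin 2) ℝ) i j with hM
    have h1 : HasFDerivAt (fun M : Arr2 => fderiv ℝ F M (rightMulArr X M))
        ((fderiv ℝ F M).comp (rightMulArr X) +
          (fderiv ℝ (fderiv ℝ F) M).flip (rightMulArr X M)) M :=
      (hdiff1 M (GL2.mem_det_ne_zero g)).clm_apply (rightMulArr X).hasFDerivAt
    have h2 := hasDerivAt_comp_curve (c := fun t => g * expGL (t • Y)) (t₀ := 0) (hlie' X)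
      (X := fun i j => ((g : Matrix (Fin 2) (Fin 2) ℝ) * Y) i j)
      (by simpa [expGL_zero] using h1) (hasDerivAt_mul_expGL g Y)
    rw [lie, h2.deriv]
    have e : rightMulArr X (fun i j => ((g : Matrix (Fin 2) (Fin 2) ℝ) * Y) i j) =
        fun i j => ((g : Matrix (Fin 2) (Fin 2) ℝ) * (Y * X)) i j := by
      rw [← Matrix.mul_assoc]
      rfl
    rw [← e]
    exact add_comm _ _
  · intro g A B
    have := ((hF.contDiffAt (hopen.mem_nhds (GL2.mem_det_ne_zero g))).isSymmSndFDerivAt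
      (by rw [minSmoothness_of_isRCLikeNormedField]; exact WithTop.coe_le_coe.2 (le_top : (2 : ℕ∞) ≤ ⊤)))
    exact this A B

theorem IsSmooth.lie {W : GL2 → ℂ} (hW : IsSmooth W) (X : Matrix (Fin 2) (Fin 2) ℝ) :
    IsSmooth (lie X W) := hW.exists_lie.1 X

theorem IsSmooth.hasDerivAt_curve {W : GL2 → ℂ} (hW : IsSmooth W) {c : ℝ → GL2} {t₀ : ℝ}
    {X : Matrix (Fin 2) (Fin 2) ℝ}
    (hc : ∀ i j, HasDerivAt (fun t => (c t : Matrix (Fin 2) (Fin 2) ℝ) i j)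
      (((c t₀ : Matrix (Fin 2) (Fin 2) ℝ) * X) i j) t₀) :
    HasDerivAt (fun t => W (c t)) (BesselZeta.lie X W (c t₀)) t₀ := by
  obtain ⟨-, d₁, d₂, h1, h2, -, -⟩ := hW.exists_lie
  rw [h2]
  exact h1 c t₀ _ hc

theorem IsSmooth.lie_add {W : GL2 → ℂ} (hW : IsSmooth W) (X Y : Matrix (Fin 2) (Fin 2) ℝ)
    (g : GL2) : BesselZeta.lie (X + Y) W g = BesselZeta.lie X W g + BesselZeta.lie Y W g := by
  obtain ⟨-, d₁, d₂, h1, h2, -, -⟩ := hW.exists_lie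
  rw [h2, h2, h2, ← map_add]
  congr 1
  ext i j
  simp [Matrix.mul_add]

theorem IsSmooth.lie_smul {W : GL2 → ℂ} (hW : IsSmooth W) (a : ℝ) (X : Matrix (Fin 2) (Fin 2) ℝ)
    (g : GL2) : BesselZeta.lie (a • X) W g = a * BesselZeta.lie X W g := by
  obtain ⟨-, d₁, d₂, h1, h2, -, -⟩ := hW.exists_lie
  rw [h2, h2, ← Complex.real_smul, ← map_smul]
  congr 1
  ext i j
  simp

theorem IsSmooth.lie_sub {W : GL2 → ℂ} (hW : IsSmooth W) (X Y : Matrix (Fin 2) (Fin 2) ℝ)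
    (g : GL2) : BesselZeta.lie (X - Y) W g = BesselZeta.lie X W g - BesselZeta.lie Y W g := by
  have h := hW.lie_add (X - Y) Y g
  rw [sub_add_cancel] at h
  rw [h, add_sub_cancel_right]

/-- The action of the Lie algebra respects brackets: the second derivatives of `W` in the matrix
entries are symmetric and cancel. -/
theorem IsSmooth.lie_lie_sub {W : GL2 → ℂ} (hW : IsSmooth W) (X Y : Matrix (Fin 2) (Fin 2) ℝ)
    (g : GL2) : BesselZeta.lie X (BesselZeta.lie Y W) g - BesselZeta.lie Y (BesselZeta.lie X W) g =
      BesselZeta.lie (X * Y - Y * X) W g := by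
  obtain ⟨-, d₁, d₂, h1, h2, h3, h4⟩ := hW.exists_lie
  rw [hW.lie_sub, h3, h3, h2, h2, h4]
  ring

theorem lie_const_mul (a : ℂ) (X : Matrix (Fin 2) (Fin 2) ℝ) (W : GL2 → ℂ) (g : GL2) :
    lie X (fun g => a * W g) g = a * lie X W g := by
  simp only [lie]
  exact deriv_const_mul_field a

theorem IsSmooth.lie_add_fun {W W' : GL2 → ℂ} (hW : IsSmooth W) (hW' : IsSmooth W')
    (X : Matrix (Fin 2) (Fin 2) ℝ) (g : GL2) : BesselZeta.lie X (fun g => W g + W' g) g =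
      BesselZeta.lie X W g + BesselZeta.lie X W' g := by
  have hc : ∀ i j, HasDerivAt (fun t : ℝ => ((g * expGL (t • X) : GL2) : Matrix (Fin 2) (Fin 2) ℝ) i j)
      ((((g * expGL ((0 : ℝ) • X) : GL2) : Matrix (Fin 2) (Fin 2) ℝ) * X) i j) 0 := fun i j => by
    simpa [expGL_zero] using hasDerivAt_mul_expGL g X i j
  have h1 := hW.hasDerivAt_curve hc
  have h2 := hW'.hasDerivAt_curve hc
  have e : g * expGL ((0 : ℝ) • X) = g := by rw [zero_smul, expGL_zero, mul_one]
  rw [e] at h1 h2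
  exact (h1.add h2).deriv

theorem rot_zero : rot 0 = 1 := by
  ext1
  simp [rot, Matrix.one_fin_two]

theorem lieR_sub_lieL_weight {W : GL2 → ℂ} (hW : IsSmooth W) {n : ℤ} (hn : W ∈ weightSpace n)
    (g : GL2) : lie (lieR - lieL) W g = Complex.I * n * W g := by
  have hc : ∀ i j, HasDerivAt (fun t : ℝ => ((g * rot t : GL2) : Matrix (Fin 2) (Fin 2) ℝ) i j)
      ((((g * rot 0 : GL2) : Matrix (Fin 2) (Fin 2) ℝ) * (lieR - lieL)) i j) 0 := by
    have h1 := Real.hasDerivAt_cos 0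
    have h2 := Real.hasDerivAt_sin 0
    intro i j
    rw [rot_zero, mul_one]
    fin_cases j
    · have := (h1.const_mul ((g : Matrix (Fin 2) (Fin 2) ℝ) i 0)).fun_add
        (h2.fun_neg.const_mul ((g : Matrix (Fin 2) (Fin 2) ℝ) i 1))
      simpa [rot, Matrix.mul_apply, Fin.sum_univ_two, lieR, lieL] using this
    · have := (h2.const_mul ((g : Matrix (Fin 2) (Fin 2) ℝ) i 0)).fun_add
        (h1.const_mul ((g : Matrix (Fin 2) (Fin 2) ℝ) i 1))
      simpa [rot, Matrix.mul_apply, Fin.sum_univ_two, lieR, lieL] using this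
  have h3 := hW.hasDerivAt_curve hc
  rw [rot_zero, mul_one] at h3
  have h4 : HasDerivAt (fun t : ℝ => W (g * rot t)) (Complex.I * n * W g) 0 := by
    have h5 : HasDerivAt (fun t : ℝ => Complex.exp (Complex.I * n * (t : ℝ)) * W g)
        (Complex.exp (Complex.I * n * ((0 : ℝ) : ℂ)) * (Complex.I * n * 1) * W g) 0 :=
      ((((hasDerivAt_id ((0 : ℝ) : ℂ)).comp_ofReal.const_mul (Complex.I * n)).cexp).mul_const (W g))
    refine (h5.congr_deriv (by simp)).congr_of_eventuallyEq (Eventually.of_forall fun t => ?_)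
    exact hn g t
  exact h3.unique h4

end

/-! ### Integral formulas for Whittaker functions -/

section

open Filter Topology Set

/-- The beta integral over `(0, ∞)`, with the integrability of its integrand. -/
theorem beta_integral_Ioi {u v : ℂ} (hu : 0 < u.re) (hv : 0 < v.re) :
    IntegrableOn (fun t : ℝ => (t : ℂ) ^ (u - 1) * (1 + (t : ℂ)) ^ (-(u + v))) (Ioi 0) ∧
    ∫ t in Ioi (0 : ℝ), (t : ℂ) ^ (u - 1) * (1 + (t : ℂ)) ^ (-(u + v)) =
      Complex.Gamma u * Complex.Gamma v / Complex.Gamma (u + v) := by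
  have himg : (fun x : ℝ => x / (1 - x)) '' Ioo 0 1 = Ioi 0 := by
    ext t
    simp only [mem_image, mem_Ioo, mem_Ioi]
    constructor
    · rintro ⟨x, ⟨h0, h1⟩, rfl⟩
      exact div_pos h0 (by linarith)
    · intro ht
      refine ⟨t / (1 + t), ⟨by positivity, by rw [div_lt_one (by positivity)]; linarith⟩, ?_⟩
      field_simp
      ring
  have hder : ∀ x ∈ Ioo (0 : ℝ) 1, HasDerivWithinAt (fun x : ℝ => x / (1 - x))
      (((1 - x) ^ 2)⁻¹) (Ioo 0 1) x := by
    intro x hx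
    have h1 : (1 - x) ≠ 0 := by linarith [hx.2]
    have := ((hasDerivAt_id x).div ((hasDerivAt_const x (1 : ℝ)).sub (hasDerivAt_id x)) h1)
    refine (this.congr_deriv ?_).hasDerivWithinAt
    simp only [id, Pi.sub_apply]
    field_simp
    ring
  have hinj : InjOn (fun x : ℝ => x / (1 - x)) (Ioo 0 1) := by
    intro x hx y hy hxy
    have h1 : (1 - x) ≠ 0 := by linarith [hx.2]
    have h2 : (1 - y) ≠ 0 := by linarith [hy.2]
    simp only at hxy
    rw [div_eq_div_iff h1 h2] at hxy
    linarith
  have key : ∀ x ∈ Ioo (0 : ℝ) 1, |((1 - x) ^ 2)⁻¹| • (((x / (1 - x) : ℝ) : ℂ) ^ (u - 1) *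
      (1 + ((x / (1 - x) : ℝ) : ℂ)) ^ (-(u + v))) = (x : ℂ) ^ (u - 1) * (1 - (x : ℂ)) ^ (v - 1) := by
    intro x hx
    have h1 : 0 < 1 - x := by linarith [hx.2]
    have h1c : ((1 - x : ℝ) : ℂ) ≠ 0 := by exact_mod_cast h1.ne'
    have e1 : 1 + ((x / (1 - x) : ℝ) : ℂ) = (((1 - x)⁻¹ : ℝ) : ℂ) := by
      push_cast
      have : (1 - (x : ℂ)) ≠ 0 := by exact_mod_cast h1.ne'
      field_simp
      ring
    have e2 : (((1 - x)⁻¹ : ℝ) : ℂ) ^ (-(u + v)) = ((1 - x : ℝ) : ℂ) ^ (u + v) := by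
      rw [Complex.ofReal_inv, Complex.cpow_neg, Complex.inv_cpow, inv_inv]
      rw [Complex.arg_ofReal_of_nonneg h1.le]
      exact Real.pi_ne_zero.symm
    have e3 : ((x / (1 - x) : ℝ) : ℂ) ^ (u - 1) =
        (x : ℂ) ^ (u - 1) * ((1 - x : ℝ) : ℂ) ^ (-(u - 1)) := by
      rw [div_eq_mul_inv, Complex.ofReal_mul, Complex.mul_cpow_ofReal_nonneg hx.1.le (by positivity),
        Complex.ofReal_inv, Complex.cpow_neg, Complex.inv_cpow]
      rw [Complex.arg_ofReal_of_nonneg h1.le]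
      exact Real.pi_ne_zero.symm
    rw [e1, e2, e3, abs_of_nonneg (by positivity), Complex.real_smul]
    have e4 : (((1 - x) ^ 2)⁻¹ : ℝ) = ((1 - x : ℝ) : ℂ) ^ (-2 : ℂ) := by
      rw [Complex.cpow_neg]
      push_cast
      norm_num
    rw [e4]
    have e5 : (1 - (x : ℂ)) = ((1 - x : ℝ) : ℂ) := by push_cast; ring
    rw [e5]
    calc _ = (x : ℂ) ^ (u - 1) * (((1 - x : ℝ) : ℂ) ^ (-2 : ℂ) * ((1 - x : ℝ) : ℂ) ^ (-(u - 1)) *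
          ((1 - x : ℝ) : ℂ) ^ (u + v)) := by ring
      _ = _ := by
        rw [← Complex.cpow_add _ _ h1c, ← Complex.cpow_add _ _ h1c]
        ring_nf
  constructor
  · rw [← himg, integrableOn_image_iff_integrableOn_abs_deriv_smul measurableSet_Ioo hder hinj,
      integrableOn_congr_fun key measurableSet_Ioo]
    have := Complex.betaIntegral_convergent hu hv
    rw [intervalIntegrable_iff_integrableOn_Ioo_of_le zero_le_one] at this
    exact this
  · rw [← himg, integral_image_eq_integral_abs_deriv_smul measurableSet_Ioo hder hinj,
      setIntegral_congr_fun measurableSet_Ioo key, ← Complex.betaIntegral_eq_Gamma_mul_div u v hu hv,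
      Complex.betaIntegral, intervalIntegral.integral_of_le zero_le_one,
      integral_Ioc_eq_integral_Ioo]

theorem cpow_add_one' {z : ℂ} (hz : z ≠ 0) (c : ℂ) : z ^ (c + 1) = z ^ c * z := by
  rw [Complex.cpow_add _ _ hz, Complex.cpow_one]

/-- If `G'` and `G / x` are integrable on `(0, ∞)`, then `G` vanishes at both ends, so that the
integral of `G'` is `0`. Both facts follow from the substitution `x = e^u`. -/
theorem integral_Ioi_deriv_eq_zero {G G' : ℝ → ℂ} (hG : ∀ x ∈ Ioi (0 : ℝ), HasDerivAt G (G' x) x)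
    (hG' : IntegrableOn G' (Ioi 0)) (hG0 : IntegrableOn (fun x => G x / x) (Ioi 0)) :
    ∫ x in Ioi (0 : ℝ), G' x = 0 := by
  have himg : Real.exp '' univ = Ioi 0 := by rw [image_univ, Real.range_exp]
  have hd : ∀ x ∈ (univ : Set ℝ), HasDerivWithinAt Real.exp (Real.exp x) univ x :=
    fun x _ => (Real.hasDerivAt_exp x).hasDerivWithinAt
  have hinj : InjOn Real.exp univ := Real.exp_injective.injOn
  rw [← himg, integrableOn_image_iff_integrableOn_abs_deriv_smul MeasurableSet.univ hd hinj,
    integrableOn_univ] at hG' hG0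
  rw [← himg, integral_image_eq_integral_abs_deriv_smul MeasurableSet.univ hd hinj,
    setIntegral_univ]
  refine integral_eq_zero_of_hasDerivAt_of_integrable (f := fun u => G (Real.exp u)) (fun u => ?_)
    hG' (hG0.congr (Eventually.of_forall fun u => ?_))
  · rw [Real.abs_exp]
    exact (hG _ (Real.exp_pos u)).scomp u (Real.hasDerivAt_exp u)
  · have : ((Real.exp u : ℝ) : ℂ) ≠ 0 := by exact_mod_cast (Real.exp_pos u).ne'
    simp only [Real.abs_exp, Complex.real_smul]
    field_simp

/-- The integrand of Tricomi's integral `∫₀^∞ e^{-xt} t^{a-1} (1+t)^b dt`. -/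
def tricomiIntegrand (a b : ℂ) (x t : ℝ) : ℂ :=
  Complex.exp (-(x * t : ℝ)) * (t : ℂ) ^ (a - 1) * (1 + (t : ℂ)) ^ b

/-- Tricomi's integral, `Γ(a) U(a, a + b + 1, x)` for the confluent hypergeometric function `U`. -/
def tricomi (a b : ℂ) (x : ℝ) : ℂ := ∫ t in Ioi (0 : ℝ), tricomiIntegrand a b x t

theorem measurable_tricomiIntegrand (a b : ℂ) :
    Measurable (fun p : ℝ × ℝ => tricomiIntegrand a b p.1 p.2) := by
  unfold tricomiIntegrand
  fun_prop

theorem measurable_tricomiIntegrand_right (a b : ℂ) (x : ℝ) :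
    Measurable (tricomiIntegrand a b x) := by
  unfold tricomiIntegrand
  fun_prop

theorem norm_tricomiIntegrand (a b : ℂ) (x : ℝ) {t : ℝ} (ht : 0 < t) :
    ‖tricomiIntegrand a b x t‖ = Real.exp (-(x * t)) * t ^ (a.re - 1) * (1 + t) ^ b.re := by
  have h : (1 + (t : ℂ)) = ((1 + t : ℝ) : ℂ) := by push_cast; ring
  rw [tricomiIntegrand, norm_mul, norm_mul, Complex.norm_cpow_eq_rpow_re_of_pos ht, h,
    Complex.norm_cpow_eq_rpow_re_of_pos (by linarith), Complex.norm_exp]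
  simp

theorem one_add_rpow_le_exp (β : ℝ) {ε : ℝ} (hε : 0 < ε) :
    ∃ C : ℝ, 0 < C ∧ ∀ t : ℝ, 0 < t → (1 + t) ^ β ≤ C * Real.exp (ε * t) := by
  set δ : ℝ := min 1 (ε / (|β| + 1)) with hδ
  have hδ0 : 0 < δ := lt_min one_pos (by positivity)
  refine ⟨(1 / δ) ^ |β|, by positivity, fun t ht => ?_⟩
  have h1 : (1 + t) ≤ (1 / δ) * Real.exp (δ * t) := by
    have h2 : δ ≤ 1 := min_le_left _ _
    have h3 := Real.add_one_le_exp (δ * t)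
    rw [one_div, ← div_eq_inv_mul, le_div_iff₀ hδ0]
    nlinarith
  calc (1 + t) ^ β ≤ (1 + t) ^ |β| :=
        Real.rpow_le_rpow_of_exponent_le (by linarith) (le_abs_self _)
    _ ≤ ((1 / δ) * Real.exp (δ * t)) ^ |β| :=
        Real.rpow_le_rpow (by linarith) h1 (abs_nonneg _)
    _ = (1 / δ) ^ |β| * Real.exp (δ * t * |β|) := by
        rw [Real.mul_rpow (by positivity) (Real.exp_pos _).le, ← Real.exp_mul]
    _ ≤ _ := by
        refine mul_le_mul_of_nonneg_left (Real.exp_le_exp.2 ?_) (by positivity)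
        have h4 : δ ≤ ε / (|β| + 1) := min_le_right _ _
        rw [le_div_iff₀ (by positivity)] at h4
        have h5 : δ * |β| ≤ ε := by nlinarith
        calc δ * t * |β| = (δ * |β|) * t := by ring
          _ ≤ ε * t := by gcongr

theorem integrableOn_tricomiIntegrand {a : ℂ} (ha : 0 < a.re) (b : ℂ) {x : ℝ} (hx : 0 < x) :
    IntegrableOn (tricomiIntegrand a b x) (Ioi 0) := by
  obtain ⟨C, hC, hb⟩ := one_add_rpow_le_exp b.re (half_pos hx)
  have h1 : IntegrableOn (fun t : ℝ => C * (t ^ (a.re - 1) * Real.exp (-(x / 2) * t ^ (1 : ℝ))))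
      (Ioi 0) :=
    (integrableOn_rpow_mul_exp_neg_mul_rpow (by linarith) one_pos (half_pos hx)).const_mul C
  refine h1.mono' (measurable_tricomiIntegrand_right a b x).aestronglyMeasurable ?_
  filter_upwards [ae_restrict_mem measurableSet_Ioi] with t ht
  have ht : 0 < t := ht
  rw [norm_tricomiIntegrand a b x ht, Real.rpow_one]
  have h2 : Real.exp (-(x * t)) * Real.exp (x / 2 * t) = Real.exp (-(x / 2) * t) := by
    rw [← Real.exp_add]; ring_nf
  calc _ ≤ Real.exp (-(x * t)) * t ^ (a.re - 1) * (C * Real.exp (x / 2 * t)) := by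
        gcongr
        exact hb t ht
    _ = C * (t ^ (a.re - 1) * (Real.exp (-(x * t)) * Real.exp (x / 2 * t))) := by ring
    _ = _ := by rw [h2]

/-- Differentiation under the integral sign, which shifts `a` by one. -/
theorem hasDerivAt_tricomi {a : ℂ} (ha : 0 < a.re) (b : ℂ) {x : ℝ} (hx : 0 < x) :
    HasDerivAt (tricomi a b) (-tricomi (a + 1) b x) x := by
  have ha1 : 0 < (a + 1).re := by simp; linarith
  have key := hasDerivAt_integral_of_dominated_loc_of_deriv_le
    (μ := volume.restrict (Ioi (0 : ℝ))) (F := fun x t => tricomiIntegrand a b x t)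
    (F' := fun x t => -tricomiIntegrand (a + 1) b x t) (x₀ := x) (s := Ioi (x / 2))
    (bound := fun t => ‖tricomiIntegrand (a + 1) b (x / 2) t‖)
    (Ioi_mem_nhds (by linarith))
    (Eventually.of_forall fun y => (measurable_tricomiIntegrand_right a b y).aestronglyMeasurable)
    (integrableOn_tricomiIntegrand ha b hx)
    ((measurable_tricomiIntegrand_right (a + 1) b x).neg.aestronglyMeasurable) ?_
    (integrableOn_tricomiIntegrand ha1 b (half_pos hx)).norm ?_
  · have := key.2
    rw [integral_neg] at this
    exact this
  · filter_upwards [ae_restrict_mem measurableSet_Ioi] with t ht y hy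
    have ht : 0 < t := ht
    have hy : x / 2 < y := hy
    rw [norm_neg, norm_tricomiIntegrand _ _ _ ht, norm_tricomiIntegrand _ _ _ ht]
    gcongr
  · filter_upwards [ae_restrict_mem measurableSet_Ioi] with t ht y hy
    have ht : 0 < t := ht
    have htc : (t : ℂ) ≠ 0 := by exact_mod_cast ht.ne'
    have h1 : HasDerivAt (fun y : ℝ => Complex.exp (-(y * t : ℝ)))
        (Complex.exp (-(y * t : ℝ)) * (-(t : ℂ))) y := by
      have h2 : HasDerivAt (fun y : ℝ => (-((y * t : ℝ) : ℂ))) (-(t : ℂ)) y := by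
        have := ((hasDerivAt_id y).mul_const t).ofReal_comp.fun_neg
        simpa using this
      exact h2.cexp
    have h3 := (h1.mul_const ((t : ℂ) ^ (a - 1))).mul_const ((1 + (t : ℂ)) ^ b)
    refine h3.congr_deriv ?_
    have h4 : (t : ℂ) ^ (a + 1 - 1) = (t : ℂ) ^ (a - 1) * t := by
      rw [← cpow_add_one' htc]; ring_nf
    rw [tricomiIntegrand, h4]
    ring

/-- Kummer's differential equation, in the form of a contiguous relation. -/
theorem tricomi_relation {a : ℂ} (ha : 0 < a.re) (b : ℂ) {x : ℝ} (hx : 0 < x) :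
    x * tricomi (a + 1 + 1) b x + (x - (a + b + 1)) * tricomi (a + 1) b x - a * tricomi a b x
      = 0 := by
  have ha1 : 0 < (a + 1).re := by simp; linarith
  have ha2 : 0 < (a + 1 + 1).re := by simp; linarith
  have i0 := integrableOn_tricomiIntegrand ha b hx
  have i1 := integrableOn_tricomiIntegrand ha1 b hx
  have i2 := integrableOn_tricomiIntegrand ha2 b hx
  set G : ℝ → ℂ := fun t => tricomiIntegrand (a + 1) (b + 1) x t with hG
  set G' : ℝ → ℂ := fun t => -((x : ℂ) * tricomiIntegrand (a + 1 + 1) b x t +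
    (x - (a + b + 1)) * tricomiIntegrand (a + 1) b x t - a * tricomiIntegrand a b x t) with hG'
  have hGi : IntegrableOn G (Ioi 0) := integrableOn_tricomiIntegrand ha1 _ hx
  have hG'i : IntegrableOn G' (Ioi 0) :=
    (((i2.const_mul _).add (i1.const_mul _)).sub (i0.const_mul _)).neg
  have hder : ∀ t ∈ Ioi (0 : ℝ), HasDerivAt G (G' t) t := by
    intro t ht
    have ht : 0 < t := ht
    have htc : (t : ℂ) ≠ 0 := by exact_mod_cast ht.ne'
    have ht1 : (1 + (t : ℂ)) ≠ 0 := by exact_mod_cast (by linarith : (1 + t) ≠ 0)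
    have h1 : HasDerivAt (fun t : ℝ => Complex.exp (-(x * t : ℝ)))
        (Complex.exp (-(x * t : ℝ)) * (-(x : ℂ))) t := by
      have h2 : HasDerivAt (fun t : ℝ => (-((x * t : ℝ) : ℂ))) (-(x : ℂ)) t := by
        have := ((hasDerivAt_id t).const_mul x).ofReal_comp.fun_neg
        simpa using this
      exact h2.cexp
    have ha0 : a ≠ 0 := by rintro rfl; simp at ha
    have h2 : HasDerivAt (fun t : ℝ => (t : ℂ) ^ (a + 1 - 1)) (a * (t : ℂ) ^ (a - 1)) t := by
      have := hasDerivAt_ofReal_cpow_const ht.ne' ha0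
      simpa using this
    have h3 : HasDerivAt (fun t : ℝ => (1 + (t : ℂ)) ^ (b + 1)) ((b + 1) * (1 + (t : ℂ)) ^ b) t := by
      have h4 : HasDerivAt (fun z : ℂ => (1 + z) ^ (b + 1)) ((b + 1) * (1 + (t : ℂ)) ^ b) (t : ℂ) := by
        have := ((hasDerivAt_id (t : ℂ)).const_add 1).cpow_const (c := b + 1) (by
          left; simp; linarith)
        simpa using this
      exact h4.comp_ofReal
    have h5 := (h1.fun_mul h2).fun_mul h3
    refine h5.congr_deriv ?_
    have e1 : (t : ℂ) ^ (a + 1 + 1 - 1) = (t : ℂ) ^ (a - 1) * t * t := by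
      rw [← cpow_add_one' htc, ← cpow_add_one' htc]; ring_nf
    have e2 : (t : ℂ) ^ (a + 1 - 1) = (t : ℂ) ^ (a - 1) * t := by
      rw [← cpow_add_one' htc]; ring_nf
    simp only [hG', tricomiIntegrand, e1, e2, cpow_add_one' ht1]
    ring
  have hG0 : IntegrableOn (fun t => G t / t) (Ioi 0) := by
    refine (integrableOn_tricomiIntegrand ha (b + 1) hx).congr_fun (fun t ht => ?_) measurableSet_Ioi
    have ht : 0 < t := ht
    have htc : (t : ℂ) ≠ 0 := by exact_mod_cast ht.ne'
    have e2 : (t : ℂ) ^ (a + 1 - 1) = (t : ℂ) ^ (a - 1) * t := by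
      rw [← cpow_add_one' htc]; ring_nf
    simp only [hG, tricomiIntegrand, e2]
    field_simp
  have h0 := integral_Ioi_deriv_eq_zero hder hG'i hG0
  simp only [hG'] at h0
  rw [integral_neg, neg_eq_zero, integral_sub, integral_add, integral_const_mul,
    integral_const_mul, integral_const_mul] at h0
  · exact h0
  · exact i2.const_mul _
  · exact i1.const_mul _
  · exact (i2.const_mul _).add (i1.const_mul _)
  · exact i0.const_mul _

/-- The leading asymptotics of Tricomi's integral at infinity (Watson's lemma). -/
theorem tendsto_tricomi {a : ℂ} (ha : 0 < a.re) (b : ℂ) :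
    Tendsto (fun x : ℝ => (x : ℂ) ^ a * tricomi a b x) atTop (𝓝 (Complex.Gamma a)) := by
  set g : ℝ → ℝ → ℂ := fun x s =>
    Complex.exp (-(s : ℝ)) * (s : ℂ) ^ (a - 1) * (1 + ((s / x : ℝ) : ℂ)) ^ b with hg
  have e1 : ∀ x : ℝ, 0 < x → (x : ℂ) ^ a * tricomi a b x = ∫ s in Ioi (0 : ℝ), g x s := by
    intro x hx
    have hxc : (x : ℂ) ≠ 0 := by exact_mod_cast hx.ne'
    have h := integral_comp_mul_left_Ioi (g x) 0 hx
    rw [mul_zero, Complex.real_smul, eq_comm] at h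
    rw [Complex.ofReal_inv, inv_mul_eq_iff_eq_mul₀ hxc] at h
    rw [h, tricomi, ← integral_const_mul, ← integral_const_mul]
    refine setIntegral_congr_fun measurableSet_Ioi fun t ht => ?_
    have ht : 0 < t := ht
    have e2 : x * t / x = t := by field_simp
    have e3 : (x : ℂ) ^ a = (x : ℂ) * (x : ℂ) ^ (a - 1) := by
      rw [mul_comm, ← cpow_add_one' hxc]; ring_nf
    simp only [hg, tricomiIntegrand, e2, e3]
    rw [Complex.ofReal_mul, Complex.mul_cpow_ofReal_nonneg hx.le ht.le]
    ring
  have e4 : Complex.Gamma a = ∫ s in Ioi (0 : ℝ), Complex.exp (-(s : ℝ)) * (s : ℂ) ^ (a - 1) := by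
    rw [Complex.Gamma_eq_integral ha, Complex.GammaIntegral]
    simp
  rw [e4]
  refine Tendsto.congr' (f₁ := fun x => ∫ s in Ioi (0 : ℝ), g x s) ?_ ?_
  · filter_upwards [eventually_gt_atTop 0] with x hx
    exact (e1 x hx).symm
  refine tendsto_integral_filter_of_dominated_convergence
    (fun s => ‖tricomiIntegrand a (|b.re| : ℝ) 1 s‖) ?_ ?_
    (integrableOn_tricomiIntegrand ha _ one_pos).norm ?_
  · refine Eventually.of_forall fun x => Measurable.aestronglyMeasurable ?_
    simp only [hg]
    fun_prop
  · filter_upwards [eventually_ge_atTop 1] with x hx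
    filter_upwards [ae_restrict_mem measurableSet_Ioi] with s hs
    have hs : 0 < s := hs
    have hsx : 0 < s / x := by positivity
    have h5 : (1 + ((s / x : ℝ) : ℂ)) = ((1 + s / x : ℝ) : ℂ) := by push_cast; ring
    rw [norm_tricomiIntegrand _ _ _ hs]
    simp only [hg]
    rw [norm_mul, norm_mul, Complex.norm_cpow_eq_rpow_re_of_pos hs, h5,
      Complex.norm_cpow_eq_rpow_re_of_pos (by linarith), Complex.norm_exp]
    simp only [Complex.neg_re, Complex.ofReal_re, one_mul]
    refine mul_le_mul_of_nonneg_left ?_ (by positivity)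
    calc (1 + s / x) ^ b.re ≤ (1 + s / x) ^ |b.re| :=
          Real.rpow_le_rpow_of_exponent_le (by linarith) (le_abs_self _)
      _ ≤ (1 + s) ^ |b.re| := by
          gcongr
          exact div_le_self hs.le hx
  · filter_upwards [ae_restrict_mem measurableSet_Ioi] with s hs
    have hs : 0 < s := hs
    have h6 : Tendsto (fun x : ℝ => ((s / x : ℝ) : ℂ)) atTop (𝓝 0) := by
      have : Tendsto (fun x : ℝ => s / x) atTop (𝓝 0) := tendsto_const_nhds.div_atTop tendsto_id
      exact_mod_cast (Complex.continuous_ofReal.tendsto 0).comp this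
    have h7 : Tendsto (fun x : ℝ => (1 + ((s / x : ℝ) : ℂ)) ^ b) atTop (𝓝 ((1 + 0) ^ b)) := by
      have h8 : ContinuousAt (fun z : ℂ => (1 + z) ^ b) 0 :=
        (((hasDerivAt_id (0 : ℂ)).const_add 1).cpow_const (by left; simp)).continuousAt
      exact h8.tendsto.comp h6
    rw [add_zero, Complex.one_cpow] at h7
    have := h7.const_mul (Complex.exp (-(s : ℝ)) * (s : ℂ) ^ (a - 1))
    rw [mul_one] at this
    exact this

/-- The Mellin transform of `e^{-x}` times Tricomi's integral. -/
theorem mellin_tricomi {a : ℂ} (ha : 0 < a.re) (b : ℂ) {s : ℂ} (hs : 0 < s.re)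
    (hsab : 0 < (s - a - b).re) :
    IntegrableOn (fun x : ℝ => Complex.exp (-(x : ℝ)) * (x : ℂ) ^ (s - 1) * tricomi a b x) (Ioi 0) ∧
    ∫ x in Ioi (0 : ℝ), Complex.exp (-(x : ℝ)) * (x : ℂ) ^ (s - 1) * tricomi a b x =
      Complex.Gamma s * (Complex.Gamma a * Complex.Gamma (s - a - b) / Complex.Gamma (s - b)) := by
  set f : ℝ → ℝ → ℂ := fun x t =>
    Complex.exp (-(x : ℝ)) * (x : ℂ) ^ (s - 1) * tricomiIntegrand a b x t with hf
  have hfm : Measurable (Function.uncurry f) := by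
    have := measurable_tricomiIntegrand a b
    simp only [hf, Function.uncurry_def]
    fun_prop
  -- the inner integral over `x` is a Gamma integral
  have hin : ∀ t : ℝ, 0 < t → IntegrableOn (fun x => f x t) (Ioi 0) ∧
      (∫ x in Ioi (0 : ℝ), f x t = Complex.Gamma s *
        ((t : ℂ) ^ (a - 1) * (1 + (t : ℂ)) ^ (-(a + (s - a - b))))) ∧
      ∫ x in Ioi (0 : ℝ), ‖f x t‖ = Real.Gamma s.re * ‖((t : ℂ) ^ (a - 1) *
        (1 + (t : ℂ)) ^ (-(a + (s - a - b))))‖ := by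
    intro t ht
    have ht1 : 0 < 1 + t := by linarith
    have hc : (1 + (t : ℂ)) = ((1 + t : ℝ) : ℂ) := by push_cast; ring
    have hc0 : (1 + (t : ℂ)) ≠ 0 := by rw [hc]; exact_mod_cast ht1.ne'
    have e1 : ∀ x : ℝ, f x t = ((t : ℂ) ^ (a - 1) * (1 + (t : ℂ)) ^ b) *
        ((x : ℂ) ^ (s - 1) * Complex.exp (-(((1 + t : ℝ) : ℂ) * (x : ℂ)))) := by
      intro x
      have : Complex.exp (-(((1 + t : ℝ) : ℂ) * (x : ℂ))) =
          Complex.exp (-(x : ℝ)) * Complex.exp (-(x * t : ℝ)) := by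
        rw [← Complex.exp_add]; push_cast; ring_nf
      rw [this]
      simp only [hf, tricomiIntegrand]
      ring
    have e2 : ∀ x : ℝ, 0 < x → ‖f x t‖ = ‖(t : ℂ) ^ (a - 1) * (1 + (t : ℂ)) ^ b‖ *
        (x ^ (s.re - 1) * Real.exp (-((1 + t) * x))) := by
      intro x hx
      rw [e1, norm_mul, norm_mul _ (Complex.exp _), Complex.norm_cpow_eq_rpow_re_of_pos hx,
        Complex.norm_exp]
      simp
    have hE : (1 / ((1 + t : ℝ) : ℂ)) ^ s = (1 + (t : ℂ)) ^ (-s) := by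
      rw [one_div, Complex.cpow_neg, ← hc, Complex.inv_cpow]
      rw [hc, Complex.arg_ofReal_of_nonneg ht1.le]
      exact Real.pi_ne_zero.symm
    have hadd : (1 + (t : ℂ)) ^ (-(a + (s - a - b))) = (1 + (t : ℂ)) ^ b * (1 + (t : ℂ)) ^ (-s) := by
      rw [← Complex.cpow_add _ _ hc0]; ring_nf
    refine ⟨?_, ?_, ?_⟩
    · have h3 : IntegrableOn (fun x : ℝ => x ^ (s.re - 1) * Real.exp (-(1 + t) * x ^ (1 : ℝ)))
          (Ioi 0) := integrableOn_rpow_mul_exp_neg_mul_rpow (by linarith) one_pos ht1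
      refine (h3.const_mul ‖(t : ℂ) ^ (a - 1) * (1 + (t : ℂ)) ^ b‖).mono'
        (hfm.comp measurable_prodMk_right).aestronglyMeasurable ?_
      filter_upwards [ae_restrict_mem measurableSet_Ioi] with x hx
      rw [e2 x hx, Real.rpow_one, neg_mul]
    · simp_rw [e1]
      rw [integral_const_mul, Complex.integral_cpow_mul_exp_neg_mul_Ioi hs ht1, hE, hadd]
      ring
    · rw [setIntegral_congr_fun measurableSet_Ioi e2, integral_const_mul,
        Real.integral_rpow_mul_exp_neg_mul_Ioi hs ht1, hadd, ← hE, norm_mul, norm_mul, norm_mul]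
      have : ‖(1 / ((1 + t : ℝ) : ℂ)) ^ s‖ = (1 / (1 + t)) ^ s.re := by
        rw [← Complex.norm_cpow_eq_rpow_re_of_pos (by positivity)]
        push_cast
        rfl
      rw [this]
      ring
  have hβ := beta_integral_Ioi ha hsab
  have hint : Integrable (Function.uncurry f)
      ((volume.restrict (Ioi (0 : ℝ))).prod (volume.restrict (Ioi (0 : ℝ)))) := by
    rw [integrable_prod_iff' hfm.aestronglyMeasurable]
    constructor
    · filter_upwards [ae_restrict_mem measurableSet_Ioi] with t ht using (hin t ht).1
    · refine (hβ.1.norm.const_mul (Real.Gamma s.re)).congr ?_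
      filter_upwards [ae_restrict_mem measurableSet_Ioi] with t ht
      exact (hin t ht).2.2.symm
  have e5 : ∀ x : ℝ, ∫ t in Ioi (0 : ℝ), f x t =
      Complex.exp (-(x : ℝ)) * (x : ℂ) ^ (s - 1) * tricomi a b x := fun x => by
    simp only [hf]
    rw [integral_const_mul, tricomi]
  constructor
  · have := hint.integral_prod_left
    simp only [Function.uncurry_apply_pair, e5] at this
    exact this
  · simp_rw [← e5]
    rw [integral_integral_swap hint, setIntegral_congr_fun measurableSet_Ioi
      (fun t ht => (hin t ht).2.1), integral_const_mul, hβ.2]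
    ring_nf

end

/-! ### Existence and Mellin transforms of Whittaker functions -/

section

open Filter Topology Set

/-- `w` is the Whittaker function `W_{k,m}` on `(0, ∞)`, with derivative `w'`: the differential
equation, the asymptotics of `w` and `w'` at infinity, and the Mellin transforms. -/
structure WhittakerPair (k m : ℂ) (w w' : ℝ → ℂ) : Prop where
  ode : ∀ x : ℝ, 0 < x → HasDerivAt w (w' x) x
  ode' : ∀ x : ℝ, 0 < x →
    HasDerivAt w' (-((-1 / 4 + k / x + (1 / 4 - m ^ 2) / (x : ℂ) ^ 2) * w x)) x
  asymp : Tendsto (fun x : ℝ => w x * Complex.exp ((x : ℂ) / 2) * (x : ℂ) ^ (-k)) atTop (𝓝 1)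
  asymp' : Tendsto (fun x : ℝ => w' x * Complex.exp ((x : ℂ) / 2) * (x : ℂ) ^ (-k)) atTop
    (𝓝 (-1 / 2))
  integrable : ∀ ν : ℂ, 0 < (1 / 2 + m + ν).re → 0 < (1 / 2 - m + ν).re →
    IntegrableOn (fun x : ℝ => Complex.exp (-(x : ℂ) / 2) * (x : ℂ) ^ (ν - 1) * w x) (Ioi 0)
  integrable' : ∀ ν : ℂ, 0 < (1 / 2 + m + ν).re → 0 < (1 / 2 - m + ν).re →
    IntegrableOn (fun x : ℝ => Complex.exp (-(x : ℂ) / 2) * (x : ℂ) ^ ν * w' x) (Ioi 0)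
  mellin : ∀ ν : ℂ, 0 < (1 / 2 + m + ν).re → 0 < (1 / 2 - m + ν).re →
    ∫ x in Ioi (0 : ℝ), Complex.exp (-(x : ℂ) / 2) * (x : ℂ) ^ (ν - 1) * w x =
      Complex.Gamma (1 / 2 + m + ν) * Complex.Gamma (1 / 2 - m + ν) / Complex.Gamma (ν - k + 1)

theorem tendsto_inv_ofReal_atTop : Tendsto (fun x : ℝ => ((x : ℂ))⁻¹) atTop (𝓝 0) := by
  have h := (Complex.continuous_ofReal.tendsto 0).comp tendsto_inv_atTop_zero
  refine (h.congr fun x => ?_).trans (by simp)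
  simp

/-- The raising recurrence `W_{k+1,m} = (x/2 - k) W_{k,m} - x W_{k,m}'`. -/
theorem WhittakerPair.raise {k m : ℂ} {w w' : ℝ → ℂ} (h : WhittakerPair k m w w') :
    WhittakerPair (k + 1) m (fun x => (x / 2 - k) * w x - x * w' x)
      (fun x => w x / 2 + (x / 2 - k - 1) * w' x
        + (-x / 4 + k + (1 / 4 - m ^ 2) / x) * w x) := by
  have hid : ∀ x : ℝ, HasDerivAt (fun x : ℝ => (x : ℂ)) 1 x := fun x =>
    (hasDerivAt_id (x : ℂ)).comp_ofReal
  have e0 : ∀ (ν : ℂ) (x : ℝ), 0 < x → (x : ℂ) ^ (ν + 1 - 1) = (x : ℂ) ^ (ν - 1) * x := by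
    intro ν x hx
    rw [← cpow_add_one' (by exact_mod_cast hx.ne')]; ring_nf
  have e1 : ∀ (ν : ℂ) (x : ℝ), 0 < x → (x : ℂ) ^ ν = (x : ℂ) ^ (ν - 1) * x := by
    intro ν x hx
    rw [← cpow_add_one' (by exact_mod_cast hx.ne')]; ring_nf
  have e2 : ∀ (ν : ℂ) (x : ℝ), 0 < x → (x : ℂ) ^ (ν + 1) = (x : ℂ) ^ (ν - 1) * x * x := by
    intro ν x hx
    rw [cpow_add_one' (by exact_mod_cast hx.ne'), e1 ν x hx]
  have re1 : ∀ ν : ℂ, (1 / 2 + m + (ν + 1)).re = (1 / 2 + m + ν).re + 1 := by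
    intro ν; simp; ring
  have re2 : ∀ ν : ℂ, (1 / 2 - m + (ν + 1)).re = (1 / 2 - m + ν).re + 1 := by
    intro ν; simp; ring
  have i0 := h.integrable
  have i1 : ∀ ν : ℂ, 0 < (1 / 2 + m + ν).re → 0 < (1 / 2 - m + ν).re →
      IntegrableOn (fun x : ℝ => Complex.exp (-(x : ℂ) / 2) * (x : ℂ) ^ (ν + 1 - 1) * w x)
        (Ioi 0) := fun ν h1 h2 =>
    h.integrable (ν + 1) (by rw [re1]; linarith) (by rw [re2]; linarith)
  have i2 : ∀ ν : ℂ, 0 < (1 / 2 + m + ν).re → 0 < (1 / 2 - m + ν).re →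
      IntegrableOn (fun x : ℝ => Complex.exp (-(x : ℂ) / 2) * (x : ℂ) ^ (ν + 1) * w' x)
        (Ioi 0) := fun ν h1 h2 =>
    h.integrable' (ν + 1) (by rw [re1]; linarith) (by rw [re2]; linarith)
  constructor
  · intro x hx
    have hxc : (x : ℂ) ≠ 0 := by exact_mod_cast hx.ne'
    refine (((((hid x).div_const 2).sub_const k).fun_mul (h.ode x hx)).fun_sub
      ((hid x).fun_mul (h.ode' x hx))).congr_deriv ?_
    field_simp
    ring
  · intro x hx
    have hxc : (x : ℂ) ≠ 0 := by exact_mod_cast hx.ne'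
    have h3 : HasDerivAt (fun x : ℝ => (1 / 4 - m ^ 2) / (x : ℂ))
        (-(1 / 4 - m ^ 2) / (x : ℂ) ^ 2) x := by
      refine ((hasDerivAt_const x (1 / 4 - m ^ 2)).fun_div (hid x) hxc).congr_deriv ?_
      simp
    refine ((((h.ode x hx).div_const 2).fun_add
      (((((hid x).div_const 2).sub_const k).sub_const 1).fun_mul (h.ode' x hx))).fun_add
      ((((((hid x).fun_neg).div_const 4).add_const k).fun_add h3).fun_mul (h.ode x hx))).congr_deriv ?_
    field_simp
    ring
  · have h4 := (((tendsto_const_nhds (x := (1 / 2 : ℂ))).sub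
      (tendsto_inv_ofReal_atTop.const_mul k)).mul h.asymp).sub h.asymp'
    refine (h4.congr' ?_).trans (by norm_num)
    filter_upwards [eventually_gt_atTop 0] with x hx
    have hxc : (x : ℂ) ≠ 0 := by exact_mod_cast hx.ne'
    have : (x : ℂ) ^ (-k) = (x : ℂ) ^ (-(k + 1)) * x := by
      rw [← cpow_add_one' hxc]; ring_nf
    rw [this]
    field_simp
  · have h4 := ((tendsto_inv_ofReal_atTop.div_const 2).mul h.asymp).add
      ((((tendsto_const_nhds (x := (1 / 2 : ℂ))).sub
      (tendsto_inv_ofReal_atTop.const_mul (k + 1))).mul h.asymp').add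
      ((((tendsto_const_nhds (x := (-1 / 4 : ℂ))).add
        (tendsto_inv_ofReal_atTop.const_mul k)).add
        ((tendsto_inv_ofReal_atTop.mul tendsto_inv_ofReal_atTop).const_mul
          (1 / 4 - m ^ 2))).mul h.asymp))
    refine (h4.congr' ?_).trans (by norm_num)
    filter_upwards [eventually_gt_atTop 0] with x hx
    have hxc : (x : ℂ) ≠ 0 := by exact_mod_cast hx.ne'
    have : (x : ℂ) ^ (-k) = (x : ℂ) ^ (-(k + 1)) * x := by
      rw [← cpow_add_one' hxc]; ring_nf
    rw [this]
    field_simp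
    ring
  · intro ν h1 h2
    refine IntegrableOn.congr_fun (s := Ioi 0) (((i1 ν h1 h2).const_mul (1 / 2)).sub
      (((i0 ν h1 h2).const_mul k).add (h.integrable' ν h1 h2))) (fun x hx => ?_)
      measurableSet_Ioi
    simp only [Pi.sub_apply, Pi.add_apply, e0 ν x hx, e1 ν x hx]
    ring
  · intro ν h1 h2
    refine IntegrableOn.congr_fun (s := Ioi 0) (((i1 ν h1 h2).const_mul (1 / 2)).add
      ((((i2 ν h1 h2).const_mul (1 / 2)).sub ((h.integrable' ν h1 h2).const_mul (k + 1))).add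
      (((i1 (ν + 1) (by rw [re1]; linarith) (by rw [re2]; linarith)).const_mul (-1 / 4)).add
      (((i1 ν h1 h2).const_mul k).add ((i0 ν h1 h2).const_mul (1 / 4 - m ^ 2)))))) (fun x hx => ?_) measurableSet_Ioi
    have hxc : (x : ℂ) ≠ 0 := by exact_mod_cast (show (0 : ℝ) < x from hx).ne'
    have e3 : (x : ℂ) ^ (ν + 1 + 1 - 1) = (x : ℂ) ^ (ν - 1) * x * x := by
      rw [← e2 ν x hx]; ring_nf
    simp only [Pi.sub_apply, Pi.add_apply, e3, e2 ν x hx, e0 ν x hx, e1 ν x hx]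
    field_simp
    ring
  · intro ν h1 h2
    have hG : ∀ x ∈ Ioi (0 : ℝ), HasDerivAt
        (fun x : ℝ => Complex.exp (-(x : ℂ) / 2) * (x : ℂ) ^ ν * w x)
        (-1 / 2 * (Complex.exp (-(x : ℂ) / 2) * (x : ℂ) ^ (ν + 1 - 1) * w x) +
          ν * (Complex.exp (-(x : ℂ) / 2) * (x : ℂ) ^ (ν - 1) * w x) +
          Complex.exp (-(x : ℂ) / 2) * (x : ℂ) ^ ν * w' x) x := by
      intro x hx
      have hxc : (x : ℂ) ≠ 0 := by exact_mod_cast (show (0 : ℝ) < x from hx).ne'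
      have h5 : HasDerivAt (fun x : ℝ => (x : ℂ) ^ ν) (ν * (x : ℂ) ^ (ν - 1)) x := by
        have := ((hasDerivAt_id (x : ℂ)).cpow_const (c := ν) (by left; simpa using hx)).comp_ofReal
        simpa using this
      refine ((((((hid x).fun_neg).div_const 2).cexp).fun_mul h5).fun_mul (h.ode x hx)).congr_deriv ?_
      simp only [e0 ν x hx, e1 ν x hx]
      ring
    have j1 := (i1 ν h1 h2).const_mul (-1 / 2)
    have j2 := (i0 ν h1 h2).const_mul ν
    have j3 := h.integrable' ν h1 h2
    have h6 := integral_Ioi_deriv_eq_zero hG ((j1.add j2).add j3) (by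
      refine (i0 ν h1 h2).congr_fun (fun x hx => ?_) measurableSet_Ioi
      have hxc : (x : ℂ) ≠ 0 := by exact_mod_cast (show (0 : ℝ) < x from hx).ne'
      simp only [e1 ν x hx]
      field_simp)
    rw [integral_add, integral_add, integral_const_mul, integral_const_mul] at h6
    rotate_left
    · exact j1
    · exact j2
    · exact j1.add j2
    · exact j3
    have h7 : ∫ x in Ioi (0 : ℝ), Complex.exp (-(x : ℂ) / 2) * (x : ℂ) ^ (ν - 1) *
        ((x / 2 - k) * w x - x * w' x) = (1 / 2 : ℂ) * (∫ x in Ioi (0 : ℝ),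
          Complex.exp (-(x : ℂ) / 2) * (x : ℂ) ^ (ν + 1 - 1) * w x) -
          k * (∫ x in Ioi (0 : ℝ), Complex.exp (-(x : ℂ) / 2) * (x : ℂ) ^ (ν - 1) * w x) -
          ∫ x in Ioi (0 : ℝ), Complex.exp (-(x : ℂ) / 2) * (x : ℂ) ^ ν * w' x := by
      rw [← integral_const_mul, ← integral_const_mul, ← integral_sub, ← integral_sub]
      · refine setIntegral_congr_fun measurableSet_Ioi fun x hx => ?_
        simp only [e0 ν x hx, e1 ν x hx]
        ring
      · exact ((i1 ν h1 h2).const_mul _).sub ((i0 ν h1 h2).const_mul _)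
      · exact j3
      · exact (i1 ν h1 h2).const_mul _
      · exact (i0 ν h1 h2).const_mul _
    have h8 : Complex.Gamma (1 / 2 + m + ν) * Complex.Gamma (1 / 2 - m + ν) /
        Complex.Gamma (ν - (k + 1) + 1) = (ν - k) * (Complex.Gamma (1 / 2 + m + ν) *
          Complex.Gamma (1 / 2 - m + ν) / Complex.Gamma (ν - k + 1)) := by
      rw [show ν - (k + 1) + 1 = ν - k by ring]
      rcases eq_or_ne (ν - k) 0 with h9 | h9
      -- both sides vanish, the left one because `Γ` has the value `0` at its pole `0`
      · rw [h9, Complex.Gamma_zero]; simp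
      · rw [Complex.Gamma_add_one _ h9]
        field_simp
    rw [h7, h8, ← h.mellin ν h1 h2]
    linear_combination -h6

/-- The Whittaker function for small `k`, from Tricomi's integral. -/
theorem exists_whittakerPair_of_re_pos {k m : ℂ} (ha : 0 < (m + 1 / 2 - k).re) :
    ∃ w w' : ℝ → ℂ, WhittakerPair k m w w' := by
  set a : ℂ := m + 1 / 2 - k with hadef
  set b : ℂ := m + k - 1 / 2 with hbdef
  have ha1 : 0 < (a + 1).re := by simp only [Complex.add_re, Complex.one_re]; linarith
  have hΓ : Complex.Gamma a ≠ 0 := Complex.Gamma_ne_zero_of_re_pos ha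
  have hid : ∀ x : ℝ, HasDerivAt (fun x : ℝ => (x : ℂ)) 1 x := fun x =>
    (hasDerivAt_id (x : ℂ)).comp_ofReal
  set U := tricomi a b with hU
  set U1 := tricomi (a + 1) b with hU1
  set U2 := tricomi (a + 1 + 1) b with hU2
  set P : ℝ → ℂ := fun x => Complex.exp (-(x : ℂ) / 2) * (x : ℂ) ^ (m + 1 / 2) / Complex.Gamma a
    with hP
  have dP : ∀ x : ℝ, 0 < x → HasDerivAt P ((-1 / 2 + (m + 1 / 2) / x) * P x) x := by
    intro x hx
    have hxc : (x : ℂ) ≠ 0 := by exact_mod_cast hx.ne'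
    have h5 : HasDerivAt (fun x : ℝ => (x : ℂ) ^ (m + 1 / 2))
        ((m + 1 / 2) * (x : ℂ) ^ (m + 1 / 2 - 1)) x := by
      have := ((hasDerivAt_id (x : ℂ)).cpow_const (c := m + 1 / 2)
        (by left; simpa using hx)).comp_ofReal
      simpa using this
    refine (((((hid x).fun_neg).div_const 2).cexp.fun_mul h5).div_const _).congr_deriv ?_
    rw [hP, Complex.cpow_sub _ _ hxc, Complex.cpow_one]
    field_simp
  have dU : ∀ x : ℝ, 0 < x → HasDerivAt U (-U1 x) x := fun x hx => hasDerivAt_tricomi ha b hx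
  have dU1 : ∀ x : ℝ, 0 < x → HasDerivAt U1 (-U2 x) x := fun x hx => hasDerivAt_tricomi ha1 b hx
  have tU := tendsto_tricomi ha b
  have tU1 : Tendsto (fun x : ℝ => (x : ℂ) ^ a * U1 x) atTop (𝓝 0) := by
    have := tendsto_inv_ofReal_atTop.mul (tendsto_tricomi ha1 b)
    rw [zero_mul] at this
    refine this.congr' ?_
    filter_upwards [eventually_gt_atTop 0] with x hx
    have hxc : (x : ℂ) ≠ 0 := by exact_mod_cast hx.ne'
    rw [cpow_add_one' hxc, ← hU1]
    field_simp
  have hPa : ∀ x : ℝ, 0 < x → P x * Complex.exp ((x : ℂ) / 2) * (x : ℂ) ^ (-k) =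
      (x : ℂ) ^ a / Complex.Gamma a := by
    intro x hx
    have hxc : (x : ℂ) ≠ 0 := by exact_mod_cast hx.ne'
    have e1 : Complex.exp (-(x : ℂ) / 2) * Complex.exp ((x : ℂ) / 2) = 1 := by
      rw [← Complex.exp_add, ← Complex.exp_zero]; ring_nf
    have e2 : (x : ℂ) ^ a = (x : ℂ) ^ (m + 1 / 2) * (x : ℂ) ^ (-k) := by
      rw [← Complex.cpow_add _ _ hxc, hadef]; ring_nf
    rw [hP, e2]
    linear_combination ((x : ℂ) ^ (m + 1 / 2) * (x : ℂ) ^ (-k) / Complex.Gamma a) * e1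
  have hexp : ∀ x : ℝ, Complex.exp (-(x : ℂ) / 2) * Complex.exp (-(x : ℂ) / 2) =
      Complex.exp (-(x : ℝ)) := by
    intro x
    rw [← Complex.exp_add]; ring_nf
  have hcp : ∀ (x : ℝ), 0 < x → ∀ (c d e : ℂ), c + d = e →
      (x : ℂ) ^ e = (x : ℂ) ^ c * (x : ℂ) ^ d := by
    intro x hx c d e h
    rw [← Complex.cpow_add _ _ (by exact_mod_cast hx.ne'), h]
  refine ⟨fun x => P x * U x, fun x => (-1 / 2 + (m + 1 / 2) / x) * P x * U x - P x * U1 x, ?_⟩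
  constructor
  · intro x hx
    refine ((dP x hx).fun_mul (dU x hx)).congr_deriv ?_
    ring
  · intro x hx
    have hxc : (x : ℂ) ≠ 0 := by exact_mod_cast hx.ne'
    have h3 : HasDerivAt (fun x : ℝ => -1 / 2 + (m + 1 / 2) / (x : ℂ))
        (-(m + 1 / 2) / (x : ℂ) ^ 2) x := by
      refine (((hasDerivAt_const x (m + 1 / 2)).fun_div (hid x) hxc).const_add (-1 / 2)).congr_deriv ?_
      simp
    refine (((h3.fun_mul (dP x hx)).fun_mul (dU x hx)).fun_sub
      ((dP x hx).fun_mul (dU1 x hx))).congr_deriv ?_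
    have hrel : (x : ℂ) * U2 x + (x - (a + b + 1)) * U1 x - a * U x = 0 := tricomi_relation ha b hx
    have hrel2 : U2 x = -((x - (a + b + 1)) * U1 x - a * U x) / x := by
      field_simp
      linear_combination hrel
    rw [hrel2, hadef, hbdef]
    field_simp
    ring
  · have := tU.div_const (Complex.Gamma a)
    rw [div_self hΓ] at this
    refine this.congr' ?_
    filter_upwards [eventually_gt_atTop 0] with x hx
    linear_combination (-U x) * hPa x hx
  · have := (((tendsto_const_nhds (x := (-1 / 2 : ℂ))).add
      (tendsto_inv_ofReal_atTop.const_mul (m + 1 / 2))).mul (tU.div_const (Complex.Gamma a))).sub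
      (tU1.div_const (Complex.Gamma a))
    rw [div_self hΓ] at this
    refine (this.congr' ?_).trans (by norm_num)
    filter_upwards [eventually_gt_atTop 0] with x hx
    rw [← hU]
    linear_combination (-(-1 / 2 + (m + 1 / 2) * (x : ℂ)⁻¹) * U x + U1 x) * hPa x hx
  · intro ν h1 h2
    have h3 := (mellin_tricomi ha b (s := 1 / 2 + m + ν) h1 (by
      rw [hadef, hbdef]; convert h2 using 2; ring)).1
    refine IntegrableOn.congr_fun (s := Ioi 0) (h3.div_const (Complex.Gamma a)) (fun x hx => ?_) measurableSet_Ioi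
    simp only [hP, ← hexp, ← hU]
    rw [hcp x hx (ν - 1) (m + 1 / 2) (1 / 2 + m + ν - 1) (by ring)]
    ring
  · intro ν h1 h2
    have re1 : (1 / 2 + m + (ν + 1)).re = (1 / 2 + m + ν).re + 1 := by simp; ring
    have re2 : (1 / 2 - m + (ν + 1)).re = (1 / 2 - m + ν).re + 1 := by simp; ring
    have h3 := (mellin_tricomi ha b (s := 1 / 2 + m + ν) h1 (by
      rw [hadef, hbdef]; convert h2 using 2; ring)).1
    have h4 := (mellin_tricomi ha b (s := 1 / 2 + m + (ν + 1)) (by rw [re1]; linarith) (by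
      rw [hadef, hbdef]
      have : (1 / 2 + m + (ν + 1) - (m + 1 / 2 - k) - (m + k - 1 / 2)) = 1 / 2 - m + (ν + 1) := by
        ring
      rw [this, re2]; linarith)).1
    have h5 := (mellin_tricomi ha1 b (s := 1 / 2 + m + (ν + 1)) (by rw [re1]; linarith) (by
      rw [hadef, hbdef]; convert h2 using 2; ring)).1
    refine IntegrableOn.congr_fun (s := Ioi 0) (((h4.const_mul (-1 / 2)).add ((h3.const_mul (m + 1 / 2)).sub h5)).div_const
      (Complex.Gamma a)) (fun x hx => ?_) measurableSet_Ioi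
    have hxc : (x : ℂ) ≠ 0 := by exact_mod_cast (show (0 : ℝ) < x from hx).ne'
    simp only [hP, ← hexp, ← hU, ← hU1, Pi.add_apply, Pi.sub_apply]
    rw [hcp x hx (ν - 1) (m + 1 / 2) (1 / 2 + m + ν - 1) (by ring),
      hcp x hx ν (m + 1 / 2) (1 / 2 + m + (ν + 1) - 1) (by ring),
      hcp x hx (ν - 1) 1 ν (by ring), Complex.cpow_one]
    field_simp
    ring
  · intro ν h1 h2
    have h3 := (mellin_tricomi ha b (s := 1 / 2 + m + ν) h1 (by
      rw [hadef, hbdef]; convert h2 using 2; ring)).2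
    have h4 : ∫ x in Ioi (0 : ℝ), Complex.exp (-(x : ℂ) / 2) * (x : ℂ) ^ (ν - 1) * (P x * U x) =
        (∫ x in Ioi (0 : ℝ), Complex.exp (-(x : ℝ)) * (x : ℂ) ^ (1 / 2 + m + ν - 1) *
          tricomi a b x) / Complex.Gamma a := by
      rw [← integral_div]
      refine setIntegral_congr_fun measurableSet_Ioi fun x hx => ?_
      simp only [hP, ← hexp, ← hU]
      rw [hcp x hx (ν - 1) (m + 1 / 2) (1 / 2 + m + ν - 1) (by ring)]
      ring
    rw [h4, h3, show 1 / 2 + m + ν - a - b = 1 / 2 - m + ν by rw [hadef, hbdef]; ring,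
      show 1 / 2 + m + ν - b = ν - k + 1 by rw [hbdef]; ring]
    field_simp

/-- The Whittaker function exists for all parameters: by `n` raising steps from a parameter `k - n`
to which Tricomi's integral applies. -/
theorem exists_whittakerPair (n : ℕ) (k : ℂ) {m : ℂ}
    (hk : (k - n).re < m.re + 1 / 2) : ∃ w w' : ℝ → ℂ, WhittakerPair k m w w' := by
  induction n generalizing k with
  | zero =>
    refine exists_whittakerPair_of_re_pos ?_
    simp at hk ⊢
    linarith
  | succ n ih =>
    obtain ⟨w, w', h⟩ := ih (k - 1) (by
      refine lt_of_eq_of_lt ?_ hk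
      push_cast
      ring_nf)
    have := h.raise
    rw [sub_add_cancel] at this
    exact ⟨_, _, this⟩

end

/-! ### Uniqueness of Whittaker functions -/

section

open Filter Topology Set Asymptotics

/-- Uniqueness for the Cauchy problem of `f'' = Q f` on `(0, ∞)` with zero initial data. -/
theorem eq_zero_of_second_order_ode {Q f f' : ℝ → ℂ} (hQ : ContinuousOn Q (Ioi 0))
    (h1 : ∀ x : ℝ, 0 < x → HasDerivAt f (f' x) x)
    (h2 : ∀ x : ℝ, 0 < x → HasDerivAt f' (Q x * f x) x) {x₁ : ℝ} (hx₁ : 0 < x₁)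
    (h3 : f x₁ = 0) (h4 : f' x₁ = 0) : ∀ x : ℝ, 0 < x → f x = 0 := by
  intro x hx
  set a := min x x₁ / 2 with ha
  set b := max x x₁ + 1 with hb
  have ha0 : 0 < a := by have := lt_min hx hx₁; positivity
  have hax : a < min x x₁ := by have := lt_min hx hx₁; rw [ha]; linarith
  have hbx : max x x₁ < b := by rw [hb]; linarith
  obtain ⟨M, hM⟩ := (isCompact_Icc (a := a) (b := b)).exists_bound_of_continuousOn
    (hQ.mono fun y hy => lt_of_lt_of_le ha0 hy.1)
  have hlip : ∀ t ∈ Ioo a b, LipschitzOnWith (max 1 M).toNNReal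
      (fun y : ℂ × ℂ => (y.2, Q t * y.1)) univ := by
    intro t ht
    refine LipschitzOnWith.of_dist_le_mul fun y _ z _ => ?_
    rw [Real.coe_toNNReal _ (by positivity), Prod.dist_eq, Prod.dist_eq]
    simp only [dist_eq_norm, ← mul_sub, norm_mul]
    have hMt := hM t ⟨ht.1.le, ht.2.le⟩
    have hm1 := le_max_left 1 M
    have hm2 := le_max_right 1 M
    refine max_le ?_ ?_
    · calc ‖y.2 - z.2‖ ≤ 1 * max ‖y.1 - z.1‖ ‖y.2 - z.2‖ := by
            rw [one_mul]; exact le_max_right _ _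
        _ ≤ _ := by gcongr
    · exact mul_le_mul (hMt.trans hm2) (le_max_left _ _) (norm_nonneg _) (by positivity)
  have := ODE_solution_unique_of_mem_Ioo (v := fun t (y : ℂ × ℂ) => (y.2, Q t * y.1))
    (f := fun t => (f t, f' t)) (g := fun _ => (0, 0)) hlip (t₀ := x₁)
    ⟨lt_of_lt_of_le hax (min_le_right _ _), lt_of_le_of_lt (le_max_right _ _) hbx⟩
    (fun t ht => ⟨(h1 t (ha0.trans ht.1)).prodMk (h2 t (ha0.trans ht.1)), mem_univ _⟩)
    (fun t _ => ⟨(hasDerivAt_const t ((0 : ℂ), (0 : ℂ))).congr_deriv (by simp only [mul_zero]; rfl), mem_univ _⟩)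
    (by simp [h3, h4])
    (show x ∈ Ioo a b from
      ⟨lt_of_lt_of_le hax (min_le_left _ _), lt_of_le_of_lt (le_max_left _ _) hbx⟩)
  exact congrArg Prod.fst this

/-- A solution of Whittaker's equation of slow growth is a multiple of the Whittaker function: the
quotient `v / w` has derivative `C / w²` with a constant `C`, and would grow like `e^x` if `C ≠ 0`. -/
theorem WhittakerPair.eq_const_mul {κ : ℝ} {m : ℂ} {w w' : ℝ → ℂ} (h : WhittakerPair κ m w w')
    {v v' : ℝ → ℂ} (hv : ∀ x : ℝ, 0 < x → HasDerivAt v (v' x) x)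
    (hv' : ∀ x : ℝ, 0 < x →
      HasDerivAt v' (-((-1 / 4 + (κ : ℂ) / x + (1 / 4 - m ^ 2) / (x : ℂ) ^ 2) * v x)) x)
    (hO : v =O[atTop] fun x : ℝ => Real.exp (x / 32)) :
    ∃ a : ℂ, ∀ x : ℝ, 0 < x → v x = a * w x := by
  set Q : ℝ → ℂ := fun x => -(-1 / 4 + (κ : ℂ) / x + (1 / 4 - m ^ 2) / (x : ℂ) ^ 2) with hQdef
  have hQ : ContinuousOn Q (Ioi 0) := by
    intro x hx
    have hxc : (x : ℂ) ≠ 0 := by exact_mod_cast (show (0 : ℝ) < x from hx).ne'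
    have c1 : ContinuousAt (fun x : ℝ => (x : ℂ)) x := Complex.continuous_ofReal.continuousAt
    refine ContinuousAt.continuousWithinAt ?_
    exact ((continuousAt_const.add (continuousAt_const.div c1 hxc)).add
      (continuousAt_const.div (c1.pow 2) (pow_ne_zero 2 hxc))).neg
  -- the size of `w` at infinity
  have hE : Tendsto (fun x : ℝ => (w x ^ 2)⁻¹ * ((Real.exp (-x) * x ^ (2 * κ) : ℝ) : ℂ))
      atTop (𝓝 1) := by
    have h1 := (h.asymp.pow 2).inv₀ (by norm_num)
    rw [one_pow, inv_one] at h1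
    refine h1.congr' ?_
    filter_upwards [eventually_gt_atTop 0] with x hx
    have hxc : (x : ℂ) ≠ 0 := by exact_mod_cast hx.ne'
    have e1 : ((x ^ (2 * κ) : ℝ) : ℂ) = ((x : ℂ) ^ (κ : ℂ)) ^ 2 := by
      rw [Complex.ofReal_cpow hx.le, ← Complex.cpow_nat_mul]
      push_cast; rfl
    have e2 : ((Real.exp (-x) : ℝ) : ℂ) = (Complex.exp ((x : ℂ) / 2) ^ 2)⁻¹ := by
      rw [← Complex.exp_nat_mul, ← Complex.exp_neg]
      push_cast; ring_nf
    rw [Complex.ofReal_mul, e1, e2, Complex.cpow_neg]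
    simp only [mul_pow, mul_inv, inv_pow, inv_inv]
    ring
  have hre : ∀ᶠ x : ℝ in atTop, 1 / 2 < ((w x ^ 2)⁻¹ * ((Real.exp (-x) * x ^ (2 * κ) : ℝ) : ℂ)).re :=
    ((Complex.continuous_re.tendsto 1).comp hE).eventually (lt_mem_nhds (by norm_num))
  have hno : ∀ᶠ x : ℝ in atTop, ‖(w x ^ 2)⁻¹ * ((Real.exp (-x) * x ^ (2 * κ) : ℝ) : ℂ)‖ < 4 :=
    (hE.norm).eventually (gt_mem_nhds (by norm_num))
  have hp1 : ∀ᶠ x : ℝ in atTop, x ^ (2 * κ) ≤ 1 / 2 * Real.exp (1 / 4 * x) := by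
    have := (isLittleO_rpow_exp_pos_mul_atTop (2 * κ) (b := 1 / 4) (by norm_num)).bound
      (show (0 : ℝ) < 1 / 2 by norm_num)
    filter_upwards [this, eventually_gt_atTop 0] with x hx h0
    rwa [Real.norm_of_nonneg (by positivity), Real.norm_of_nonneg (by positivity)] at hx
  have hp2 : ∀ᶠ x : ℝ in atTop, x ^ (-(2 * κ)) ≤ 1 * Real.exp (1 / 64 * x) := by
    have := (isLittleO_rpow_exp_pos_mul_atTop (-(2 * κ)) (b := 1 / 64) (by norm_num)).bound
      (show (0 : ℝ) < 1 by norm_num)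
    filter_upwards [this, eventually_gt_atTop 0] with x hx h0
    rwa [Real.norm_of_nonneg (by positivity), Real.norm_of_nonneg (by positivity)] at hx
  have hlow : ∀ᶠ x : ℝ in atTop, w x ≠ 0 ∧ Real.exp (3 / 4 * x) ≤ ((w x ^ 2)⁻¹).re := by
    filter_upwards [hre, hp1, eventually_gt_atTop 0] with x h1 h2 h0
    rw [Complex.re_mul_ofReal] at h1
    have hpos : 0 < Real.exp (-x) * x ^ (2 * κ) := by positivity
    refine ⟨fun h3 => ?_, ?_⟩
    · rw [h3] at h1; norm_num at h1
    · have h4 : Real.exp (3 / 4 * x) * (Real.exp (-x) * x ^ (2 * κ)) ≤ 1 / 2 := by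
        calc _ ≤ Real.exp (3 / 4 * x) * (Real.exp (-x) * (1 / 2 * Real.exp (1 / 4 * x))) := by
              gcongr
          _ = 1 / 2 * (Real.exp (3 / 4 * x) * Real.exp (-x) * Real.exp (1 / 4 * x)) := by ring
          _ = 1 / 2 := by rw [← Real.exp_add, ← Real.exp_add]; ring_nf; simp
      by_contra h5
      push Not at h5
      nlinarith [mul_lt_mul_of_pos_right h5 hpos]
  have hupp : ∀ᶠ x : ℝ in atTop, ‖(w x)⁻¹‖ ≤ 2 * Real.exp (1 / 2 * x + 1 / 128 * x) := by
    filter_upwards [hno, hp2, eventually_gt_atTop 0] with x h1 h2 h0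
    have hpos : 0 < Real.exp (-x) * x ^ (2 * κ) := by positivity
    rw [norm_mul, Complex.norm_real, Real.norm_of_nonneg hpos.le, norm_inv, norm_pow] at h1
    rw [norm_inv]
    have h3 : (‖w x‖ ^ 2)⁻¹ ≤ 4 * (Real.exp x * x ^ (-(2 * κ))) := by
      rw [Real.rpow_neg h0.le, ← neg_neg x, Real.exp_neg (- x), neg_neg, ← mul_inv,
        ← div_eq_mul_inv, le_div_iff₀ hpos]
      exact h1.le
    refine le_of_sq_le_sq ?_ (by positivity)
    calc _ = (‖w x‖ ^ 2)⁻¹ := by rw [inv_pow]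
      _ ≤ 4 * (Real.exp x * x ^ (-(2 * κ))) := h3
      _ ≤ 4 * (Real.exp x * (1 * Real.exp (1 / 64 * x))) := by gcongr
      _ = 4 * Real.exp (x + 1 / 64 * x) := by rw [one_mul, Real.exp_add]
      _ = _ := by
        rw [mul_pow, ← Real.exp_nat_mul]; norm_num; ring_nf
  -- the Wronskian is constant
  set Wr : ℝ → ℂ := fun x => v' x * w x - v x * w' x with hWr
  have hWd : ∀ x ∈ Ioi (0 : ℝ), HasDerivAt Wr 0 x := by
    intro x hx
    refine (((hv' x hx).fun_mul (h.ode x hx)).fun_sub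
      ((hv x hx).fun_mul (h.ode' x hx))).congr_deriv ?_
    ring
  obtain ⟨C, hC⟩ := isOpen_Ioi.exists_is_const_of_deriv_eq_zero isPreconnected_Ioi
    (fun x hx => (hWd x hx).differentiableAt.differentiableWithinAt) (fun x hx => (hWd x hx).deriv)
  have hC0 : C = 0 := by
    by_contra hCne
    obtain ⟨A, hA, hvb⟩ := hO.exists_pos
    rw [IsBigOWith] at hvb
    set g : ℝ → ℝ := fun x => (v x / (C * w x)).re with hg
    have hgu : ∀ᶠ x : ℝ in atTop, |g x| ≤ (A * ‖C⁻¹‖ * 2) * Real.exp (5 / 8 * x) := by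
      filter_upwards [hvb, hupp, eventually_gt_atTop 0] with x h1 h2 h0
      rw [Real.norm_of_nonneg (Real.exp_pos _).le] at h1
      calc |g x| ≤ ‖v x / (C * w x)‖ := Complex.abs_re_le_norm _
        _ = ‖v x‖ * ‖C⁻¹‖ * ‖(w x)⁻¹‖ := by
            rw [div_eq_mul_inv, mul_inv, norm_mul, norm_mul, mul_assoc]
        _ ≤ (A * Real.exp (x / 32)) * ‖C⁻¹‖ * (2 * Real.exp (1 / 2 * x + 1 / 128 * x)) := by
            gcongr
        _ = (A * ‖C⁻¹‖ * 2) * Real.exp (x / 32 + (1 / 2 * x + 1 / 128 * x)) := by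
            rw [Real.exp_add (x / 32)]; ring
        _ ≤ _ := by
            gcongr
            linarith
    obtain ⟨X, hX⟩ := eventually_atTop.1 (hlow.and (hgu.and (eventually_gt_atTop 0)))
    have hgd : ∀ x, X ≤ x → HasDerivAt g ((w x ^ 2)⁻¹).re x := by
      intro x hx
      have h0 := (hX x hx).2.2
      have hw := (hX x hx).1.1
      have h5 : HasDerivAt (fun x => v x / (C * w x)) ((w x ^ 2)⁻¹) x := by
        refine ((hv x h0).fun_div ((h.ode x h0).const_mul C) (mul_ne_zero hCne hw)).congr_deriv ?_
        have h6 : v' x * w x - v x * w' x = C := hC x h0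
        field_simp
        linear_combination h6
      exact (Complex.reCLM.hasFDerivAt.comp_hasDerivAt x h5)
    have hmv : ∀ x, X ≤ x → Real.exp (3 / 4 * x) ≤
        2 * ((A * ‖C⁻¹‖ * 2) * Real.exp (5 / 8 * (x + 1))) := by
      intro x hx
      obtain ⟨ξ, hξ, he⟩ := exists_hasDerivAt_eq_slope g (fun x => ((w x ^ 2)⁻¹).re)
        (show x < x + 1 by linarith)
        (fun y hy => (hgd y (hx.trans hy.1)).continuousAt.continuousWithinAt)
        (fun y hy => hgd y (hx.trans hy.1.le))
      rw [add_sub_cancel_left, div_one] at he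
      have h7 := (hX ξ (hx.trans hξ.1.le)).1.2
      have h8 := abs_le.1 (hX x hx).2.1
      have h9 := abs_le.1 (hX (x + 1) (by linarith)).2.1
      have h10 : Real.exp (3 / 4 * x) ≤ Real.exp (3 / 4 * ξ) := by
        have := hξ.1; gcongr
      have h11 : (A * ‖C⁻¹‖ * 2) * Real.exp (5 / 8 * x) ≤
          (A * ‖C⁻¹‖ * 2) * Real.exp (5 / 8 * (x + 1)) := by
        gcongr; linarith
      linarith
    have ht : Tendsto (fun x : ℝ => Real.exp (1 / 8 * x)) atTop atTop :=
      Real.tendsto_exp_atTop.comp (tendsto_id.const_mul_atTop (by norm_num))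
    obtain ⟨x, hx1, hx2⟩ := ((ht.eventually_gt_atTop
      (2 * ((A * ‖C⁻¹‖ * 2) * Real.exp (5 / 8)))).and (eventually_ge_atTop X)).exists
    have h12 := hmv x hx2
    have e1 : Real.exp (3 / 4 * x) = Real.exp (1 / 8 * x) * Real.exp (5 / 8 * x) := by
      rw [← Real.exp_add]; ring_nf
    have e2 : Real.exp (5 / 8 * (x + 1)) = Real.exp (5 / 8) * Real.exp (5 / 8 * x) := by
      rw [← Real.exp_add]; ring_nf
    rw [e1, e2] at h12
    have := mul_lt_mul_of_pos_right hx1 (Real.exp_pos (5 / 8 * x))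
    linarith
  obtain ⟨x₁, ⟨hw1, -⟩, hx1⟩ := (hlow.and (eventually_gt_atTop 0)).exists
  refine ⟨v x₁ / w x₁, fun x hx => ?_⟩
  have h13 : v' x₁ * w x₁ - v x₁ * w' x₁ = 0 := by rw [← hC0]; exact hC x₁ hx1
  have := eq_zero_of_second_order_ode (f := fun x => v x - v x₁ / w x₁ * w x)
    (f' := fun x => v' x - v x₁ / w x₁ * w' x) hQ
    (fun x hx => (hv x hx).fun_sub ((h.ode x hx).const_mul _))
    (fun x hx => ((hv' x hx).fun_sub ((h.ode' x hx).const_mul _)).congr_deriv (by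
      simp only [hQdef]; ring)) hx1 (by field_simp; ring)
    (by field_simp; linear_combination h13) x hx
  exact sub_eq_zero.1 this

/-- The function `whittakerW` is the one constructed from Tricomi's integral. -/
theorem exists_whittakerPair_eq (κ : ℝ) (m : ℂ) : ∃ w w' : ℝ → ℂ, WhittakerPair κ m w w' ∧
    ∀ x : ℝ, 0 < x → whittakerW κ m x = w x := by
  obtain ⟨n, hn⟩ := exists_nat_gt (κ - (m.re + 1 / 2))
  obtain ⟨w, w', h⟩ := exists_whittakerPair n (κ : ℂ) (m := m) (by simp at hn ⊢; linarith)
  have hw : IsWhittakerFn κ m w := ⟨⟨w', fun x hx => ⟨h.ode x hx, h.ode' x hx⟩⟩, h.asymp⟩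
  obtain ⟨⟨f', hf⟩, hfa⟩ : IsWhittakerFn κ m (whittakerW κ m) :=
    Classical.epsilon_spec (p := IsWhittakerFn κ m) ⟨w, hw⟩
  have hO : whittakerW κ m =O[atTop] fun x : ℝ => Real.exp (x / 32) := by
    have h1 := hfa.isBigO_one ℝ
    have h2 : (fun x : ℝ => Complex.exp (-(x : ℂ) / 2) * (x : ℂ) ^ (κ : ℂ)) =O[atTop]
        fun x : ℝ => Real.exp (x / 32) := by
      have := (isLittleO_rpow_exp_pos_mul_atTop κ (b := 1 / 2) (by norm_num)).isBigO.bound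
      obtain ⟨c, hc⟩ := this
      refine IsBigO.of_bound c ?_
      filter_upwards [hc, eventually_gt_atTop 0] with x hx h0
      have hc0 : 0 ≤ c := by
        by_contra hneg
        push Not at hneg
        have := (norm_nonneg _).trans hx
        have h5 : 0 < ‖Real.exp (1 / 2 * x)‖ := norm_pos_iff.2 (Real.exp_pos _).ne'
        nlinarith
      rw [Real.norm_of_nonneg (by positivity), Real.norm_of_nonneg (by positivity)] at hx
      rw [norm_mul, Complex.norm_cpow_eq_rpow_re_of_pos h0, Complex.norm_exp,
        Real.norm_of_nonneg (by positivity)]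
      simp only [Complex.ofReal_re]
      have e3 : (-(x : ℂ) / 2).re = -(1 / 2 * x) := by simp; ring
      rw [e3]
      calc _ ≤ Real.exp (-(1 / 2 * x)) * (c * Real.exp (1 / 2 * x)) := by gcongr
        _ = c * 1 := by
          rw [mul_left_comm, ← Real.exp_add]; simp
        _ ≤ _ := by gcongr; exact Real.one_le_exp (by positivity)
    have h3 := h1.mul h2
    simp only [one_mul] at h3
    refine h3.congr' ?_ EventuallyEq.rfl
    filter_upwards [eventually_gt_atTop 0] with x hx
    have hxc : (x : ℂ) ≠ 0 := by exact_mod_cast hx.ne'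
    have e1 : Complex.exp (-(x : ℂ) / 2) * Complex.exp ((x : ℂ) / 2) = 1 := by
      rw [← Complex.exp_add, ← Complex.exp_zero]; ring_nf
    have e2 : (x : ℂ) ^ (-(κ : ℂ)) * (x : ℂ) ^ (κ : ℂ) = 1 := by
      rw [← Complex.cpow_add _ _ hxc]; simp
    calc _ = whittakerW κ m x * (Complex.exp (-(x : ℂ) / 2) * Complex.exp ((x : ℂ) / 2)) *
        ((x : ℂ) ^ (-(κ : ℂ)) * (x : ℂ) ^ (κ : ℂ)) := by ring
      _ = _ := by rw [e1, e2]; ring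
  obtain ⟨a, ha⟩ := h.eq_const_mul (fun x hx => (hf x hx).1) (fun x hx => (hf x hx).2) hO
  have ha1 : a = 1 := by
    have h1 := h.asymp.const_mul a
    rw [mul_one] at h1
    refine tendsto_nhds_unique (h1.congr' ?_) hfa
    filter_upwards [eventually_gt_atTop 0] with x hx
    rw [ha x hx]; ring
  exact ⟨w, w', h, fun x hx => by rw [ha x hx, ha1, one_mul]⟩

end

/-! ### The Whittaker model on the diagonal -/

section

open Filter Topology Set Asymptotics

theorem upper_apply (a d : ℝˣ) (x : ℝ) (i j : Fin 2) :
    (upper a d x : Matrix (Fin 2) (Fin 2) ℝ) i j = !![(a : ℝ), x; 0, (d : ℝ)] i j := rfl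

/-- The unit `e^t`. -/
def expUnit (t : ℝ) : ℝˣ := Units.mk0 (Real.exp t) (Real.exp_pos t).ne'

theorem expUnit_zero : expUnit 0 = 1 := by ext; simp [expUnit]

theorem upper_one : upper 1 1 0 = 1 := by
  ext1
  simp [upper, Matrix.one_fin_two]

theorem hasDerivAt_cexp_mul (q : ℂ) : HasDerivAt (fun t : ℝ => Complex.exp (t * q)) q 0 := by
  have h := ((hasDerivAt_id ((0 : ℝ) : ℂ)).comp_ofReal.mul_const q).cexp
  simpa using h

theorem ofReal_exp_cpow (t : ℝ) (q : ℂ) : ((Real.exp t : ℝ) : ℂ) ^ q = Complex.exp (t * q) := by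
  rw [Complex.cpow_def_of_ne_zero (by exact_mod_cast (Real.exp_pos t).ne'),
    ← Complex.ofReal_log (Real.exp_pos t).le, Real.log_exp]

/-- The centre of the Lie algebra acts by the derivative of the action of the centre. -/
theorem IsSmooth.lie_one {W : GL2 → ℂ} (hW : IsSmooth W) {q : ℂ}
    (h : ∀ (t : ℝ) (g : GL2), W (upper (expUnit t) (expUnit t) 0 * g) = Complex.exp (t * q) * W g)
    (g : GL2) : BesselZeta.lie 1 W g = q * W g := by
  have e0 : upper (expUnit 0) (expUnit 0) 0 * g = g := by rw [expUnit_zero, upper_one, one_mul]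
  have hc : ∀ i j, HasDerivAt
      (fun t : ℝ => ((upper (expUnit t) (expUnit t) 0 * g : GL2) : Matrix (Fin 2) (Fin 2) ℝ) i j)
      ((((upper (expUnit 0) (expUnit 0) 0 * g : GL2) : Matrix (Fin 2) (Fin 2) ℝ) *
        (1 : Matrix (Fin 2) (Fin 2) ℝ)) i j) 0 := by
    have h1 := Real.hasDerivAt_exp 0
    intro i j
    rw [e0, mul_one]
    have := h1.mul_const ((g : Matrix (Fin 2) (Fin 2) ℝ) i j)
    rw [Real.exp_zero, one_mul] at this
    refine this.congr_of_eventuallyEq (Eventually.of_forall fun t => ?_)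
    fin_cases i <;> simp [Matrix.mul_apply, Fin.sum_univ_two, upper_apply, expUnit]
  have h3 := hW.hasDerivAt_curve hc
  rw [e0] at h3
  have h4 : HasDerivAt (fun t : ℝ => Complex.exp (t * q) * W g) (q * W g) 0 :=
    (hasDerivAt_cexp_mul q).mul_const _
  exact h3.unique (h4.congr_of_eventuallyEq (Eventually.of_forall fun t => h t g))

theorem IsCentralChar.expUnit_mul {V : Submodule ℂ (GL2 → ℂ)} {ω : ℝˣ →* ℂˣ} {q : ℂ}
    (hω : IsCentralChar V ω) (hq : ∀ y : ℝˣ, 0 < (y : ℝ) → (ω y : ℂ) = ((y : ℝ) : ℂ) ^ q)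
    {W : GL2 → ℂ} (hW : W ∈ V) (t : ℝ) (g : GL2) :
    W (upper (expUnit t) (expUnit t) 0 * g) = Complex.exp (t * q) * W g := by
  rw [hω W hW, hq _ (Real.exp_pos t), ← ofReal_exp_cpow]
  rfl

/-- The matrix `diag(t, 1)`, for `t ≠ 0`. -/
def diagOne (t : ℝ) : GL2 := open Classical in if h : t ≠ 0 then upper (Units.mk0 t h) 1 0 else 1

theorem diagOne_apply {t : ℝ} (ht : t ≠ 0) (i j : Fin 2) :
    (diagOne t : Matrix (Fin 2) (Fin 2) ℝ) i j = !![t, 0; 0, 1] i j := by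
  rw [diagOne, dif_pos ht, upper_apply]
  simp

theorem upper_eq_diagOne (t : ℝˣ) : upper t 1 0 = diagOne t := by
  rw [diagOne, dif_pos t.ne_zero]
  congr 1
  ext; rfl

/-- The derivative along `diag(t, 1)` is the action of `diag(1, 0)`, divided by `t`. -/
theorem hasDerivAt_diagOne {W : GL2 → ℂ} (hW : IsSmooth W) {t : ℝ} (ht : t ≠ 0) :
    HasDerivAt (fun t => W (diagOne t)) (lie !![1, 0; 0, 0] W (diagOne t) / t) t := by
  have hc : ∀ i j, HasDerivAt (fun t : ℝ => (diagOne t : Matrix (Fin 2) (Fin 2) ℝ) i j)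
      (((diagOne t : Matrix (Fin 2) (Fin 2) ℝ) * (t⁻¹ • (!![1, 0; 0, 0] : Matrix (Fin 2) (Fin 2) ℝ))) i j) t := by
    intro i j
    have h1 : HasDerivAt (fun t : ℝ => !![t, 0; 0, (1 : ℝ)] i j) (!![(1 : ℝ), 0; 0, 0] i j) t := by
      fin_cases i <;> fin_cases j <;> simp [hasDerivAt_id', hasDerivAt_const]
    refine (h1.congr_of_eventuallyEq ?_).congr_deriv ?_
    · filter_upwards [isOpen_ne.mem_nhds ht] with s hs using diagOne_apply hs i j
    · fin_cases i <;> fin_cases j <;>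
        simp [Matrix.mul_apply, Fin.sum_univ_two, diagOne_apply ht, ht]
  have h := hW.hasDerivAt_curve hc
  rw [hW.lie_smul] at h
  refine h.congr_deriv ?_
  push_cast
  rw [div_eq_inv_mul]

/-- On `diag(t, 1)` the raising nilpotent acts by a scalar, by equivariance under the unipotent
subgroup. -/
theorem lieR_diagOne {W : GL2 → ℂ} (hW : IsSmooth W) {c : ℝ}
    (hN : ∀ (x : ℝ) (g : GL2),
      W (upper 1 1 x * g) = Complex.exp (2 * Real.pi * Complex.I * (c * x : ℝ)) * W g)
    {t : ℝ} (ht : t ≠ 0) :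
    lie lieR W (diagOne t) = 2 * Real.pi * Complex.I * c * t * W (diagOne t) := by
  have e0 : upper 1 1 (t * 0) * diagOne t = diagOne t := by rw [mul_zero, upper_one, one_mul]
  have hc : ∀ i j, HasDerivAt
      (fun s : ℝ => ((upper 1 1 (t * s) * diagOne t : GL2) : Matrix (Fin 2) (Fin 2) ℝ) i j)
      ((((upper 1 1 (t * 0) * diagOne t : GL2) : Matrix (Fin 2) (Fin 2) ℝ) * lieR) i j) 0 := by
    intro i j
    rw [e0]
    have h1 : HasDerivAt (fun s : ℝ => t * s) t 0 := by
      simpa using (hasDerivAt_id (0 : ℝ)).const_mul t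
    fin_cases i <;> fin_cases j <;>
      simp [Matrix.mul_apply, Fin.sum_univ_two, diagOne_apply ht, upper_apply, lieR, hasDerivAt_const, h1]
  have h3 := hW.hasDerivAt_curve hc
  rw [e0] at h3
  have h4 : HasDerivAt (fun s : ℝ => Complex.exp (s * (2 * Real.pi * Complex.I * c * t)) *
      W (diagOne t)) (2 * Real.pi * Complex.I * c * t * W (diagOne t)) 0 :=
    (hasDerivAt_cexp_mul _).mul_const _
  refine h3.unique (h4.congr_of_eventuallyEq (Eventually.of_forall fun s => ?_))
  simp only [hN]
  push_cast
  ring_nf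

theorem lieR_mul_lieL_sub : lieR * lieL - lieL * lieR = lieH := by
  ext i j
  fin_cases i <;> fin_cases j <;> simp [lieR, lieL, lieH]

theorem lieH_eq : lieH = (2 : ℝ) • !![1, 0; 0, 0] - (1 : Matrix (Fin 2) (Fin 2) ℝ) := by
  ext i j
  fin_cases i <;> fin_cases j <;> simp [lieH]; norm_num

/-- The Casimir operator on a vector of weight `l` in a Whittaker model, at `diag(t, 1)`: a second
order operator in the action of `diag(1, 0)`, which is the Euler operator `t d/dt` there. -/
theorem casimir_diagOne {c : ℝ} {V : Submodule ℂ (GL2 → ℂ)} (hV : IsWhittakerModel c V)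
    {ω : ℝˣ →* ℂˣ} (hω : IsCentralChar V ω)
    {q : ℂ} (hq : ∀ y : ℝˣ, 0 < (y : ℝ) → (ω y : ℂ) = ((y : ℝ) : ℂ) ^ q)
    {W : GL2 → ℂ} (hW : W ∈ V) {l : ℤ} (hl : W ∈ weightSpace l) {t : ℝ} (ht : t ≠ 0) :
    4 * casimir W (diagOne t) =
      4 * (lie !![1, 0; 0, 0] (lie !![1, 0; 0, 0] W) (diagOne t) -
        (q + 1) * lie !![1, 0; 0, 0] W (diagOne t) + q / 2 * (q / 2 + 1) * W (diagOne t)) +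
      4 * ((2 * Real.pi * Complex.I * c * t) ^ 2 -
        Complex.I * l * (2 * Real.pi * Complex.I * c * t)) * W (diagOne t) := by
  have hsm := hV.smooth
  have hst := hV.stable.2
  have hH : ∀ W' ∈ V, lie lieH W' = fun g => 2 * lie !![1, 0; 0, 0] W' g + (-q) * W' g := by
    intro W' hW'
    ext g
    rw [lieH_eq, (hsm W' hW').lie_sub, (hsm W' hW').lie_smul,
      (hsm W' hW').lie_one (hω.expUnit_mul hq hW')]
    push_cast
    ring
  have hL : lie lieL W = fun g => lie lieR W g + (-(Complex.I * l)) * W g := by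
    ext g
    have h := lieR_sub_lieL_weight (hsm W hW) hl g
    rw [(hsm W hW).lie_sub] at h
    linear_combination -h
  have hc := (hsm W hW).lie_lie_sub lieR lieL (diagOne t)
  rw [lieR_mul_lieL_sub] at hc
  have hmul : ∀ (a : ℂ) (W' : GL2 → ℂ), W' ∈ V → IsSmooth (fun g => a * W' g) := fun a W' hW' =>
    hsm _ (V.smul_mem a hW')
  have hNW := hst !![1, 0; 0, 0] W hW
  have hHH : lie lieH (lie lieH W) (diagOne t) =
      2 * lie lieH (lie !![1, 0; 0, 0] W) (diagOne t) + (-q) * lie lieH W (diagOne t) := by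
    conv_lhs => rw [hH W hW]
    rw [(hmul 2 _ hNW).lie_add_fun (hmul (-q) _ hW), lie_const_mul, lie_const_mul]
  have hRL : lie lieR (lie lieL W) (diagOne t) = lie lieR (lie lieR W) (diagOne t) +
      (-(Complex.I * l)) * lie lieR W (diagOne t) := by
    conv_lhs => rw [hL]
    rw [(hsm _ (hst lieR W hW)).lie_add_fun (hmul _ _ hW), lie_const_mul]
  rw [lieR_diagOne (hsm _ (hst lieR W hW)) (hV.whittaker _ (hst lieR W hW)) ht,
    lieR_diagOne (hsm W hW) (hV.whittaker W hW) ht] at hRL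
  rw [congrFun (hH _ hNW) (diagOne t), congrFun (hH _ hW) (diagOne t)] at hHH
  rw [congrFun (hH W hW) (diagOne t)] at hc
  rw [casimir, hHH]
  linear_combination (4 : ℂ) * hRL - 2 * hc

/-- The vector of weight `l` on `diag(t, 1)`, for `t` of the sign `ε`, is a multiple of a Whittaker
function. -/
theorem exists_whittaker_eq {c : ℝ} (hc : 0 < c) {V : Submodule ℂ (GL2 → ℂ)}
    (hV : IsWhittakerModel c V) {ω : ℝˣ →* ℂˣ} (hω : IsCentralChar V ω)
    {q : ℂ} (hq : ∀ y : ℝˣ, 0 < (y : ℝ) → (ω y : ℂ) = ((y : ℝ) : ℂ) ^ q)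
    {r : ℂ} (hr : ∀ W ∈ V, ∀ g, casimir W g = -(1 / 4 + (r / 2) ^ 2) * W g)
    {W : GL2 → ℂ} (hW : W ∈ V) {l : ℤ} (hl : W ∈ weightSpace l) {ε : ℝ} (hε : ε ^ 2 = 1) :
    ∃ a : ℂ, ∀ x : ℝ, 0 < x → W (diagOne (ε * x / (4 * Real.pi * c))) =
      a * (x : ℂ) ^ (q / 2) * whittakerW ((ε * l / 2 : ℝ) : ℂ) (Complex.I * r / 2) x := by
  have hsm := hV.smooth
  have hst := hV.stable.2
  have hpi := Real.pi_pos
  have hε0 : ε ≠ 0 := by rintro rfl; norm_num at hε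
  have hεc : (ε : ℂ) ^ 2 = 1 := by exact_mod_cast hε
  set b : ℝ := ε / (4 * Real.pi * c) with hb
  have hb0 : b ≠ 0 := by positivity
  have hbx : ∀ x : ℝ, ε * x / (4 * Real.pi * c) = b * x := fun x => by rw [hb]; ring
  simp only [hbx]
  set N := !![(1 : ℝ), 0; 0, 0] with hN
  obtain ⟨w, w', hw, hww⟩ := exists_whittakerPair_eq (ε * l / 2) (Complex.I * r / 2)
  have hd : ∀ W' ∈ V, ∀ x : ℝ, 0 < x →
      HasDerivAt (fun x : ℝ => W' (diagOne (b * x))) (lie N W' (diagOne (b * x)) / x) x := by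
    intro W' hW' x hx
    have hxc : (x : ℂ) ≠ 0 := by exact_mod_cast hx.ne'
    have hbc : (b : ℂ) ≠ 0 := by exact_mod_cast hb0
    have h1 := (hasDerivAt_diagOne (hsm W' hW') (t := b * x) (by positivity)).scomp x
      ((hasDerivAt_id x).const_mul b)
    refine h1.congr_deriv ?_
    rw [Complex.real_smul]
    rw [← hN]
    push_cast
    field_simp
  have hpow : ∀ (s : ℂ) (x : ℝ), 0 < x →
      HasDerivAt (fun x : ℝ => (x : ℂ) ^ s) (s * ((x : ℂ) ^ s / x)) x := by
    intro s x hx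
    have hxc : (x : ℂ) ≠ 0 := by exact_mod_cast hx.ne'
    have := ((hasDerivAt_id (x : ℂ)).cpow_const (c := s) (by left; simpa using hx)).comp_ofReal
    rw [Complex.cpow_sub _ _ (by simpa using hxc), Complex.cpow_one] at this
    simpa using this
  set v : ℝ → ℂ := fun x => (x : ℂ) ^ (-(q / 2)) * W (diagOne (b * x)) with hv
  set v' : ℝ → ℂ := fun x => (x : ℂ) ^ (-(q / 2) - 1) *
    (lie N W (diagOne (b * x)) - q / 2 * W (diagOne (b * x))) with hv'
  have hvd : ∀ x : ℝ, 0 < x → HasDerivAt v (v' x) x := by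
    intro x hx
    have hxc : (x : ℂ) ≠ 0 := by exact_mod_cast hx.ne'
    refine ((hpow _ x hx).fun_mul (hd W hW x hx)).congr_deriv ?_
    simp only [hv']
    rw [Complex.cpow_sub _ _ hxc, Complex.cpow_one]
    field_simp
    ring
  have hvd' : ∀ x : ℝ, 0 < x → HasDerivAt v' (-((-1 / 4 + ((ε * l / 2 : ℝ) : ℂ) / x +
      (1 / 4 - (Complex.I * r / 2) ^ 2) / (x : ℂ) ^ 2) * v x)) x := by
    intro x hx
    have hxc : (x : ℂ) ≠ 0 := by exact_mod_cast hx.ne'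
    have hcc : (c : ℂ) ≠ 0 := by exact_mod_cast hc.ne'
    have hpc : (Real.pi : ℂ) ≠ 0 := by exact_mod_cast hpi.ne'
    refine ((hpow _ x hx).fun_mul ((hd _ (hst N W hW) x hx).fun_sub
      ((hd W hW x hx).const_mul (q / 2)))).congr_deriv ?_
    have h1 := casimir_diagOne hV hω hq hW hl (t := b * x) (by positivity)
    rw [hr W hW] at h1
    have hbb : 2 * Real.pi * Complex.I * c * ((b * x : ℝ) : ℂ) = Complex.I * ε * x / 2 := by
      rw [hb]; push_cast
      field_simp
      ring
    rw [hbb] at h1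
    simp only [hv]
    rw [Complex.cpow_sub _ _ hxc, Complex.cpow_one]
    have hI := Complex.I_sq
    set A := lie N (lie N W) (diagOne (b * x)) with hA
    have h2 : A = (q + 1) * lie N W (diagOne (b * x)) - q / 2 * (q / 2 + 1) * W (diagOne (b * x)) -
        ((Complex.I * ε * x / 2) ^ 2 - Complex.I * l * (Complex.I * ε * x / 2)) *
          W (diagOne (b * x)) - (1 / 4 + (r / 2) ^ 2) * W (diagOne (b * x)) := by
      linear_combination (-1 / 4 : ℂ) * h1
    have h3 : (Complex.I * ε * x / 2) ^ 2 - Complex.I * l * (Complex.I * ε * x / 2) =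
        -x ^ 2 / 4 + l * ε * x / 2 := by
      linear_combination ((x : ℂ) ^ 2 / 4 * ε ^ 2 - l * ε * x / 2) * hI - (x : ℂ) ^ 2 / 4 * hεc
    have h4 : (Complex.I * r / 2) ^ 2 = -r ^ 2 / 4 := by linear_combination (r ^ 2 / 4) * hI
    rw [h2, h3, h4]
    push_cast
    field_simp
    ring
  have hO : v =O[atTop] fun x : ℝ => Real.exp (x / 32) := by
    obtain ⟨C, n, hCn⟩ := hV.moderate W hW
    have hC0 : 0 ≤ C := by
      by_contra hneg
      push Not at hneg
      have h1 := (norm_nonneg _).trans (hCn 1)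
      have h2 : 0 < (1 + (∑ i, ∑ j, |((1 : GL2) : Matrix (Fin 2) (Fin 2) ℝ) i j|)
        + |((1 : GL2) : Matrix (Fin 2) (Fin 2) ℝ).det|⁻¹) ^ n := by positivity
      nlinarith
    set B : ℝ := 2 + |b| + |b|⁻¹ with hB
    have h3 : ∀ x : ℝ, 1 ≤ x → ‖v x‖ ≤ C * B ^ n * x ^ ((n : ℝ) - q.re / 2) := by
      intro x hx
      have hx0 : 0 < x := by linarith
      have hbx0 : b * x ≠ 0 := by positivity
      have h4 := hCn (diagOne (b * x))
      have h5 : (1 + (∑ i, ∑ j, |(diagOne (b * x) : Matrix (Fin 2) (Fin 2) ℝ) i j|)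
          + |(diagOne (b * x) : Matrix (Fin 2) (Fin 2) ℝ).det|⁻¹) ≤ B * x := by
        simp only [Fin.sum_univ_two, Matrix.det_fin_two, diagOne_apply hbx0]
        simp only [Matrix.of_apply, Matrix.cons_val', Matrix.cons_val_zero, Matrix.cons_val_one,
          Matrix.cons_val_fin_one, abs_zero, abs_one, mul_one, mul_zero, sub_zero, add_zero,
          zero_add]
        rw [abs_mul, abs_of_pos hx0, mul_inv, hB]
        have h6 : x⁻¹ ≤ x := (inv_le_one_of_one_le₀ hx).trans hx
        have h7 : |b|⁻¹ * x⁻¹ ≤ |b|⁻¹ * x := by gcongr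
        nlinarith
      calc ‖v x‖ = x ^ (-(q.re / 2)) * ‖W (diagOne (b * x))‖ := by
            rw [hv, norm_mul, Complex.norm_cpow_eq_rpow_re_of_pos hx0]
            simp
        _ ≤ x ^ (-(q.re / 2)) * (C * (B * x) ^ n) := by
            gcongr
            exact h4.trans (by gcongr)
        _ = C * B ^ n * (x ^ (n : ℝ) * x ^ (-(q.re / 2))) := by
            rw [Real.rpow_natCast, mul_pow]; ring
        _ = _ := by rw [← Real.rpow_add hx0]; ring_nf
    have h8 : v =O[atTop] fun x : ℝ => x ^ ((n : ℝ) - q.re / 2) := by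
      refine IsBigO.of_bound (C * B ^ n) ?_
      filter_upwards [eventually_ge_atTop 1] with x hx
      rw [Real.norm_of_nonneg (by positivity)]
      exact h3 x hx
    refine h8.trans ?_
    have := (isLittleO_rpow_exp_pos_mul_atTop ((n : ℝ) - q.re / 2) (b := 1 / 32)
      (by norm_num)).isBigO
    refine this.congr_right fun x => ?_
    ring_nf
  obtain ⟨a, ha⟩ := hw.eq_const_mul hvd hvd' hO
  refine ⟨a, fun x hx => ?_⟩
  have hxc : (x : ℂ) ≠ 0 := by exact_mod_cast hx.ne'
  have h1 := ha x hx
  rw [hww x hx]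
  simp only [hv, Complex.cpow_neg] at h1
  have h2 : (x : ℂ) ^ (q / 2) ≠ 0 := by simp [Complex.cpow_eq_zero_iff, hxc]
  field_simp at h1
  rw [h1]
  ring

/-- The Casimir eigenvalue of a representation with a lowest weight vector. -/
theorem IsDiscreteSeries.eigenvalue {k : ℕ} {V : Submodule ℂ (GL2 → ℂ)} (hV : IsDiscreteSeries k V)
    (hsm : ∀ W ∈ V, IsSmooth W) {r : ℂ}
    (hr : ∀ W ∈ V, ∀ g, casimir W g = -(1 / 4 + (r / 2) ^ 2) * W g) :
    (Complex.I * r) ^ 2 = ((k : ℂ) - 1) ^ 2 := by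
  obtain ⟨W, hW, hW0, hk, hlow⟩ := hV
  have hs := hsm W hW
  obtain ⟨g, hg⟩ := Function.ne_iff.1 hW0
  rw [Pi.zero_apply] at hg
  have hκ : ∀ g, lie (lieR - lieL) W g = Complex.I * k * W g := by
    have := lieR_sub_lieL_weight hs hk
    exact_mod_cast this
  have hHS : lie lieH W = fun g => Complex.I * lie (lieR + lieL) W g := by
    ext g
    rw [hs.lie_add]
    linear_combination hlow g
  have hκκ : lie (lieR - lieL) (lie (lieR - lieL) W) g = -k ^ 2 * W g := by
    rw [show lie (lieR - lieL) W = fun g => Complex.I * k * W g from funext hκ, lie_const_mul, hκ]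
    linear_combination ((k : ℂ) ^ 2 * W g) * Complex.I_sq
  have h1 : lie lieH (lie lieH W) g = Complex.I * lie lieH (lie (lieR + lieL) W) g := by
    rw [← lie_const_mul, ← hHS]
  have h2 : lie (lieR + lieL) (lie lieH W) g =
      Complex.I * lie (lieR + lieL) (lie (lieR + lieL) W) g := by
    rw [← lie_const_mul, ← hHS]
  have h3 := hs.lie_lie_sub lieH (lieR + lieL) g
  have h4 : lieH * (lieR + lieL) - (lieR + lieL) * lieH = (2 : ℝ) • (lieR - lieL) := by
    ext i j
    fin_cases i <;> fin_cases j <;> simp [lieR, lieL, lieH] <;> norm_num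
  rw [h4, hs.lie_smul, hκ] at h3
  obtain ⟨-, d₁, d₂, -, e1, e2, e3⟩ := hs.exists_lie
  have h5 : lie (lieR + lieL) (lie (lieR + lieL) W) g - lie (lieR - lieL) (lie (lieR - lieL) W) g =
      2 * lie lieR (lie lieL W) g + 2 * lie lieL (lie lieR W) g := by
    have a1 : ∀ X Y : Matrix (Fin 2) (Fin 2) ℝ,
        (fun i j => ((g : Matrix (Fin 2) (Fin 2) ℝ) * (X + Y)) i j : Arr2) =
        (fun i j => ((g : Matrix (Fin 2) (Fin 2) ℝ) * X) i j) +
          fun i j => ((g : Matrix (Fin 2) (Fin 2) ℝ) * Y) i j := by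
      intro X Y; ext i j; simp [Matrix.mul_add]
    have a2 : ∀ X Y : Matrix (Fin 2) (Fin 2) ℝ,
        (fun i j => ((g : Matrix (Fin 2) (Fin 2) ℝ) * (X - Y)) i j : Arr2) =
        (fun i j => ((g : Matrix (Fin 2) (Fin 2) ℝ) * X) i j) -
          fun i j => ((g : Matrix (Fin 2) (Fin 2) ℝ) * Y) i j := by
      intro X Y; ext i j; simp [Matrix.mul_sub]
    have a3 : (lieR + lieL) * (lieR + lieL) = (lieR * lieR + lieL * lieL) +
      (lieR * lieL + lieL * lieR) := by noncomm_ring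
    have a4 : (lieR - lieL) * (lieR - lieL) = (lieR * lieR + lieL * lieL) -
      (lieR * lieL + lieL * lieR) := by noncomm_ring
    rw [e2, e2, e2, e2, a3, a4]
    simp only [a1, a2, map_add, map_sub, _root_.add_apply, _root_.sub_apply]
    ring
  have h6 := hr W hW g
  rw [casimir] at h6
  have h7 : (k : ℂ) ^ 2 - 2 * k = 4 * (-(1 / 4 + (r / 2) ^ 2)) := by
    refine mul_right_cancel₀ hg ?_
    have hI := Complex.I_sq
    push_cast at h3
    linear_combination 4 * h6 - h1 + h5 + hκκ - Complex.I * h2 - Complex.I * h3 -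
      (lie (lieR + lieL) (lie (lieR + lieL) W) g + 2 * k * W g) * hI
  linear_combination (r ^ 2) * Complex.I_sq - h7

end

/-! ### Parameters of principal series representations -/

section

open Filter Topology Set Asymptotics

theorem lie_rho_left (X : Matrix (Fin 2) (Fin 2) ℝ) (W : GL2 → ℂ) (n g : GL2) :
    lie X W (n * g) = lie X (fun g => W (n * g)) g := by
  simp only [lie, mul_assoc]

theorem quasiChar_expUnit (ε : Fin 2) (s : ℂ) (t : ℝ) :
    quasiChar ε s (expUnit t) = Complex.exp (t * s) := by
  have h : 0 < ((expUnit t : ℝˣ) : ℝ) := Real.exp_pos t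
  rw [quasiChar, sign_pos h, abs_of_pos h]
  simp only [SignType.coe_one, Complex.ofReal_one, one_pow, one_mul]
  exact ofReal_exp_cpow t s

theorem expUnit_neg (t : ℝ) : ((expUnit (-t) : ℝˣ) : ℝ) = (Real.exp t)⁻¹ := Real.exp_neg t

/-- Every element of `GL₂(ℝ)` is a product of an upper triangular and an orthogonal matrix. -/
theorem exists_upper_mul_O2 (g : GL2) :
    ∃ (a d : ℝˣ) (x : ℝ), ∃ k ∈ O2, g = upper a d x * k := by
  set r := (g : Matrix (Fin 2) (Fin 2) ℝ) 1 0 with hr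
  set s := (g : Matrix (Fin 2) (Fin 2) ℝ) 1 1 with hs
  set p := (g : Matrix (Fin 2) (Fin 2) ℝ) 0 0 with hp
  set u := (g : Matrix (Fin 2) (Fin 2) ℝ) 0 1 with hu
  have hdet : p * s - u * r ≠ 0 := by
    have := GL2.mem_det_ne_zero g
    rw [Set.mem_ofPred_eq, Matrix.det_fin_two] at this
    exact this
  have hpos : 0 < r ^ 2 + s ^ 2 := by
    by_contra h
    have h1 : r = 0 := by nlinarith [sq_nonneg r, sq_nonneg s]
    have h2 : s = 0 := by nlinarith [sq_nonneg r, sq_nonneg s]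
    rw [h1, h2] at hdet
    simp at hdet
  set n := Real.sqrt (r ^ 2 + s ^ 2) with hn
  have hn0 : 0 < n := Real.sqrt_pos.2 hpos
  have hn2 : n ^ 2 = r ^ 2 + s ^ 2 := Real.sq_sqrt hpos.le
  have hk : (!![s / n, -(r / n); r / n, s / n] : Matrix (Fin 2) (Fin 2) ℝ).det = 1 := by
    rw [Matrix.det_fin_two_of]
    field_simp
    linarith
  set k : GL2 := Matrix.GeneralLinearGroup.mkOfDetNeZero
    (!![s / n, -(r / n); r / n, s / n] : Matrix (Fin 2) (Fin 2) ℝ) (by rw [hk]; exact one_ne_zero)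
    with hkdef
  have hkc : (k : Matrix (Fin 2) (Fin 2) ℝ) = !![s / n, -(r / n); r / n, s / n] := rfl
  refine ⟨Units.mk0 ((p * s - u * r) / n) (div_ne_zero hdet hn0.ne'), Units.mk0 n hn0.ne',
    (p * r + u * s) / n, k, ?_, ?_⟩
  · rw [O2, Set.mem_ofPred_eq, hkc]
    ext i j
    fin_cases i <;> fin_cases j <;> simp [Matrix.mul_apply, Fin.sum_univ_two] <;> field_simp <;>
      linarith
  · ext i j
    rw [Units.val_mul, hkc]
    fin_cases i <;> fin_cases j <;>
      simp [Matrix.mul_apply, Fin.sum_univ_two, upper_apply] <;> field_simp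
    · rw [← hp]; linear_combination p * hn2
    · rw [← hu]; linear_combination u * hn2
    · rfl
    · rfl

/-- The central character and the Casimir eigenvalue of a principal series representation. -/
theorem principalSeries_parameters {c : ℝ} {V : Submodule ℂ (GL2 → ℂ)} (hV : IsWhittakerModel c V)
    {ω : ℝˣ →* ℂˣ} (hω : IsCentralChar V ω)
    {q : ℂ} (hq : ∀ y : ℝˣ, 0 < (y : ℝ) → (ω y : ℂ) = ((y : ℝ) : ℂ) ^ q)
    {r : ℂ} (hr : ∀ W ∈ V, ∀ g, casimir W g = -(1 / 4 + (r / 2) ^ 2) * W g)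
    {ε₁ ε₂ : Fin 2} {s₁ s₂ : ℂ}
    (hiso : IsGKIso V (principalSeries (quasiChar ε₁ s₁) (quasiChar ε₂ s₂))) :
    q = s₁ + s₂ ∧ (Complex.I * r) ^ 2 = (s₁ - s₂) ^ 2 := by
  obtain ⟨e, hinj, hrange, hK, hlie⟩ := hiso
  have hst := hV.stable.2
  have hmem : ∀ W : V, e W ∈ principalSeries (quasiChar ε₁ s₁) (quasiChar ε₂ s₂) := fun W => by
    rw [← hrange]; exact mem_range_self W
  obtain ⟨W₀, hW₀, hW₀0⟩ := (Submodule.ne_bot_iff V).1 hV.nontrivial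
  -- a vector whose image does not vanish at the identity
  obtain ⟨W, hW1⟩ : ∃ W : V, e W 1 ≠ 0 := by
    have h1 : e ⟨W₀, hW₀⟩ ≠ 0 := by
      intro h
      exact hW₀0 (congrArg Subtype.val (hinj (h.trans (map_zero e).symm)))
    obtain ⟨g, hg⟩ := Function.ne_iff.1 h1
    obtain ⟨a, d, x, k, hk, rfl⟩ := exists_upper_mul_O2 g
    rw [(hmem _).2.2] at hg
    refine ⟨⟨rho k W₀, hV.stable.1 k hk W₀ hW₀⟩, ?_⟩
    rw [hK k hk ⟨W₀, hW₀⟩ ⟨rho k W₀, hV.stable.1 k hk W₀ hW₀⟩ rfl, rho, one_mul]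
    exact right_ne_zero_of_mul hg
  set f : GL2 → ℂ := e W with hf
  have hfs : IsSmooth f := (hmem W).1
  have hfe := (hmem W).2.2
  rw [← hf] at hfe
  let L : Matrix (Fin 2) (Fin 2) ℝ → V → V := fun X W' => ⟨lie X W', hst X W' W'.2⟩
  have hL : ∀ X W', e (L X W') = lie X (e W') := fun X W' => hlie X W' (L X W') rfl
  constructor
  · have h1 : lie 1 f 1 = q * f 1 := by
      have h2 : L 1 W = q • W := by
        apply Subtype.ext
        ext g
        exact (hV.smooth W W.2).lie_one (hω.expUnit_mul hq W.2) g
      rw [hf, ← hL, h2, map_smul]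
      rfl
    have h3 : lie 1 f 1 = (s₁ + s₂) * f 1 := by
      refine hfs.lie_one (fun t g => ?_) 1
      rw [hfe, quasiChar_expUnit, quasiChar_expUnit, ← Complex.exp_add, div_self (Units.ne_zero _)]
      simp only [abs_one, Real.sqrt_one, Complex.ofReal_one, mul_one]
      ring_nf
    exact mul_right_cancel₀ hW1 (h1.symm.trans h3)
  · have h1 : lie lieH (lie lieH f) 1 + 2 * lie lieR (lie lieL f) 1 + 2 * lie lieL (lie lieR f) 1 =
        4 * (-(1 / 4 + (r / 2) ^ 2)) * f 1 := by
      have h2 : L lieH (L lieH W) + (2 : ℂ) • L lieR (L lieL W) + (2 : ℂ) • L lieL (L lieR W) =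
          (4 * (-(1 / 4 + (r / 2) ^ 2))) • W := by
        apply Subtype.ext
        ext g
        have h3 := hr W W.2 g
        rw [casimir] at h3
        have h4 : lie lieH (lie lieH W) g + 2 * lie lieR (lie lieL W) g +
          2 * lie lieL (lie lieR W) g = 4 * (-(1 / 4 + (r / 2) ^ 2)) * (W : GL2 → ℂ) g := by
          linear_combination 4 * h3
        exact h4
      have h5 := congrArg e h2
      simp only [map_add, map_smul, hL] at h5
      exact congrFun h5 1
    set σ := s₁ - s₂ with hσ
    have hdiag : ∀ t : ℝ, f (upper (expUnit t) (expUnit (-t)) 0) =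
        Complex.exp (t * (σ + 1)) * f 1 := by
      intro t
      have h6 := hfe (expUnit t) (expUnit (-t)) 0 1
      rw [mul_one] at h6
      rw [h6, quasiChar_expUnit, quasiChar_expUnit, expUnit_neg, div_inv_eq_mul]
      have h7 : Real.sqrt |((expUnit t : ℝˣ) : ℝ) * Real.exp t| = Real.exp t := by
        rw [show ((expUnit t : ℝˣ) : ℝ) = Real.exp t from rfl, abs_mul_self,
          Real.sqrt_mul_self (Real.exp_pos t).le]
      rw [h7, Complex.ofReal_exp, ← Complex.exp_add, ← Complex.exp_add, hσ]
      push_cast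
      ring_nf
    have hcH : ∀ s : ℝ, ∀ i j, HasDerivAt (fun t : ℝ =>
        ((upper (expUnit t) (expUnit (-t)) 0 : GL2) : Matrix (Fin 2) (Fin 2) ℝ) i j)
        ((((upper (expUnit s) (expUnit (-s)) 0 : GL2) : Matrix (Fin 2) (Fin 2) ℝ) * lieH) i j) s := by
      intro s i j
      have h8 : HasDerivAt (fun t : ℝ => ((expUnit t : ℝˣ) : ℝ)) ((expUnit s : ℝˣ) : ℝ) s :=
        Real.hasDerivAt_exp s
      have h9 : HasDerivAt (fun t : ℝ => ((expUnit (-t) : ℝˣ) : ℝ)) (-((expUnit (-s) : ℝˣ) : ℝ)) s := by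
        have := (Real.hasDerivAt_exp (-s)).comp s (hasDerivAt_neg s)
        rw [mul_neg_one] at this
        exact this
      fin_cases i <;> fin_cases j <;>
        simp [Matrix.mul_apply, Fin.sum_univ_two, upper_apply, lieH, hasDerivAt_const, h8, h9]
    have hexp : ∀ s : ℝ, HasDerivAt (fun t : ℝ => Complex.exp (t * (σ + 1)) * f 1)
        ((σ + 1) * (Complex.exp (s * (σ + 1)) * f 1)) s := by
      intro s
      have := (((hasDerivAt_id (s : ℂ)).comp_ofReal.mul_const (σ + 1)).cexp).mul_const (f 1)
      refine this.congr_deriv ?_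
      simp only [id]
      ring
    have hH1 : ∀ s : ℝ, lie lieH f (upper (expUnit s) (expUnit (-s)) 0) =
        (σ + 1) * (Complex.exp (s * (σ + 1)) * f 1) := fun s =>
      (hfs.hasDerivAt_curve (hcH s)).unique ((hexp s).congr_of_eventuallyEq
        (Eventually.of_forall hdiag))
    have e0 : upper (expUnit 0) (expUnit (-0)) 0 = 1 := by rw [neg_zero, expUnit_zero, upper_one]
    have hH2 : lie lieH (lie lieH f) 1 = (σ + 1) * ((σ + 1) * f 1) := by
      have h10 := ((hfs.lie lieH).hasDerivAt_curve (hcH 0)).unique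
        (((hexp 0).const_mul (σ + 1)).congr_of_eventuallyEq (Eventually.of_forall hH1))
      rw [e0] at h10
      simpa using h10
    have hH3 : lie lieH f 1 = (σ + 1) * f 1 := by
      have := hH1 0
      rw [e0] at this
      simpa using this
    -- left invariance under unipotent matrices
    have hRL : lie lieR (lie lieL f) 1 = 0 := by
      have hc : ∀ i j, HasDerivAt (fun t : ℝ =>
          ((upper 1 1 t : GL2) : Matrix (Fin 2) (Fin 2) ℝ) i j)
          ((((upper 1 1 0 : GL2) : Matrix (Fin 2) (Fin 2) ℝ) * lieR) i j) 0 := by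
        intro i j
        fin_cases i <;> fin_cases j <;>
          simp [Matrix.mul_apply, Fin.sum_univ_two, upper_apply, lieR, hasDerivAt_const,
            hasDerivAt_id']
      have h11 := (hfs.lie lieL).hasDerivAt_curve hc
      have h12 : ∀ t : ℝ, lie lieL f (upper 1 1 t) = lie lieL f 1 := by
        intro t
        have h13 : ∀ g, f (upper 1 1 t * g) = f g := by
          intro g
          rw [hfe]
          simp [quasiChar]
        have h14 := lie_rho_left lieL f (upper 1 1 t) 1
        rw [mul_one] at h14
        rw [h14]
        simp only [h13]
      rw [upper_one] at h11
      exact h11.unique ((hasDerivAt_const (0 : ℝ) (lie lieL f 1)).congr_of_eventuallyEq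
        (Eventually.of_forall h12))
    have hc := hfs.lie_lie_sub lieR lieL 1
    rw [lieR_mul_lieL_sub, hRL, hH3] at hc
    rw [hH2, hRL] at h1
    refine mul_right_cancel₀ hW1 ?_
    linear_combination -h1 - 2 * hc + (r ^ 2 * f 1) * Complex.I_sq

/-- Squares determine the parameters up to the sign. -/
theorem eq_or_eq_neg_of_I_mul_sq {r σ : ℂ} (h : (Complex.I * r) ^ 2 = σ ^ 2) :
    Complex.I * r = σ ∨ Complex.I * r = -σ := sq_eq_sq_iff_eq_or_eq_neg.1 h

end

/-! ### The unitary group and its action on the Hermitian half space -/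

section

open Filter Topology Set
open scoped ComplexOrder

/-- The group `GU(2,2)`, with the multiplier `μ` recorded. -/
def IsGU (g : Matrix I4 I4 ℂ) (μ : ℝ) : Prop := gᴴ * formJ ℂ * g = (μ : ℂ) • formJ ℂ

/-- The numerator `A I + B` of `g⟨I⟩`. -/
def num (g : Matrix I4 I4 ℂ) : Matrix (Fin 2) (Fin 2) ℂ :=
  g.toBlocks₁₁ * basePoint + g.toBlocks₁₂

/-- The denominator `J(g, I) = C I + E` of `g⟨I⟩`. -/
abbrev den (g : Matrix I4 I4 ℂ) : Matrix (Fin 2) (Fin 2) ℂ := autFactor g basePoint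

theorem IsGU.mul {g h : Matrix I4 I4 ℂ} {μ ν : ℝ} (hg : IsGU g μ) (hh : IsGU h ν) :
    IsGU (g * h) (μ * ν) := by
  unfold IsGU at *
  have : (g * h)ᴴ * formJ ℂ * (g * h) = hᴴ * (gᴴ * formJ ℂ * g) * h := by
    simp only [conjTranspose_mul, Matrix.mul_assoc]
  rw [this, hg, Matrix.mul_smul, Matrix.smul_mul, hh, smul_smul]
  push_cast
  rfl

/-- The defining relation of `GU(2,2)`, paired with the block column `(I, 1)`. It determines
`Im g⟨I⟩` in terms of `J(g, I)`, see `IsGU.hermIm_eq`. -/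
theorem IsGU.num_den {g : Matrix I4 I4 ℂ} {μ : ℝ} (hg : IsGU g μ) :
    (num g)ᴴ * den g - (den g)ᴴ * num g = (-2 * Complex.I * μ) • (1 : Matrix (Fin 2) (Fin 2) ℂ) := by
  unfold IsGU at hg
  set A := g.toBlocks₁₁ with hA
  set B := g.toBlocks₁₂ with hB
  set C := g.toBlocks₂₁ with hC
  set E := g.toBlocks₂₂ with hE
  have hgb : g = fromBlocks A B C E := (fromBlocks_toBlocks g).symm
  rw [hgb, formJ, fromBlocks_conjTranspose, fromBlocks_multiply, fromBlocks_multiply,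
    fromBlocks_smul, fromBlocks_inj] at hg
  obtain ⟨h1, h2, h3, h4⟩ := hg
  simp only [mul_zero, zero_add, mul_neg, mul_one, add_zero, smul_zero, smul_neg] at h1 h2 h3 h4
  have e1 : num g = Complex.I • A + B := by
    rw [num, basePoint, Matrix.mul_smul, mul_one]
  have e2 : den g = Complex.I • C + E := by
    rw [den, autFactor, basePoint, Matrix.mul_smul, mul_one]
  rw [e1, e2]
  have hs : star Complex.I = -Complex.I := Complex.conj_I
  simp only [conjTranspose_add, conjTranspose_smul, hs]
  have e3 : ((-Complex.I) • Aᴴ + Bᴴ) * (Complex.I • C + E) -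
      ((-Complex.I) • Cᴴ + Eᴴ) * (Complex.I • A + B) =
      (-(Complex.I * Complex.I)) • (-Cᴴ * A + Aᴴ * C) + (-Complex.I) • (-Cᴴ * B + Aᴴ * E) +
        Complex.I • (-Eᴴ * A + Bᴴ * C) + (-Eᴴ * B + Bᴴ * E) := by
    ext i j
    simp only [Matrix.add_mul, Matrix.mul_add, Matrix.smul_mul, Matrix.mul_smul, Matrix.neg_mul,
      Matrix.add_apply, Matrix.sub_apply, Matrix.smul_apply, Matrix.neg_apply, smul_eq_mul]
    ring
  rw [e3, h1, h2, h3, h4, smul_zero, zero_add, add_zero, smul_neg, smul_smul, smul_smul,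
    ← sub_eq_add_neg, ← sub_smul]
  congr 1
  ring

theorem IsGU.den_det_ne_zero {g : Matrix I4 I4 ℂ} {μ : ℝ} (hg : IsGU g μ) (hμ : μ ≠ 0) :
    (den g).det ≠ 0 := by
  intro h0
  obtain ⟨x, hx, hdx⟩ := exists_mulVec_eq_zero_iff.2 h0
  have h1 := congrArg (fun M => star x ⬝ᵥ (M *ᵥ x)) hg.num_den
  simp only [sub_mulVec, ← mulVec_mulVec, hdx, mulVec_zero, zero_sub, smul_mulVec,
    one_mulVec, dotProduct_neg, dotProduct_smul] at h1
  rw [dotProduct_mulVec, ← star_mulVec, hdx, star_zero, zero_dotProduct, neg_zero, smul_eq_mul] at h1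
  have h2 : star x ⬝ᵥ x ≠ 0 := by rwa [Ne, dotProduct_star_self_eq_zero]
  have h3 : (-2 * Complex.I * (μ : ℂ)) ≠ 0 := by
    simp [hμ, Complex.I_ne_zero]
  exact mul_ne_zero h3 h2 h1.symm

theorem num_eq {g : Matrix I4 I4 ℂ} (h : (den g).det ≠ 0) :
    num g = act g basePoint * den g := by
  rw [act, Matrix.mul_assoc, Matrix.nonsing_inv_mul _ (isUnit_iff_ne_zero.2 h), Matrix.mul_one]
  rfl

theorem den_mul {g h : Matrix I4 I4 ℂ} (hh : (den h).det ≠ 0) :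
    den (g * h) = autFactor g (act h basePoint) * den h := by
  have e : den (g * h) = g.toBlocks₂₁ * num h + g.toBlocks₂₂ * den h := by
    conv_lhs => rw [← fromBlocks_toBlocks g, ← fromBlocks_toBlocks h, fromBlocks_multiply]
    simp only [den, autFactor, num, toBlocks_fromBlocks₂₁, toBlocks_fromBlocks₂₂]
    noncomm_ring
  rw [e, num_eq hh, autFactor]
  noncomm_ring

theorem num_mul {g h : Matrix I4 I4 ℂ} (hh : (den h).det ≠ 0) :
    num (g * h) = (g.toBlocks₁₁ * act h basePoint + g.toBlocks₁₂) * den h := by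
  have e : num (g * h) = g.toBlocks₁₁ * num h + g.toBlocks₁₂ * den h := by
    conv_lhs => rw [← fromBlocks_toBlocks g, ← fromBlocks_toBlocks h, fromBlocks_multiply]
    simp only [den, autFactor, num, toBlocks_fromBlocks₁₁, toBlocks_fromBlocks₁₂]
    noncomm_ring
  rw [e, num_eq hh]
  noncomm_ring

theorem act_mul {g h : Matrix I4 I4 ℂ} (hh : (den h).det ≠ 0) :
    act (g * h) basePoint = act g (act h basePoint) := by
  have e : act (g * h) basePoint = num (g * h) * (den (g * h))⁻¹ := rfl
  rw [e, num_mul hh, den_mul hh, Matrix.mul_inv_rev, Matrix.mul_assoc, ← Matrix.mul_assoc (den h),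
    Matrix.mul_nonsing_inv _ (isUnit_iff_ne_zero.2 hh), Matrix.one_mul]
  rfl

/-- The Hermitian imaginary part `(Z - Zᴴ) / 2i`. -/
def hermIm (Z : Matrix (Fin 2) (Fin 2) ℂ) : Matrix (Fin 2) (Fin 2) ℂ :=
  (2 * Complex.I)⁻¹ • (Z - Zᴴ)

theorem IsGU.den_hermIm {g : Matrix I4 I4 ℂ} {μ : ℝ} (hg : IsGU g μ) (hμ : μ ≠ 0) :
    (den g)ᴴ * hermIm (act g basePoint) * den g = (μ : ℂ) • (1 : Matrix (Fin 2) (Fin 2) ℂ) := by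
  have h1 := hg.num_den
  rw [num_eq (hg.den_det_ne_zero hμ), conjTranspose_mul] at h1
  have h2 : (den g)ᴴ * hermIm (act g basePoint) * den g = (-(2 * Complex.I)⁻¹) •
      ((den g)ᴴ * (act g basePoint)ᴴ * den g - (den g)ᴴ * (act g basePoint * den g)) := by
    rw [hermIm, Matrix.mul_smul, Matrix.smul_mul, neg_smul, ← smul_neg]
    congr 1
    noncomm_ring
  rw [h2, h1, smul_smul]
  congr 1
  have := Complex.I_ne_zero
  field_simp

theorem IsGU.hermIm_eq {g : Matrix I4 I4 ℂ} {μ : ℝ} (hg : IsGU g μ) (hμ : μ ≠ 0) :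
    hermIm (act g basePoint) = (μ : ℂ) • (((den g)⁻¹)ᴴ * (den g)⁻¹) := by
  have hu : IsUnit (den g).det := isUnit_iff_ne_zero.2 (hg.den_det_ne_zero hμ)
  have h1 := hg.den_hermIm hμ
  have h2 := congrArg (fun M => ((den g)⁻¹)ᴴ * M * (den g)⁻¹) h1
  simp only [Matrix.mul_smul, Matrix.smul_mul, Matrix.mul_one] at h2
  rw [← h2]
  have h3 : ((den g)⁻¹)ᴴ * (den g)ᴴ = 1 := by
    rw [← conjTranspose_mul, Matrix.mul_nonsing_inv _ hu, conjTranspose_one]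
  calc hermIm (act g basePoint) = (((den g)⁻¹)ᴴ * (den g)ᴴ) * hermIm (act g basePoint) *
        (den g * (den g)⁻¹) := by rw [h3, Matrix.mul_nonsing_inv _ hu]; simp
    _ = _ := by simp only [Matrix.mul_assoc]

/-- For `μ > 0` the image `g⟨I⟩` is in the Hermitian half space; only the positivity of the lower
right entry of its imaginary part and the determinant of the latter are used. -/
theorem IsGU.hermIm_pos {g : Matrix I4 I4 ℂ} {μ : ℝ} (hg : IsGU g μ) (hμ : 0 < μ) :
    0 < (hermIm (act g basePoint) 1 1).re ∧ (hermIm (act g basePoint) 1 1).im = 0 ∧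
    (hermIm (act g basePoint)).det * (den g).det * star (den g).det = (μ : ℂ) ^ 2 := by
  have hd := hg.den_det_ne_zero hμ.ne'
  have hu : IsUnit (den g).det := isUnit_iff_ne_zero.2 hd
  set e := (den g)⁻¹ with he
  have hedet : e.det ≠ 0 := by
    have h := congrArg Matrix.det (Matrix.mul_nonsing_inv _ hu)
    rw [det_mul, det_one] at h
    exact right_ne_zero_of_mul_eq_one h
  have hY := hg.hermIm_eq hμ.ne'
  rw [← he] at hY
  have h11 : hermIm (act g basePoint) 1 1 =
      ((μ * (Complex.normSq (e 0 1) + Complex.normSq (e 1 1)) : ℝ) : ℂ) := by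
    rw [hY]
    simp only [Matrix.smul_apply, Matrix.mul_apply, Fin.sum_univ_two, conjTranspose_apply,
      smul_eq_mul]
    push_cast
    rw [Complex.normSq_eq_conj_mul_self, Complex.normSq_eq_conj_mul_self]
    rfl
  refine ⟨?_, ?_, ?_⟩
  · rw [h11, Complex.ofReal_re]
    refine mul_pos hμ ?_
    rw [det_fin_two] at hedet
    by_contra hneg
    have p1 := Complex.normSq_nonneg (e 0 1)
    have p2 := Complex.normSq_nonneg (e 1 1)
    have q1 : e 0 1 = 0 := Complex.normSq_eq_zero.1 (by linarith)
    have q2 : e 1 1 = 0 := Complex.normSq_eq_zero.1 (by linarith)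
    rw [q1, q2] at hedet
    simp at hedet
  · rw [h11, Complex.ofReal_im]
  · have h := congrArg Matrix.det (hg.den_hermIm hμ.ne')
    rw [det_mul, det_mul, det_conjTranspose, det_smul, det_one, mul_one, Fintype.card_fin] at h
    rw [← h]
    ring

theorem hermIm_apply (Z : Matrix (Fin 2) (Fin 2) ℂ) (i j : Fin 2) :
    hermIm Z i j = (Z i j - star (Z j i)) / (2 * Complex.I) := by
  simp [hermIm, div_eq_inv_mul]

theorem hermIm_diag (Z : Matrix (Fin 2) (Fin 2) ℂ) (i : Fin 2) :
    hermIm Z i i = ((Z i i).im : ℂ) := by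
  rw [hermIm_apply, div_eq_iff (by simp [Complex.I_ne_zero])]
  apply Complex.ext <;> simp
  ring

/-! ### The maximal compact subgroup -/

theorem mem_KInf_iff {k : Matrix I4 I4 ℂ} : k ∈ KInf ↔ IsGU k 1 ∧ act k basePoint = basePoint := by
  rw [KInf, Set.mem_ofPred_eq, IsGU, Complex.ofReal_one, one_smul]

theorem hermIm_basePoint : hermIm basePoint = 1 := by
  have hs : star Complex.I = -Complex.I := Complex.conj_I
  rw [hermIm, basePoint, conjTranspose_smul, conjTranspose_one, hs, ← sub_smul, smul_smul,
    sub_neg_eq_add, ← two_mul, inv_mul_cancel₀ (by simp [Complex.I_ne_zero]), one_smul]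

theorem den_unitary {k : Matrix I4 I4 ℂ} (hk : k ∈ KInf) : (den k)ᴴ * den k = 1 := by
  obtain ⟨h1, h2⟩ := mem_KInf_iff.1 hk
  have := h1.den_hermIm one_ne_zero
  rw [h2, hermIm_basePoint, Matrix.mul_one, Complex.ofReal_one, one_smul] at this
  exact this

theorem den_det_ne_zero_of_mem_KInf {k : Matrix I4 I4 ℂ} (hk : k ∈ KInf) : (den k).det ≠ 0 :=
  (mem_KInf_iff.1 hk).1.den_det_ne_zero one_ne_zero

theorem act_mul_KInf (g : Matrix I4 I4 ℂ) {k : Matrix I4 I4 ℂ} (hk : k ∈ KInf) :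
    act (g * k) basePoint = act g basePoint := by
  rw [act_mul (den_det_ne_zero_of_mem_KInf hk), (mem_KInf_iff.1 hk).2]

theorem den_mul_KInf (g : Matrix I4 I4 ℂ) {k : Matrix I4 I4 ℂ} (hk : k ∈ KInf) :
    den (g * k) = den g * den k := by
  rw [den_mul (den_det_ne_zero_of_mem_KInf hk), (mem_KInf_iff.1 hk).2]

/-- Elements with the same multiplier and the same image of `I` differ by an element of `K_∞`. -/
theorem exists_KInf_of_act_eq {g p : Matrix I4 I4 ℂ} {μ : ℝ} (hμ : μ ≠ 0) (hg : IsGU g μ)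
    (hp : IsGU p μ) (h : num p = act g basePoint * den p) : ∃ k ∈ KInf, g = p * k := by
  have hμc : (μ : ℂ) ≠ 0 := by exact_mod_cast hμ
  have hJ : formJ ℂ * formJ ℂ = -1 := by
    rw [formJ, fromBlocks_multiply]
    simp [← fromBlocks_one, fromBlocks_neg]
  -- the inverse of `p` is `-μ⁻¹ J pᴴ J`
  set q : Matrix I4 I4 ℂ := (-(μ : ℂ)⁻¹) • (formJ ℂ * pᴴ * formJ ℂ) with hq
  have hqp : q * p = 1 := by
    rw [hq, Matrix.smul_mul]
    have : formJ ℂ * pᴴ * formJ ℂ * p = formJ ℂ * (pᴴ * formJ ℂ * p) := by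
      simp only [Matrix.mul_assoc]
    rw [this, hp, Matrix.mul_smul, hJ, smul_smul, smul_neg, neg_mul, inv_mul_cancel₀ hμc, neg_smul,
      one_smul, neg_neg]
  have hpq : p * q = 1 := mul_eq_one_comm.1 hqp
  have hpk : g = p * (q * g) := by rw [← Matrix.mul_assoc, hpq, Matrix.one_mul]
  have hk1 : IsGU (q * g) 1 := by
    have e1 : gᴴ * formJ ℂ * g = (q * g)ᴴ * (pᴴ * formJ ℂ * p) * (q * g) := by
      conv_lhs => rw [hpk]
      simp only [conjTranspose_mul, Matrix.mul_assoc]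
    rw [hg, hp, Matrix.mul_smul, Matrix.smul_mul] at e1
    have := smul_right_injective _ hμc e1
    rw [IsGU, Complex.ofReal_one, one_smul]
    exact this.symm
  refine ⟨q * g, mem_KInf_iff.2 ⟨hk1, ?_⟩, hpk⟩
  have hdk := hk1.den_det_ne_zero one_ne_zero
  have hdp := hp.den_det_ne_zero hμ
  have hdg := hg.den_det_ne_zero hμ
  have hpi : p⁻¹ = q := inv_eq_right_inv hpq
  have hap : act p basePoint = act g basePoint := by
    rw [show act p basePoint = num p * (den p)⁻¹ from rfl, h, Matrix.mul_assoc,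
      Matrix.mul_nonsing_inv _ (isUnit_iff_ne_zero.2 hdp), Matrix.mul_one]
  rw [act_mul hdg, ← hap, ← act_mul hdp, hqp]
  have e3 : (1 : Matrix I4 I4 ℂ).toBlocks₁₁ = 1 ∧ (1 : Matrix I4 I4 ℂ).toBlocks₁₂ = 0 ∧
      (1 : Matrix I4 I4 ℂ).toBlocks₂₁ = 0 ∧ (1 : Matrix I4 I4 ℂ).toBlocks₂₂ = 1 := by
    refine ⟨?_, ?_, ?_, ?_⟩ <;> (ext i j; simp [toBlocks₁₁, toBlocks₁₂, toBlocks₂₁, toBlocks₂₂, one_apply])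
  rw [act, autFactor, e3.1, e3.2.1, e3.2.2.1, e3.2.2.2]
  simp

end

/-! ### The parabolic subgroup -/

section

open Filter Topology Set

theorem isGU_leviOne (ζ : ℂˣ) : IsGU (leviOne ζ) 1 := by
  have h : (ζ : ℂ) ≠ 0 := ζ.ne_zero
  have h' : (starRingEnd ℂ) (ζ : ℂ) ≠ 0 := by simp
  rw [IsGU, leviOne, formJ, fromBlocks_conjTranspose, fromBlocks_multiply, fromBlocks_multiply,
    fromBlocks_smul, fromBlocks_inj]
  refine ⟨?_, ?_, ?_, ?_⟩ <;> ext i j <;> fin_cases i <;> fin_cases j <;>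
    simp [Matrix.mul_apply, Fin.sum_univ_two, h, h']

theorem isGU_leviTwo (u : ℂˣ) (A : GL2) :
    IsGU (leviTwo u A) (Complex.normSq (u : ℂ) * (A : Matrix (Fin 2) (Fin 2) ℝ).det) := by
  rw [IsGU, leviTwo, formJ, fromBlocks_conjTranspose, fromBlocks_multiply, fromBlocks_multiply,
    fromBlocks_smul, fromBlocks_inj]
  refine ⟨?_, ?_, ?_, ?_⟩ <;> ext i j <;> fin_cases i <;> fin_cases j <;>
    simp [Matrix.mul_apply, Fin.sum_univ_two, Complex.normSq_eq_conj_mul_self, det_fin_two] <;>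
    first | ring1 | (left; ring1)

theorem isGU_unipN (z y : ℂ) (w : ℝ) : IsGU (unipN z y w) 1 := by
  rw [IsGU, unipN, formJ, fromBlocks_multiply, fromBlocks_conjTranspose, fromBlocks_multiply, fromBlocks_multiply,
    fromBlocks_smul, fromBlocks_inj]
  refine ⟨?_, ?_, ?_, ?_⟩ <;> ext i j <;> fin_cases i <;> fin_cases j <;>
    simp [Matrix.mul_apply, Fin.sum_univ_two] <;> ring

theorem isGU_parabolic (ζ u : ℂˣ) (A : GL2) (z y : ℂ) (w : ℝ) :
    IsGU (leviOne ζ * leviTwo u A * unipN z y w)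
      (Complex.normSq (u : ℂ) * (A : Matrix (Fin 2) (Fin 2) ℝ).det) := by
  have := ((isGU_leviOne ζ).mul (isGU_leviTwo u A)).mul (isGU_unipN z y w)
  rwa [one_mul, mul_one] at this

theorem den_parabolic (ζ u : ℂˣ) (A : GL2) (z y : ℂ) (w : ℝ) :
    den (leviOne ζ * leviTwo u A * unipN z y w) =
      !![((starRingEnd ℂ) (ζ : ℂ))⁻¹ *
          (Complex.normSq (u : ℂ) * (A : Matrix (Fin 2) (Fin 2) ℝ).det : ℝ), 0;
        u * ((A : Matrix (Fin 2) (Fin 2) ℝ) 1 0 * (starRingEnd ℂ) y -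
          (A : Matrix (Fin 2) (Fin 2) ℝ) 1 1 * (starRingEnd ℂ) z),
        u * ((A : Matrix (Fin 2) (Fin 2) ℝ) 1 0 * Complex.I + (A : Matrix (Fin 2) (Fin 2) ℝ) 1 1)] := by
  rw [den, autFactor, leviOne, leviTwo, unipN, fromBlocks_multiply, fromBlocks_multiply,
    fromBlocks_multiply, toBlocks_fromBlocks₂₁, toBlocks_fromBlocks₂₂, basePoint]
  ext i j
  fin_cases i <;> fin_cases j <;> simp <;> ring

theorem num_parabolic (ζ u : ℂˣ) (A : GL2) (z y : ℂ) (w : ℝ) :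
    num (leviOne ζ * leviTwo u A * unipN z y w) =
      !![ζ * (Complex.I + w + z * (starRingEnd ℂ) y), ζ * (z * Complex.I + y);
        u * ((A : Matrix (Fin 2) (Fin 2) ℝ) 0 0 * (starRingEnd ℂ) y -
          (A : Matrix (Fin 2) (Fin 2) ℝ) 0 1 * (starRingEnd ℂ) z),
        u * ((A : Matrix (Fin 2) (Fin 2) ℝ) 0 0 * Complex.I + (A : Matrix (Fin 2) (Fin 2) ℝ) 0 1)] := by
  rw [num, leviOne, leviTwo, unipN, fromBlocks_multiply, fromBlocks_multiply,
    fromBlocks_multiply, toBlocks_fromBlocks₁₁, toBlocks_fromBlocks₁₂, basePoint]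
  ext i j
  fin_cases i <;> fin_cases j <;> simp <;> ring

theorem IsGU.unique {g : Matrix I4 I4 ℂ} {μ ν : ℝ} (h : IsGU g μ) (h' : IsGU g ν) : μ = ν := by
  have e : (μ : ℂ) • formJ ℂ = (ν : ℂ) • formJ ℂ := Eq.trans (Eq.symm h) h'
  have := congrFun (congrFun e (Sum.inl 0)) (Sum.inr 0)
  simpa [formJ] using this

/-- The `GL₂`-part of the Iwasawa decomposition: the value of an equivariant function of weight `l`
at a matrix of positive determinant. -/
theorem weight_apply {c : ℝ} {W : GL2 → ℂ} {l : ℕ} {ω : ℝˣ →* ℂˣ}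
    (hN : ∀ (x : ℝ) (g : GL2),
      W (upper 1 1 x * g) = Complex.exp (2 * Real.pi * Complex.I * (c * x : ℝ)) * W g)
    (hω : ∀ (z : ℝˣ) (g : GL2), W (upper z z 0 * g) = (ω z : ℂ) * W g)
    (hl : W ∈ weightSpace l) (A : GL2) {x v : ℝ} (hv : 0 < v) {j : ℂ}
    (hj : j = (A : Matrix (Fin 2) (Fin 2) ℝ) 1 0 * Complex.I + (A : Matrix (Fin 2) (Fin 2) ℝ) 1 1)
    (hx : ((x : ℂ) + v * Complex.I) * j =
      (A : Matrix (Fin 2) (Fin 2) ℝ) 0 0 * Complex.I + (A : Matrix (Fin 2) (Fin 2) ℝ) 0 1)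
    (ρ : ℝˣ) (hρ : (ρ : ℝ) = ‖j‖) :
    W A * j ^ l = Complex.exp (2 * Real.pi * Complex.I * (c * x : ℝ)) * (ω ρ : ℂ) * (ρ : ℝ) ^ l *
      W (diagOne v) := by
  set θ := -Complex.arg j with hθ
  have hpol : (‖j‖ : ℂ) * Complex.exp (Complex.arg j * Complex.I) = j := Complex.norm_mul_exp_arg_mul_I j
  have hre : j.re = ρ * Real.cos θ := by
    rw [hθ, Real.cos_neg, hρ, Complex.norm_mul_cos_arg]
  have him : j.im = -(ρ * Real.sin θ) := by
    rw [hθ, Real.sin_neg, hρ, mul_neg, neg_neg, Complex.norm_mul_sin_arg]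
  have h10 : (A : Matrix (Fin 2) (Fin 2) ℝ) 1 0 = -(ρ * Real.sin θ) := by
    rw [← him, hj]; simp
  have h11 : (A : Matrix (Fin 2) (Fin 2) ℝ) 1 1 = ρ * Real.cos θ := by
    rw [← hre, hj]; simp
  have h0 := congrArg Complex.re hx
  have h1 := congrArg Complex.im hx
  simp at h0 h1
  rw [hre, him] at h0 h1
  have hA : A = upper 1 1 x * (upper ρ ρ 0 * (diagOne v * rot θ)) := by
    ext i k
    fin_cases i <;> fin_cases k <;>
      simp [Matrix.mul_apply, Fin.sum_univ_two, diagOne_apply hv.ne', upper_apply, rot, h10, h11, ← h0, ← h1] <;> ring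
  rw [hA, hN, hω, hl _ θ]
  have hjl : j ^ l = (ρ : ℝ) ^ l * Complex.exp (-(Complex.I * l * θ)) := by
    rw [← hpol, mul_pow, ← Complex.exp_nat_mul, hρ, hθ]
    congr 2
    push_cast
    ring
  rw [hjl]
  have he : Complex.exp (Complex.I * l * θ) * Complex.exp (-(Complex.I * l * θ)) = 1 := by
    rw [← Complex.exp_add, add_neg_cancel, Complex.exp_zero]
  push_cast
  linear_combination (Complex.exp (2 * Real.pi * Complex.I * (c * x)) * (ω ρ : ℂ) * (ρ : ℝ) ^ l *
      W (diagOne v)) * he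

/-- The character `z ↦ χ₀(z) z^l` only depends on `|z|`. -/
theorem chi_mul_pow {χ₀ : ℂˣ →* ℂˣ} {ω : ℝˣ →* ℂˣ} {l : ℕ} {q : ℂ}
    (hq : ∀ y : ℝˣ, 0 < (y : ℝ) → (ω y : ℂ) = ((y : ℝ) : ℂ) ^ q)
    (hχω : ∀ x : ℝˣ, χ₀ (Units.map (Complex.ofRealHom : ℝ →* ℂ) x) = ω x)
    (hχl : ∀ z : ℂˣ, ‖(z : ℂ)‖ = 1 → χ₀ z = z ^ (-(l : ℤ))) (z : ℂˣ) :
    (χ₀ z : ℂ) * (z : ℂ) ^ l = ((‖(z : ℂ)‖ : ℝ) : ℂ) ^ (q + l) := by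
  have hz : ‖(z : ℂ)‖ ≠ 0 := norm_ne_zero_iff.2 z.ne_zero
  have hzc : ((‖(z : ℂ)‖ : ℝ) : ℂ) ≠ 0 := by exact_mod_cast hz
  set ρ : ℝˣ := Units.mk0 ‖(z : ℂ)‖ hz with hρ
  set y : ℂˣ := z * (Units.map (Complex.ofRealHom : ℝ →* ℂ) ρ)⁻¹ with hy
  have hy1 : ‖(y : ℂ)‖ = 1 := by
    rw [hy, Units.val_mul, Units.val_inv_eq_inv_val, norm_mul, norm_inv]
    simp [hρ]
  have hzy : z = Units.map (Complex.ofRealHom : ℝ →* ℂ) ρ * y := by rw [hy]; simp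
  have e1 : (χ₀ z : ℂ) = (‖(z : ℂ)‖ : ℂ) ^ q * ((y : ℂ) ^ l)⁻¹ := by
    conv_lhs => rw [hzy]
    rw [map_mul, hχω, hχl y hy1, Units.val_mul, hq ρ (norm_pos_iff.2 z.ne_zero)]
    simp [hρ]
  have e2 : (z : ℂ) ^ l = (‖(z : ℂ)‖ : ℂ) ^ l * (y : ℂ) ^ l := by
    conv_lhs => rw [hzy]
    simp [hρ, mul_pow]
  have hyl : (y : ℂ) ^ l ≠ 0 := pow_ne_zero _ y.ne_zero
  rw [e1, e2, Complex.cpow_add _ _ hzc, Complex.cpow_natCast]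
  field_simp

end

/-! ### The Iwasawa decomposition and the function `W^#` -/

section

open Filter Topology Set

/-- Every element of `GU(2,2)` of positive multiplier has a factorization: the Iwasawa
decomposition with respect to the parabolic subgroup. -/
theorem exists_factorization {g : Matrix I4 I4 ℂ} {μ : ℝ} (hg : IsGU g μ) (hμ : 0 < μ) :
    Nonempty (Factorization g) := by
  obtain ⟨hv, -, hdet⟩ := hg.hermIm_pos hμ
  set Z := act g basePoint with hZ
  have hdg := hg.den_det_ne_zero hμ.ne'
  set d := Complex.normSq (den g).det with hd
  have hdpos : 0 < d := Complex.normSq_pos.2 hdg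
  rw [hermIm_diag, Complex.ofReal_re] at hv
  obtain ⟨x, v, hxv⟩ : ∃ x v : ℝ, Z 1 1 = x + v * Complex.I := ⟨_, _, (Complex.re_add_im _).symm⟩
  obtain ⟨x0, v0, hxv0⟩ : ∃ x v : ℝ, Z 0 0 = x + v * Complex.I := ⟨_, _, (Complex.re_add_im _).symm⟩
  obtain ⟨a, b, hab⟩ : ∃ x v : ℝ, Z 0 1 = x + v * Complex.I := ⟨_, _, (Complex.re_add_im _).symm⟩
  obtain ⟨a', b', hab'⟩ : ∃ x v : ℝ, Z 1 0 = x + v * Complex.I := ⟨_, _, (Complex.re_add_im _).symm⟩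
  have hv' : 0 < v := by rw [hxv] at hv; simpa using hv
  have hdetR : (v0 * v - ((a' - a) ^ 2 + (b + b') ^ 2) / 4) * d = μ ^ 2 := by
    have e : (hermIm Z).det = ((v0 * v - ((a' - a) ^ 2 + (b + b') ^ 2) / 4 : ℝ) : ℂ) := by
      rw [det_fin_two, hermIm_diag, hermIm_diag, hermIm_apply, hermIm_apply, hxv, hxv0, hab, hab']
      simp only [Complex.add_im, Complex.ofReal_im, Complex.mul_im, Complex.I_im, Complex.I_re,
        Complex.ofReal_re, star_add, star_mul', Complex.star_def, Complex.conj_ofReal, Complex.conj_I]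
      field_simp
      apply Complex.ext <;> simp [pow_two] <;> ring
    rw [e] at hdet
    rw [mul_assoc, mul_comm _ (star _), Complex.star_def, ← Complex.normSq_eq_conj_mul_self, ← hd] at hdet
    exact_mod_cast hdet
  set δ := v0 * v - ((a' - a) ^ 2 + (b + b') ^ 2) / 4 with hδ
  have hδ0 : 0 < δ := by
    by_contra h
    nlinarith [mul_nonneg (neg_nonneg.2 (not_lt.1 h)) hdpos.le, sq_pos_of_pos hμ]
  -- the parameters of the parabolic part
  obtain ⟨ζ, hζ, hζ2⟩ : ∃ ζ : ℝ, 0 < ζ ∧ ζ ^ 2 = μ * δ / v :=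
    ⟨Real.sqrt (μ * δ / v), by positivity, Real.sq_sqrt (by positivity)⟩
  obtain ⟨u, hu, hu2⟩ : ∃ u : ℝ, 0 < u ∧ u ^ 2 = μ / v :=
    ⟨Real.sqrt (μ / v), by positivity, Real.sq_sqrt (by positivity)⟩
  have hζδ : ζ ^ 2 = u ^ 2 * δ := by rw [hζ2, hu2]; ring
  have hu2' : u ^ 2 * v = μ := by rw [hu2]; field_simp
  have hζc : (ζ : ℂ) ≠ 0 := by exact_mod_cast hζ.ne'
  have huc : (u : ℂ) ≠ 0 := by exact_mod_cast hu.ne'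
  set A : GL2 := Matrix.GeneralLinearGroup.mkOfDetNeZero !![v, x; 0, 1]
    (by rw [det_fin_two_of]; simpa using hv'.ne') with hA
  have hA' : (A : Matrix (Fin 2) (Fin 2) ℝ) = !![v, x; 0, 1] := rfl
  obtain ⟨y₁, hy₁⟩ : ∃ t : ℝ, 2 * ζ * t = u * (a + a') := ⟨u * (a + a') / (2 * ζ), by field_simp⟩
  obtain ⟨y₂, hy₂⟩ : ∃ t : ℝ, 2 * ζ * t = u * (b - b') := ⟨u * (b - b') / (2 * ζ), by field_simp⟩
  obtain ⟨z₁, hz₁⟩ : ∃ t : ℝ, 2 * ζ * t = u * (b + b') := ⟨u * (b + b') / (2 * ζ), by field_simp⟩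
  obtain ⟨z₂, hz₂⟩ : ∃ t : ℝ, 2 * ζ * t = u * (a' - a) := ⟨u * (a' - a) / (2 * ζ), by field_simp⟩
  obtain ⟨κ, hκ⟩ : ∃ κ : ℝ, ζ * κ = 1 := ⟨ζ⁻¹, mul_inv_cancel₀ hζ.ne'⟩
  have hκi : (ζ : ℂ)⁻¹ = κ := by
    rw [inv_eq_iff_eq_inv, eq_comm, inv_eq_iff_eq_inv]
    exact eq_inv_of_mul_eq_one_right (by exact_mod_cast hκ)
  have hkey : ζ ^ 2 * (1 + z₁ ^ 2 + z₂ ^ 2) = v0 * μ := by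
    linear_combination hζδ + (2 * ζ * z₁ + u * (b + b')) / 4 * hz₁ +
      (2 * ζ * z₂ + u * (a' - a)) / 4 * hz₂ + v0 * hu2' + u ^ 2 * hδ
  set y : ℂ := (y₁ : ℂ) + y₂ * Complex.I with hy
  set z : ℂ := (z₁ : ℂ) + z₂ * Complex.I with hz
  set w : ℝ := κ * (x0 * κ * μ - u * (a * z₁ + b * z₂)) - (z₁ * y₁ + z₂ * y₂) with hw
  have hp := isGU_parabolic (Units.mk0 _ hζc) (Units.mk0 _ huc) A z y w
  have hμ' : Complex.normSq ((Units.mk0 _ huc : ℂˣ) : ℂ) * (A : Matrix (Fin 2) (Fin 2) ℝ).det = μ := by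
    rw [hA', det_fin_two_of, Units.val_mk0, Complex.normSq_ofReal]
    linarith
  rw [hμ'] at hp
  obtain ⟨k, hk, e⟩ := exists_KInf_of_act_eq hμ.ne' hg hp (by
    rw [num_parabolic, den_parabolic, hμ', ← hZ, hA']
    ext i j
    fin_cases i <;> fin_cases j <;>
      simp only [Matrix.mul_apply, Fin.sum_univ_two, Fin.mk_zero, Fin.mk_one, 
        Matrix.of_apply, Matrix.cons_val', Matrix.cons_val_zero, Matrix.cons_val_one,
        Matrix.cons_val_fin_one, Units.val_mk0, hxv, hxv0, hab, hab', hy, hz, map_add, map_mul,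
        Complex.conj_ofReal, Complex.conj_I, hκi] <;>
      apply Complex.ext <;>
      simp 
    · linear_combination (x0 * κ * μ - u * (a * z₁ + b * z₂)) * hκ
    · linear_combination κ * hkey - ζ * (1 + z₁ ^ 2 + z₂ ^ 2) * hκ + z₂ * (hy₁ - hz₂) / 2 -
        z₁ * (hz₁ + hy₂) / 2
    · linear_combination (hy₁ - hz₂) / 2
    · linear_combination (hz₁ + hy₂) / 2
    · linear_combination u * v * κ * (hy₁ + hz₂) / 2 - u * v * (y₁ + z₂) * hκ + a' * κ * hu2'
    · linear_combination u * v * κ * (hz₁ - hy₂) / 2 - u * v * (z₁ - y₂) * hκ + b' * κ * hu2'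
    · ring
    · ring)
  exact ⟨⟨Units.mk0 _ hζc, Units.mk0 _ huc, A, z, y, w, k, hk, e⟩⟩

/-- `W^#` in terms of the point `g⟨I⟩` and the automorphy factor; the value does not depend on the
factorization. -/
theorem WSharp_eq {c : ℝ} {W : GL2 → ℂ} {l : ℕ} {ω : ℝˣ →* ℂˣ} {χ₀ : ℂˣ →* ℂˣ} {q : ℂ}
    (hN : ∀ (x : ℝ) (g : GL2),
      W (upper 1 1 x * g) = Complex.exp (2 * Real.pi * Complex.I * (c * x : ℝ)) * W g)
    (hω : ∀ (z : ℝˣ) (g : GL2), W (upper z z 0 * g) = (ω z : ℂ) * W g)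
    (hl : W ∈ weightSpace l)
    (hq : ∀ y : ℝˣ, 0 < (y : ℝ) → (ω y : ℂ) = ((y : ℝ) : ℂ) ^ q)
    (hχω : ∀ x : ℝˣ, χ₀ (Units.map (Complex.ofRealHom : ℝ →* ℂ) x) = ω x)
    (hχl : ∀ z : ℂˣ, ‖(z : ℂ)‖ = 1 → χ₀ z = z ^ (-(l : ℤ)))
    {g : Matrix I4 I4 ℂ} {μ : ℝ} (hg : IsGU g μ) (hμ : 0 < μ) (s : ℂ) {x v δ : ℝ}
    (hx : act g basePoint 1 1 = x + v * Complex.I)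
    (hδ : δ = μ ^ 2 / Complex.normSq (den g).det) :
    WSharp W χ₀ l g s = (((δ / v) ^ 3 : ℝ) : ℂ) ^ (s + 1 / 2) *
      ((μ : ℂ) ^ l * (((den g).det) ^ l)⁻¹ * (Real.sqrt δ : ℂ) ^ (-(q + l))) *
      (Complex.exp (2 * Real.pi * Complex.I * (c * x : ℝ)) * W (diagOne v)) := by
  have hne := exists_factorization hg hμ
  rw [WSharp, dif_pos hne]
  generalize Classical.choice hne = d
  have hdg := hg.den_det_ne_zero hμ.ne'
  have hv : 0 < v := by
    have := (hg.hermIm_pos hμ).1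
    rw [hermIm_diag, hx] at this
    simpa using this
  obtain ⟨ζ, u, A, z, y, w, k, hk, e⟩ := d
  dsimp only
  set p := leviOne ζ * leviTwo u A * unipN z y w with hp
  have hpGU := isGU_parabolic ζ u A z y w
  set N := Complex.normSq (u : ℂ) * (A : Matrix (Fin 2) (Fin 2) ℝ).det with hNdef
  have hNμ : N = μ := by
    have h1 := hpGU.mul (mem_KInf_iff.1 hk).1
    rw [← hp, ← e, mul_one] at h1
    exact h1.unique hg
  have hden : (den g).det = (den p).det * (den k).det := by
    rw [e, den_mul_KInf p hk, det_mul]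
  have hact : act g basePoint = act p basePoint := by rw [e, act_mul_KInf p hk]
  have hdp : (den p).det ≠ 0 := hpGU.den_det_ne_zero (by rw [hNμ]; exact hμ.ne')
  have hnum := num_eq hdp
  rw [← hact] at hnum
  set j : ℂ := (A : Matrix (Fin 2) (Fin 2) ℝ) 1 0 * Complex.I + (A : Matrix (Fin 2) (Fin 2) ℝ) 1 1 with hj
  have hZ := congrFun (congrFun hnum 1) 1
  rw [hp, num_parabolic, den_parabolic, Matrix.mul_apply, Fin.sum_univ_two] at hZ
  simp only [Matrix.of_apply, Matrix.cons_val', Matrix.cons_val_zero, Matrix.cons_val_one,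
    Matrix.cons_val_fin_one, mul_zero, zero_add, hx] at hZ
  have hdetp : (den p).det = ((starRingEnd ℂ) (ζ : ℂ))⁻¹ * N * (u * j) := by
    rw [hp, den_parabolic, det_fin_two_of, zero_mul, sub_zero]
  have hu := u.ne_zero
  have hζ := ζ.ne_zero
  have hζ' : (starRingEnd ℂ) (ζ : ℂ) ≠ 0 := by simp
  have hj0 : j ≠ 0 := by
    rintro h
    rw [hdetp, h] at hdp
    simp at hdp
  have hZ' : ((x : ℂ) + v * Complex.I) * j =
      (A : Matrix (Fin 2) (Fin 2) ℝ) 0 0 * Complex.I + (A : Matrix (Fin 2) (Fin 2) ℝ) 0 1 := by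
    apply mul_left_cancel₀ hu
    rw [hZ]
    ring
  have hW := weight_apply hN hω hl A hv hj hZ' (Units.mk0 ‖j‖ (norm_ne_zero_iff.2 hj0)) rfl
  rw [hq _ (by simpa using hj0), Units.val_mk0] at hW
  -- the absolute values of the parameters
  have ha0 : 0 < ‖(ζ : ℂ)‖ := norm_pos_iff.2 hζ
  have hb0 : 0 < ‖(u : ℂ)‖ := norm_pos_iff.2 hu
  have hρ0 : 0 < ‖j‖ := norm_pos_iff.2 hj0
  have hχζ := chi_mul_pow hq hχω hχl (Units.map (starRingEnd ℂ : ℂ →* ℂ) ζ)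
  have hχu := chi_mul_pow hq hχω hχl u
  have e1 : ((Units.map (starRingEnd ℂ : ℂ →* ℂ) ζ : ℂˣ) : ℂ) = (starRingEnd ℂ) (ζ : ℂ) := rfl
  rw [e1, Complex.norm_conj] at hχζ
  set a := ‖(ζ : ℂ)‖ with ha
  set b := ‖(u : ℂ)‖ with hb
  set ρ := ‖j‖ with hρ
  have hk1 : Complex.normSq (den k).det = 1 := by
    have h1 := congrArg Matrix.det (den_unitary hk)
    rw [det_mul, det_conjTranspose, det_one, Complex.star_def, ← Complex.normSq_eq_conj_mul_self] at h1
    exact_mod_cast h1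
  have hδ' : δ = (a / (b * ρ)) ^ 2 := by
    rw [hδ, hden, map_mul, hk1, mul_one, hdetp, hNμ]
    simp only [map_mul, map_inv₀, Complex.normSq_eq_norm_sq, Complex.norm_conj, Complex.norm_real,
      Real.norm_eq_abs, sq_abs]
    rw [← ha, ← hb, ← hρ]
    field_simp
  have hsqrt : Real.sqrt δ = a / (b * ρ) := by rw [hδ', Real.sqrt_sq (by positivity)]
  have hvρ : v * ρ ^ 2 = (A : Matrix (Fin 2) (Fin 2) ℝ).det := by
    have h1 := congrArg Complex.re hZ'
    have h2 := congrArg Complex.im hZ'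
    rw [hρ, ← Complex.normSq_eq_norm_sq, Complex.normSq_apply, det_fin_two]
    simp [hj] at h1 h2 ⊢
    linear_combination (A : Matrix (Fin 2) (Fin 2) ℝ) 1 1 * h2 - (A : Matrix (Fin 2) (Fin 2) ℝ) 1 0 * h1
  have hμv : μ = b ^ 2 * (v * ρ ^ 2) := by
    rw [hvρ, ← hNμ, hNdef, Complex.normSq_eq_norm_sq]
  have hmod : |Complex.normSq (ζ : ℂ) * N⁻¹| ^ 3 = (δ / v) ^ 3 := by
    rw [hNμ, Complex.normSq_eq_norm_sq, ← ha, abs_of_pos (by positivity), hδ', hμv]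
    congr 1
    field_simp
  have hcpow : (Real.sqrt δ : ℂ) ^ (-(q + l)) =
      ((a : ℂ) ^ (q + l))⁻¹ * ((b : ℂ) ^ (q + l) * (ρ : ℂ) ^ (q + l)) := by
    have hdiv : (Real.sqrt δ : ℂ) = (((b * ρ) / a : ℝ) : ℂ)⁻¹ := by
      rw [hsqrt, ← Complex.ofReal_inv, inv_div]
    have hpos : 0 < b * ρ / a := by positivity
    rw [hdiv, Complex.inv_cpow _ _ (by
      rw [Complex.arg_ofReal_of_nonneg hpos.le]; exact Real.pi_pos.ne), Complex.cpow_neg, inv_inv,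
      div_eq_mul_inv, Complex.ofReal_mul, Complex.mul_cpow_ofReal_nonneg (by positivity) (by positivity),
      Complex.ofReal_mul, Complex.mul_cpow_ofReal_nonneg (by positivity) (by positivity),
      Complex.ofReal_inv, Complex.inv_cpow _ _ (by
      rw [Complex.arg_ofReal_of_nonneg ha0.le]; exact Real.pi_pos.ne)]
    ring
  have hρc : (ρ : ℂ) ≠ 0 := by exact_mod_cast hρ0.ne'
  have hμc : (μ : ℂ) ≠ 0 := by exact_mod_cast hμ.ne'
  have hac : (a : ℂ) ^ (q + l) ≠ 0 := by
    rw [Complex.cpow_ne_zero_iff]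
    exact Or.inl (by exact_mod_cast ha0.ne')
  have hχζ0 : (χ₀ (Units.map (starRingEnd ℂ : ℂ →* ℂ) ζ) : ℂ) ≠ 0 := Units.ne_zero _
  have hdk : (den k).det ≠ 0 := den_det_ne_zero_of_mem_KInf hk
  have hρq : (ρ : ℂ) ^ (q + l) = (ρ : ℂ) ^ q * (ρ : ℂ) ^ l := by
    rw [Complex.cpow_add _ _ hρc, Complex.cpow_natCast]
  rw [Factorization.modulus, hmod, _root_.zpow_neg, zpow_natCast, mul_assoc, mul_assoc, mul_assoc]
  congr 1
  rw [hcpow, ← hχζ, ← hχu, hden, hdetp, hNμ, hρq, Units.val_inv_eq_inv_val]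
  have hjl : j ^ l ≠ 0 := pow_ne_zero _ hj0
  have hul : (u : ℂ) ^ l ≠ 0 := pow_ne_zero _ hu
  have hdkl : (den k).det ^ l ≠ 0 := pow_ne_zero _ hdk
  have hζl : (starRingEnd ℂ) (ζ : ℂ) ^ l ≠ 0 := pow_ne_zero _ hζ'
  have hμl : (μ : ℂ) ^ l ≠ 0 := pow_ne_zero _ hμc
  have hWA : W A = (Complex.exp (2 * Real.pi * Complex.I * (c * x : ℝ)) * (ρ : ℂ) ^ q * (ρ : ℂ) ^ l *
      W (diagOne v)) / j ^ l := by rw [← hW, mul_div_cancel_right₀ _ hjl]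
  rw [hWA]
  simp only [mul_pow, inv_pow]
  field_simp

end

/-! ### The integrand as a function on the Siegel half space -/

section

open Filter Topology Set

/-- The matrix of an element of `GSp₄(ℝ)`. -/
abbrev mat (h : GSp4) : Matrix I4 I4 ℝ := ((h : GL I4 ℝ) : Matrix I4 I4 ℝ)

theorem toC_mul {n : Type} [Fintype n] (A B : Matrix n n ℝ) : toC (A * B) = toC A * toC B :=
  Matrix.map_mul (f := Complex.ofRealHom)

theorem toC_conjTranspose {n : Type} (A : Matrix n n ℝ) : (toC A)ᴴ = toC Aᵀ := by
  ext i j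
  simp [toC]

theorem toC_transpose {n : Type} (A : Matrix n n ℝ) : (toC A)ᵀ = toC Aᵀ := rfl

theorem toC_smul {n : Type} (a : ℝ) (A : Matrix n n ℝ) : toC (a • A) = (a : ℂ) • toC A := by
  ext i j
  simp [toC]

theorem toC_formJ : toC (formJ ℝ) = formJ ℂ := by
  ext (i | i) (j | j) <;> simp [toC, formJ, one_apply] <;> split_ifs <;> simp

theorem mat_mul (g h : GSp4) : mat (g * h) = mat g * mat h := rfl

theorem mult_eq_of {g : Matrix I4 I4 ℝ} {m : ℝ} (h : gᵀ * formJ ℝ * g = m • formJ ℝ) : mult g = m := by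
  rw [mult, h]
  simp [formJ]

theorem mat_mult (h : GSp4) : (mat h)ᵀ * formJ ℝ * mat h = mult (mat h) • formJ ℝ := by
  obtain ⟨m, hm⟩ := h.2
  rw [mult_eq_of hm]
  exact hm

theorem mult_ne_zero (h : GSp4) : mult (mat h) ≠ 0 := by
  obtain ⟨m, hm⟩ := h.2
  rw [mult_eq_of hm]
  exact m.ne_zero

theorem mult_mul (g h : GSp4) : mult (mat (g * h)) = mult (mat g) * mult (mat h) := by
  apply mult_eq_of
  rw [mat_mul, transpose_mul]
  have : (mat h)ᵀ * (mat g)ᵀ * formJ ℝ * (mat g * mat h) =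
      (mat h)ᵀ * ((mat g)ᵀ * formJ ℝ * mat g) * mat h := by simp only [Matrix.mul_assoc]
  rw [this, mat_mult, Matrix.mul_smul, Matrix.smul_mul, mat_mult, smul_smul]

theorem isGU_toC {g : Matrix I4 I4 ℝ} {m : ℝ} (h : gᵀ * formJ ℝ * g = m • formJ ℝ) :
    IsGU (toC g) m := by
  rw [IsGU, toC_conjTranspose, ← toC_formJ, ← toC_mul, ← toC_mul, h, toC_smul]

theorem isGU_mat (h : GSp4) : IsGU (toC (mat h)) (mult (mat h)) := isGU_toC (mat_mult h)

/-- The point `h⟨I⟩`, in the upper half space if the multiplier of `h` is positive and in the lower one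
otherwise. -/
def point (h : GSp4) : Matrix (Fin 2) (Fin 2) ℂ := act (toC (mat h)) basePoint

theorem den_ne_zero (h : GSp4) : (den (toC (mat h))).det ≠ 0 :=
  (isGU_mat h).den_det_ne_zero (mult_ne_zero h)

/-- The point `h⟨I⟩` is a symmetric matrix. -/
theorem point_transpose (h : GSp4) : (point h)ᵀ = point h := by
  have hu : IsUnit (den (toC (mat h))).det := isUnit_iff_ne_zero.2 (den_ne_zero h)
  have hg : (toC (mat h))ᵀ * formJ ℂ * toC (mat h) = (mult (mat h) : ℂ) • formJ ℂ := by
    rw [toC_transpose, ← toC_formJ, ← toC_mul, ← toC_mul, mat_mult, toC_smul]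
  set g := toC (mat h) with hgdef
  have key : (num g)ᵀ * den g = (den g)ᵀ * num g := by
    set A := g.toBlocks₁₁ with hA
    set B := g.toBlocks₁₂ with hB
    set C := g.toBlocks₂₁ with hC
    set E := g.toBlocks₂₂ with hE
    have hgb : g = fromBlocks A B C E := (fromBlocks_toBlocks g).symm
    rw [hgb, formJ, fromBlocks_transpose, fromBlocks_multiply, fromBlocks_multiply,
      fromBlocks_smul, fromBlocks_inj] at hg
    obtain ⟨h1, h2, h3, h4⟩ := hg
    simp only [mul_zero, zero_add, mul_neg, mul_one, add_zero, smul_zero, smul_neg] at h1 h2 h3 h4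
    have e1 : num g = Complex.I • A + B := by
      rw [num, basePoint, Matrix.mul_smul, mul_one]
    have e2 : den g = Complex.I • C + E := by
      rw [den, autFactor, basePoint, Matrix.mul_smul, mul_one]
    rw [e1, e2, ← sub_eq_zero]
    simp only [transpose_add, transpose_smul]
    have e3 : (Complex.I • Aᵀ + Bᵀ) * (Complex.I • C + E) -
        (Complex.I • Cᵀ + Eᵀ) * (Complex.I • A + B) =
        (Complex.I * Complex.I) • (-Cᵀ * A + Aᵀ * C) + Complex.I • (-Cᵀ * B + Aᵀ * E) +
          Complex.I • (-Eᵀ * A + Bᵀ * C) + (-Eᵀ * B + Bᵀ * E) := by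
      ext i j
      simp only [Matrix.add_mul, Matrix.mul_add, Matrix.smul_mul, Matrix.mul_smul, Matrix.neg_mul,
        Matrix.add_apply, Matrix.sub_apply, Matrix.smul_apply, Matrix.neg_apply, smul_eq_mul]
      ring
    rw [e3, h1, h2, h3, h4, smul_zero, zero_add, add_zero, smul_neg, add_neg_cancel]
  rw [num_eq (den_ne_zero h), transpose_mul] at key
  have h2 := congrArg (fun M => ((den g)⁻¹)ᵀ * M * (den g)⁻¹) key
  have h3 : ((den g)⁻¹)ᵀ * (den g)ᵀ = 1 := by
    rw [← transpose_mul, Matrix.mul_nonsing_inv _ hu, transpose_one]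
  calc (point h)ᵀ = ((den g)⁻¹)ᵀ * (den g)ᵀ * (act g basePoint)ᵀ * (den g * (den g)⁻¹) := by
        rw [h3, Matrix.mul_nonsing_inv _ hu, Matrix.one_mul, Matrix.mul_one]; rfl
    _ = ((den g)⁻¹)ᵀ * ((den g)ᵀ * (act g basePoint)ᵀ * den g) * (den g)⁻¹ := by
        simp only [Matrix.mul_assoc]
    _ = ((den g)⁻¹)ᵀ * ((den g)ᵀ * (act g basePoint * den g)) * (den g)⁻¹ := by rw [h2]
    _ = ((den g)⁻¹)ᵀ * (den g)ᵀ * act g basePoint * (den g * (den g)⁻¹) := by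
        simp only [Matrix.mul_assoc]
    _ = point h := by
        rw [h3, Matrix.mul_nonsing_inv _ hu, Matrix.one_mul, Matrix.mul_one]; rfl

/-- The real part of `h⟨I⟩`. -/
def ptRe (h : GSp4) : Matrix (Fin 2) (Fin 2) ℝ := (point h).map Complex.re

/-- The imaginary part of `h⟨I⟩`. -/
def ptIm (h : GSp4) : Matrix (Fin 2) (Fin 2) ℝ := (point h).map Complex.im

theorem ptRe_symm (h : GSp4) (i j : Fin 2) : ptRe h i j = ptRe h j i := by
  rw [ptRe, map_apply, map_apply, ← point_transpose h, transpose_apply, point_transpose]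

theorem ptIm_symm (h : GSp4) (i j : Fin 2) : ptIm h i j = ptIm h j i := by
  rw [ptIm, map_apply, map_apply, ← point_transpose h, transpose_apply, point_transpose]

theorem point_eq (h : GSp4) : point h = toC (ptRe h) + Complex.I • toC (ptIm h) := by
  ext i j
  simp [ptRe, ptIm, toC, mul_comm Complex.I, Complex.re_add_im]

theorem hermIm_point (h : GSp4) : hermIm (point h) = toC (ptIm h) := by
  ext i j
  have e : point h j i = point h i j := by rw [← transpose_apply (point h), point_transpose]
  rw [hermIm_apply, e, div_eq_iff (by simp [Complex.I_ne_zero])]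
  simp only [toC, ptIm, map_apply]
  apply Complex.ext <;> simp
  ring

/-- `det Im(h⟨I⟩) = μ(h)² / |det J(h, I)|²`. -/
theorem det_ptIm (h : GSp4) (hμ : 0 < mult (mat h)) :
    (ptIm h).det = mult (mat h) ^ 2 / Complex.normSq (den (toC (mat h))).det := by
  have h1 := ((isGU_mat h).hermIm_pos hμ).2.2
  have h2 : Complex.normSq (den (toC (mat h))).det ≠ 0 := by
    rw [Ne, Complex.normSq_eq_zero]; exact den_ne_zero h
  rw [eq_div_iff h2]
  have h3 : (hermIm (act (toC (mat h)) basePoint)).det = ((ptIm h).det : ℂ) := by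
    change (hermIm (point h)).det = _
    rw [hermIm_point, det_fin_two, det_fin_two]
    simp [toC]
  rw [h3, mul_assoc, mul_comm _ (star _), Complex.star_def, ← Complex.normSq_eq_conj_mul_self] at h1
  exact_mod_cast h1

theorem det_ptIm_pos (h : GSp4) (hμ : 0 < mult (mat h)) : 0 < (ptIm h).det := by
  rw [det_ptIm h hμ]
  have := Complex.normSq_pos.2 (den_ne_zero h)
  positivity

theorem ptIm_one_one_pos (h : GSp4) (hμ : 0 < mult (mat h)) : 0 < ptIm h 1 1 := by
  have := ((isGU_mat h).hermIm_pos hμ).1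
  change 0 < (hermIm (point h) 1 1).re at this
  rw [hermIm_point] at this
  simpa [toC] using this

/-- The invariant `tr(S Y)` of a real symmetric matrix `Y`. -/
def BForm.tr (f : BForm) (Y : Matrix (Fin 2) (Fin 2) ℝ) : ℝ := (f.S * Y).trace

theorem BForm.tr_eq (f : BForm) (Y : Matrix (Fin 2) (Fin 2) ℝ) (hY : Y 1 0 = Y 0 1) :
    f.tr Y = f.a * Y 0 0 + f.b * Y 0 1 + f.c * Y 1 1 := by
  rw [BForm.tr, trace_fin_two, BForm.S, Matrix.mul_apply, Matrix.mul_apply, Fin.sum_univ_two,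
    Fin.sum_univ_two, hY]
  simp
  ring

theorem eta_eq (f : BForm) (hc : f.c = 1) :
    ∃ α : ℂ, α.re = f.b / 2 ∧ α.im = Real.sqrt f.D / 2 ∧
      eta f = fromBlocks !![1, 0; α, 1] 0 0 !![1, -(starRingEnd ℂ) α; 0, 1] := by
  refine ⟨(f.b + Complex.I * Real.sqrt f.D) / (2 * f.c), ?_, ?_, rfl⟩ <;> rw [hc]
  · rw [show ((f.b : ℂ) + Complex.I * Real.sqrt f.D) / (2 * (1 : ℝ)) =
      ((f.b / 2 : ℝ) : ℂ) + ((Real.sqrt f.D / 2 : ℝ) : ℂ) * Complex.I by push_cast; ring]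
    simp
  · rw [show ((f.b : ℂ) + Complex.I * Real.sqrt f.D) / (2 * (1 : ℝ)) =
      ((f.b / 2 : ℝ) : ℂ) + ((Real.sqrt f.D / 2 : ℝ) : ℂ) * Complex.I by push_cast; ring]
    simp

theorem isGU_eta (f : BForm) (hc : f.c = 1) : IsGU (eta f) 1 := by
  obtain ⟨α, -, -, e⟩ := eta_eq f hc
  rw [e, IsGU, formJ, fromBlocks_conjTranspose, fromBlocks_multiply, fromBlocks_multiply,
    fromBlocks_smul, fromBlocks_inj]
  refine ⟨?_, ?_, ?_, ?_⟩ <;> ext i j <;> fin_cases i <;> fin_cases j <;>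
    simp [Matrix.mul_apply, Fin.sum_univ_two]

theorem den_eta_mul (f : BForm) (hc : f.c = 1) (h : GSp4) :
    (den (eta f * toC (mat h))).det = (den (toC (mat h))).det := by
  obtain ⟨α, -, -, e⟩ := eta_eq f hc
  rw [den_mul (den_ne_zero h), det_mul, autFactor, e, toBlocks_fromBlocks₂₁,
    toBlocks_fromBlocks₂₂, Matrix.zero_mul, zero_add, det_fin_two_of]
  simp

/-- The relevant coordinate of `ηh⟨I⟩` is `tr(S h⟨I⟩)`. -/
theorem act_eta_mul (f : BForm) (hc : f.c = 1) (hD : 0 < f.D) (h : GSp4) :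
    act (eta f * toC (mat h)) basePoint 1 1 = f.tr (ptRe h) + f.tr (ptIm h) * Complex.I := by
  obtain ⟨α, hre, him, e⟩ := eta_eq f hc
  have hinv : (!![1, -(starRingEnd ℂ) α; 0, 1] : Matrix (Fin 2) (Fin 2) ℂ)⁻¹ =
      !![1, (starRingEnd ℂ) α; 0, 1] := by
    apply inv_eq_right_inv
    ext i j
    fin_cases i <;> fin_cases j <;> simp [Matrix.mul_apply, Fin.sum_univ_two]
  have hs : Real.sqrt f.D ^ 2 = 4 * f.a - f.b ^ 2 := by
    rw [Real.sq_sqrt hD.le, BForm.D, hc, mul_one]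
  rw [act_mul (den_ne_zero h), act, autFactor, e, toBlocks_fromBlocks₂₁, toBlocks_fromBlocks₂₂,
    toBlocks_fromBlocks₁₁, toBlocks_fromBlocks₁₂, Matrix.zero_mul, zero_add, add_zero, hinv]
  change (_ * point h * _ : Matrix (Fin 2) (Fin 2) ℂ) 1 1 = _
  rw [f.tr_eq _ (ptRe_symm h 1 0), f.tr_eq _ (ptIm_symm h 1 0), point_eq, hc]
  simp only [Matrix.mul_apply, Fin.sum_univ_two, Matrix.add_apply, Matrix.smul_apply, toC, map_apply,
    ptRe_symm h 1 0, ptIm_symm h 1 0]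
  apply Complex.ext <;> simp [hre, him]
  · linear_combination (ptRe h 0 0) / 4 * hs
  · linear_combination (ptIm h 0 0) / 4 * hs

/-- The zeta integrand in the coordinates `x = √(det Y)`, `t = tr(S Y)`. -/
def zetaKernel (l : ℕ) (W : GL2 → ℂ) (q s : ℂ) (x t : ℝ) : ℂ :=
  (x : ℂ) ^ (6 * s + 3 + l - q) * (t : ℂ) ^ (-(3 * s + 3 / 2)) * Complex.exp (-(2 * Real.pi * t)) *
    W (diagOne t)

/-- The integrand only depends on `det Im(h⟨I⟩)` and `tr(S Im(h⟨I⟩))`. -/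
theorem integrand_eq (f : BForm) (hc : f.c = 1) (hD : 0 < f.D)
    {W : GL2 → ℂ} {l : ℕ} {ω : ℝˣ →* ℂˣ} {χ₀ : ℂˣ →* ℂˣ} {q : ℂ}
    (hN : ∀ (x : ℝ) (g : GL2),
      W (upper 1 1 x * g) = Complex.exp (2 * Real.pi * Complex.I * (f.c * x : ℝ)) * W g)
    (hω : ∀ (z : ℝˣ) (g : GL2), W (upper z z 0 * g) = (ω z : ℂ) * W g)
    (hl : W ∈ weightSpace l)
    (hq : ∀ y : ℝˣ, 0 < (y : ℝ) → (ω y : ℂ) = ((y : ℝ) : ℂ) ^ q)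
    (hχω : ∀ x : ℝˣ, χ₀ (Units.map (Complex.ofRealHom : ℝ →* ℂ) x) = ω x)
    (hχl : ∀ z : ℂˣ, ‖(z : ℂ)‖ = 1 → χ₀ z = z ^ (-(l : ℤ)))
    (s : ℂ) (h : GSp4) :
    integrand f l W χ₀ s h = if 0 < mult (mat h) then
      zetaKernel l W q s (Real.sqrt (ptIm h).det) (f.tr (ptIm h)) else 0 := by
  rw [integrand, besselB]
  split_ifs with hμ
  swap
  · rw [mul_zero]
  set μ := mult (mat h) with hμdef
  have hGU : IsGU (eta f * toC (mat h)) μ := by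
    have := (isGU_eta f hc).mul (isGU_mat h)
    rwa [one_mul] at this
  have hx := act_eta_mul f hc hD h
  have hδ : (ptIm h).det = μ ^ 2 / Complex.normSq (den (eta f * toC (mat h))).det := by
    rw [den_eta_mul f hc, det_ptIm h hμ]
  rw [WSharp_eq hN hω hl hq hχω hχl hGU hμ s hx hδ, den_eta_mul f hc]
  have hv : 0 < f.tr (ptIm h) := by
    have := (hGU.hermIm_pos hμ).1
    rw [hermIm_diag, hx] at this
    simpa using this
  have hδ0 := det_ptIm_pos h hμ
  have hδ2 := det_ptIm h hμ
  have hd0 := den_ne_zero h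
  have htr : (toC f.S * (act (toC (mat h)) basePoint).map (starRingEnd ℂ)).trace =
      f.tr (ptRe h) - f.tr (ptIm h) * Complex.I := by
    have e : (act (toC (mat h)) basePoint).map (starRingEnd ℂ) = toC (ptRe h) - Complex.I • toC (ptIm h) := by
      ext i j
      simp only [toC, ptRe, ptIm, map_apply, Matrix.sub_apply, Matrix.smul_apply, smul_eq_mul]
      apply Complex.ext <;> simp [point] <;> rfl
    rw [e, Matrix.mul_sub, trace_sub, Matrix.mul_smul, trace_smul, ← toC_mul, ← toC_mul,
      smul_eq_mul, mul_comm Complex.I]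
    congr 1
    · rw [BForm.tr]; simp [trace_fin_two, toC]
    · rw [BForm.tr]; simp [trace_fin_two, toC]
  rw [htr]
  change _ * ((μ : ℂ) ^ l * _ * _) = _
  set d := (den (toC (mat h))).det with hd
  set δ := (ptIm h).det with hδdef
  set v := f.tr (ptIm h) with hvdef
  set ξ := Real.sqrt δ with hξ
  have hξ0 : 0 < ξ := Real.sqrt_pos.2 hδ0
  have hξ2 : ξ ^ 2 = δ := Real.sq_sqrt hδ0.le
  have hξc : (ξ : ℂ) ≠ 0 := by exact_mod_cast hξ0.ne'
  have hconj : (starRingEnd ℂ) ((autFactor (toC (mat h)) basePoint).det ^ (-(l : ℤ))) =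
      ((starRingEnd ℂ d) ^ l)⁻¹ := by
    rw [map_zpow₀, _root_.zpow_neg, zpow_natCast]
  rw [hconj]
  have hdl : d ^ l ≠ 0 := pow_ne_zero _ hd0
  have hdl' : (starRingEnd ℂ d) ^ l ≠ 0 := pow_ne_zero _ (by simpa using hd0)
  have hpow : (μ : ℂ) ^ l * (d ^ l)⁻¹ * ((μ : ℂ) ^ l * ((starRingEnd ℂ d) ^ l)⁻¹) = (ξ : ℂ) ^ (2 * (l : ℂ)) := by
    have e1 : (ξ : ℂ) ^ (2 * (l : ℂ)) = ((δ : ℝ) : ℂ) ^ l := by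
      rw [← hξ2, show (2 * (l : ℂ)) = ((2 * l : ℕ) : ℂ) by push_cast; ring, Complex.cpow_natCast,
        pow_mul]
      push_cast
      rfl
    rw [e1, hδ2]
    push_cast
    rw [Complex.normSq_eq_conj_mul_self, div_pow, mul_pow, ← hμdef]
    field_simp
    ring
  have hmod : (((δ / v) ^ 3 : ℝ) : ℂ) ^ (s + 1 / 2) = (ξ : ℂ) ^ (6 * s + 3) * (v : ℂ) ^ (-(3 * s + 3 / 2)) := by
    have e1 : Real.log ((δ / v) ^ 3) = 6 * Real.log ξ - 3 * Real.log v := by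
      rw [← hξ2, Real.log_pow, Real.log_div (by positivity) hv.ne', Real.log_pow]
      push_cast; ring
    have hpos : 0 < (δ / v) ^ 3 := by positivity
    rw [Complex.cpow_def_of_ne_zero (by exact_mod_cast hpos.ne'), Complex.cpow_def_of_ne_zero hξc,
      Complex.cpow_def_of_ne_zero (by exact_mod_cast hv.ne'), ← Complex.ofReal_log hpos.le,
      ← Complex.ofReal_log hξ0.le, ← Complex.ofReal_log hv.le, e1, ← Complex.exp_add]
    congr 1
    push_cast
    ring
  have hexp : Complex.exp (2 * Real.pi * Complex.I * (f.c * f.tr (ptRe h) : ℝ)) *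
      Complex.exp (-2 * Real.pi * Complex.I * (f.tr (ptRe h) - v * Complex.I)) =
      Complex.exp (-(2 * Real.pi * v)) := by
    rw [← Complex.exp_add, hc]
    congr 1
    push_cast
    linear_combination (2 * Real.pi * v : ℂ) * Complex.I_sq
  have hsum : (ξ : ℂ) ^ (6 * s + 3 + l - q) =
      (ξ : ℂ) ^ (6 * s + 3) * (ξ : ℂ) ^ (2 * (l : ℂ)) * (ξ : ℂ) ^ (-(q + l)) := by
    rw [← Complex.cpow_add _ _ hξc, ← Complex.cpow_add _ _ hξc]
    congr 1
    ring
  rw [hmod, zetaKernel, ← hexp, hsum, ← hpow]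
  ring

end

/-! ### Invariance under the Bessel subgroup -/

section

open Filter Topology Set

theorem point_mul (g h : GSp4) : point (g * h) = act (toC (mat g)) (point h) := by
  rw [point, mat_mul, toC_mul, act_mul (den_ne_zero h), point]

/-- The action of block triangular elements on the Siegel half space. -/
theorem point_mul_of_block {g : GSp4} {A B E F : Matrix (Fin 2) (Fin 2) ℝ}
    (hg : mat g = fromBlocks A B 0 E) (hF : E * F = 1) (h : GSp4) :
    ptRe (g * h) = (A * ptRe h + B) * F ∧ ptIm (g * h) = A * ptIm h * F := by
  have hinv : (toC E)⁻¹ = toC F := by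
    apply inv_eq_right_inv
    rw [← toC_mul, hF]
    ext i j
    simp [toC, one_apply]
    split_ifs <;> simp
  have hb : toC (mat g) = fromBlocks (toC A) (toC B) 0 (toC E) := by
    rw [hg, toC, fromBlocks_map]
    congr 1
  have e : point (g * h) = toC ((A * ptRe h + B) * F) + Complex.I • toC (A * ptIm h * F) := by
    rw [point_mul, act, autFactor, hb, toBlocks_fromBlocks₂₁, toBlocks_fromBlocks₂₂,
      toBlocks_fromBlocks₁₁, toBlocks_fromBlocks₁₂, Matrix.zero_mul, zero_add, hinv, point_eq,
      toC_mul, toC_mul, toC_mul, show toC (A * ptRe h + B) = toC A * toC (ptRe h) + toC B by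
        rw [← toC_mul]; ext i j; simp [toC]]
    simp only [Matrix.mul_add, Matrix.add_mul, Matrix.mul_smul, Matrix.smul_mul]
    abel
  constructor
  · ext i j
    rw [ptRe, map_apply, e]
    simp [toC]
  · ext i j
    rw [ptIm, map_apply, e]
    simp [toC]

theorem mem_torus_iff {f : BForm} {t : GL2} : t ∈ torus f ↔
    (t : Matrix (Fin 2) (Fin 2) ℝ)ᵀ * f.S * (t : Matrix (Fin 2) (Fin 2) ℝ)
      = (t : Matrix (Fin 2) (Fin 2) ℝ).det • f.S := Iff.rfl

theorem torus_det_pos {f : BForm} (hc : f.c = 1) (hD : 0 < f.D) {t : GL2} (ht : t ∈ torus f) :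
    0 < (t : Matrix (Fin 2) (Fin 2) ℝ).det := by
  have h := congrFun (congrFun (mem_torus_iff.1 ht) 1) 1
  have h0 := GL2.mem_det_ne_zero t
  have h0' : (t : Matrix (Fin 2) (Fin 2) ℝ).det ≠ 0 := h0
  simp [Matrix.mul_apply, Fin.sum_univ_two, BForm.S, hc] at h
  rw [BForm.D, hc] at hD
  refine lt_of_le_of_ne ?_ h0'.symm
  rw [← h]
  nlinarith [sq_nonneg ((t : Matrix (Fin 2) (Fin 2) ℝ) 1 1 + f.b / 2 * (t : Matrix (Fin 2) (Fin 2) ℝ) 0 1),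
    mul_nonneg hD.le (sq_nonneg ((t : Matrix (Fin 2) (Fin 2) ℝ) 0 1))]

theorem GL2.mul_val_inv (t : GL2) :
    (t : Matrix (Fin 2) (Fin 2) ℝ) * ((t⁻¹ : GL2) : Matrix (Fin 2) (Fin 2) ℝ) = 1 := by
  rw [← Units.val_mul, mul_inv_cancel, Units.val_one]

/-- The lower right block of `levi t` is inverse to `ᵗt / det t`. -/
theorem levi_block_inv (t : GL2) :
    ((t : Matrix (Fin 2) (Fin 2) ℝ).det • ((t⁻¹ : GL2) : Matrix (Fin 2) (Fin 2) ℝ)ᵀ) *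
      ((t : Matrix (Fin 2) (Fin 2) ℝ).det⁻¹ • (t : Matrix (Fin 2) (Fin 2) ℝ)ᵀ) = 1 := by
  have h0 : (t : Matrix (Fin 2) (Fin 2) ℝ).det ≠ 0 := GL2.mem_det_ne_zero t
  rw [Matrix.smul_mul, Matrix.mul_smul, smul_smul, mul_inv_cancel₀ h0, one_smul, ← transpose_mul,
    GL2.mul_val_inv, transpose_one]

theorem mult_levi_mul_unip (t : GL2) {X : Matrix (Fin 2) (Fin 2) ℝ} (hX : Xᵀ = X) :
    mult (levi t * unip X) = (t : Matrix (Fin 2) (Fin 2) ℝ).det := by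
  apply mult_eq_of
  have h1 : (t : Matrix (Fin 2) (Fin 2) ℝ)ᵀ * ((t⁻¹ : GL2) : Matrix (Fin 2) (Fin 2) ℝ)ᵀ = 1 := by
    rw [← transpose_mul, ← Units.val_mul, inv_mul_cancel, Units.val_one, transpose_one]
  have h2 : ((t⁻¹ : GL2) : Matrix (Fin 2) (Fin 2) ℝ) * (t : Matrix (Fin 2) (Fin 2) ℝ) = 1 := by
    rw [← Units.val_mul, inv_mul_cancel, Units.val_one]
  have hl : (levi t)ᵀ * formJ ℝ * levi t = (t : Matrix (Fin 2) (Fin 2) ℝ).det • formJ ℝ := by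
    rw [levi, formJ, fromBlocks_transpose, fromBlocks_multiply, fromBlocks_multiply, fromBlocks_smul]
    simp only [transpose_zero, transpose_smul, transpose_transpose, Matrix.mul_zero, Matrix.zero_mul,
      Matrix.mul_one, Matrix.mul_neg, Matrix.neg_mul, add_zero, zero_add, neg_zero, smul_zero,
      Matrix.mul_smul, Matrix.smul_mul, h1, h2, smul_neg]
  have hu : (unip X)ᵀ * formJ ℝ * unip X = formJ ℝ := by
    rw [unip, formJ, fromBlocks_transpose, fromBlocks_multiply, fromBlocks_multiply]
    simp [hX]
  rw [transpose_mul]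
  calc (unip X)ᵀ * (levi t)ᵀ * formJ ℝ * (levi t * unip X) =
      (unip X)ᵀ * ((levi t)ᵀ * formJ ℝ * levi t) * unip X := by simp only [Matrix.mul_assoc]
    _ = _ := by rw [hl, Matrix.mul_smul, Matrix.smul_mul, hu]

/-- The coordinates of an element of the Bessel subgroup acting on the half space. -/
theorem besselR_mul {f : BForm} (hc : f.c = 1) (hD : 0 < f.D) {r : GSp4} (hr : r ∈ besselR f) :
    0 < mult (mat r) ∧ ∃ t ∈ torus f, ∃ X : Matrix (Fin 2) (Fin 2) ℝ, ∀ h : GSp4,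
      ptRe (r * h) = (t : Matrix (Fin 2) (Fin 2) ℝ).det⁻¹ •
        ((t : Matrix (Fin 2) (Fin 2) ℝ) * ptRe h * (t : Matrix (Fin 2) (Fin 2) ℝ)ᵀ) + X ∧
      ptIm (r * h) = (t : Matrix (Fin 2) (Fin 2) ℝ).det⁻¹ •
        ((t : Matrix (Fin 2) (Fin 2) ℝ) * ptIm h * (t : Matrix (Fin 2) (Fin 2) ℝ)ᵀ) := by
  obtain ⟨t, ht, X, hX, e⟩ := hr
  refine ⟨?_, t, ht, (t : Matrix (Fin 2) (Fin 2) ℝ) * X *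
    ((t : Matrix (Fin 2) (Fin 2) ℝ).det⁻¹ • (t : Matrix (Fin 2) (Fin 2) ℝ)ᵀ), fun h => ?_⟩
  · change 0 < mult ((r : GL I4 ℝ) : Matrix I4 I4 ℝ)
    rw [e, mult_levi_mul_unip t hX]
    exact torus_det_pos hc hD ht
  · have hb : mat r = fromBlocks (t : Matrix (Fin 2) (Fin 2) ℝ) ((t : Matrix (Fin 2) (Fin 2) ℝ) * X) 0
      ((t : Matrix (Fin 2) (Fin 2) ℝ).det • ((t⁻¹ : GL2) : Matrix (Fin 2) (Fin 2) ℝ)ᵀ) := by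
      change ((r : GL I4 ℝ) : Matrix I4 I4 ℝ) = _
      rw [e, levi, unip, fromBlocks_multiply]
      simp
    obtain ⟨h1, h2⟩ := point_mul_of_block hb (levi_block_inv t) h
    rw [h1, h2]
    constructor
    · rw [Matrix.add_mul, Matrix.mul_smul]
    · rw [Matrix.mul_smul]

theorem det_ptIm_besselR {f : BForm} (hc : f.c = 1) (hD : 0 < f.D) {r : GSp4} (hr : r ∈ besselR f)
    (h : GSp4) : (ptIm (r * h)).det = (ptIm h).det := by
  obtain ⟨-, t, ht, X, H⟩ := besselR_mul hc hD hr
  have h0 := (torus_det_pos hc hD ht).ne'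
  rw [(H h).2, det_smul, det_mul, det_mul, det_transpose, Fintype.card_fin]
  field_simp

theorem tr_ptIm_besselR {f : BForm} (hc : f.c = 1) (hD : 0 < f.D) {r : GSp4} (hr : r ∈ besselR f)
    (h : GSp4) : f.tr (ptIm (r * h)) = f.tr (ptIm h) := by
  obtain ⟨-, t, ht, X, H⟩ := besselR_mul hc hD hr
  have h0 := (torus_det_pos hc hD ht).ne'
  have e : (f.S * ((t : Matrix (Fin 2) (Fin 2) ℝ) * ptIm h * (t : Matrix (Fin 2) (Fin 2) ℝ)ᵀ)).trace =
      (t : Matrix (Fin 2) (Fin 2) ℝ).det * (f.S * ptIm h).trace := by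
    rw [← Matrix.mul_assoc, trace_mul_comm, ← Matrix.mul_assoc, ← Matrix.mul_assoc,
      mem_torus_iff.1 ht, Matrix.smul_mul, trace_smul, smul_eq_mul]
  rw [(H h).2, BForm.tr, BForm.tr, Matrix.mul_smul, trace_smul, e, smul_eq_mul,
    inv_mul_cancel_left₀ h0]

theorem mult_besselR_mul_pos {f : BForm} (hc : f.c = 1) (hD : 0 < f.D) {r : GSp4}
    (hr : r ∈ besselR f) (h : GSp4) : 0 < mult (mat (r * h)) ↔ 0 < mult (mat h) := by
  rw [mult_mul]
  exact mul_pos_iff_of_pos_left (besselR_mul hc hD hr).1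

theorem formOf_c (D : ℕ) : (formOf D).c = 1 := by
  rw [formOf]
  split_ifs <;> rfl

theorem formOf_D (D : ℕ) : (formOf D).D = D := by
  rw [formOf]
  split_ifs
  · simp [BForm.D]
    ring
  · simp [BForm.D]
    ring

end

/-! ### The topology of `GSp₄(ℝ)` and of the homogeneous space -/

section

open Filter Topology Set
open scoped ENNReal

theorem formJ_mul_formJ : formJ ℝ * formJ ℝ = -1 := by
  rw [formJ, fromBlocks_multiply]
  simp [← fromBlocks_one, fromBlocks_neg]

/-- Inverses in `GSp₄(ℝ)` are polynomial in the entries and the inverse of the multiplier. -/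
theorem symplectic_inv_mul {M : Matrix I4 I4 ℝ} {m y : ℝ} (hM : Mᵀ * formJ ℝ * M = m • formJ ℝ)
    (hy : m * y = 1) : (-y) • (formJ ℝ * Mᵀ * formJ ℝ) * M = 1 := by
  have : formJ ℝ * Mᵀ * formJ ℝ * M = formJ ℝ * (Mᵀ * formJ ℝ * M) := by
    simp only [Matrix.mul_assoc]
  rw [Matrix.smul_mul, this, hM, Matrix.mul_smul, formJ_mul_formJ, smul_smul, smul_neg, neg_mul,
    mul_comm y, hy, neg_smul, one_smul, neg_neg]

/-- The coordinates of `GSp₄(ℝ)`: the entries of the matrix, and the inverse of its multiplier. -/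
def entries (h : GSp4) : (I4 → I4 → ℝ) × ℝ := (fun i j => mat h i j, (mult (mat h))⁻¹)

theorem continuous_mult : Continuous (mult : Matrix I4 I4 ℝ → ℝ) := by
  unfold mult
  fun_prop

theorem continuous_mat : Continuous mat := Units.continuous_val.comp continuous_subtype_val

theorem continuous_entries : Continuous entries := by
  refine Continuous.prodMk ?_ ((continuous_mult.comp continuous_mat).inv₀ mult_ne_zero)
  exact continuous_pi fun i => continuous_pi fun j => continuous_mat.matrix_elem i j

/-- `GSp₄(ℝ)` is a closed subspace of a Euclidean space. The inverse of the multiplier has to be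
among the coordinates, since the multiplier may tend to `0`. -/
theorem isClosedEmbedding_entries : IsClosedEmbedding entries := by
  refine ⟨?_, ?_⟩
  · set Φ : (I4 → I4 → ℝ) × ℝ → Matrix I4 I4 ℝ × (Matrix I4 I4 ℝ)ᵐᵒᵖ := fun p =>
      (Matrix.of p.1, MulOpposite.op ((-p.2) • (formJ ℝ * (Matrix.of p.1)ᵀ * formJ ℝ))) with hΦ
    have hof : Continuous fun p : (I4 → I4 → ℝ) × ℝ => Matrix.of p.1 := continuous_fst
    have hΦc : Continuous Φ := by
      refine Continuous.prodMk hof (MulOpposite.continuous_op.comp ?_)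
      refine Continuous.smul continuous_snd.neg ?_
      exact (continuous_const.matrix_mul hof.matrix_transpose).matrix_mul continuous_const
    refine IsEmbedding.of_comp continuous_entries hΦc ?_
    have e : Φ ∘ entries = (Units.embedProduct (Matrix I4 I4 ℝ)) ∘ (Subtype.val : GSp4 → GL I4 ℝ) := by
      funext h
      refine Prod.ext rfl ?_
      refine congrArg MulOpposite.op ?_
      have h1 := symplectic_inv_mul (mat_mult h) (mul_inv_cancel₀ (mult_ne_zero h))
      have h2 : mat h * (((h : GL I4 ℝ)⁻¹ : GL I4 ℝ) : Matrix I4 I4 ℝ) = 1 := by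
        rw [mat, ← Units.val_mul, mul_inv_cancel, Units.val_one]
      exact left_inv_eq_right_inv h1 h2
    rw [e]
    exact Units.isEmbedding_embedProduct.comp IsEmbedding.subtypeVal
  · have hr : range entries = {p : (I4 → I4 → ℝ) × ℝ |
        (Matrix.of p.1)ᵀ * formJ ℝ * Matrix.of p.1 = mult (Matrix.of p.1) • formJ ℝ ∧
          mult (Matrix.of p.1) * p.2 = 1} := by
      ext p
      constructor
      · rintro ⟨h, rfl⟩
        exact ⟨mat_mult h, mul_inv_cancel₀ (mult_ne_zero h)⟩
      · rintro ⟨h1, h2⟩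
        have h3 := symplectic_inv_mul h1 h2
        have h4 := mul_eq_one_comm.1 h3
        refine ⟨⟨⟨Matrix.of p.1, _, h4, h3⟩, Units.mk0 _ (left_ne_zero_of_mul_eq_one h2), h1⟩, ?_⟩
        refine Prod.ext rfl ?_
        exact (eq_inv_of_mul_eq_one_right h2).symm
    have hof : Continuous fun p : (I4 → I4 → ℝ) × ℝ => Matrix.of p.1 := continuous_fst
    rw [hr, ofPred_and]
    refine (isClosed_eq ?_ ?_).inter (isClosed_eq ?_ continuous_const)
    · exact (hof.matrix_transpose.matrix_mul continuous_const).matrix_mul hof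
    · exact (continuous_mult.comp hof).smul continuous_const
    · exact (continuous_mult.comp hof).mul continuous_snd

instance : PolishSpace GSp4 := isClosedEmbedding_entries.polishSpace

instance : LocallyCompactSpace GSp4 := isClosedEmbedding_entries.locallyCompactSpace

instance : MeasurableSpace GSp4 := borel _

instance : BorelSpace GSp4 := ⟨rfl⟩

/-- Closed subsets of `GSp₄(ℝ)` with bounded entries and multiplier bounded away from zero are
compact. -/
theorem isCompact_of_entries_le {s : Set GSp4} (hs : IsClosed s) {M : ℝ}
    (hM : ∀ h ∈ s, (∀ i j, |mat h i j| ≤ M) ∧ |(mult (mat h))⁻¹| ≤ M) : IsCompact s := by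
  have hc : IsCompact ((Set.pi univ fun _ : I4 => Set.pi univ fun _ : I4 => Icc (-M) M) ×ˢ
      Icc (-M) M : Set ((I4 → I4 → ℝ) × ℝ)) :=
    (isCompact_univ_pi fun _ => isCompact_univ_pi fun _ => isCompact_Icc).prod isCompact_Icc
  refine (isClosedEmbedding_entries.isCompact_preimage hc).of_isClosed_subset hs fun h hh => ?_
  obtain ⟨h1, h2⟩ := hM h hh
  exact ⟨fun i _ j _ => abs_le.1 (h1 i j), abs_le.1 h2⟩

/-- The Bessel subgroup is cut out by polynomial equations. -/
theorem isClosed_besselR (f : BForm) : IsClosed (besselR f : Set GSp4) := by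
  -- the conditions on the blocks `A`, `B`, `C`, `E` that describe the subgroup
  have hr : (besselR f : Set GSp4) = {h : GSp4 | (mat h).toBlocks₂₁ = 0 ∧
      (mat h).toBlocks₁₁ᵀ * f.S * (mat h).toBlocks₁₁ = (mat h).toBlocks₁₁.det • f.S ∧
      (mat h).toBlocks₁₁.det = mult (mat h)} := by
    ext h
    constructor
    · rintro ⟨t, ht, X, hX, e⟩
      have e' : mat h = fromBlocks (t : Matrix (Fin 2) (Fin 2) ℝ) ((t : Matrix (Fin 2) (Fin 2) ℝ) * X) 0
        ((t : Matrix (Fin 2) (Fin 2) ℝ).det • ((t⁻¹ : GL2) : Matrix (Fin 2) (Fin 2) ℝ)ᵀ) := by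
        change ((h : GL I4 ℝ) : Matrix I4 I4 ℝ) = _
        rw [e, levi, unip, fromBlocks_multiply]
        simp
      have e2 : mult (mat h) = (t : Matrix (Fin 2) (Fin 2) ℝ).det := by
        change mult ((h : GL I4 ℝ) : Matrix I4 I4 ℝ) = _
        rw [e, mult_levi_mul_unip t hX]
      refine ⟨?_, ?_, ?_⟩
      · rw [e', toBlocks_fromBlocks₂₁]
      · rw [e', toBlocks_fromBlocks₁₁]; exact ht
      · rw [e2, e', toBlocks_fromBlocks₁₁]
    · rintro ⟨h1, h2, h3⟩
      set A := (mat h).toBlocks₁₁ with hA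
      set B := (mat h).toBlocks₁₂ with hB
      set E := (mat h).toBlocks₂₂ with hE
      have hb : mat h = fromBlocks A B 0 E := by
        rw [← h1]; exact (fromBlocks_toBlocks _).symm
      have hdet : A.det ≠ 0 := h3 ▸ mult_ne_zero h
      have hu : IsUnit A.det := isUnit_iff_ne_zero.2 hdet
      set t : GL2 := Matrix.GeneralLinearGroup.mkOfDetNeZero A hdet with ht
      have htA : (t : Matrix (Fin 2) (Fin 2) ℝ) = A := rfl
      have hm := mat_mult h
      rw [hb, formJ, fromBlocks_transpose, fromBlocks_multiply, fromBlocks_multiply,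
        fromBlocks_smul, fromBlocks_inj] at hm
      obtain ⟨-, m2, -, m4⟩ := hm
      simp only [transpose_zero, Matrix.mul_zero, Matrix.zero_mul, Matrix.mul_one, Matrix.mul_neg,
        Matrix.neg_mul, add_zero, zero_add, neg_zero, smul_zero] at m2 m4
      rw [← hb, ← h3] at m2
      have hti : ((t⁻¹ : GL2) : Matrix (Fin 2) (Fin 2) ℝ) = A⁻¹ := by
        rw [Matrix.coe_units_inv, htA]
      have hAt : (A⁻¹)ᵀ * Aᵀ = 1 := by
        rw [← transpose_mul, Matrix.mul_nonsing_inv _ hu, transpose_one]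
      have hE' : E = A.det • (A⁻¹)ᵀ := by
        have := congrArg (fun M => (A⁻¹)ᵀ * M) m2
        simp only [← Matrix.mul_assoc, hAt, Matrix.one_mul, Matrix.mul_smul, Matrix.mul_one] at this
        exact this
      refine ⟨t, h2, A⁻¹ * B, ?_, ?_⟩
      · have hX : Bᵀ * (A⁻¹)ᵀ = A⁻¹ * B := by
          have m4' : A.det • (Bᵀ * (A⁻¹)ᵀ) = A.det • (A⁻¹ * B) := by
            have hEt : Eᵀ = A.det • A⁻¹ := by rw [hE', transpose_smul, transpose_transpose]
            have : Bᵀ * E = Eᵀ * B := by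
              rw [← sub_eq_zero, sub_eq_add_neg, add_comm]; exact m4
            rw [hE', transpose_smul, transpose_transpose, Matrix.mul_smul, Matrix.smul_mul] at this
            exact this
          exact smul_right_injective _ hdet m4'
        rw [transpose_mul, hX]
      · change mat h = _
        rw [hb, levi, unip, fromBlocks_multiply, hti, htA, hE']
        simp only [Matrix.mul_one, Matrix.mul_zero, add_zero, Matrix.zero_mul, zero_add]
        rw [← Matrix.mul_assoc, Matrix.mul_nonsing_inv _ hu, Matrix.one_mul]
  rw [hr]
  have cA : Continuous fun h : GSp4 => (mat h).toBlocks₁₁ :=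
    continuous_matrix fun i j => continuous_mat.matrix_elem _ _
  have cC : Continuous fun h : GSp4 => (mat h).toBlocks₂₁ :=
    continuous_matrix fun i j => continuous_mat.matrix_elem _ _
  refine (isClosed_eq cC continuous_const).inter ((isClosed_eq ?_ ?_).inter (isClosed_eq ?_ ?_))
  · exact (cA.matrix_transpose.matrix_mul continuous_const).matrix_mul cA
  · exact cA.matrix_det.smul continuous_const
  · exact cA.matrix_det
  · exact continuous_mult.comp continuous_mat

/-! ### The quotient by the Bessel subgroup -/

theorem continuous_mk (f : BForm) : Continuous (BesselQuot.mk f) := continuous_quotient_mk'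

theorem surjective_mk (f : BForm) : Function.Surjective (BesselQuot.mk f) := Quotient.mk_surjective

theorem mk_rep {f : BForm} (x : BesselQuot f) : BesselQuot.mk f x.rep = x := Quotient.out_eq x

theorem mk_eq_mk {f : BForm} {g h : GSp4} :
    BesselQuot.mk f g = BesselQuot.mk f h ↔ ∃ r ∈ besselR f, g = r * h := by
  have e : BesselQuot.mk f g = BesselQuot.mk f h ↔ QuotientGroup.rightRel (besselR f) g h :=
    Quotient.eq
  rw [e, QuotientGroup.rightRel_apply]
  constructor
  · intro hr
    exact ⟨(h * g⁻¹)⁻¹, inv_mem hr, by group⟩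
  · rintro ⟨r, hr, rfl⟩
    simpa using inv_mem hr

theorem isOpenMap_mk (f : BForm) : IsOpenMap (BesselQuot.mk f) := by
  intro U hU
  have e : BesselQuot.mk f ⁻¹' (BesselQuot.mk f '' U) = ⋃ r : besselR f, (fun h => (r : GSp4) * h) '' U := by
    ext h
    rw [mem_iUnion]
    constructor
    · rintro ⟨u, hu, e⟩
      obtain ⟨r, hr, rfl⟩ := mk_eq_mk.1 e.symm
      exact ⟨⟨r, hr⟩, u, hu, rfl⟩
    · rintro ⟨r, u, hu, rfl⟩
      exact ⟨u, hu, (mk_eq_mk.2 ⟨r, r.2, rfl⟩).symm⟩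
  change IsOpen (BesselQuot.mk f ⁻¹' (BesselQuot.mk f '' U))
  rw [e]
  exact isOpen_iUnion fun r => (Homeomorph.mulLeft (r : GSp4)).isOpenMap U hU

theorem isQuotientMap_mk (f : BForm) : IsQuotientMap (BesselQuot.mk f) := isQuotientMap_quotient_mk'

theorem secondCountable_besselQuot (f : BForm) : SecondCountableTopology (BesselQuot f) :=
  (isQuotientMap_mk f).secondCountableTopology (isOpenMap_mk f)

theorem t1_besselQuot (f : BForm) : T1Space (BesselQuot f) := by
  refine ⟨fun x => ?_⟩
  rw [← (isQuotientMap_mk f).isClosed_preimage]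
  obtain ⟨h, rfl⟩ := surjective_mk f x
  have e : BesselQuot.mk f ⁻¹' {BesselQuot.mk f h} = (fun g => g * h⁻¹) ⁻¹' (besselR f : Set GSp4) := by
    ext g
    simp only [mem_preimage, mem_singleton_iff, SetLike.mem_coe]
    rw [mk_eq_mk]
    constructor
    · rintro ⟨r, hr, rfl⟩
      simpa using hr
    · intro hr
      exact ⟨_, hr, by group⟩
  rw [e]
  exact (isClosed_besselR f).preimage (continuous_mul_const _)

/-- Functions on the quotient are measurable if they are so on the group. -/
theorem measurable_of_comp_mk {f : BForm} {α : Type*} [MeasurableSpace α]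
    {F : BesselQuot f → α} (hF : Measurable fun h => F (BesselQuot.mk f h)) : Measurable F := by
  have := secondCountable_besselQuot f
  have := t1_besselQuot f
  intro s hs
  have h1 : MeasurableSet[MeasurableSpace.map (BesselQuot.mk f) inferInstance] (F ⁻¹' s) := hF hs
  rwa [(continuous_mk f).map_eq_borel (surjective_mk f)] at h1

end

/-! ### Unfolding the invariant measure to the group -/

section

open Filter Topology Set
open scoped ENNReal Pointwise

instance (f : BForm) : LocallyCompactSpace (besselR f) :=
  (isClosed_besselR f).isClosedEmbedding_subtypeVal.locallyCompactSpace

instance (f : BForm) : SecondCountableTopology (besselR f) :=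
  (IsEmbedding.subtypeVal (p := fun h : GSp4 => h ∈ besselR f)).secondCountableTopology

/-- A right Haar measure on the Bessel subgroup. -/
def rightHaar (f : BForm) : Measure (besselR f) := (Measure.haar : Measure (besselR f)).inv

instance (f : BForm) : (rightHaar f).IsMulRightInvariant := by
  unfold rightHaar; infer_instance

instance (f : BForm) : SFinite (rightHaar f) := by
  unfold rightHaar Measure.inv; infer_instance

theorem rightHaar_lt_top {f : BForm} {K : Set (besselR f)} (hK : IsCompact K) : rightHaar f K < ∞ := by
  rw [rightHaar, Measure.inv_apply]
  exact hK.inv.measure_lt_top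

theorem rightHaar_pos {f : BForm} {U : Set (besselR f)} (hU : IsOpen U) (hne : U.Nonempty) :
    0 < rightHaar f U := by
  rw [rightHaar, Measure.inv_apply]
  exact hU.inv.measure_pos _ hne.inv

/-- The right Haar measure on the coset of `h`. -/
def cosetMeasure (f : BForm) (h : GSp4) : Measure GSp4 := (rightHaar f).map fun r : besselR f => (r : GSp4) * h

theorem measurable_coset (f : BForm) (h : GSp4) : Measurable fun r : besselR f => (r : GSp4) * h :=
  (continuous_subtype_val.mul continuous_const).measurable

/-- `cosetMeasure` only depends on the coset, because `rightHaar` is right invariant. -/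
theorem cosetMeasure_mul {f : BForm} {r : GSp4} (hr : r ∈ besselR f) (h : GSp4) :
    cosetMeasure f (r * h) = cosetMeasure f h := by
  have e : (fun r' : besselR f => (r' : GSp4) * (r * h)) =
      (fun r' : besselR f => (r' : GSp4) * h) ∘ fun r' => r' * ⟨r, hr⟩ := by
    funext r'
    simp [mul_assoc]
  rw [cosetMeasure, e, ← Measure.map_map (measurable_coset f h) (measurable_mul_const _),
    map_mul_right_eq_self]
  rfl

theorem cosetMeasure_rep {f : BForm} (h : GSp4) :
    cosetMeasure f (BesselQuot.mk f h).rep = cosetMeasure f h := by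
  obtain ⟨r, hr, e⟩ := mk_eq_mk.1 (mk_rep (BesselQuot.mk f h))
  rw [e, cosetMeasure_mul hr]

theorem measurable_cosetMeasure_rep (f : BForm) :
    Measurable fun x : BesselQuot f => cosetMeasure f x.rep := by
  refine Measure.measurable_of_measurable_coe _ fun s hs => ?_
  refine measurable_of_comp_mk ?_
  simp only [cosetMeasure_rep]
  have hm : Measurable fun p : GSp4 × besselR f => (p.2 : GSp4) * p.1 :=
    ((continuous_subtype_val.comp continuous_snd).mul continuous_fst).measurable
  have e : (fun h : GSp4 => cosetMeasure f h s) =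
      fun h => rightHaar f (Prod.mk h ⁻¹' ((fun p : GSp4 × besselR f => (p.2 : GSp4) * p.1) ⁻¹' s)) := by
    funext h
    rw [cosetMeasure, Measure.map_apply (measurable_coset f h) hs]
    rfl
  rw [e]
  exact measurable_measure_prodMk_left (hm hs)

/-- The measure `∫ φ(h) = ∫_{R\H} ∫_R φ(r h) dr dν` on `GSp₄(ℝ)`. -/
def unfolding (f : BForm) (ν : Measure (BesselQuot f)) : Measure GSp4 :=
  ν.bind fun x => cosetMeasure f x.rep

theorem lintegral_unfolding (f : BForm) (ν : Measure (BesselQuot f)) {φ : GSp4 → ℝ≥0∞}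
    (hφ : Measurable φ) :
    ∫⁻ h, φ h ∂unfolding f ν = ∫⁻ x, ∫⁻ r, φ ((r : GSp4) * x.rep) ∂rightHaar f ∂ν := by
  rw [unfolding, Measure.lintegral_bind (measurable_cosetMeasure_rep f).aemeasurable hφ.aemeasurable]
  refine lintegral_congr fun x => ?_
  rw [cosetMeasure, lintegral_map hφ (measurable_coset f _)]

theorem rightMul_mk {f : BForm} (g h : GSp4) :
    BesselQuot.rightMul g (BesselQuot.mk f h) = BesselQuot.mk f (h * g) := rfl

theorem measurable_rightMul {f : BForm} (g : GSp4) :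
    Measurable (BesselQuot.rightMul g : BesselQuot f → BesselQuot f) :=
  measurable_of_comp_mk (((continuous_mk f).comp (continuous_mul_const g)).measurable)

theorem unfolding_apply (f : BForm) (ν : Measure (BesselQuot f)) {s : Set GSp4} (hs : MeasurableSet s) :
    unfolding f ν s = ∫⁻ x, cosetMeasure f x.rep s ∂ν :=
  Measure.bind_apply hs (measurable_cosetMeasure_rep f).aemeasurable

theorem unfolding_isMulRightInvariant {f : BForm} {ν : Measure (BesselQuot f)}
    (hν : IsInvariantMeasure f ν) : (unfolding f ν).IsMulRightInvariant := by
  refine ⟨fun g => Measure.ext fun s hs => ?_⟩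
  have hm : Measurable fun h : GSp4 => h * g := measurable_mul_const g
  rw [Measure.map_apply hm hs, unfolding_apply f ν (hm hs), unfolding_apply f ν hs]
  have hJ : Measurable fun x : BesselQuot f => cosetMeasure f x.rep s :=
    (Measure.measurable_coe hs).comp (measurable_cosetMeasure_rep f)
  conv_rhs => rw [← hν.invariant g]
  rw [lintegral_map hJ (measurable_rightMul g)]
  refine lintegral_congr fun x => ?_
  have e : cosetMeasure f (BesselQuot.rightMul g x).rep = cosetMeasure f (x.rep * g) := by
    conv_lhs => rw [← mk_rep x, rightMul_mk, cosetMeasure_rep]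
  rw [e, cosetMeasure, cosetMeasure, Measure.map_apply (measurable_coset f _) (hm hs),
    Measure.map_apply (measurable_coset f _) hs]
  congr 1
  ext r
  simp [mul_assoc]

/-- For a compact set `K`, every coset meets `K` in a translate of a subset of the compact set
`R ∩ K K⁻¹`, and only the cosets in the image of `K` contribute. -/
theorem unfolding_isFiniteMeasureOnCompacts {f : BForm} {ν : Measure (BesselQuot f)}
    (hν : IsInvariantMeasure f ν) : IsFiniteMeasureOnCompacts (unfolding f ν) := by
  have := hν.locallyFinite
  refine ⟨fun K hK => ?_⟩
  have hKm : MeasurableSet K := hK.isClosed.measurableSet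
  set L : Set (besselR f) := Subtype.val ⁻¹' (K * K⁻¹) with hL
  have hLc : IsCompact L :=
    (isClosed_besselR f).isClosedEmbedding_subtypeVal.isCompact_preimage (hK.mul hK.inv)
  rw [unfolding_apply f ν hKm]
  have hle : ∀ x : BesselQuot f, cosetMeasure f x.rep K ≤
      (BesselQuot.mk f '' K).indicator (fun _ => rightHaar f L) x := by
    intro x
    rw [cosetMeasure, Measure.map_apply (measurable_coset f _) hKm]
    by_cases hx : x ∈ BesselQuot.mk f '' K
    · rw [indicator_of_mem hx]
      obtain ⟨k, hk, rfl⟩ := hx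
      have e : (rightHaar f) ((fun r : besselR f => (r : GSp4) * (BesselQuot.mk f k).rep) ⁻¹' K) =
          (rightHaar f) ((fun r : besselR f => (r : GSp4) * k) ⁻¹' K) := by
        have := congrArg (fun μ => μ K) (cosetMeasure_rep (f := f) k)
        rwa [cosetMeasure, cosetMeasure, Measure.map_apply (measurable_coset f _) hKm,
          Measure.map_apply (measurable_coset f _) hKm] at this
      rw [e]
      refine measure_mono fun r hr => ?_
      exact ⟨_, hr, k⁻¹, by simpa using hk, by simp⟩
    · rw [indicator_of_notMem hx]
      have e : (fun r : besselR f => (r : GSp4) * x.rep) ⁻¹' K = ∅ := by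
        refine eq_empty_of_forall_notMem fun r hr => hx ⟨_, hr, ?_⟩
        rw [← mk_rep x, mk_eq_mk, mk_rep x]
        exact ⟨r, r.2, rfl⟩
      rw [e, measure_empty]
  refine (lintegral_mono hle).trans_lt ?_
  have hmK : IsCompact (BesselQuot.mk f '' K) := hK.image (continuous_mk f)
  refine (lintegral_indicator_const_le _ _).trans_lt ?_
  exact ENNReal.mul_lt_top (rightHaar_lt_top hLc) hmK.measure_lt_top

/-- Elements that are conjugate to their inverse have modular character one, so that a right
invariant measure is invariant under left translation by them. -/
theorem map_mul_left_of_conj_inv {m : Measure GSp4} (hm : m.IsMulRightInvariant)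
    (hf : IsFiniteMeasureOnCompacts m) {g w : GSp4} (hw : w * g * w⁻¹ = g⁻¹) :
    m.map (fun h => g * h) = m := by
  have hinv : IsFiniteMeasureOnCompacts m.inv := by
    refine ⟨fun K hK => ?_⟩
    rw [Measure.inv_apply]
    exact hK.inv.measure_lt_top
  have hΔ : Measure.modularCharacter g = 1 := by
    have h1 := congrArg Measure.modularCharacter hw
    rw [map_mul, map_mul, mul_comm, ← mul_assoc, ← map_mul, inv_mul_cancel, map_one, one_mul] at h1
    have h2 : Measure.modularCharacter g * Measure.modularCharacter g = 1 := by
      nth_rewrite 2 [h1]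
      rw [← map_mul, mul_inv_cancel, map_one]
    exact (pow_eq_one_iff_of_nonneg (zero_le) two_ne_zero).1 (by rw [sq]; exact h2)
  have e1 := Measure.isMulLeftInvariant_eq_smul m.inv (Measure.haar : Measure GSp4)
  have e2 := Measure.map_right_mul_eq_modularCharacterFun_smul (Measure.haar : Measure GSp4) g⁻¹
  have hΔ' : Measure.modularCharacterFun g⁻¹ = 1 := by
    change Measure.modularCharacter g⁻¹ = 1
    rw [← hw, map_mul, map_mul, hΔ, mul_one, ← map_mul, mul_inv_cancel, map_one]
  rw [hΔ', one_smul] at e2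
  have e3 : m.inv.map (fun h => h * g⁻¹) = m.inv := by
    rw [e1, Measure.map_smul, e2]
  have e4 : (fun h : GSp4 => g * h) = Inv.inv ∘ (fun h => h * g⁻¹) ∘ Inv.inv := by
    funext h; simp
  rw [e4, ← Measure.map_map measurable_inv ((measurable_mul_const _).comp measurable_inv),
    ← Measure.map_map (measurable_mul_const _) measurable_inv]
  change ((m.inv).map (fun h => h * g⁻¹)).inv = m
  rw [e3, Measure.inv_inv]

end

/-! ### Haar measure on a triangular group -/

section

open Filter Topology Set
open scoped ENNReal

/-- The effect of a fibrewise affine map on a product measure. -/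
theorem map_shear {β : Type*} [MeasurableSpace β] {μ : Measure β} [SFinite μ] {φ : β → β}
    (hφ : Measurable φ) {κ : ℝ≥0∞} (hμ : μ.map φ = κ • μ) {c : β → ℝ} (hc : Measurable c) {k : ℝ}
    (hk : 0 < k) :
    (μ.prod volume).map (fun p : β × ℝ => (φ p.1, c p.1 + k * p.2)) =
      (κ * ENNReal.ofReal k⁻¹) • μ.prod volume := by
  have hm : Measurable fun p : β × ℝ => (φ p.1, c p.1 + k * p.2) := by fun_prop
  refine Measure.ext_of_lintegral _ fun F hF => ?_
  rw [lintegral_map hF hm, lintegral_prod (fun p : β × ℝ => F (φ p.1, c p.1 + k * p.2))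
      (hF.comp hm).aemeasurable, lintegral_smul_measure,
    lintegral_prod _ hF.aemeasurable]
  have h1 : ∀ b : β, ∫⁻ x, F (φ b, c b + k * x) = ENNReal.ofReal k⁻¹ * ∫⁻ x, F (φ b, x) := by
    intro b
    have hF' : Measurable fun x => F (φ b, x) := by fun_prop
    have h2 : ∫⁻ x, F (φ b, c b + k * x) = ∫⁻ x, F (φ b, c b + x) ∂(volume.map fun x : ℝ => k * x) := by
      rw [lintegral_map (by fun_prop) (by fun_prop)]
    rw [h2, Real.map_volume_mul_left hk.ne', lintegral_smul_measure, abs_of_pos (inv_pos.2 hk),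
      lintegral_add_left_eq_self (fun x => F (φ b, x)) (c b), smul_eq_mul]
  have hG : Measurable fun b => ∫⁻ x, F (b, x) := hF.lintegral_prod_right'
  simp only [h1]
  rw [lintegral_const_mul (f := fun b => ∫⁻ x, F (φ b, x)) _ (hG.comp hφ), ← lintegral_map hG hφ, hμ, lintegral_smul_measure,
    smul_eq_mul, smul_eq_mul, mul_left_comm, mul_assoc]

/-- The group of the pairs of a symmetric matrix `[x, y; y, z]` and a lower triangular matrix
`[1, 0; u, 1] diag(e^a, e^e)`, the former being acted on by the latter through `X ↦ A X ᵗA`. An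
element is the tuple `(a, e, u, x, y, z)`. -/
def Tri : Type := ((((ℝ × ℝ) × ℝ) × ℝ) × ℝ) × ℝ

namespace Tri

instance : MeasurableSpace Tri := inferInstanceAs (MeasurableSpace (((((ℝ × ℝ) × ℝ) × ℝ) × ℝ) × ℝ))

/-- The element with the given coordinates. -/
def mk (a e u x y z : ℝ) : Tri := (((((a, e), u), x), y), z)
/-- The logarithm of the first diagonal entry. -/
def a (p : Tri) : ℝ := p.1.1.1.1.1
/-- The logarithm of the second diagonal entry. -/
def e (p : Tri) : ℝ := p.1.1.1.1.2
/-- The unipotent coordinate. -/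
def u (p : Tri) : ℝ := p.1.1.1.2
/-- The upper left entry of the symmetric matrix. -/
def x (p : Tri) : ℝ := p.1.1.2
/-- The off-diagonal entry of the symmetric matrix. -/
def y (p : Tri) : ℝ := p.1.2
/-- The lower right entry of the symmetric matrix. -/
def z (p : Tri) : ℝ := p.2

instance : Mul Tri := ⟨fun p q => mk (p.a + q.a) (p.e + q.e) (p.u + Real.exp (p.e - p.a) * q.u)
  (p.x + Real.exp p.a ^ 2 * q.x)
  (p.y + p.u * Real.exp p.a ^ 2 * q.x + Real.exp p.a * Real.exp p.e * q.y)
  (p.z + p.u ^ 2 * Real.exp p.a ^ 2 * q.x + 2 * p.u * Real.exp p.a * Real.exp p.e * q.y +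
    Real.exp p.e ^ 2 * q.z)⟩

instance : One Tri := ⟨mk 0 0 0 0 0 0⟩

instance : Inv Tri := ⟨fun p => mk (-p.a) (-p.e) (-(Real.exp (p.a - p.e) * p.u))
  (-(Real.exp (-p.a) ^ 2 * p.x))
  (-(Real.exp (-p.a) * Real.exp (-p.e) * (p.y - p.u * p.x)))
  (-(Real.exp (-p.e) ^ 2 * (p.z - 2 * p.u * p.y + p.u ^ 2 * p.x)))⟩

theorem ext' {p q : Tri} (h1 : p.a = q.a) (h2 : p.e = q.e) (h3 : p.u = q.u) (h4 : p.x = q.x)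
    (h5 : p.y = q.y) (h6 : p.z = q.z) : p = q :=
  Prod.ext (Prod.ext (Prod.ext (Prod.ext (Prod.ext h1 h2) h3) h4) h5) h6

theorem mul_def (p q : Tri) : p * q = mk (p.a + q.a) (p.e + q.e) (p.u + Real.exp (p.e - p.a) * q.u)
  (p.x + Real.exp p.a ^ 2 * q.x)
  (p.y + p.u * Real.exp p.a ^ 2 * q.x + Real.exp p.a * Real.exp p.e * q.y)
  (p.z + p.u ^ 2 * Real.exp p.a ^ 2 * q.x + 2 * p.u * Real.exp p.a * Real.exp p.e * q.y +
    Real.exp p.e ^ 2 * q.z) := rfl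

theorem inv_def (p : Tri) : p⁻¹ = mk (-p.a) (-p.e) (-(Real.exp (p.a - p.e) * p.u))
  (-(Real.exp (-p.a) ^ 2 * p.x))
  (-(Real.exp (-p.a) * Real.exp (-p.e) * (p.y - p.u * p.x)))
  (-(Real.exp (-p.e) ^ 2 * (p.z - 2 * p.u * p.y + p.u ^ 2 * p.x))) := rfl

theorem one_def : (1 : Tri) = mk 0 0 0 0 0 0 := rfl

section
variable (a' e' u' x' y' z' : ℝ)
theorem mk_a : (mk a' e' u' x' y' z').a = a' := rfl
theorem mk_e : (mk a' e' u' x' y' z').e = e' := rfl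
theorem mk_u : (mk a' e' u' x' y' z').u = u' := rfl
theorem mk_x : (mk a' e' u' x' y' z').x = x' := rfl
theorem mk_y : (mk a' e' u' x' y' z').y = y' := rfl
theorem mk_z : (mk a' e' u' x' y' z').z = z' := rfl
end

instance : Group Tri := Group.ofLeftAxioms
  (by
    intro p q r
    have h1 := Real.exp_pos p.a
    have h2 := Real.exp_pos q.a
    apply ext' <;> simp only [mul_def, mk_a, mk_e, mk_u, mk_x, mk_y, mk_z, Real.exp_add, Real.exp_sub] <;>
      first | ring1 | (field_simp; ring))
  (by
    intro p
    apply ext' <;> simp [mul_def, one_def, mk_a, mk_e, mk_u, mk_x, mk_y, mk_z])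
  (by
    intro p
    have h1 := Real.exp_pos p.a
    have h2 := Real.exp_pos p.e
    apply ext' <;>
      simp only [mul_def, inv_def, one_def, mk_a, mk_e, mk_u, mk_x, mk_y, mk_z, Real.exp_sub, Real.exp_neg] <;>
      first | ring1 | (field_simp; ring))

theorem measurable_a : Measurable a := measurable_fst.fst.fst.fst.fst
theorem measurable_e : Measurable e := measurable_fst.fst.fst.fst.snd
theorem measurable_u : Measurable u := measurable_fst.fst.fst.snd
theorem measurable_x : Measurable x := measurable_fst.fst.snd
theorem measurable_y : Measurable y := measurable_fst.snd
theorem measurable_z : Measurable z := measurable_snd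

theorem measurable_mk {α : Type*} [MeasurableSpace α] {a e u x y z : α → ℝ} (ha : Measurable a)
    (he : Measurable e) (hu : Measurable u) (hx : Measurable x) (hy : Measurable y)
    (hz : Measurable z) : Measurable fun t => mk (a t) (e t) (u t) (x t) (y t) (z t) :=
  ((((ha.prodMk he).prodMk hu).prodMk hx).prodMk hy).prodMk hz

instance : MeasurableMul₂ Tri := by
  have := measurable_a; have := measurable_e; have := measurable_u
  have := measurable_x; have := measurable_y; have := measurable_z
  refine ⟨?_⟩
  simp only [mul_def]
  apply measurable_mk <;> fun_prop

instance : MeasurableInv Tri := by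
  have := measurable_a; have := measurable_e; have := measurable_u
  have := measurable_x; have := measurable_y; have := measurable_z
  refine ⟨?_⟩
  change Measurable fun p : Tri => p⁻¹
  simp only [inv_def]
  apply measurable_mk <;> fun_prop

/-- Lebesgue measure in the six coordinates. -/
def vol : Measure Tri := (volume : Measure (((((ℝ × ℝ) × ℝ) × ℝ) × ℝ) × ℝ))

instance : SigmaFinite vol := inferInstanceAs
  (SigmaFinite (volume : Measure (((((ℝ × ℝ) × ℝ) × ℝ) × ℝ) × ℝ)))

/-- The density of the left Haar measure. -/
def weight (p : Tri) : ℝ := Real.exp (-2 * p.a - 4 * p.e)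

theorem weight_mul (p q : Tri) : weight (p * q) = weight p * weight q := by
  rw [weight, weight, weight, ← Real.exp_add]
  congr 1
  rw [mul_def, mk_a, mk_e]
  ring

theorem measurable_weight : Measurable weight := by
  have := measurable_a; have := measurable_e
  unfold weight
  fun_prop

/-- Left translation is a composition of fibrewise affine maps of the coordinates; `weight` collects
the inverses of their Jacobians. -/
theorem map_vol (p : Tri) : vol.map (fun q => p * q) = ENNReal.ofReal (weight p) • vol := by
  have s0 : (volume : Measure ℝ).map (fun t => p.a + t) = (1 : ℝ≥0∞) • volume := by
    rw [one_smul]; exact map_add_left_eq_self volume p.a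
  have s1 := map_shear (β := ℝ) (c := fun _ => p.e) (by fun_prop) s0 measurable_const one_pos
  have s2 := map_shear (c := fun _ => p.u) (by fun_prop) s1 measurable_const (Real.exp_pos (p.e - p.a))
  have s3 := map_shear (c := fun _ => p.x) (by fun_prop) s2 measurable_const
    (pow_pos (Real.exp_pos p.a) 2)
  have s4 := map_shear (c := fun t => p.y + p.u * Real.exp p.a ^ 2 * t.2) (by fun_prop) s3
    (by fun_prop) (mul_pos (Real.exp_pos p.a) (Real.exp_pos p.e))
  have s5 := map_shear (c := fun t => p.z + p.u ^ 2 * Real.exp p.a ^ 2 * t.1.2 +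
      2 * p.u * Real.exp p.a * Real.exp p.e * t.2) (by fun_prop) s4
    (by fun_prop) (pow_pos (Real.exp_pos p.e) 2)
  have hw : (((((1 : ℝ≥0∞) * ENNReal.ofReal 1⁻¹) * ENNReal.ofReal (Real.exp (p.e - p.a))⁻¹) *
      ENNReal.ofReal (Real.exp p.a ^ 2)⁻¹) * ENNReal.ofReal (Real.exp p.a * Real.exp p.e)⁻¹) *
      ENNReal.ofReal (Real.exp p.e ^ 2)⁻¹ = ENNReal.ofReal (weight p) := by
    have h1 := Real.exp_pos p.a
    have h2 := Real.exp_pos p.e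
    have h3 := Real.exp_pos (p.e - p.a)
    rw [one_mul, ← ENNReal.ofReal_mul (by positivity), ← ENNReal.ofReal_mul (by positivity),
      ← ENNReal.ofReal_mul (by positivity), ← ENNReal.ofReal_mul (by positivity)]
    congr 1
    rw [weight, ← Real.exp_nat_mul, ← Real.exp_nat_mul, ← Real.exp_add, ← Real.exp_neg, ← Real.exp_neg,
      ← Real.exp_neg, ← Real.exp_neg, inv_one, one_mul, ← Real.exp_add, ← Real.exp_add, ← Real.exp_add]
    congr 1
    push_cast
    ring
  rw [hw] at s5
  refine Eq.trans (congrArg (fun φ => vol.map φ) (funext fun q => ?_)) s5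
  apply ext' <;> simp only [mul_def, mk_a, mk_e, mk_u, mk_x, mk_y, mk_z, one_mul] <;> rfl

/-- A left Haar measure. -/
def haar : Measure Tri := vol.withDensity fun p => ENNReal.ofReal (weight p)

instance : SigmaFinite haar := by
  unfold haar
  exact SigmaFinite.withDensity_ofReal weight

theorem lintegral_haar {F : Tri → ℝ≥0∞} (hF : Measurable F) :
    ∫⁻ p, F p ∂haar = ∫⁻ p, ENNReal.ofReal (weight p) * F p ∂vol :=
  lintegral_withDensity_eq_lintegral_mul _ measurable_weight.ennreal_ofReal hF

instance : haar.IsMulLeftInvariant := by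
  refine ⟨fun p => Measure.ext_of_lintegral _ fun F hF => ?_⟩
  have hm : Measurable fun q : Tri => p * q := measurable_const_mul p
  have hw := measurable_weight.ennreal_ofReal
  have hp : 0 < weight p := Real.exp_pos _
  have hp0 : ENNReal.ofReal (weight p) ≠ 0 := by rwa [Ne, ENNReal.ofReal_eq_zero, not_le]
  rw [lintegral_map hF hm, lintegral_haar (F := fun q => F (p * q)) (hF.comp hm), lintegral_haar hF]
  have e1 : ∀ q, ENNReal.ofReal (weight q) * F (p * q) = (ENNReal.ofReal (weight p))⁻¹ *
      (ENNReal.ofReal (weight (p * q)) * F (p * q)) := by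
    intro q
    rw [weight_mul, ENNReal.ofReal_mul hp.le, mul_assoc, ← mul_assoc (_⁻¹),
      ENNReal.inv_mul_cancel hp0 ENNReal.ofReal_ne_top, one_mul]
  simp only [e1]
  have hwF : Measurable fun q => ENNReal.ofReal (weight q) * F q := hw.mul hF
  rw [lintegral_const_mul (f := fun q => ENNReal.ofReal (weight (p * q)) * F (p * q)) _ (hwF.comp hm), ← lintegral_map hwF hm, map_vol, lintegral_smul_measure,
    smul_eq_mul, ← mul_assoc, ENNReal.inv_mul_cancel hp0 ENNReal.ofReal_ne_top, one_mul]

end Tri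

end

/-! ### Integration over the orbits of the torus -/

section

open Filter Topology Set
open scoped ENNReal

theorem lintegral_comp_mul {f : ℝ → ℝ≥0∞} (hf : Measurable f) {k : ℝ} (hk : 0 < k) :
    ∫⁻ x, f (k * x) = ENNReal.ofReal k⁻¹ * ∫⁻ x, f x := by
  rw [← lintegral_map (f := f) hf (by fun_prop : Measurable fun x : ℝ => k * x),
    Real.map_volume_mul_left hk.ne', lintegral_smul_measure, abs_of_pos (inv_pos.2 hk), smul_eq_mul]

/-- Polar coordinates, in the variable `t = c + r²`. -/
theorem lintegral_polar {g : ℝ → ℝ≥0∞} (hg : Measurable g) (c : ℝ) :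
    ∫⁻ y : ℝ, ∫⁻ w : ℝ, g (c + y ^ 2 + w ^ 2) = ENNReal.ofReal Real.pi * ∫⁻ t in Ioi c, g t := by
  have hpi := Real.pi_pos
  have h1 : ∫⁻ y : ℝ, ∫⁻ w : ℝ, g (c + y ^ 2 + w ^ 2) = ∫⁻ p : ℝ × ℝ, g (c + p.1 ^ 2 + p.2 ^ 2) := by
    rw [Measure.volume_eq_prod, lintegral_prod _ (by fun_prop)]
  rw [h1, ← lintegral_comp_polarCoord_symm]
  have h2 : ∀ p : ℝ × ℝ, ENNReal.ofReal p.1 • g (c + (polarCoord.symm p).1 ^ 2 + (polarCoord.symm p).2 ^ 2) =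
      ENNReal.ofReal p.1 * g (c + p.1 ^ 2) := by
    intro p
    rw [polarCoord_symm_apply, smul_eq_mul]
    congr 2
    have := Real.cos_sq_add_sin_sq p.2
    linear_combination p.1 ^ 2 * this
  simp only [h2]
  rw [polarCoord_target, Measure.volume_eq_prod, ← Measure.prod_restrict,
    lintegral_prod _ (by fun_prop)]
  simp only [lintegral_const, Measure.restrict_apply MeasurableSet.univ, univ_inter, Real.volume_Ioo]
  rw [lintegral_mul_const _ (by fun_prop)]
  have h3 : Ioi c = (fun r : ℝ => c + r ^ 2) '' Ioi 0 := by
    ext t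
    constructor
    · intro ht
      have ht' : 0 < t - c := sub_pos.2 ht
      exact ⟨Real.sqrt (t - c), Real.sqrt_pos.2 ht', by simp [Real.sq_sqrt ht'.le]⟩
    · rintro ⟨r, hr, rfl⟩
      exact lt_add_of_pos_right c (pow_pos hr 2)
  rw [h3, lintegral_image_eq_lintegral_abs_deriv_mul measurableSet_Ioi (f' := fun r => 2 * r)]
  · rw [mul_comm, show Real.pi - -Real.pi = Real.pi * 2 by ring, ENNReal.ofReal_mul hpi.le, mul_assoc]
    congr 1
    rw [← lintegral_const_mul _ (by fun_prop)]
    refine setLIntegral_congr_fun measurableSet_Ioi fun r hr => ?_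
    have hr' : (0 : ℝ) < r := hr
    rw [abs_of_pos (by positivity), ENNReal.ofReal_mul zero_le_two, mul_assoc]
  · intro r _
    have := ((hasDerivAt_id r).fun_pow 2).const_add c
    exact (this.congr_deriv (by simp)).hasDerivWithinAt
  · intro r hr r' hr' h
    have hr1 : (0 : ℝ) < r := hr
    have hr2 : (0 : ℝ) < r' := hr'
    have : r ^ 2 = r' ^ 2 := by simpa using h
    exact (pow_left_inj₀ hr1.le hr2.le two_ne_zero).1 this

/-- The substitution `y = sinh a`: the Jacobian is `cosh a`, and an even function has the same integral
against `cosh a` and against `e^a`. -/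
theorem lintegral_exp_sinh {H : ℝ → ℝ≥0∞} (hH : Measurable H) :
    ∫⁻ a : ℝ, ENNReal.ofReal (Real.exp a) * H (Real.sinh a ^ 2) = ∫⁻ y : ℝ, H (y ^ 2) := by
  have hsm : Measurable Real.sinh := Real.continuous_sinh.measurable
  set J := ∫⁻ a : ℝ, ENNReal.ofReal (Real.exp a) * H (Real.sinh a ^ 2) with hJ
  -- by symmetry, `e^a` can be replaced by `cosh a`
  have h1 : J = ∫⁻ a : ℝ, ENNReal.ofReal (Real.exp (-a)) * H (Real.sinh a ^ 2) := by
    have h := lintegral_neg_eq_self (μ := volume) (fun a => ENNReal.ofReal (Real.exp a) * H (Real.sinh a ^ 2))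
    rw [hJ, ← h]
    simp only [Real.sinh_neg, neg_sq]
  have h2 : J + J = 2 * ∫⁻ a : ℝ, ENNReal.ofReal (Real.cosh a) * H (Real.sinh a ^ 2) := by
    conv_lhs => rw [h1]; arg 2; rw [← h1, hJ]
    rw [← lintegral_add_left (by fun_prop), ← lintegral_const_mul _ (by
      exact Real.continuous_cosh.measurable.ennreal_ofReal.mul (by fun_prop))]
    refine lintegral_congr fun a => ?_
    rw [← add_mul, ← ENNReal.ofReal_add (Real.exp_pos _).le (Real.exp_pos _).le, ← mul_assoc]
    congr 1
    rw [show (2 : ℝ≥0∞) = ENNReal.ofReal 2 by simp, ← ENNReal.ofReal_mul zero_le_two, Real.cosh_eq]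
    congr 1
    ring
  have h3 : ∫⁻ y : ℝ, H (y ^ 2) = ∫⁻ a : ℝ, ENNReal.ofReal (Real.cosh a) * H (Real.sinh a ^ 2) := by
    have e : (univ : Set ℝ) = Real.sinh '' univ := by rw [image_univ, Real.sinh_surjective.range_eq]
    rw [← setLIntegral_univ, e, lintegral_image_eq_lintegral_abs_deriv_mul MeasurableSet.univ
      (fun a _ => (Real.hasDerivAt_sinh a).hasDerivWithinAt) Real.sinh_injective.injOn, setLIntegral_univ]
    simp only [abs_of_pos (Real.cosh_pos _)]
  rw [h3]
  rw [← two_mul] at h2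
  exact (ENNReal.mul_right_inj two_ne_zero ENNReal.ofNat_ne_top).1 h2

/-- The Cauchy-Schlömilch substitution, followed by integration over circles. -/
theorem lintegral_orbit {E x : ℝ} (hE : 0 < E) (hx : 0 < x) {g : ℝ → ℝ≥0∞} (hg : Measurable g) :
    ∫⁻ a : ℝ, ∫⁻ u : ℝ, ENNReal.ofReal (Real.exp a ^ 2) *
        g (Real.exp a ^ 2 * (E + u ^ 2) + (x * Real.exp (-a)) ^ 2) =
      ENNReal.ofReal (Real.pi / (2 * Real.sqrt E)) * ∫⁻ t in Ioi (2 * Real.sqrt E * x), g t := by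
  set ε := Real.sqrt E with hε
  have hε0 : 0 < ε := Real.sqrt_pos.2 hE
  have hεE : ε ^ 2 = E := Real.sq_sqrt hE.le
  set m := Real.sqrt (ε * x) with hm
  have hm0 : 0 < m := Real.sqrt_pos.2 (by positivity)
  have hm2 : m ^ 2 = ε * x := Real.sq_sqrt (by positivity)
  set G : ℝ → ℝ≥0∞ := fun v => ∫⁻ w : ℝ, g (v + w ^ 2) with hG
  have hGm : Measurable G := by
    have : Measurable fun p : ℝ × ℝ => g (p.1 + p.2 ^ 2) := by fun_prop
    exact this.lintegral_prod_right'
  have h1 : ∀ a : ℝ, ∫⁻ u : ℝ, ENNReal.ofReal (Real.exp a ^ 2) *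
      g (Real.exp a ^ 2 * (E + u ^ 2) + (x * Real.exp (-a)) ^ 2) =
      ENNReal.ofReal (Real.exp a) * G (E * Real.exp a ^ 2 + (x * Real.exp (-a)) ^ 2) := by
    intro a
    have hp := Real.exp_pos a
    have e : ∀ u : ℝ, g (Real.exp a ^ 2 * (E + u ^ 2) + (x * Real.exp (-a)) ^ 2) =
        (fun w => g (E * Real.exp a ^ 2 + (x * Real.exp (-a)) ^ 2 + w ^ 2)) (Real.exp a * u) := by
      intro u
      congr 1
      ring
    simp only [e]
    rw [lintegral_const_mul _ (by fun_prop), lintegral_comp_mul (f := fun w => g (_ + w ^ 2)) (by fun_prop) hp,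
      ← mul_assoc, ← ENNReal.ofReal_mul (by positivity)]
    congr 2
    field_simp
  simp only [h1]
  have hG' : Measurable fun a : ℝ => ENNReal.ofReal (Real.exp a) * G (E * Real.exp a ^ 2 + (x * Real.exp (-a)) ^ 2) := by
    fun_prop
  rw [← lintegral_add_right_eq_self (fun a : ℝ => ENNReal.ofReal (Real.exp a) *
    G (E * Real.exp a ^ 2 + (x * Real.exp (-a)) ^ 2)) (Real.log (m / ε))]
  have h2 : ∀ a : ℝ, ENNReal.ofReal (Real.exp (a + Real.log (m / ε))) *
      G (E * Real.exp (a + Real.log (m / ε)) ^ 2 + (x * Real.exp (-(a + Real.log (m / ε)))) ^ 2) =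
      ENNReal.ofReal (m / ε) * (ENNReal.ofReal (Real.exp a) *
        (fun t => G (2 * ε * x + (2 * m) ^ 2 * t)) (Real.sinh a ^ 2)) := by
    intro a
    rw [neg_add, Real.exp_add, Real.exp_add, Real.exp_neg (Real.log _), Real.exp_log (by positivity),
      ENNReal.ofReal_mul (Real.exp_pos a).le, mul_comm (ENNReal.ofReal (Real.exp a)), mul_assoc]
    congr 3
    have hmul : Real.exp a * Real.exp (-a) = 1 := by rw [← Real.exp_add, add_neg_cancel, Real.exp_zero]
    rw [Real.sinh_eq, ← hεE]
    have hx' : x = m ^ 2 / ε := by rw [hm2]; field_simp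
    rw [hx']
    field_simp
    linear_combination (2 : ℝ) * hmul
  simp only [h2]
  rw [lintegral_const_mul _ (by
      exact (by fun_prop : Measurable fun a : ℝ => ENNReal.ofReal (Real.exp a)).mul
        (hGm.comp (by fun_prop (disch := exact Real.continuous_sinh.measurable)))),
    lintegral_exp_sinh (H := fun t => G (2 * ε * x + (2 * m) ^ 2 * t)) (by fun_prop)]
  have h3 : ∀ y : ℝ, G (2 * ε * x + (2 * m) ^ 2 * y ^ 2) = (fun y => G (2 * ε * x + y ^ 2)) (2 * m * y) := by
    intro y
    simp only [mul_pow]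
  simp only [h3]
  rw [lintegral_comp_mul (f := fun y => G (2 * ε * x + y ^ 2)) (by fun_prop) (by positivity),
    lintegral_polar hg, ← mul_assoc, ← mul_assoc, ← ENNReal.ofReal_mul (by positivity),
    ← ENNReal.ofReal_mul (by positivity)]
  congr 2
  field_simp

/-- The substitution `x = e^σ`. -/
theorem lintegral_exp_pow (K : ℝ → ℝ≥0∞) :
    ∫⁻ σ : ℝ, ENNReal.ofReal (Real.exp (-4 * σ)) * K (Real.exp σ) =
      ∫⁻ x in Ioi (0 : ℝ), ENNReal.ofReal (x⁻¹ ^ 5) * K x := by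
  have e : Ioi (0 : ℝ) = Real.exp '' univ := by rw [image_univ, Real.range_exp]
  rw [e, lintegral_image_eq_lintegral_abs_deriv_mul MeasurableSet.univ
    (fun a _ => (Real.hasDerivAt_exp a).hasDerivWithinAt) Real.exp_injective.injOn, setLIntegral_univ]
  refine lintegral_congr fun σ => ?_
  have hp := Real.exp_pos σ
  rw [abs_of_pos hp, ← mul_assoc, ← ENNReal.ofReal_mul hp.le]
  congr 2
  rw [show (-4 : ℝ) * σ = -(((4 : ℕ) : ℝ) * σ) by push_cast; ring, Real.exp_neg, Real.exp_nat_mul]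
  field_simp

/-- The radial part of the invariant measure on the cone of positive definite matrices, in terms of
`x = √det` and of the value `t` of a linear form. -/
theorem lintegral_radial {E : ℝ} (hE : 0 < E) {Ψ : ℝ → ℝ → ℝ≥0∞}
    (hΨ : Measurable (Function.uncurry Ψ)) :
    ∫⁻ a : ℝ, ∫⁻ e : ℝ, ∫⁻ u : ℝ, ENNReal.ofReal (Real.exp (-2 * a - 4 * e)) *
        Ψ (Real.exp (a + e)) (Real.exp a ^ 2 * (E + u ^ 2) + Real.exp e ^ 2) =
      ENNReal.ofReal (Real.pi / (2 * Real.sqrt E)) *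
        ∫⁻ x in Ioi (0 : ℝ), ∫⁻ t in Ioi (2 * Real.sqrt E * x), ENNReal.ofReal (x⁻¹ ^ 5) * Ψ x t := by
  have hΨ2 : ∀ x, Measurable (Ψ x) := fun x => hΨ.comp measurable_prodMk_left
  have hΨc : ∀ {α : Type} [MeasurableSpace α] {p q : α → ℝ}, Measurable p → Measurable q →
      Measurable fun z => Ψ (p z) (q z) := fun hp hq => hΨ.comp (hp.prodMk hq)
  have h1 : ∀ a : ℝ, (∫⁻ e : ℝ, ∫⁻ u : ℝ, ENNReal.ofReal (Real.exp (-2 * a - 4 * e)) *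
        Ψ (Real.exp (a + e)) (Real.exp a ^ 2 * (E + u ^ 2) + Real.exp e ^ 2)) =
      ∫⁻ σ : ℝ, ∫⁻ u : ℝ, ENNReal.ofReal (Real.exp (-4 * σ)) * (ENNReal.ofReal (Real.exp a ^ 2) *
        Ψ (Real.exp σ) (Real.exp a ^ 2 * (E + u ^ 2) + (Real.exp σ * Real.exp (-a)) ^ 2)) := by
    intro a
    rw [← lintegral_add_right_eq_self (fun e => ∫⁻ u : ℝ, ENNReal.ofReal (Real.exp (-2 * a - 4 * e)) *
        Ψ (Real.exp (a + e)) (Real.exp a ^ 2 * (E + u ^ 2) + Real.exp e ^ 2)) (-a)]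
    refine lintegral_congr fun σ => lintegral_congr fun u => ?_
    rw [← mul_assoc, ← ENNReal.ofReal_mul (Real.exp_pos _).le, ← Real.exp_nat_mul a 2, ← Real.exp_add,
      ← Real.exp_add]
    congr 3
    · push_cast; ring_nf
    · ring_nf
  simp only [h1]
  rw [lintegral_lintegral_swap]
  · have h2 : ∀ σ : ℝ, (∫⁻ a : ℝ, ∫⁻ u : ℝ, ENNReal.ofReal (Real.exp (-4 * σ)) *
        (ENNReal.ofReal (Real.exp a ^ 2) *
        Ψ (Real.exp σ) (Real.exp a ^ 2 * (E + u ^ 2) + (Real.exp σ * Real.exp (-a)) ^ 2))) =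
        ENNReal.ofReal (Real.exp (-4 * σ)) * (ENNReal.ofReal (Real.pi / (2 * Real.sqrt E)) *
          ∫⁻ t in Ioi (2 * Real.sqrt E * Real.exp σ), Ψ (Real.exp σ) t) := by
      intro σ
      rw [← lintegral_orbit hE (Real.exp_pos σ) (hΨ2 _), ← lintegral_const_mul]
      · refine lintegral_congr fun a => ?_
        rw [lintegral_const_mul]
        have := hΨ2 (Real.exp σ)
        fun_prop
      · have := hΨ2 (Real.exp σ)
        have hm : Measurable fun p : ℝ × ℝ => ENNReal.ofReal (Real.exp p.1 ^ 2) *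
          Ψ (Real.exp σ) (Real.exp p.1 ^ 2 * (E + p.2 ^ 2) + (Real.exp σ * Real.exp (-p.1)) ^ 2) := by
          fun_prop
        exact hm.lintegral_prod_right'
    simp only [h2]
    rw [lintegral_exp_pow (fun x => ENNReal.ofReal (Real.pi / (2 * Real.sqrt E)) *
          ∫⁻ t in Ioi (2 * Real.sqrt E * x), Ψ x t), ← lintegral_const_mul' _ _ ENNReal.ofReal_ne_top]
    refine lintegral_congr fun x => ?_
    rw [lintegral_const_mul _ (hΨ2 x), mul_left_comm]
  · have hm : Measurable fun q : (ℝ × ℝ) × ℝ => ENNReal.ofReal (Real.exp (-4 * q.1.2)) *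
        (ENNReal.ofReal (Real.exp q.1.1 ^ 2) *
        Ψ (Real.exp q.1.2) (Real.exp q.1.1 ^ 2 * (E + q.2 ^ 2) + (Real.exp q.1.2 * Real.exp (-q.1.1)) ^ 2)) :=
      (by fun_prop : Measurable fun q : (ℝ × ℝ) × ℝ => ENNReal.ofReal (Real.exp (-4 * q.1.2))).mul
        ((by fun_prop : Measurable fun q : (ℝ × ℝ) × ℝ => ENNReal.ofReal (Real.exp q.1.1 ^ 2)).mul
          (hΨc (by fun_prop) (by fun_prop)))
    exact hm.lintegral_prod_right'.aemeasurable

end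

/-! ### Triangular elements of `GSp₄(ℝ)` -/

section

open Filter Topology Set
open scoped ENNReal

/-- The element of `GSp₄(ℝ)` with the given matrix. -/
def ofSymplectic (M : Matrix I4 I4 ℝ) (m : ℝ) (hm : m ≠ 0) (hM : Mᵀ * formJ ℝ * M = m • formJ ℝ) :
    GSp4 :=
  ⟨⟨M, (-m⁻¹) • (formJ ℝ * Mᵀ * formJ ℝ),
    mul_eq_one_comm.1 (symplectic_inv_mul hM (mul_inv_cancel₀ hm)),
    symplectic_inv_mul hM (mul_inv_cancel₀ hm)⟩, Units.mk0 m hm, hM⟩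

theorem mat_ofSymplectic (M : Matrix I4 I4 ℝ) (m : ℝ) (hm : m ≠ 0)
    (hM : Mᵀ * formJ ℝ * M = m • formJ ℝ) : mat (ofSymplectic M m hm hM) = M := rfl

theorem GSp4.ext {g h : GSp4} (e : mat g = mat h) : g = h := Subtype.ext (Units.ext e)

/-- Block diagonal matrices with blocks inverse to one another up to transposition are
symplectic similitudes. -/
theorem symplectic_diag {A E : Matrix (Fin 2) (Fin 2) ℝ} {m : ℝ} (h : Aᵀ * E = m • 1) :
    (fromBlocks A 0 0 E)ᵀ * formJ ℝ * fromBlocks A 0 0 E = m • formJ ℝ := by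
  have h' : Eᵀ * A = m • 1 := by
    have := congrArg Matrix.transpose h
    rwa [transpose_mul, transpose_transpose, transpose_smul, transpose_one] at this
  rw [formJ, fromBlocks_transpose, fromBlocks_multiply, fromBlocks_multiply, fromBlocks_smul]
  simp only [transpose_zero, Matrix.mul_zero, Matrix.zero_mul, Matrix.mul_one, Matrix.mul_neg,
    Matrix.neg_mul, add_zero, zero_add, neg_zero, smul_zero, h, h', smul_neg]

theorem symplectic_unip {X : Matrix (Fin 2) (Fin 2) ℝ} (hX : Xᵀ = X) :
    (unip X)ᵀ * formJ ℝ * unip X = (1 : ℝ) • formJ ℝ := by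
  rw [unip, formJ, fromBlocks_transpose, fromBlocks_multiply, fromBlocks_multiply, one_smul]
  simp [hX]

/-- The translation `[1, X; 0, 1]`. -/
def transG (X : Matrix (Fin 2) (Fin 2) ℝ) (hX : Xᵀ = X) : GSp4 :=
  ofSymplectic (unip X) 1 one_ne_zero (symplectic_unip hX)

/-- The block diagonal element with blocks `A` and `E`. -/
def diagG (A E : Matrix (Fin 2) (Fin 2) ℝ) (m : ℝ) (hm : m ≠ 0) (h : Aᵀ * E = m • 1) : GSp4 :=
  ofSymplectic (fromBlocks A 0 0 E) m hm (symplectic_diag h)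

theorem ptRe_transG (X : Matrix (Fin 2) (Fin 2) ℝ) (hX : Xᵀ = X) (h : GSp4) :
    ptRe (transG X hX * h) = ptRe h + X ∧ ptIm (transG X hX * h) = ptIm h := by
  have := point_mul_of_block (g := transG X hX) (A := 1) (B := X) (E := 1) (F := 1) rfl (by simp) h
  simpa using this

theorem mult_transG (X : Matrix (Fin 2) (Fin 2) ℝ) (hX : Xᵀ = X) : mult (mat (transG X hX)) = 1 :=
  mult_eq_of (symplectic_unip hX)

theorem pt_diagG {A E : Matrix (Fin 2) (Fin 2) ℝ} {m : ℝ} (hm : m ≠ 0) (h : Aᵀ * E = m • 1) (g : GSp4) :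
    ptRe (diagG A E m hm h * g) = m⁻¹ • (A * ptRe g * Aᵀ) ∧
      ptIm (diagG A E m hm h * g) = m⁻¹ • (A * ptIm g * Aᵀ) := by
  have hF : E * (m⁻¹ • Aᵀ) = 1 := by
    apply mul_eq_one_comm.1
    rw [Matrix.smul_mul, h, smul_smul, inv_mul_cancel₀ hm, one_smul]
  have := point_mul_of_block (g := diagG A E m hm h) (A := A) (B := 0) (E := E) rfl hF g
  simpa only [Matrix.mul_smul, add_zero] using this

theorem mult_diagG {A E : Matrix (Fin 2) (Fin 2) ℝ} {m : ℝ} (hm : m ≠ 0) (h : Aᵀ * E = m • 1) :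
    mult (mat (diagG A E m hm h)) = m := mult_eq_of (symplectic_diag h)

/-- The element with upper left block `[1, 0; u, 1]`. -/
def lowerG (u : ℝ) : GSp4 := diagG !![1, 0; u, 1] !![1, -u; 0, 1] 1 one_ne_zero (by
  ext i j
  fin_cases i <;> fin_cases j <;> simp [Matrix.mul_apply, Fin.sum_univ_two])

/-- The element with upper left block `diag(e^a, e^e)`, and multiplier one. -/
def torusG (a e : ℝ) : GSp4 := diagG !![Real.exp a, 0; 0, Real.exp e]
  !![Real.exp (-a), 0; 0, Real.exp (-e)] 1 one_ne_zero (by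
  ext i j
  fin_cases i <;> fin_cases j <;> simp [Matrix.mul_apply, Fin.sum_univ_two, ← Real.exp_add])

/-- The element of `GSp₄(ℝ)` of multiplier one that corresponds to an element of `Tri`. -/
def triG (b : Tri) : GSp4 :=
  transG !![b.x, b.y; b.y, b.z] (by ext i j; fin_cases i <;> fin_cases j <;> rfl) *
    (lowerG b.u * torusG b.a b.e)

theorem mult_triG (b : Tri) : mult (mat (triG b)) = 1 := by
  rw [triG, mult_mul, mult_mul, mult_transG, lowerG, torusG, mult_diagG, mult_diagG, one_mul, one_mul]

/-- The coordinates of the Iwasawa decomposition of `h⟨I⟩`. -/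
def coord (h : GSp4) : Tri :=
  Tri.mk (Real.log (ptIm h 0 0) / 2) (Real.log ((ptIm h).det / ptIm h 0 0) / 2)
    (ptIm h 0 1 / ptIm h 0 0) (ptRe h 0 0) (ptRe h 0 1) (ptRe h 1 1)

theorem ptIm_zero_zero_pos (h : GSp4) (hμ : 0 < mult (mat h)) : 0 < ptIm h 0 0 := by
  have h1 := det_ptIm_pos h hμ
  have h2 := ptIm_one_one_pos h hμ
  rw [det_fin_two, ptIm_symm h 1 0] at h1
  by_contra hneg
  nlinarith [mul_nonneg (neg_nonneg.2 (not_lt.1 hneg)) h2.le, mul_self_nonneg (ptIm h 0 1)]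

theorem conj_apply (A X : Matrix (Fin 2) (Fin 2) ℝ) (i j : Fin 2) : (A * X * Aᵀ) i j =
    (A i 0 * X 0 0 + A i 1 * X 1 0) * A j 0 + (A i 0 * X 0 1 + A i 1 * X 1 1) * A j 1 := by
  simp [Matrix.mul_apply, Fin.sum_univ_two]

/-- The Iwasawa coordinates are equivariant under left translation by `Tri`. -/
theorem coord_triG_mul (b : Tri) (h : GSp4) (hμ : 0 < mult (mat h)) :
    coord (triG b * h) = b * coord h := by
  have hY0 := ptIm_zero_zero_pos h hμ
  have hd := det_ptIm_pos h hμ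
  have ha := Real.exp_pos b.a
  have he := Real.exp_pos b.e
  rw [triG, mul_assoc, mul_assoc]
  set g₁ := torusG b.a b.e * h with hg₁
  set g₂ := lowerG b.u * g₁ with hg₂
  have h1 := pt_diagG (m := 1) (A := !![Real.exp b.a, 0; 0, Real.exp b.e])
    (E := !![Real.exp (-b.a), 0; 0, Real.exp (-b.e)]) one_ne_zero (by
      ext i j
      fin_cases i <;> fin_cases j <;> simp [Matrix.mul_apply, Fin.sum_univ_two, ← Real.exp_add]) h
  have h2 := pt_diagG (m := 1) (A := !![1, 0; b.u, 1]) (E := !![1, -b.u; 0, 1]) one_ne_zero (by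
      ext i j
      fin_cases i <;> fin_cases j <;> simp [Matrix.mul_apply, Fin.sum_univ_two]) g₁
  have h3 := ptRe_transG !![b.x, b.y; b.y, b.z] (by ext i j; fin_cases i <;> fin_cases j <;> rfl) g₂
  change ptRe g₁ = _ ∧ ptIm g₁ = _ at h1
  change ptRe g₂ = _ ∧ ptIm g₂ = _ at h2
  have s1 := ptRe_symm h 1 0
  have s2 := ptIm_symm h 1 0
  have X1 : ptRe g₁ = !![Real.exp b.a ^ 2 * ptRe h 0 0, Real.exp b.a * Real.exp b.e * ptRe h 0 1;
      Real.exp b.a * Real.exp b.e * ptRe h 0 1, Real.exp b.e ^ 2 * ptRe h 1 1] := by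
    ext i j
    rw [h1.1, inv_one, one_smul, conj_apply, s1]
    fin_cases i <;> fin_cases j <;> simp <;> ring
  have Y1 : ptIm g₁ = !![Real.exp b.a ^ 2 * ptIm h 0 0, Real.exp b.a * Real.exp b.e * ptIm h 0 1;
      Real.exp b.a * Real.exp b.e * ptIm h 0 1, Real.exp b.e ^ 2 * ptIm h 1 1] := by
    ext i j
    rw [h1.2, inv_one, one_smul, conj_apply, s2]
    fin_cases i <;> fin_cases j <;> simp <;> ring
  have X2 : ptRe g₂ = !![ptRe g₁ 0 0, ptRe g₁ 0 1 + b.u * ptRe g₁ 0 0;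
      ptRe g₁ 0 1 + b.u * ptRe g₁ 0 0, ptRe g₁ 1 1 + 2 * b.u * ptRe g₁ 0 1 + b.u ^ 2 * ptRe g₁ 0 0] := by
    ext i j
    rw [h2.1, inv_one, one_smul, conj_apply, ptRe_symm g₁ 1 0]
    fin_cases i <;> fin_cases j <;> simp <;> ring
  have Y2 : ptIm g₂ = !![ptIm g₁ 0 0, ptIm g₁ 0 1 + b.u * ptIm g₁ 0 0;
      ptIm g₁ 0 1 + b.u * ptIm g₁ 0 0, ptIm g₁ 1 1 + 2 * b.u * ptIm g₁ 0 1 + b.u ^ 2 * ptIm g₁ 0 0] := by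
    ext i j
    rw [h2.2, inv_one, one_smul, conj_apply, ptIm_symm g₁ 1 0]
    fin_cases i <;> fin_cases j <;> simp <;> ring
  have hdet : (ptIm g₂).det = Real.exp b.a ^ 2 * Real.exp b.e ^ 2 * (ptIm h).det := by
    rw [Y2, Y1, det_fin_two, det_fin_two, s2]
    simp
    ring
  rw [coord, h3.1, h3.2, hdet, coord, Tri.mul_def, X2, Y2, X1, Y1]
  apply Tri.ext' <;> simp only [Tri.mk_a, Tri.mk_e, Tri.mk_u, Tri.mk_x, Tri.mk_y, Tri.mk_z, Matrix.add_apply,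
    Matrix.of_apply, Matrix.cons_val', Matrix.cons_val_zero, Matrix.cons_val_one, Matrix.cons_val_fin_one]
  · rw [Real.log_mul (by positivity) hY0.ne', Real.log_pow, Real.log_exp]
    push_cast; ring
  · rw [mul_div_mul_comm, Real.log_mul (by positivity) (by positivity), mul_div_cancel_left₀ _ (by positivity),
      Real.log_pow, Real.log_exp]
    push_cast; ring
  · rw [Real.exp_sub]
    field_simp
    ring
  · ring
  · ring
  · ring

/-- Translations are conjugate to their inverses by `diag(1, 1, -1, -1)`. -/
theorem map_transG_mul {m : Measure GSp4} (hm : m.IsMulRightInvariant)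
    (hf : IsFiniteMeasureOnCompacts m) (X : Matrix (Fin 2) (Fin 2) ℝ) (hX : Xᵀ = X) :
    m.map (fun h => transG X hX * h) = m := by
  refine map_mul_left_of_conj_inv hm hf (w := diagG 1 (-1) (-1) (by norm_num) (by simp)) ?_
  rw [mul_inv_eq_iff_eq_mul, ← inv_mul_eq_iff_eq_mul, inv_inv]
  apply GSp4.ext
  simp only [mat_mul, transG, diagG, mat_ofSymplectic, unip, fromBlocks_multiply]
  simp

/-- Lower triangular unipotent elements of the Levi subgroup are conjugate to their inverses by
`diag(1, -1, 1, -1)`. -/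
theorem map_lowerG_mul {m : Measure GSp4} (hm : m.IsMulRightInvariant)
    (hf : IsFiniteMeasureOnCompacts m) (u : ℝ) : m.map (fun h => lowerG u * h) = m := by
  refine map_mul_left_of_conj_inv hm hf (w := diagG !![1, 0; 0, -1] !![1, 0; 0, -1] 1 one_ne_zero (by
    ext i j; fin_cases i <;> fin_cases j <;> simp [Matrix.mul_apply, Fin.sum_univ_two])) ?_
  rw [mul_inv_eq_iff_eq_mul, ← inv_mul_eq_iff_eq_mul, inv_inv]
  apply GSp4.ext
  simp only [mat_mul, lowerG, diagG, mat_ofSymplectic, fromBlocks_multiply]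
  simp

/-- The elements of the torus are conjugate to their inverses by the Weyl element `J`. -/
theorem map_torusG_mul {m : Measure GSp4} (hm : m.IsMulRightInvariant)
    (hf : IsFiniteMeasureOnCompacts m) (a e : ℝ) : m.map (fun h => torusG a e * h) = m := by
  refine map_mul_left_of_conj_inv hm hf (w := ofSymplectic (formJ ℝ) 1 one_ne_zero (by
    have ht : (formJ ℝ)ᵀ * formJ ℝ = 1 := by
      rw [formJ, fromBlocks_transpose, fromBlocks_multiply]
      simp
    rw [ht, one_mul, one_smul])) ?_
  rw [mul_inv_eq_iff_eq_mul, ← inv_mul_eq_iff_eq_mul, inv_inv]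
  apply GSp4.ext
  simp only [mat_mul, torusG, diagG, mat_ofSymplectic, formJ, fromBlocks_multiply]
  simp only [Matrix.zero_mul, Matrix.mul_zero, Matrix.one_mul, zero_add, add_zero, Matrix.mul_neg,
    Matrix.neg_mul]
  congr 1
  all_goals
    ext i j
    fin_cases i <;> fin_cases j <;> simp [← Real.exp_add]

theorem map_triG_mul {m : Measure GSp4} (hm : m.IsMulRightInvariant)
    (hf : IsFiniteMeasureOnCompacts m) (b : Tri) : m.map (fun h => triG b * h) = m := by
  have e : (fun h => triG b * h) = (fun h => transG !![b.x, b.y; b.y, b.z]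
      (by ext i j; fin_cases i <;> fin_cases j <;> rfl) * h) ∘ (fun h => lowerG b.u * h) ∘
        fun h => torusG b.a b.e * h := by
    funext h
    simp only [triG, Function.comp, mul_assoc]
  rw [e, ← Measure.map_map (measurable_const_mul _) ((measurable_const_mul _).comp (measurable_const_mul _)),
    ← Measure.map_map (measurable_const_mul _) (measurable_const_mul _), map_torusG_mul hm hf,
    map_lowerG_mul hm hf, map_transG_mul hm hf]

end

/-! ### The unfolded measure in Iwasawa coordinates -/

section

open Filter Topology Set
open scoped ENNReal

theorem continuous_toC_mat : Continuous fun h : GSp4 => toC (mat h) :=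
  continuous_mat.matrix_map Complex.continuous_ofReal

theorem continuous_point : Continuous point := by
  have h1 : Continuous fun h : GSp4 => den (toC (mat h)) := by
    unfold den autFactor
    exact (Continuous.matrix_mul (continuous_matrix fun i j => continuous_toC_mat.matrix_elem _ _)
      continuous_const).add (continuous_matrix fun i j => continuous_toC_mat.matrix_elem _ _)
  have h2 : Continuous fun h : GSp4 => num (toC (mat h)) := by
    unfold num
    exact (Continuous.matrix_mul (continuous_matrix fun i j => continuous_toC_mat.matrix_elem _ _)
      continuous_const).add (continuous_matrix fun i j => continuous_toC_mat.matrix_elem _ _)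
  have e : point = fun h => num (toC (mat h)) *
      ((den (toC (mat h))).det⁻¹ • (den (toC (mat h))).adjugate) := by
    funext h
    rw [point, act, Matrix.inv_def, Ring.inverse_eq_inv']
    rfl
  rw [e]
  exact h2.matrix_mul ((h1.matrix_det.inv₀ den_ne_zero).smul h1.matrix_adjugate)

theorem continuous_ptRe (i j : Fin 2) : Continuous fun h => ptRe h i j :=
  Complex.continuous_re.comp (continuous_point.matrix_elem i j)

theorem continuous_ptIm (i j : Fin 2) : Continuous fun h => ptIm h i j :=
  Complex.continuous_im.comp (continuous_point.matrix_elem i j)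

theorem continuous_det_ptIm : Continuous fun h => (ptIm h).det := by
  simp only [det_fin_two]
  exact ((continuous_ptIm 0 0).mul (continuous_ptIm 1 1)).sub
    ((continuous_ptIm 0 1).mul (continuous_ptIm 1 0))

theorem continuous_mult_mat : Continuous fun h : GSp4 => mult (mat h) :=
  continuous_mult.comp continuous_mat

theorem continuous_tr_ptIm (f : BForm) : Continuous fun h => f.tr (ptIm h) := by
  have e : (fun h => f.tr (ptIm h)) = fun h => f.a * ptIm h 0 0 + f.b * ptIm h 0 1 + f.c * ptIm h 1 1 :=
    funext fun h => f.tr_eq _ (ptIm_symm h 1 0)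
  rw [e]
  exact (((continuous_ptIm 0 0).const_mul _).add ((continuous_ptIm 0 1).const_mul _)).add
    ((continuous_ptIm 1 1).const_mul _)

theorem measurable_coord : Measurable coord := by
  have h1 := (continuous_ptIm 0 0).measurable
  have h2 := (continuous_ptIm 0 1).measurable
  have h3 := continuous_det_ptIm.measurable
  exact Tri.measurable_mk ((Real.measurable_log.comp h1).div_const _)
    ((Real.measurable_log.comp (h3.div h1)).div_const _) (h2.div h1) (continuous_ptRe 0 0).measurable
    (continuous_ptRe 0 1).measurable (continuous_ptRe 1 1).measurable

/-- The imaginary part of `h⟨I⟩` in the Iwasawa coordinates. -/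
theorem coord_ptIm (h : GSp4) (hμ : 0 < mult (mat h)) :
    Real.exp (coord h).a ^ 2 = ptIm h 0 0 ∧ (coord h).u * Real.exp (coord h).a ^ 2 = ptIm h 0 1 ∧
      Real.exp (coord h).e ^ 2 + (coord h).u ^ 2 * Real.exp (coord h).a ^ 2 = ptIm h 1 1 ∧
      Real.exp (coord h).a ^ 2 * Real.exp (coord h).e ^ 2 = (ptIm h).det := by
  have hY0 := ptIm_zero_zero_pos h hμ
  have hd := det_ptIm_pos h hμ
  have ha : Real.exp (coord h).a ^ 2 = ptIm h 0 0 := by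
    rw [← Real.exp_nat_mul, coord, Tri.mk_a]
    push_cast
    rw [mul_div_cancel₀ _ two_ne_zero, Real.exp_log hY0]
  have he : Real.exp (coord h).e ^ 2 = (ptIm h).det / ptIm h 0 0 := by
    rw [← Real.exp_nat_mul, coord, Tri.mk_e]
    push_cast
    rw [mul_div_cancel₀ _ two_ne_zero, Real.exp_log (div_pos hd hY0)]
  have hu : (coord h).u = ptIm h 0 1 / ptIm h 0 0 := rfl
  rw [ha, he, hu]
  refine ⟨rfl, by field_simp, ?_, by field_simp⟩
  rw [det_fin_two, ptIm_symm h 1 0]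
  field_simp
  ring

/-- `√det Y` and `tr(SY)` in the Iwasawa coordinates. -/
theorem coord_spec {f : BForm} (hc : f.c = 1) (h : GSp4) (hμ : 0 < mult (mat h)) :
    Real.sqrt (ptIm h).det = Real.exp ((coord h).a + (coord h).e) ∧
      f.tr (ptIm h) = Real.exp (coord h).a ^ 2 * (f.D / 4 + ((coord h).u + f.b / 2) ^ 2) +
        Real.exp (coord h).e ^ 2 := by
  have hd := det_ptIm_pos h hμ
  obtain ⟨h1, h2, h3, h4⟩ := coord_ptIm h hμ
  constructor
  · rw [Real.sqrt_eq_iff_mul_self_eq hd.le (Real.exp_pos _).le, Real.exp_add, ← h4]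
    ring
  · rw [f.tr_eq _ (ptIm_symm h 1 0), ← h1, ← h2, ← h3, BForm.D, hc]
    ring

/-- The set of multipliers in `[1/2, 2]`, a neighbourhood of the group of multiplier one. -/
def multBand : Set GSp4 := {h | mult (mat h) ∈ Icc (1 / 2 : ℝ) 2}

theorem measurableSet_multBand : MeasurableSet multBand :=
  (isClosed_Icc.preimage continuous_mult_mat).measurableSet

theorem mult_pos_of_mem_multBand {h : GSp4} (hh : h ∈ multBand) : 0 < mult (mat h) :=
  lt_of_lt_of_le (by norm_num) hh.1

/-- The real form of `h⟨I⟩ J(h, I) = A I + B` and of `J(h, I)ᴴ Y J(h, I) = μ`, in the blocks of `h`. -/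
theorem blocks_eq (h : GSp4) :
    (mat h).toBlocks₁₂ = ptRe h * (mat h).toBlocks₂₂ - ptIm h * (mat h).toBlocks₂₁ ∧
    (mat h).toBlocks₁₁ = ptRe h * (mat h).toBlocks₂₁ + ptIm h * (mat h).toBlocks₂₂ ∧
    ((mat h).toBlocks₂₂)ᵀ * ptIm h * (mat h).toBlocks₂₂ +
      ((mat h).toBlocks₂₁)ᵀ * ptIm h * (mat h).toBlocks₂₁ = mult (mat h) • 1 := by
  have hden : ∀ i j, den (toC (mat h)) i j =
      ((mat h).toBlocks₂₂ i j : ℂ) + Complex.I * ((mat h).toBlocks₂₁ i j : ℂ) := by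
    intro i j
    simp [den, autFactor, basePoint, toC, toBlocks₂₁, toBlocks₂₂, add_comm]
  have hnum : ∀ i j, num (toC (mat h)) i j =
      ((mat h).toBlocks₁₂ i j : ℂ) + Complex.I * ((mat h).toBlocks₁₁ i j : ℂ) := by
    intro i j
    simp [num, basePoint, toC, toBlocks₁₁, toBlocks₁₂, add_comm]
  have h1 : num (toC (mat h)) = point h * den (toC (mat h)) := num_eq (den_ne_zero h)
  have h2 := (isGU_mat h).den_hermIm (mult_ne_zero h)
  change (den (toC (mat h)))ᴴ * hermIm (point h) * _ = _ at h2
  rw [hermIm_point] at h2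
  have h1' := fun i j => congrFun (congrFun h1 i) j
  have h2' := fun i j => congrFun (congrFun h2 i) j
  have hp : ∀ i j, point h i j = (ptRe h i j : ℂ) + Complex.I * (ptIm h i j : ℂ) := by
    intro i j
    rw [mul_comm]
    exact (Complex.re_add_im _).symm
  refine ⟨?_, ?_, ?_⟩ <;> ext i j
  · have := congrArg Complex.re (h1' i j)
    simpa [Matrix.mul_apply, Fin.sum_univ_two, hden, hnum, hp, ← sub_eq_add_neg, sub_add_sub_comm] using this
  · have := congrArg Complex.im (h1' i j)
    simp [Matrix.mul_apply, Fin.sum_univ_two, hden, hnum, hp] at this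
    simp only [Matrix.add_apply, Matrix.mul_apply, Fin.sum_univ_two]
    linarith
  · have := congrArg Complex.re (h2' i j)
    have e1 : (((mult (mat h) : ℂ) • (1 : Matrix (Fin 2) (Fin 2) ℂ)) i j).re =
        (mult (mat h) • (1 : Matrix (Fin 2) (Fin 2) ℝ)) i j := by
      rw [Matrix.smul_apply, Matrix.smul_apply, Matrix.one_apply, Matrix.one_apply]
      split_ifs <;> simp
    rw [e1] at this
    rw [← this]
    have hY : ∀ i j, toC (ptIm h) i j = (ptIm h i j : ℂ) := fun _ _ => rfl
    simp [Matrix.mul_apply, Fin.sum_univ_two, hden, hY, conjTranspose_apply]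
    ring

/-- The region of bounded `h⟨I⟩`, with `det Y` bounded below, is compact. -/
theorem isCompact_region (M : ℝ) : IsCompact {h : GSp4 | h ∈ multBand ∧ 1 ≤ M * (ptIm h).det ∧
    (∀ i j, |ptRe h i j| ≤ M) ∧ ∀ i j, |ptIm h i j| ≤ M} := by
  refine isCompact_of_entries_le (M := 2 + 2 * M + 8 * M ^ 2) ?_ ?_
  · have h1 : ∀ i j : Fin 2, IsClosed {h : GSp4 | |ptRe h i j| ≤ M} := fun i j =>
      isClosed_le (continuous_ptRe i j).abs continuous_const
    have h2 : ∀ i j : Fin 2, IsClosed {h : GSp4 | |ptIm h i j| ≤ M} := fun i j =>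
      isClosed_le (continuous_ptIm i j).abs continuous_const
    have h3 : IsClosed {h : GSp4 | ∀ i j, |ptRe h i j| ≤ M} := by
      simp only [ofPred_forall]
      exact isClosed_iInter fun i => isClosed_iInter fun j => h1 i j
    have h4 : IsClosed {h : GSp4 | ∀ i j, |ptIm h i j| ≤ M} := by
      simp only [ofPred_forall]
      exact isClosed_iInter fun i => isClosed_iInter fun j => h2 i j
    exact (isClosed_Icc.preimage continuous_mult_mat).inter
      ((isClosed_le continuous_const (continuous_det_ptIm.const_mul M)).inter (h3.inter h4))
  · rintro h ⟨hμ, hdet, hX, hY⟩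
    have hμ0 := mult_pos_of_mem_multBand hμ
    have hM0 : 0 ≤ M := (abs_nonneg _).trans (hX 0 0)
    obtain ⟨hB, hA, hQ⟩ := blocks_eq h
    have hd := det_ptIm_pos h hμ0
    have hY0 := ptIm_zero_zero_pos h hμ0
    have hY1 := ptIm_one_one_pos h hμ0
    set A := (mat h).toBlocks₁₁
    set B := (mat h).toBlocks₁₂
    set C := (mat h).toBlocks₂₁
    set E := (mat h).toBlocks₂₂
    set X := ptRe h
    set Y := ptIm h with hYdef
    have hs : Y 1 0 = Y 0 1 := ptIm_symm h 1 0
    have hq : ∀ p q : ℝ, Y.det * p ^ 2 ≤ Y 1 1 * (Y 0 0 * p ^ 2 + 2 * Y 0 1 * p * q + Y 1 1 * q ^ 2) ∧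
        Y.det * q ^ 2 ≤ Y 0 0 * (Y 0 0 * p ^ 2 + 2 * Y 0 1 * p * q + Y 1 1 * q ^ 2) := by
      intro p q
      rw [det_fin_two, hs]
      constructor <;> nlinarith [sq_nonneg (Y 0 1 * p + Y 1 1 * q), sq_nonneg (Y 0 0 * p + Y 0 1 * q)]
    have hjj : ∀ j, (Y 0 0 * E 0 j ^ 2 + 2 * Y 0 1 * E 0 j * E 1 j + Y 1 1 * E 1 j ^ 2) +
        (Y 0 0 * C 0 j ^ 2 + 2 * Y 0 1 * C 0 j * C 1 j + Y 1 1 * C 1 j ^ 2) = mult (mat h) := by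
      intro j
      have := congrFun (congrFun hQ j) j
      simp [Matrix.mul_apply, Fin.sum_univ_two, hs] at this
      linarith
    have hpos : ∀ p q : ℝ, 0 ≤ Y 0 0 * p ^ 2 + 2 * Y 0 1 * p * q + Y 1 1 * q ^ 2 := by
      intro p q
      have h1 := (hq p q).2
      have h2 : 0 ≤ Y.det * q ^ 2 := by positivity
      exact (mul_nonneg_iff_of_pos_left hY0).1 (h2.trans h1)
    have habs : ∀ {v c : ℝ}, 0 ≤ c → c ≤ M → Y.det * v ^ 2 ≤ c * 2 → |v| ≤ 2 * M := by
      intro v c hc0 hcM hv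
      refine abs_le_of_sq_le_sq ?_ (by positivity)
      have h1 : M * Y.det * v ^ 2 ≤ M * (M * 2) := by
        rw [mul_assoc]
        exact mul_le_mul_of_nonneg_left (hv.trans (by linarith)) hM0
      nlinarith [sq_nonneg v, mul_le_mul_of_nonneg_right hdet (sq_nonneg v)]
    have hQ2 : ∀ {p q p' q' : ℝ}, (Y 0 0 * p ^ 2 + 2 * Y 0 1 * p * q + Y 1 1 * q ^ 2) +
        (Y 0 0 * p' ^ 2 + 2 * Y 0 1 * p' * q' + Y 1 1 * q' ^ 2) = mult (mat h) →
        |p| ≤ 2 * M ∧ |q| ≤ 2 * M := by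
      intro p q p' q' he
      have hle : Y 0 0 * p ^ 2 + 2 * Y 0 1 * p * q + Y 1 1 * q ^ 2 ≤ 2 := by
        have h3 : mult (mat h) ≤ 2 := hμ.2
        linarith [hpos p' q']
      exact ⟨habs hY1.le ((le_abs_self _).trans (hY 1 1))
          ((hq p q).1.trans (mul_le_mul_of_nonneg_left hle hY1.le)),
        habs hY0.le ((le_abs_self _).trans (hY 0 0))
          ((hq p q).2.trans (mul_le_mul_of_nonneg_left hle hY0.le))⟩
    have hE : ∀ i j, |E i j| ≤ 2 * M := by
      intro i j
      have := hQ2 (hjj j)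
      fin_cases i
      exacts [this.1, this.2]
    have hC : ∀ i j, |C i j| ≤ 2 * M := by
      intro i j
      have := hQ2 ((add_comm _ _).trans (hjj j))
      fin_cases i
      exacts [this.1, this.2]
    have hmul : ∀ {P Q : Matrix (Fin 2) (Fin 2) ℝ}, (∀ i j, |P i j| ≤ M) → (∀ i j, |Q i j| ≤ 2 * M) →
        ∀ i j, |(P * Q) i j| ≤ 4 * M ^ 2 := by
      intro P Q hP hQ i j
      rw [Matrix.mul_apply, Fin.sum_univ_two]
      refine (abs_add_le _ _).trans ?_
      rw [abs_mul, abs_mul]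
      nlinarith [mul_le_mul (hP i 0) (hQ 0 j) (abs_nonneg _) hM0,
        mul_le_mul (hP i 1) (hQ 1 j) (abs_nonneg _) hM0]
    refine ⟨fun i j => ?_, ?_⟩
    · have hM2 := sq_nonneg M
      rcases i with i | i <;> rcases j with j | j
      · change |A i j| ≤ _
        rw [hA, Matrix.add_apply]
        linarith [abs_add_le ((X * C) i j) ((Y * E) i j), hmul hX hC i j, hmul hY hE i j]
      · change |B i j| ≤ _
        rw [hB, Matrix.sub_apply]
        linarith [abs_sub ((X * E) i j) ((Y * C) i j), hmul hX hE i j, hmul hY hC i j]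
      · change |C i j| ≤ _
        linarith [hC i j]
      · change |E i j| ≤ _
        linarith [hE i j]
    · rw [abs_of_pos (inv_pos.2 hμ0)]
      have := inv_anti₀ (by norm_num : (0 : ℝ) < 1 / 2) hμ.1
      norm_num at this
      nlinarith [sq_nonneg M]

/-- The preimage of a bounded set of Iwasawa coordinates in `multBand` is relatively compact. This is
why multipliers are kept in a compact interval; without it the image would not be `σ`-finite. -/
theorem sigmaFinite_map_coord {m : Measure GSp4} (hf : IsFiniteMeasureOnCompacts m) :
    SigmaFinite ((m.restrict multBand).map coord) := by
  -- bounds for the entries of `X` and `Y` and for `1 / det Y` in the Iwasawa coordinates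
  set φ : Fin 7 → Tri → ℝ := ![fun p => |p.x|, fun p => |p.y|, fun p => |p.z|,
    fun p => Real.exp p.a ^ 2, fun p => |p.u * Real.exp p.a ^ 2|,
    fun p => Real.exp p.e ^ 2 + p.u ^ 2 * Real.exp p.a ^ 2,
    fun p => (Real.exp p.a ^ 2 * Real.exp p.e ^ 2)⁻¹] with hφ
  have hm : ∀ k, Measurable (φ k) := by
    have := Tri.measurable_a; have := Tri.measurable_e; have := Tri.measurable_u
    have := Tri.measurable_x; have := Tri.measurable_y; have := Tri.measurable_z
    intro k
    fin_cases k <;> simp only [hφ] <;> dsimp <;> fun_prop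
  have hS : ∀ n : ℕ, MeasurableSet {p : Tri | ∀ k, φ k p ≤ n} := by
    intro n
    simp only [ofPred_forall]
    exact MeasurableSet.iInter fun k => measurableSet_le (hm k) measurable_const
  refine ⟨⟨⟨fun n : ℕ => {p : Tri | ∀ k, φ k p ≤ n}, fun _ => trivial, fun n => ?_, ?_⟩⟩⟩
  · rw [Measure.map_apply measurable_coord (hS n), Measure.restrict_apply (measurable_coord (hS n))]
    refine lt_of_le_of_lt (measure_mono ?_) (isCompact_region n).measure_lt_top
    rintro h ⟨hh, hμ⟩
    have hμ0 := mult_pos_of_mem_multBand hμ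
    obtain ⟨e1, e2, e3, e4⟩ := coord_ptIm h hμ0
    have hd := det_ptIm_pos h hμ0
    have k0 : |ptRe h 0 0| ≤ n := hh 0
    have k1 : |ptRe h 0 1| ≤ n := hh 1
    have k2 : |ptRe h 1 1| ≤ n := hh 2
    have k3 : Real.exp (coord h).a ^ 2 ≤ n := hh 3
    have k4 : |(coord h).u * Real.exp (coord h).a ^ 2| ≤ n := hh 4
    have k5 : Real.exp (coord h).e ^ 2 + (coord h).u ^ 2 * Real.exp (coord h).a ^ 2 ≤ n := hh 5
    have k6 : (Real.exp (coord h).a ^ 2 * Real.exp (coord h).e ^ 2)⁻¹ ≤ n := hh 6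
    rw [e1] at k3
    rw [e2] at k4
    rw [e3] at k5
    rw [e4, inv_le_iff_one_le_mul₀ hd] at k6
    have k3' : |ptIm h 0 0| ≤ n := by rwa [abs_of_pos (ptIm_zero_zero_pos h hμ0)]
    have k5' : |ptIm h 1 1| ≤ n := by rwa [abs_of_pos (ptIm_one_one_pos h hμ0)]
    refine ⟨hμ, k6, fun i j => ?_, fun i j => ?_⟩
    · fin_cases i <;> fin_cases j
      exacts [k0, k1, (congrArg abs (ptRe_symm h 1 0)).trans_le k1, k2]
    · fin_cases i <;> fin_cases j
      exacts [k3', k4, (congrArg abs (ptIm_symm h 1 0)).trans_le k4, k5']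
  · refine eq_univ_of_forall fun p => mem_iUnion.2 ?_
    obtain ⟨n, hn⟩ := exists_nat_ge (∑ k, |φ k p|)
    exact ⟨n, fun k => (le_abs_self _).trans
      ((Finset.single_le_sum (fun i _ => abs_nonneg (φ i p)) (Finset.mem_univ k)).trans hn)⟩

/-- By uniqueness of Haar measure on `Tri`, a right-invariant measure on `GSp₄(ℝ)` is a multiple of
Haar measure in the Iwasawa coordinates. -/
theorem exists_map_coord_eq {m : Measure GSp4} (hm : m.IsMulRightInvariant)
    (hf : IsFiniteMeasureOnCompacts m) :
    ∃ κ : ℝ≥0∞, (m.restrict multBand).map coord = κ • Tri.haar := by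
  have hinv : ((m.restrict multBand).map coord).IsMulLeftInvariant := by
    refine ⟨fun b => ?_⟩
    rw [Measure.map_map (measurable_const_mul b) measurable_coord]
    have e : (fun p => b * p) ∘ coord =ᵐ[m.restrict multBand] coord ∘ fun h => triG b * h := by
      filter_upwards [ae_restrict_mem measurableSet_multBand] with h hh
      exact (coord_triG_mul b h (mult_pos_of_mem_multBand hh)).symm
    rw [Measure.map_congr e, ← Measure.map_map measurable_coord (measurable_const_mul _)]
    congr 1
    have hp : (fun h => triG b * h) ⁻¹' multBand = multBand := by
      ext h
      simp only [multBand, mem_preimage, mem_ofPred_eq, mult_mul, mult_triG, one_mul]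
    conv_rhs => rw [← map_triG_mul hm hf b]
    rw [Measure.restrict_map (measurable_const_mul _) measurableSet_multBand, hp]
  have hpos : 0 < Tri.haar univ := by
    have h1 := Tri.lintegral_haar (F := fun _ => 1) measurable_const
    simp only [lintegral_one, mul_one] at h1
    rw [h1, lintegral_pos_iff_support (Tri.measurable_weight.ennreal_ofReal)]
    have h2 : (Function.support fun p : Tri => ENNReal.ofReal (Tri.weight p)) = univ := by
      ext p
      have : 0 < Tri.weight p := Real.exp_pos _
      simpa using this
    rw [h2]
    exact isOpen_univ.measure_pos (volume : Measure (((((ℝ × ℝ) × ℝ) × ℝ) × ℝ) × ℝ)) univ_nonempty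
  obtain ⟨s, -, -, hs0, hs1⟩ := Measure.exists_subset_measure_lt_top MeasurableSet.univ hpos
  have hσ : SigmaFinite ((m.restrict multBand).map coord) := sigmaFinite_map_coord hf
  exact ⟨_, measure_eq_div_smul _ Tri.haar hs0.ne' hs1.ne⟩

/-- The multiplier of `h` and the entries of the real part of `h⟨I⟩` are in fixed compact intervals.
In the Bessel subgroup this defines a compact neighbourhood of `1`; its translates cut every coset of
positive multiplier in a set of the same volume. -/
def window (h : GSp4) : Prop :=
  (ptRe h 0 0 ∈ Icc (-1 / 2 : ℝ) (1 / 2) ∧ ptRe h 0 1 ∈ Icc (-1 / 2 : ℝ) (1 / 2) ∧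
    ptRe h 1 1 ∈ Icc (-1 / 2 : ℝ) (1 / 2)) ∧ h ∈ multBand

/-- The form `S` is definite, so the torus is compact up to scalars. -/
theorem abs_le_of_torus {f : BForm} (hc : f.c = 1) (hD : 0 < f.D) {t : GL2} (ht : t ∈ torus f)
    (h2 : (t : Matrix (Fin 2) (Fin 2) ℝ).det ≤ 2) (i j : Fin 2) :
    |(t : Matrix (Fin 2) (Fin 2) ℝ) i j| ≤
      1 + (8 / f.D + 2) * (2 + f.b ^ 2) * (f.a + 1) := by
  have hdp := torus_det_pos hc hD ht
  have ha : 0 < f.a := by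
    rw [BForm.D, hc] at hD
    nlinarith [sq_nonneg f.b]
  set M := (t : Matrix (Fin 2) (Fin 2) ℝ) with hM
  have key : f.a * M 0 j ^ 2 + f.b * M 0 j * M 1 j + M 1 j ^ 2 ≤ 2 * (f.a + 1) := by
    have h := congrFun (congrFun (mem_torus_iff.1 ht) j) j
    fin_cases j <;> simp [Matrix.mul_apply, Fin.sum_univ_two, BForm.S, hc, ← hM] at h ⊢ <;> nlinarith
  have hDe : f.D = 4 * f.a - f.b ^ 2 := by rw [BForm.D, hc]; ring
  have k0 : M 0 j ^ 2 ≤ 8 / f.D * (f.a + 1) := by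
    rw [div_mul_eq_mul_div, le_div_iff₀ hD, hDe]
    nlinarith [sq_nonneg (M 1 j + f.b / 2 * M 0 j)]
  have k1 : M 1 j ^ 2 ≤ 4 * (f.a + 1) + f.b ^ 2 / 2 * M 0 j ^ 2 := by
    have h3 : (M 1 j + f.b / 2 * M 0 j) ^ 2 ≤ 2 * (f.a + 1) := by
      have : 0 ≤ f.D * M 0 j ^ 2 := by positivity
      rw [hDe] at this
      nlinarith
    nlinarith [sq_nonneg (M 1 j + f.b / 2 * M 0 j + f.b / 2 * M 0 j)]
  have hq : 0 ≤ 8 / f.D * (f.a + 1) := by positivity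
  have h3 : M i j ^ 2 ≤ (8 / f.D + 2) * (2 + f.b ^ 2) * (f.a + 1) := by
    have e : (8 / f.D + 2) * (2 + f.b ^ 2) * (f.a + 1) = (8 / f.D * (f.a + 1)) * (2 + f.b ^ 2) +
      2 * (2 + f.b ^ 2) * (f.a + 1) := by ring
    have hb := sq_nonneg f.b
    rw [e]
    fin_cases i
    · change M 0 j ^ 2 ≤ _
      nlinarith [mul_nonneg hq hb, mul_nonneg hb ha.le]
    · change M 1 j ^ 2 ≤ _
      nlinarith [mul_nonneg hq hb, mul_nonneg hb ha.le, mul_le_mul_of_nonneg_left k0 hb]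
  refine abs_le_of_sq_le_sq (h3.trans ?_) (by positivity)
  nlinarith [show 0 ≤ (8 / f.D + 2) * (2 + f.b ^ 2) * (f.a + 1) by positivity]

theorem ptRe_one : ptRe 1 = 0 ∧ ptIm 1 = 1 := by
  have h1 : point 1 = basePoint := by
    have e : mat 1 = 1 := rfl
    have e2 : toC (1 : Matrix I4 I4 ℝ) = 1 := by
      rw [toC, Matrix.map_one _ Complex.ofReal_zero Complex.ofReal_one]
    rw [point, e, e2, act, autFactor, ← fromBlocks_one, toBlocks_fromBlocks₁₁, toBlocks_fromBlocks₁₂,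
      toBlocks_fromBlocks₂₁, toBlocks_fromBlocks₂₂]
    simp
  rw [ptRe, ptIm, h1, basePoint]
  constructor <;> ext i j <;> fin_cases i <;> fin_cases j <;> simp

/-- The windows on the Bessel subgroup have finite measure, as bounded sets. -/
theorem rightHaar_window_lt_top {f : BForm} (hc : f.c = 1) (hD : 0 < f.D) :
    rightHaar f {r : besselR f | window (r : GSp4)} < ∞ := by
  set N := 1 + (8 / f.D + 2) * (2 + f.b ^ 2) * (f.a + 1) with hN
  set K : Set GSp4 := {h | (∀ i j, |mat h i j| ≤ 2 + N) ∧ |(mult (mat h))⁻¹| ≤ 2 + N} with hK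
  have hKc : IsCompact K := by
    refine isCompact_of_entries_le (M := 2 + N) ?_ fun h hh => hh
    have h1 : IsClosed {h : GSp4 | ∀ i j, |mat h i j| ≤ 2 + N} := by
      simp only [ofPred_forall]
      exact isClosed_iInter fun i => isClosed_iInter fun j =>
        isClosed_le (continuous_mat.matrix_elem i j).abs continuous_const
    exact h1.inter (isClosed_le ((continuous_mult_mat.inv₀ mult_ne_zero).abs) continuous_const)
  have hKr : IsCompact ((Subtype.val : besselR f → GSp4) ⁻¹' K) :=
    ((isClosed_besselR f).isClosedEmbedding_subtypeVal).isCompact_preimage hKc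
  refine lt_of_le_of_lt (measure_mono ?_) (rightHaar_lt_top hKr)
  rintro ⟨r, hr⟩ ⟨⟨hx, hy, hz⟩, hμ⟩
  have hμ' := hμ
  obtain ⟨t, ht, X, hX, e⟩ := hr
  have e' : mat r = levi t * unip X := e
  have hdet : (t : Matrix (Fin 2) (Fin 2) ℝ).det = mult (mat r) := by
    rw [e', mult_levi_mul_unip t hX]
  have hN0 := abs_le_of_torus hc hD ht (hdet ▸ hμ.2)
  have hN1 : 0 ≤ N := (abs_nonneg _).trans (hN0 0 0)
  have hd0 : (t : Matrix (Fin 2) (Fin 2) ℝ).det ≠ 0 := (torus_det_pos hc hD ht).ne'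
  have hadj : (t : Matrix (Fin 2) (Fin 2) ℝ).det • ((t⁻¹ : GL2) : Matrix (Fin 2) (Fin 2) ℝ)ᵀ =
      (adjugate (t : Matrix (Fin 2) (Fin 2) ℝ))ᵀ := by
    rw [coe_units_inv, Matrix.inv_def, Ring.inverse_eq_inv', transpose_smul, smul_smul,
      mul_inv_cancel₀ hd0, one_smul]
  set M := (t : Matrix (Fin 2) (Fin 2) ℝ) with hM
  have hblk : mat r = fromBlocks M (M * X) 0 (adjugate M)ᵀ := by
    rw [e', levi, hadj, unip, fromBlocks_multiply]
    simp [hM]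
  -- the upper right block is `ptRe r` times the lower right one
  have hB : M * X = ptRe r * (adjugate M)ᵀ := by
    have h1 := (point_mul_of_block (g := r) (A := M) (B := M * X) (E := (adjugate M)ᵀ)
      (F := M.det⁻¹ • Mᵀ) hblk (by rw [← hadj]; exact levi_block_inv t) 1).1
    rw [mul_one, ptRe_one.1, Matrix.mul_zero, zero_add] at h1
    rw [h1, Matrix.mul_assoc, Matrix.smul_mul, ← transpose_mul, adjugate_mul, transpose_smul, transpose_one,
      smul_smul, inv_mul_cancel₀ hd0, one_smul, Matrix.mul_one]
  have hA : ∀ i j, |(adjugate M)ᵀ i j| ≤ N := by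
    intro i j
    rw [adjugate_fin_two]
    fin_cases i <;> fin_cases j <;> simp <;> apply hN0
  have hXb : ∀ i j, |ptRe r i j| ≤ 1 / 2 := by
    have a1 := abs_le.2 ⟨by linarith [hx.1], hx.2⟩
    have a2 := abs_le.2 ⟨by linarith [hy.1], hy.2⟩
    have a3 := abs_le.2 ⟨by linarith [hz.1], hz.2⟩
    intro i j
    fin_cases i <;> fin_cases j
    · exact a1
    · exact a2
    · change |ptRe r 1 0| ≤ 1 / 2
      rw [ptRe_symm r 1 0]; exact a2
    · exact a3
  refine ⟨fun i j => ?_, ?_⟩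
  · change |mat r i j| ≤ 2 + N
    rw [hblk]
    rcases i with i | i <;> rcases j with j | j
    · rw [fromBlocks_apply₁₁]; linarith [hN0 i j]
    · rw [fromBlocks_apply₁₂, hB, Matrix.mul_apply, Fin.sum_univ_two]
      refine (abs_add_le _ _).trans ?_
      rw [abs_mul, abs_mul]
      nlinarith [mul_le_mul (hXb i 0) (hA 0 j) (abs_nonneg _) (by norm_num),
        mul_le_mul (hXb i 1) (hA 1 j) (abs_nonneg _) (by norm_num)]
    · rw [fromBlocks_apply₂₁]; simp; linarith
    · rw [fromBlocks_apply₂₂]; linarith [hA i j]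
  · change |(mult (mat r))⁻¹| ≤ 2 + N
    have h0 : 0 < mult (mat r) := mult_pos_of_mem_multBand hμ'
    rw [abs_of_pos (inv_pos.2 h0)]
    have := inv_anti₀ (by norm_num : (0 : ℝ) < 1 / 2) hμ'.1
    norm_num at this
    linarith

theorem rightHaar_window_pos (f : BForm) : 0 < rightHaar f {r : besselR f | window (r : GSp4)} := by
  set U : Set GSp4 := {h | (ptRe h 0 0 ∈ Ioo (-1 / 2 : ℝ) (1 / 2) ∧ ptRe h 0 1 ∈ Ioo (-1 / 2 : ℝ) (1 / 2) ∧
    ptRe h 1 1 ∈ Ioo (-1 / 2 : ℝ) (1 / 2)) ∧ mult (mat h) ∈ Ioo (1 / 2 : ℝ) 2} with hU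
  have hUo : IsOpen U :=
    ((isOpen_Ioo.preimage (continuous_ptRe 0 0)).inter ((isOpen_Ioo.preimage (continuous_ptRe 0 1)).inter
      (isOpen_Ioo.preimage (continuous_ptRe 1 1)))).inter (isOpen_Ioo.preimage continuous_mult_mat)
  refine lt_of_lt_of_le (rightHaar_pos (hUo.preimage continuous_subtype_val)
    ⟨(1 : besselR f), ?_⟩) (measure_mono ?_)
  · have e : mult (mat (1 : GSp4)) = 1 := mult_eq_of (by
      have : mat (1 : GSp4) = 1 := rfl
      rw [this]; simp)
    change (_ ∧ _ ∧ _) ∧ mult (mat (1 : GSp4)) ∈ _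
    simp only [Subgroup.coe_one, ptRe_one.1, e]
    norm_num
  · rintro r ⟨⟨h1, h2, h3⟩, h4⟩
    exact ⟨⟨Ioo_subset_Icc_self h1, Ioo_subset_Icc_self h2, Ioo_subset_Icc_self h3⟩,
      Ioo_subset_Icc_self h4⟩

theorem transG_mem (f : BForm) (X : Matrix (Fin 2) (Fin 2) ℝ) (hX : Xᵀ = X) : transG X hX ∈ besselR f :=
  ⟨1, one_mem _, X, hX, by rw [levi_one, one_mul]; rfl⟩

/-- The scalar matrix `x`, an element of the centre. -/
def scalarG (x : ℝ) (hx : x ≠ 0) : GSp4 := diagG (x • 1) (x • 1) (x ^ 2) (pow_ne_zero 2 hx) (by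
  simp [smul_smul, sq])

theorem scalarG_mem (f : BForm) (x : ℝ) (hx : x ≠ 0) : scalarG x hx ∈ besselR f := by
  have hdet : (x • (1 : Matrix (Fin 2) (Fin 2) ℝ)).det = x ^ 2 := by simp
  set t : GL2 := Matrix.GeneralLinearGroup.mkOfDetNeZero (x • 1) (by rw [hdet]; positivity) with ht
  have e : (t : Matrix (Fin 2) (Fin 2) ℝ) = x • 1 := rfl
  have e2 : ((t⁻¹ : GL2) : Matrix (Fin 2) (Fin 2) ℝ) = x⁻¹ • 1 := by
    have h1 : (t : Matrix (Fin 2) (Fin 2) ℝ) * (x⁻¹ • 1) = 1 := by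
      rw [e]; simp [smul_smul, hx]
    have h2 : ((t⁻¹ : GL2) : Matrix (Fin 2) (Fin 2) ℝ) * (t : Matrix (Fin 2) (Fin 2) ℝ) = 1 := by
      rw [← Units.val_mul, inv_mul_cancel, Units.val_one]
    exact left_inv_eq_right_inv h2 h1
  refine ⟨t, ?_, 0, by simp, ?_⟩
  · rw [mem_torus_iff, e, hdet]
    simp [smul_smul, sq]
  · rw [unip_zero, Matrix.mul_one, levi, e, e2, hdet]
    change fromBlocks _ _ _ _ = _
    congr 1
    rw [transpose_smul, transpose_one, smul_smul]
    congr 1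
    field_simp

theorem pt_scalarG (x : ℝ) (hx : x ≠ 0) (h : GSp4) :
    ptRe (scalarG x hx * h) = ptRe h ∧ ptIm (scalarG x hx * h) = ptIm h ∧
      mult (mat (scalarG x hx * h)) = x ^ 2 * mult (mat h) := by
  have h0 : x ^ 2 ≠ 0 := pow_ne_zero 2 hx
  have h1 := pt_diagG (A := x • 1) (E := x • 1) h0 (by simp [smul_smul, sq]) h
  have h2 := mult_diagG (A := x • 1) (E := x • 1) h0 (by simp [smul_smul, sq])
  change ptRe (scalarG x hx * h) = _ ∧ ptIm (scalarG x hx * h) = _ at h1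
  change mult (mat (scalarG x hx)) = _ at h2
  refine ⟨?_, ?_, ?_⟩
  · rw [h1.1]; simp [smul_smul]; field_simp; simp
  · rw [h1.2]; simp [smul_smul]; field_simp; simp
  · rw [mult_mul, h2]

/-- The window on any coset of positive multiplier has the same volume. -/
theorem rightHaar_window {f : BForm} (hc : f.c = 1) (hD : 0 < f.D) {h : GSp4} (hμ : 0 < mult (mat h)) :
    rightHaar f {r : besselR f | window ((r : GSp4) * h)} =
      rightHaar f {r : besselR f | window (r : GSp4)} := by
  have hx : (Real.sqrt (mult (mat h)))⁻¹ ≠ 0 := (inv_pos.2 (Real.sqrt_pos.2 hμ)).ne'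
  have hsym : (-ptRe h)ᵀ = -ptRe h := by
    ext i j
    simp [ptRe_symm h j i]
  -- translate `h` by the Bessel subgroup to a point with real part `0` and multiplier one
  set r₀ : besselR f := ⟨scalarG _ hx * transG (-ptRe h) hsym,
    mul_mem (scalarG_mem f _ hx) (transG_mem f _ hsym)⟩ with hr₀
  set h₁ : GSp4 := (r₀ : GSp4) * h with hh₁
  have e1 : h₁ = scalarG _ hx * (transG (-ptRe h) hsym * h) := mul_assoc _ _ _
  have hX : ptRe h₁ = 0 := by
    rw [e1, (pt_scalarG _ hx _).1, (ptRe_transG _ hsym h).1, add_neg_cancel]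
  have hm : mult (mat h₁) = 1 := by
    rw [e1, (pt_scalarG _ hx _).2.2, mult_mul, mult_transG, one_mul, inv_pow, Real.sq_sqrt hμ.le,
      inv_mul_cancel₀ hμ.ne']
  have h2 : {r : besselR f | window ((r : GSp4) * h₁)} = {r : besselR f | window (r : GSp4)} := by
    ext r
    obtain ⟨-, t, -, X, H⟩ := besselR_mul hc hD r.2
    have hp : ptRe ((r : GSp4) * h₁) = ptRe (r : GSp4) := by
      have := (H 1).1
      rw [mul_one] at this
      rw [(H h₁).1, this, hX, ptRe_one.1]
    simp only [mem_ofPred_eq, window, multBand, hp, mult_mul, hm, mul_one]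
  have h3 : (fun r : besselR f => r * r₀) ⁻¹' {r : besselR f | window ((r : GSp4) * h)} =
      {r : besselR f | window ((r : GSp4) * h₁)} := by
    ext r
    simp only [mem_preimage, mem_ofPred_eq, Subgroup.coe_mul, hh₁, mul_assoc]
  rw [← h2, ← h3, measure_preimage_mul_right]

theorem measurableSet_window : MeasurableSet {h : GSp4 | window h} :=
  ((((continuous_ptRe 0 0).measurable measurableSet_Icc).inter
    (((continuous_ptRe 0 1).measurable measurableSet_Icc).inter
      ((continuous_ptRe 1 1).measurable measurableSet_Icc)))).inter measurableSet_multBand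

end

/-! ### The invariant measure in the coordinates `√det Y` and `tr(SY)` -/

section

open Filter Topology Set
open scoped ENNReal

/-- A function of `√det Y` and `tr(SY)`, extended by zero to negative multipliers. -/
def invariantFn (f : BForm) (Ψ : ℝ → ℝ → ℝ≥0∞) (h : GSp4) : ℝ≥0∞ :=
  open Classical in
  if 0 < mult (mat h) then Ψ (Real.sqrt (ptIm h).det) (f.tr (ptIm h)) else 0

theorem measurable_invariantFn (f : BForm) {Ψ : ℝ → ℝ → ℝ≥0∞} (hΨ : Measurable (Function.uncurry Ψ)) :
    Measurable (invariantFn f Ψ) := by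
  refine Measurable.ite (continuous_mult_mat.measurable measurableSet_Ioi) ?_ measurable_const
  exact hΨ.comp ((continuous_det_ptIm.measurable.sqrt).prodMk (continuous_tr_ptIm f).measurable)

theorem invariantFn_mul {f : BForm} (hc : f.c = 1) (hD : 0 < f.D) (Ψ : ℝ → ℝ → ℝ≥0∞) {r : GSp4}
    (hr : r ∈ besselR f) (h : GSp4) : invariantFn f Ψ (r * h) = invariantFn f Ψ h := by
  simp only [invariantFn, mult_besselR_mul_pos hc hD hr, det_ptIm_besselR hc hD hr,
    tr_ptIm_besselR hc hD hr]

theorem invariantFn_rep {f : BForm} (hc : f.c = 1) (hD : 0 < f.D) (Ψ : ℝ → ℝ → ℝ≥0∞) (h : GSp4) :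
    invariantFn f Ψ (BesselQuot.mk f h).rep = invariantFn f Ψ h := by
  obtain ⟨r, hr, e⟩ := mk_eq_mk.1 (mk_rep (BesselQuot.mk f h))
  rw [e, invariantFn_mul hc hD Ψ hr]

theorem measurable_invariantFn_rep {f : BForm} (hc : f.c = 1) (hD : 0 < f.D) {Ψ : ℝ → ℝ → ℝ≥0∞}
    (hΨ : Measurable (Function.uncurry Ψ)) :
    Measurable fun z : BesselQuot f => invariantFn f Ψ z.rep := by
  refine measurable_of_comp_mk ?_
  simp only [invariantFn_rep hc hD]
  exact measurable_invariantFn f hΨ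

/-- Integration over the coordinates of the symmetric matrix, against a product of densities of total
mass one. -/
theorem lintegral_vol_mul {H : (ℝ × ℝ) × ℝ → ℝ≥0∞} (hH : Measurable H) {i : ℝ → ℝ≥0∞} (hi : Measurable i)
    (h1 : ∫⁻ x, i x = 1) :
    ∫⁻ p, H ((p.a, p.e), p.u) * i p.x * i p.y * i p.z ∂Tri.vol =
      ∫⁻ a, ∫⁻ e, ∫⁻ u, H ((a, e), u) := by
  have e1 : ∀ {α : Type} [MeasurableSpace α] (μ : Measure α) [SFinite μ] {K : α → ℝ≥0∞}, Measurable K →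
      ∫⁻ p, K p.1 * i p.2 ∂(μ.prod (volume : Measure ℝ)) = ∫⁻ q, K q ∂μ := by
    intro α _ μ _ K hK
    rw [lintegral_prod_mul hK.aemeasurable hi.aemeasurable, h1, mul_one]
  have m1 : Measurable fun p : ((ℝ × ℝ) × ℝ) × ℝ => H p.1 * i p.2 := by fun_prop
  have m2 : Measurable fun p : (((ℝ × ℝ) × ℝ) × ℝ) × ℝ => H p.1.1 * i p.1.2 * i p.2 := by fun_prop
  calc _ = ∫⁻ p : ((((ℝ × ℝ) × ℝ) × ℝ) × ℝ) × ℝ, (H p.1.1.1 * i p.1.1.2 * i p.1.2) * i p.2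
        ∂((volume : Measure ((((ℝ × ℝ) × ℝ) × ℝ) × ℝ)).prod volume) := rfl
    _ = ∫⁻ p : (((ℝ × ℝ) × ℝ) × ℝ) × ℝ, (H p.1.1 * i p.1.2) * i p.2
        ∂((volume : Measure (((ℝ × ℝ) × ℝ) × ℝ)).prod volume) := e1 _ m2
    _ = ∫⁻ p : ((ℝ × ℝ) × ℝ) × ℝ, H p.1 * i p.2
        ∂((volume : Measure ((ℝ × ℝ) × ℝ)).prod volume) := e1 _ m1
    _ = ∫⁻ p : (ℝ × ℝ) × ℝ, H p ∂((volume : Measure (ℝ × ℝ)).prod volume) := e1 _ hH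
    _ = ∫⁻ q : ℝ × ℝ, (∫⁻ u, H (q, u)) ∂((volume : Measure ℝ).prod volume) :=
        lintegral_prod _ hH.aemeasurable
    _ = _ := lintegral_prod _ (hH.lintegral_prod_right').aemeasurable

/-- The invariant measure in the coordinates `x = √det Y` and `t = tr(SY)`, up to a constant. -/
theorem exists_lintegral_invariantFn {f : BForm} (hc : f.c = 1) (hD : 0 < f.D)
    {ν : Measure (BesselQuot f)} (hν : IsInvariantMeasure f ν) :
    ∃ C : ℝ≥0∞, ∀ Ψ : ℝ → ℝ → ℝ≥0∞, Measurable (Function.uncurry Ψ) →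
      ∫⁻ z, invariantFn f Ψ z.rep ∂ν = C * ∫⁻ x in Ioi (0 : ℝ), ∫⁻ t in Ioi (Real.sqrt f.D * x),
        ENNReal.ofReal (x⁻¹ ^ 5) * Ψ x t := by
  obtain ⟨κ, hκ⟩ := exists_map_coord_eq (unfolding_isMulRightInvariant hν)
    (unfolding_isFiniteMeasureOnCompacts hν)
  set A := rightHaar f {r : besselR f | window (r : GSp4)} with hA
  have hA0 : A ≠ 0 := (rightHaar_window_pos f).ne'
  have hA1 : A ≠ ∞ := (rightHaar_window_lt_top hc hD).ne
  refine ⟨A⁻¹ * (κ * ENNReal.ofReal (Real.pi / (2 * Real.sqrt (f.D / 4)))), fun Ψ hΨ => ?_⟩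
  have hG := measurable_invariantFn f hΨ
  -- integrate over the cosets first
  have h1 : ∫⁻ h, {h | window h}.indicator (invariantFn f Ψ) h ∂unfolding f ν =
      A * ∫⁻ z, invariantFn f Ψ z.rep ∂ν := by
    rw [lintegral_unfolding f ν (hG.indicator measurableSet_window),
      ← lintegral_const_mul _ (measurable_invariantFn_rep hc hD hΨ)]
    refine lintegral_congr fun z => ?_
    have e : ∀ r : besselR f, {h | window h}.indicator (invariantFn f Ψ) ((r : GSp4) * z.rep) =
        {r : besselR f | window ((r : GSp4) * z.rep)}.indicator (fun _ => invariantFn f Ψ z.rep) r := by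
      intro r
      simp only [indicator, mem_ofPred_eq, invariantFn_mul hc hD Ψ r.2]
    have hm : MeasurableSet {r : besselR f | window ((r : GSp4) * z.rep)} :=
      measurable_coset f z.rep measurableSet_window
    simp only [e]
    rw [lintegral_indicator hm, lintegral_const, Measure.restrict_apply_univ, mul_comm]
    by_cases hμ : 0 < mult (mat z.rep)
    · rw [rightHaar_window hc hD hμ]
    · rw [invariantFn, if_neg hμ, mul_zero, mul_zero]
  -- integrate in the Iwasawa coordinates
  set i : ℝ → ℝ≥0∞ := (Icc (-1 / 2 : ℝ) (1 / 2)).indicator fun _ => 1 with hi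
  have him : Measurable i := measurable_const.indicator measurableSet_Icc
  have hi1 : ∫⁻ x, i x = 1 := by
    rw [hi, lintegral_indicator measurableSet_Icc, lintegral_const, Measure.restrict_apply_univ,
      Real.volume_Icc]
    norm_num
  set P : (ℝ × ℝ) × ℝ → ℝ≥0∞ := fun q => Ψ (Real.exp (q.1.1 + q.1.2))
    (Real.exp q.1.1 ^ 2 * (f.D / 4 + (q.2 + f.b / 2) ^ 2) + Real.exp q.1.2 ^ 2) with hP
  have hPm : Measurable P := by
    have : Measurable fun q : (ℝ × ℝ) × ℝ => (Real.exp (q.1.1 + q.1.2),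
      Real.exp q.1.1 ^ 2 * (f.D / 4 + (q.2 + f.b / 2) ^ 2) + Real.exp q.1.2 ^ 2) := by fun_prop
    exact hΨ.comp this
  set F : Tri → ℝ≥0∞ := fun p => P ((p.a, p.e), p.u) * i p.x * i p.y * i p.z with hF
  have hFm : Measurable F := by
    have := Tri.measurable_a; have := Tri.measurable_e; have := Tri.measurable_u
    have := Tri.measurable_x; have := Tri.measurable_y; have := Tri.measurable_z
    have h6 : Measurable fun p : Tri => P ((p.a, p.e), p.u) := by
      apply hPm.comp; fun_prop
    fun_prop
  have h2 : ∫⁻ h, {h | window h}.indicator (invariantFn f Ψ) h ∂unfolding f ν =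
      κ * ∫⁻ p, F p ∂Tri.haar := by
    have e : ∀ h, {h | window h}.indicator (invariantFn f Ψ) h = multBand.indicator (F ∘ coord) h := by
      intro h
      by_cases hμ : h ∈ multBand
      · have hμ0 := mult_pos_of_mem_multBand hμ
        obtain ⟨e1, e2⟩ := coord_spec hc h hμ0
        rw [indicator_of_mem hμ, Function.comp, hF]
        simp only [hP, ← e1, ← e2]
        change _ = _ * i (ptRe h 0 0) * i (ptRe h 0 1) * i (ptRe h 1 1)
        by_cases hw : window h
        · obtain ⟨⟨w1, w2, w3⟩, -⟩ := id hw
          rw [indicator_of_mem (s := {h | window h}) hw, invariantFn, if_pos hμ0, hi,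
            indicator_of_mem w1, indicator_of_mem w2, indicator_of_mem w3, mul_one, mul_one, mul_one]
        · rw [indicator_of_notMem (s := {h | window h}) hw]
          have hw' : ¬(ptRe h 0 0 ∈ Icc (-1 / 2 : ℝ) (1 / 2) ∧ ptRe h 0 1 ∈ Icc (-1 / 2 : ℝ) (1 / 2) ∧
            ptRe h 1 1 ∈ Icc (-1 / 2 : ℝ) (1 / 2)) := fun hh => hw ⟨hh, hμ⟩
          rw [not_and_or, not_and_or] at hw'
          rcases hw' with w | w | w
          · rw [hi, indicator_of_notMem w, mul_zero, zero_mul, zero_mul]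
          · rw [hi, indicator_of_notMem (a := ptRe h 0 1) w, mul_zero, zero_mul]
          · rw [hi, indicator_of_notMem (a := ptRe h 1 1) w, mul_zero]
      · rw [indicator_of_notMem hμ, indicator_of_notMem]
        exact fun hw => hμ hw.2
    simp only [e]
    rw [lintegral_indicator measurableSet_multBand]
    change ∫⁻ h, F (coord h) ∂(unfolding f ν).restrict multBand = _
    rw [← lintegral_map hFm measurable_coord, hκ, lintegral_smul_measure, smul_eq_mul]
  have h3 : ∫⁻ p, F p ∂Tri.haar = ∫⁻ a, ∫⁻ e, ∫⁻ u, ENNReal.ofReal (Real.exp (-2 * a - 4 * e)) *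
      P ((a, e), u) := by
    have hm : Measurable fun q : (ℝ × ℝ) × ℝ =>
        ENNReal.ofReal (Real.exp (-2 * q.1.1 - 4 * q.1.2)) * P q := by fun_prop
    rw [Tri.lintegral_haar hFm, ← lintegral_vol_mul hm him hi1]
    refine lintegral_congr fun p => ?_
    simp only [hF, Tri.weight]
    ring
  have h4 : ∫⁻ p, F p ∂Tri.haar = ENNReal.ofReal (Real.pi / (2 * Real.sqrt (f.D / 4))) *
      ∫⁻ x in Ioi (0 : ℝ), ∫⁻ t in Ioi (Real.sqrt f.D * x), ENNReal.ofReal (x⁻¹ ^ 5) * Ψ x t := by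
    have hs : 2 * Real.sqrt (f.D / 4) = Real.sqrt f.D := by
      rw [show (4 : ℝ) = 2 ^ 2 by norm_num, Real.sqrt_div' _ (by positivity), Real.sqrt_sq (by norm_num)]
      ring
    have h5 := lintegral_radial (E := f.D / 4) (by positivity) hΨ
    rw [hs] at h5 ⊢
    rw [h3, ← h5]
    refine lintegral_congr fun a => lintegral_congr fun e => ?_
    exact lintegral_add_right_eq_self (fun u => ENNReal.ofReal (Real.exp (-2 * a - 4 * e)) *
      Ψ (Real.exp (a + e)) (Real.exp a ^ 2 * (f.D / 4 + u ^ 2) + Real.exp e ^ 2)) (f.b / 2)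
  have h7 : A * ∫⁻ z, invariantFn f Ψ z.rep ∂ν = κ * (ENNReal.ofReal (Real.pi / (2 * Real.sqrt (f.D / 4))) *
      ∫⁻ x in Ioi (0 : ℝ), ∫⁻ t in Ioi (Real.sqrt f.D * x), ENNReal.ofReal (x⁻¹ ^ 5) * Ψ x t) := by
    rw [← h1, h2, h4]
  rw [mul_assoc, mul_assoc, ← h7, ← mul_assoc, ENNReal.inv_mul_cancel hA0 hA1, one_mul]

end

/-! ### The Cartan decomposition and the normalization of the measure -/

section

open Filter Topology Set
open scoped ENNReal

theorem det_tZero {f : BForm} (hc : f.c = 1) (hD : 0 < f.D) : (tZero f).det = 1 := by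
  have hp : Real.sqrt (2 * f.c / Real.sqrt f.D) ≠ 0 := by
    rw [hc]; exact (Real.sqrt_pos.2 (by positivity)).ne'
  rw [tZero, det_fin_two_of, mul_inv_cancel₀ hp]
  ring

/-- The matrix `t₀` diagonalizes the form. -/
theorem tZero_conj {f : BForm} (hc : f.c = 1) (hD : 0 < f.D) :
    (tZero f)ᵀ * f.S * tZero f = (Real.sqrt f.D / 2) • 1 := by
  have hs := Real.sqrt_pos.2 hD
  set p := Real.sqrt (2 * f.c / Real.sqrt f.D) with hp
  have hp0 : p ≠ 0 := by
    rw [hp, hc]; exact (Real.sqrt_pos.2 (by positivity)).ne'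
  have hp2 : p ^ 2 * Real.sqrt f.D = 2 := by
    rw [hp, Real.sq_sqrt (by rw [hc]; positivity), hc]
    field_simp
  have hD2 : Real.sqrt f.D ^ 2 = 4 * f.a - f.b ^ 2 := by
    rw [Real.sq_sqrt hD.le, BForm.D, hc]; ring
  have e : tZero f = !![p, 0; -(f.b / 2) * p, p⁻¹] := by
    simp only [hp, tZero, hc, mul_one]
  have hpi : p⁻¹ ^ 2 = Real.sqrt f.D / 2 := by
    rw [inv_pow, inv_eq_iff_eq_inv, inv_div, eq_div_iff hs.ne', hp2]
  rw [e, BForm.S, hc]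
  ext i j
  fin_cases i <;> fin_cases j <;> simp [Matrix.mul_apply, Fin.sum_univ_two]
  · have h1 : p ^ 2 * (4 * f.a - f.b ^ 2) = 2 * Real.sqrt f.D := by
      rw [← hD2, sq (Real.sqrt f.D), ← mul_assoc, hp2]
    linear_combination (1 / 4) * h1
  · field_simp; ring_nf; simp
  · field_simp; ring
  · rw [← hpi]; ring

theorem tZero_mul_inv {f : BForm} (hc : f.c = 1) (hD : 0 < f.D) : tZero f * (tZero f)⁻¹ = 1 :=
  Matrix.mul_nonsing_inv _ (by rw [det_tZero hc hD]; exact isUnit_one)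

theorem tZero_inv_mul {f : BForm} (hc : f.c = 1) (hD : 0 < f.D) : (tZero f)⁻¹ * tZero f = 1 :=
  Matrix.nonsing_inv_mul _ (by rw [det_tZero hc hD]; exact isUnit_one)

theorem S_eq_tZero {f : BForm} (hc : f.c = 1) (hD : 0 < f.D) :
    f.S = (Real.sqrt f.D / 2) • ((tZero f)⁻¹ᵀ * (tZero f)⁻¹) := by
  have h1 := tZero_mul_inv hc hD
  have h2 : (tZero f)⁻¹ᵀ * (tZero f)ᵀ = 1 := by rw [← transpose_mul, h1, transpose_one]
  calc f.S = ((tZero f)⁻¹ᵀ * (tZero f)ᵀ) * f.S * (tZero f * (tZero f)⁻¹) := by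
        rw [h1, h2, Matrix.one_mul, Matrix.mul_one]
    _ = (tZero f)⁻¹ᵀ * ((tZero f)ᵀ * f.S * tZero f) * (tZero f)⁻¹ := by simp only [Matrix.mul_assoc]
    _ = _ := by rw [tZero_conj hc hD, Matrix.mul_smul, Matrix.smul_mul, Matrix.mul_one]

/-- The form of a conjugate by `t₀` is a multiple of the trace. -/
theorem tr_tZero_conj {f : BForm} (hc : f.c = 1) (hD : 0 < f.D) (Y : Matrix (Fin 2) (Fin 2) ℝ) :
    f.tr (tZero f * Y * (tZero f)ᵀ) = Real.sqrt f.D / 2 * Y.trace := by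
  have e : (f.S * (tZero f * Y * (tZero f)ᵀ)).trace = ((tZero f)ᵀ * f.S * tZero f * Y).trace := by
    rw [← Matrix.mul_assoc, trace_mul_comm]
    simp only [Matrix.mul_assoc]
  rw [BForm.tr, e, tZero_conj hc hD, Matrix.smul_mul, Matrix.one_mul, trace_smul, smul_eq_mul]

theorem cartan_blocks {f : BForm} (hc : f.c = 1) (hD : 0 < f.D) (x : ℝ) {y : ℝ} (hy : y ≠ 0) :
    (x • (tZero f * !![y, 0; 0, y⁻¹]))ᵀ * ((tZero f)⁻¹ᵀ * !![y⁻¹, 0; 0, y]) = x • 1 := by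
  have h2 : (tZero f)ᵀ * (tZero f)⁻¹ᵀ = 1 := by rw [← transpose_mul, tZero_inv_mul hc hD, transpose_one]
  have h3 : (!![y, 0; 0, y⁻¹])ᵀ * !![y⁻¹, 0; 0, y] = (1 : Matrix (Fin 2) (Fin 2) ℝ) := by
    ext i j
    fin_cases i <;> fin_cases j <;> simp [Matrix.mul_apply, Fin.sum_univ_two, hy]
  rw [transpose_smul, transpose_mul, Matrix.smul_mul, Matrix.mul_assoc, ← Matrix.mul_assoc (tZero f)ᵀ, h2,
    Matrix.one_mul, h3]

/-- The double coset representative as an element of `GSp₄(ℝ)`. -/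
def cartanG {f : BForm} (hc : f.c = 1) (hD : 0 < f.D) {x y : ℝ} (hx : x ≠ 0) (hy : y ≠ 0) : GSp4 :=
  diagG (x • (tZero f * !![y, 0; 0, y⁻¹])) ((tZero f)⁻¹ᵀ * !![y⁻¹, 0; 0, y]) x hx
    (cartan_blocks hc hD x hy)

theorem pt_cartanG {f : BForm} (hc : f.c = 1) (hD : 0 < f.D) {x y : ℝ} (hx : x ≠ 0) (hy : y ≠ 0)
    {k : GSp4} (hk : ptRe k = 0 ∧ ptIm k = 1) :
    ptRe (cartanG hc hD hx hy * k) = 0 ∧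
      ptIm (cartanG hc hD hx hy * k) = tZero f * !![x * y ^ 2, 0; 0, x * y⁻¹ ^ 2] * (tZero f)ᵀ := by
  have h := pt_diagG hx (cartan_blocks hc hD x hy) k
  rw [hk.1, hk.2] at h
  refine ⟨h.1.trans (by simp), h.2.trans ?_⟩
  have e : !![y, 0; 0, y⁻¹] * (!![y, 0; 0, y⁻¹])ᵀ = !![y ^ 2, 0; 0, y⁻¹ ^ 2] := by
    ext i j
    fin_cases i <;> fin_cases j <;> simp [Matrix.mul_apply, Fin.sum_univ_two, sq]
  rw [Matrix.mul_one, transpose_smul, Matrix.smul_mul, Matrix.mul_smul, smul_smul, smul_smul,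
    inv_mul_cancel₀ hx, one_mul, transpose_mul, Matrix.mul_assoc, ← Matrix.mul_assoc !![y, 0; 0, y⁻¹], e,
    ← Matrix.mul_smul, ← Matrix.smul_mul, Matrix.mul_assoc]
  congr 2
  ext i j
  fin_cases i <;> fin_cases j <;> simp

theorem pt_of_toC_mem_KInf {k : GSp4} (hk : toC (mat k) ∈ KInf) : ptRe k = 0 ∧ ptIm k = 1 := by
  have h1 : point k = point 1 := by
    have := ptRe_one
    have e1 := point_eq 1
    rw [this.1, this.2] at e1
    rw [e1, point, (mem_KInf_iff.1 hk).2, basePoint]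
    ext i j
    fin_cases i <;> fin_cases j <;> simp [toC]
  rw [ptRe, ptIm, h1]
  exact ptRe_one

/-- Symmetric real `2 × 2` matrices are diagonalized by a rotation. -/
theorem exists_rotation (α β δ : ℝ) : ∃ ρ : Matrix (Fin 2) (Fin 2) ℝ, ρ * ρᵀ = 1 ∧ ρ.det = 1 ∧
    ∃ p q : ℝ, q ≤ p ∧ ρ * !![α, β; β, δ] * ρᵀ = !![p, 0; 0, q] := by
  set w : ℂ := ⟨(α - δ) / 2, β⟩ with hw
  set φ := Complex.arg w
  have h1 : ‖w‖ * Real.cos φ = (α - δ) / 2 := Complex.norm_mul_cos_arg w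
  have h2 : ‖w‖ * Real.sin φ = β := Complex.norm_mul_sin_arg w
  set c := Real.cos (φ / 2) with hc
  set s := Real.sin (φ / 2) with hs
  have hcs : c ^ 2 + s ^ 2 = 1 := Real.cos_sq_add_sin_sq _
  have h3 : Real.cos φ = c ^ 2 - s ^ 2 := by
    rw [← mul_div_cancel₀ φ (two_ne_zero (α := ℝ)), Real.cos_two_mul']
  have h4 : Real.sin φ = 2 * s * c := by
    conv_lhs => rw [← mul_div_cancel₀ φ (two_ne_zero (α := ℝ)), Real.sin_two_mul]
  rw [h3] at h1
  rw [h4] at h2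
  have hα : α = δ + 2 * (‖w‖ * (c ^ 2 - s ^ 2)) := by linarith
  refine ⟨!![c, s; -s, c], ?_, ?_, δ + ‖w‖ * (c ^ 2 - s ^ 2) + ‖w‖, δ + ‖w‖ * (c ^ 2 - s ^ 2) - ‖w‖,
    by linarith [norm_nonneg w], ?_⟩
  · ext i j
    fin_cases i <;> fin_cases j <;> simp [Matrix.mul_apply, Fin.sum_univ_two] <;> linarith
  · simp [det_fin_two]; linarith
  · ext i j
    rw [conj_apply]
    fin_cases i <;> fin_cases j <;> simp
    · rw [hα, ← h2]
      linear_combination (δ + ‖w‖ * (c ^ 2 - s ^ 2) + ‖w‖ * (c ^ 2 + s ^ 2 + 1)) * hcs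
    · rw [hα, ← h2]; ring
    · rw [hα, ← h2]; ring
    · rw [hα, ← h2]
      linear_combination (δ + ‖w‖ * (c ^ 2 - s ^ 2) - ‖w‖ * (c ^ 2 + s ^ 2 + 1)) * hcs

/-- The element of the Bessel subgroup given by a matrix of determinant one in the torus. -/
theorem exists_torusG {f : BForm} {T : Matrix (Fin 2) (Fin 2) ℝ} (hT : T.det = 1) (hS : Tᵀ * f.S * T = f.S) :
    ∃ r ∈ besselR f, mult (mat r) = 1 ∧ ∀ h, ptRe (r * h) = T * ptRe h * Tᵀ ∧ ptIm (r * h) = T * ptIm h * Tᵀ := by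
  have hu : IsUnit T.det := by rw [hT]; exact isUnit_one
  have h1 : Tᵀ * T⁻¹ᵀ = (1 : ℝ) • 1 := by
    rw [← transpose_mul, Matrix.nonsing_inv_mul _ hu, transpose_one, one_smul]
  set t : GL2 := ⟨T, T⁻¹, Matrix.mul_nonsing_inv _ hu, Matrix.nonsing_inv_mul _ hu⟩ with ht
  have e1 : (t : Matrix (Fin 2) (Fin 2) ℝ) = T := rfl
  have e2 : ((t⁻¹ : GL2) : Matrix (Fin 2) (Fin 2) ℝ) = T⁻¹ := rfl
  refine ⟨diagG T T⁻¹ᵀ 1 one_ne_zero h1, ⟨t, ?_, 0, by simp, ?_⟩, mult_diagG one_ne_zero h1, fun h => ?_⟩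
  · rw [mem_torus_iff, e1, hS, hT, one_smul]
  · rw [unip_zero, Matrix.mul_one, levi, e1, e2, hT, one_smul]
    rfl
  · have := pt_diagG one_ne_zero h1 h
    rwa [inv_one, one_smul, one_smul] at this

/-- The coordinates of the coset of `cartan x y`. -/
theorem invariants_cartanG {f : BForm} (hc : f.c = 1) (hD : 0 < f.D) {x y : ℝ} (hx : 0 < x) (hy : 0 < y)
    {k : GSp4} (hk : ptRe k = 0 ∧ ptIm k = 1) :
    Real.sqrt (ptIm (cartanG hc hD hx.ne' hy.ne' * k)).det = x ∧
      f.tr (ptIm (cartanG hc hD hx.ne' hy.ne' * k)) = Real.sqrt f.D / 2 * (x * y ^ 2 + x * y⁻¹ ^ 2) := by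
  rw [(pt_cartanG hc hD hx.ne' hy.ne' hk).2, tr_tZero_conj hc hD, det_mul, det_mul, det_transpose,
    det_tZero hc hD, det_fin_two_of, trace_fin_two_of]
  refine ⟨?_, rfl⟩
  rw [Real.sqrt_eq_iff_mul_self_eq _ hx.le]
  · field_simp
    ring
  · have : 0 < x * y ^ 2 * (x * y⁻¹ ^ 2) := by positivity
    linarith

theorem range_of_mem_Icc {y : ℝ} (hy : y ∈ Icc (1 : ℝ) 2) : 2 ≤ y ^ 2 + y⁻¹ ^ 2 ∧ y ^ 2 + y⁻¹ ^ 2 ≤ 17 / 4 := by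
  have hy0 : 0 < y := by linarith [hy.1]
  have e : y ^ 2 * (y ^ 2 + y⁻¹ ^ 2) = (y ^ 2) ^ 2 + 1 := by field_simp
  have h1 : 1 ≤ y ^ 2 := by nlinarith [hy.1]
  have h2 : y ^ 2 ≤ 4 := by nlinarith [hy.2]
  have h3 : 0 < y ^ 2 := by positivity
  constructor
  · refine le_of_mul_le_mul_left ?_ h3
    rw [e]; nlinarith [sq_nonneg (y ^ 2 - 1)]
  · refine le_of_mul_le_mul_left ?_ h3
    rw [e]; nlinarith [mul_nonneg (sub_nonneg.2 h1) (sub_nonneg.2 h2)]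

/-- Every element of positive multiplier is in the double coset of some `cartan x y`. -/
theorem exists_cartan {f : BForm} (hc : f.c = 1) (hD : 0 < f.D) {h : GSp4} (hμ : 0 < mult (mat h)) :
    ∃ x y : ℝ, ∃ hx : 0 < x, ∃ hy : 1 ≤ y, ∃ r ∈ besselR f, ∃ k : GSp4, toC (mat k) ∈ KInf ∧
      r * h = cartanG hc hD hx.ne' (zero_lt_one.trans_le hy).ne' * k := by
  have hd := det_ptIm_pos h hμ
  set Y := ptIm h with hY
  set Y' := (tZero f)⁻¹ * Y * (tZero f)⁻¹ᵀ with hY'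
  have h1 := tZero_mul_inv hc hD
  have h1' := tZero_inv_mul hc hD
  have h2 : (tZero f)⁻¹ᵀ * (tZero f)ᵀ = 1 := by rw [← transpose_mul, h1, transpose_one]
  have hYY : Y = tZero f * Y' * (tZero f)ᵀ := by
    calc Y = (tZero f * (tZero f)⁻¹) * Y * ((tZero f)⁻¹ᵀ * (tZero f)ᵀ) := by
          rw [h1, h2, Matrix.one_mul, Matrix.mul_one]
      _ = _ := by simp only [hY', Matrix.mul_assoc]
  have hYt : Yᵀ = Y := by
    ext i j
    exact ptIm_symm h j i
  have hsym : Y' 1 0 = Y' 0 1 := by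
    have : Y'ᵀ = Y' := by
      rw [hY', transpose_mul, transpose_mul, transpose_transpose, hYt, Matrix.mul_assoc]
    exact congrFun (congrFun this 0) 1
  clear_value Y'
  have hdet : Y'.det = Y.det := by
    have := congrArg Matrix.det hYY
    rwa [det_mul, det_mul, det_transpose, det_tZero hc hD, one_mul, mul_one, eq_comm] at this
  obtain ⟨ρ, hρ, hρd, p, q, hpq, hdiag⟩ := exists_rotation (Y' 0 0) (Y' 0 1) (Y' 1 1)
  have hρ' : ρᵀ * ρ = 1 := mul_eq_one_comm.1 hρ
  have eY : Y' = !![Y' 0 0, Y' 0 1; Y' 0 1, Y' 1 1] := by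
    conv_lhs => rw [eta_fin_two Y', hsym]
  rw [← eY] at hdiag
  have hpqd : p * q = Y.det := by
    have := congrArg Matrix.det hdiag
    rw [det_mul, det_mul, det_transpose, hρd, det_fin_two_of, hdet] at this
    linarith
  have htr : f.tr Y = Real.sqrt f.D / 2 * (p + q) := by
    rw [hYY, tr_tZero_conj hc hD]
    have := congrArg Matrix.trace hdiag
    rw [trace_mul_comm, ← Matrix.mul_assoc, hρ', Matrix.one_mul, trace_fin_two_of] at this
    rw [this]
  have hs := Real.sqrt_pos.2 hD
  have hpq0 : 0 < p ∧ 0 < q := by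
    have h3 : 0 < p + q := by
      have h4 : 0 < f.tr Y := by
        obtain ⟨-, e⟩ := coord_spec hc h hμ
        rw [← hY] at e
        rw [e]; positivity
      rw [htr] at h4
      exact (mul_pos_iff_of_pos_left (by positivity)).1 h4
    have h5 : 0 < p * q := hpqd ▸ hd
    have h6 : 0 < p := by linarith
    exact ⟨h6, (mul_pos_iff_of_pos_left h6).1 h5⟩
  obtain ⟨hp0, hq0⟩ := hpq0
  set x := Real.sqrt (p * q) with hx
  have hx0 : 0 < x := Real.sqrt_pos.2 (mul_pos hp0 hq0)
  have hx2 : x ^ 2 = p * q := Real.sq_sqrt (mul_pos hp0 hq0).le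
  have hqx : q ≤ x := Real.le_sqrt_of_sq_le (by nlinarith)
  set y := Real.sqrt (p / x) with hy
  have hxp : x ≤ p := by
    rw [hx]; exact Real.sqrt_le_iff.2 ⟨hp0.le, by nlinarith⟩
  have hy1 : 1 ≤ y := Real.one_le_sqrt.2 ((one_le_div hx0).2 hxp)
  have hy0 : 0 < y := zero_lt_one.trans_le hy1
  have hy2 : y ^ 2 = p / x := Real.sq_sqrt (by positivity)
  have hxy : x * y ^ 2 = p ∧ x * y⁻¹ ^ 2 = q := by
    rw [inv_pow, hy2]
    constructor
    · field_simp
    · field_simp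
      linarith
  refine ⟨x, y, hx0, hy1, ?_⟩
  -- the torus element with conjugate `ρ`
  set T := tZero f * ρ * (tZero f)⁻¹ with hT
  have hTd : T.det = 1 := by
    rw [hT, det_mul, det_mul, hρd, mul_one, ← det_mul, h1, det_one]
  have hTS : Tᵀ * f.S * T = f.S := by
    have e : Tᵀ * f.S * T = (tZero f)⁻¹ᵀ * (ρᵀ * ((tZero f)ᵀ * f.S * tZero f) * ρ) * (tZero f)⁻¹ := by
      simp only [hT, transpose_mul, Matrix.mul_assoc]
    rw [e, tZero_conj hc hD, Matrix.mul_smul, Matrix.mul_one, Matrix.smul_mul, hρ', Matrix.mul_smul,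
      Matrix.smul_mul, Matrix.mul_one, ← S_eq_tZero hc hD]
  have hTY : T * Y * Tᵀ = tZero f * !![x * y ^ 2, 0; 0, x * y⁻¹ ^ 2] * (tZero f)ᵀ := by
    rw [hxy.1, hxy.2, ← hdiag]
    simp only [hT, hY', transpose_mul, Matrix.mul_assoc]
  obtain ⟨r₁, hr₁, hm₁, H₁⟩ := exists_torusG hTd hTS
  have hz0 : Real.sqrt (x / mult (mat h)) ≠ 0 := (Real.sqrt_pos.2 (by positivity)).ne'
  set h₁ := r₁ * h with hh₁
  have hXs : (-ptRe h₁)ᵀ = -ptRe h₁ := by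
    ext i j
    simp [ptRe_symm h₁ j i]
  set h₂ := scalarG _ hz0 * (transG _ hXs * h₁) with hh₂
  have hX2 : ptRe h₂ = 0 := by
    rw [(pt_scalarG _ hz0 _).1, (ptRe_transG _ hXs h₁).1, add_neg_cancel]
  have hY2 : ptIm h₂ = T * Y * Tᵀ := by
    rw [(pt_scalarG _ hz0 _).2.1, (ptRe_transG _ hXs h₁).2, (H₁ h).2]
  have hm2 : mult (mat h₂) = x := by
    rw [(pt_scalarG _ hz0 _).2.2, mult_mul, mult_transG, hh₁, mult_mul, hm₁, one_mul, one_mul,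
      Real.sq_sqrt (by positivity)]
    field_simp
  have hk1 : ptRe (1 : GSp4) = 0 ∧ ptIm (1 : GSp4) = 1 := ptRe_one
  have hC := pt_cartanG hc hD hx0.ne' hy0.ne' hk1
  rw [mul_one] at hC
  set g := cartanG hc hD hx0.ne' hy0.ne' with hg
  have hmg : mult (mat g) = x := mult_diagG hx0.ne' (cartan_blocks hc hD x hy0.ne')
  have hpt : point h₂ = point g := by
    rw [point_eq h₂, point_eq g, hX2, hY2, hC.1, hC.2, hTY]
  refine ⟨scalarG _ hz0 * (transG _ hXs * r₁), mul_mem (scalarG_mem f _ hz0)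
    (mul_mem (transG_mem f _ hXs) hr₁), g⁻¹ * h₂, ?_, ?_⟩
  · rw [mem_KInf_iff]
    have hm3 : mult (mat (g⁻¹ * h₂)) = 1 := by
      have : mult (mat (g * (g⁻¹ * h₂))) = x := by rw [mul_inv_cancel_left, hm2]
      rw [mult_mul, hmg] at this
      exact mul_left_cancel₀ hx0.ne' (this.trans (mul_one x).symm)
    refine ⟨hm3 ▸ isGU_mat (g⁻¹ * h₂), ?_⟩
    change point (g⁻¹ * h₂) = basePoint
    rw [point_mul, hpt, ← point_mul, inv_mul_cancel, point_eq, ptRe_one.1, ptRe_one.2, basePoint]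
    ext i j
    fin_cases i <;> fin_cases j <;> simp [toC]
  · rw [mul_inv_cancel_left, mul_assoc, mul_assoc]

/-- The set `unitBox` in the coordinates `√det Y` and `tr(SY)`. -/
theorem mem_unitBox_iff {f : BForm} (hc : f.c = 1) (hD : 0 < f.D) (z : BesselQuot f) :
    z ∈ unitBox f ↔ 0 < mult (mat z.rep) ∧ Real.sqrt (ptIm z.rep).det ∈ Icc (1 : ℝ) 2 ∧
      f.tr (ptIm z.rep) ∈ Icc (Real.sqrt f.D * Real.sqrt (ptIm z.rep).det)
        (17 / 8 * Real.sqrt f.D * Real.sqrt (ptIm z.rep).det) := by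
  have hs := Real.sqrt_pos.2 hD
  constructor
  · rintro ⟨h, rfl, x, hx, y, hy, k, hk, e⟩
    have hx0 : 0 < x := by linarith [hx.1]
    have hy0 : 0 < y := by linarith [hy.1]
    obtain ⟨r, hr, er⟩ := mk_eq_mk.1 (mk_rep (BesselQuot.mk f h))
    rw [er, mult_besselR_mul_pos hc hD hr, det_ptIm_besselR hc hD hr, tr_ptIm_besselR hc hD hr]
    set g := cartanG hc hD hx0.ne' hy0.ne' with hg
    have hmg : mult (mat g) = x := mult_diagG hx0.ne' (cartan_blocks hc hD x hy0.ne')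
    have ek : mat (g⁻¹ * h) = k := by
      have e' : mat h = mat g * k := e
      have e1 : mat g⁻¹ * mat g = 1 := by rw [← mat_mul, inv_mul_cancel]; rfl
      rw [mat_mul, e', ← Matrix.mul_assoc, e1, Matrix.one_mul]
    have hkK : toC (mat (g⁻¹ * h)) ∈ KInf := ek ▸ hk
    have eh : h = g * (g⁻¹ * h) := by rw [mul_inv_cancel_left]
    obtain ⟨i1, i2⟩ := invariants_cartanG hc hD hx0 hy0 (pt_of_toC_mem_KInf hkK)
    rw [← hg, ← eh] at i1 i2
    have hmk : mult (mat (g⁻¹ * h)) = 1 :=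
      IsGU.unique (isGU_mat _) (mem_KInf_iff.1 hkK).1
    rw [i1, i2]
    obtain ⟨r1, r2⟩ := range_of_mem_Icc hy
    refine ⟨?_, hx, ?_, ?_⟩
    · rw [eh, mult_mul, hmg, hmk, mul_one]; exact hx0
    · nlinarith [mul_le_mul_of_nonneg_left r1 (mul_pos hs hx0).le]
    · nlinarith [mul_le_mul_of_nonneg_left r2 (mul_pos hs hx0).le]
  · rintro ⟨hμ, hdet, -, htr⟩
    obtain ⟨x, y, hx0, hy1, r, hr, k, hk, e⟩ := exists_cartan hc hD hμ
    have hy0 := zero_lt_one.trans_le hy1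
    obtain ⟨i1, i2⟩ := invariants_cartanG hc hD hx0 hy0 (pt_of_toC_mem_KInf hk)
    rw [← e, det_ptIm_besselR hc hD hr] at i1
    rw [← e, tr_ptIm_besselR hc hD hr] at i2
    rw [i1] at hdet htr
    rw [i2] at htr
    refine ⟨r * z.rep, ?_, x, hdet, y, ⟨hy1, ?_⟩, mat k, hk, congrArg mat e⟩
    · rw [mk_eq_mk.2 ⟨r, hr, rfl⟩, mk_rep]
    · have h1 : y ^ 2 + y⁻¹ ^ 2 ≤ 17 / 4 := by
        have h2 : 0 < Real.sqrt f.D * x := mul_pos hs hx0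
        refine le_of_mul_le_mul_left ?_ h2
        linarith
      have e : y ^ 2 * (y ^ 2 + y⁻¹ ^ 2) = (y ^ 2) ^ 2 + 1 := by field_simp
      have h3 := mul_le_mul_of_nonneg_left h1 (sq_nonneg y)
      rw [e] at h3
      by_contra hlt
      have h4 : 0 < y ^ 2 - 4 := by nlinarith [not_le.1 hlt]
      nlinarith [mul_pos h4 (show 0 < y ^ 2 - 1 / 4 by linarith)]

/-- The integral of the indicator of `unitBox`, which determines the constant. -/
theorem lintegral_invariantFn_unitBox {D : ℝ} (hD : 0 < D) :
    ∫⁻ x in Ioi (0 : ℝ), ∫⁻ t in Ioi (Real.sqrt D * x), ENNReal.ofReal (x⁻¹ ^ 5) *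
      (if x ∈ Icc (1 : ℝ) 2 ∧ t ∈ Icc (Real.sqrt D * x) (17 / 8 * Real.sqrt D * x) then 1 else 0) =
      ENNReal.ofReal (Real.sqrt D * (9 / 8) * (7 / 24)) := by
  have hs := Real.sqrt_pos.2 hD
  have h1 : ∀ x ∈ Ioi (0 : ℝ), (∫⁻ t in Ioi (Real.sqrt D * x), ENNReal.ofReal (x⁻¹ ^ 5) *
      (if x ∈ Icc (1 : ℝ) 2 ∧ t ∈ Icc (Real.sqrt D * x) (17 / 8 * Real.sqrt D * x) then 1 else 0)) =
      (Icc (1 : ℝ) 2).indicator (fun x => ENNReal.ofReal (Real.sqrt D * (9 / 8) * x⁻¹ ^ 4)) x := by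
    intro x hx
    have hx0 : (0 : ℝ) < x := hx
    by_cases hm : x ∈ Icc (1 : ℝ) 2
    · have e : ∀ t ∈ Ioi (Real.sqrt D * x), (ENNReal.ofReal (x⁻¹ ^ 5) *
          (if x ∈ Icc (1 : ℝ) 2 ∧ t ∈ Icc (Real.sqrt D * x) (17 / 8 * Real.sqrt D * x) then 1 else 0)) =
          (Iic (17 / 8 * Real.sqrt D * x)).indicator (fun _ => ENNReal.ofReal (x⁻¹ ^ 5)) t := by
        intro t ht
        have ht' : Real.sqrt D * x < t := ht
        by_cases h : t ≤ 17 / 8 * Real.sqrt D * x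
        · rw [if_pos ⟨hm, ht'.le, h⟩, indicator_of_mem (mem_Iic.2 h), mul_one]
        · rw [if_neg (fun hh => h hh.2.2), indicator_of_notMem (s := Iic (17 / 8 * Real.sqrt D * x)) h,
            mul_zero]
      rw [setLIntegral_congr_fun measurableSet_Ioi e, lintegral_indicator measurableSet_Iic,
        Measure.restrict_restrict measurableSet_Iic, inter_comm, Ioi_inter_Iic, setLIntegral_const,
        Real.volume_Ioc, indicator_of_mem hm, ← ENNReal.ofReal_mul (by positivity)]
      congr 1
      field_simp
      ring
    · rw [indicator_of_notMem hm]
      simp [hm]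
  have hc : ContinuousOn (fun x : ℝ => Real.sqrt D * (9 / 8) * x⁻¹ ^ 4) (Icc 1 2) := by
    refine continuousOn_const.mul ((continuousOn_inv₀.mono ?_).pow 4)
    intro x hx
    exact (zero_lt_one.trans_le hx.1).ne'
  rw [setLIntegral_congr_fun measurableSet_Ioi h1, lintegral_indicator measurableSet_Icc,
    Measure.restrict_restrict measurableSet_Icc,
    inter_eq_left.2 (show Icc (1 : ℝ) 2 ⊆ Ioi 0 from fun x hx => zero_lt_one.trans_le hx.1),
    ← ofReal_integral_eq_lintegral_ofReal hc.integrableOn_Icc]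
  · congr 1
    rw [integral_Icc_eq_integral_Ioc, ← intervalIntegral.integral_of_le one_le_two,
      intervalIntegral.integral_const_mul]
    congr 1
    have h2 : ∫ x in (1 : ℝ)..2, x⁻¹ ^ 4 = ∫ x in (1 : ℝ)..2, x ^ (-4 : ℤ) := by
      refine intervalIntegral.integral_congr fun x _ => ?_
      rw [_root_.zpow_neg, inv_pow]
      norm_cast
    rw [h2, integral_zpow (Or.inr ⟨by norm_num, by
      rw [uIcc_of_le one_le_two]; exact fun h => absurd h.1 (by norm_num)⟩)]
    norm_num
  · exact Eventually.of_forall fun x => by positivity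

theorem integral_normalization : ∫ x in (1 : ℝ)..2, ∫ y in (1 : ℝ)..2, (y - y⁻¹ ^ 3) * x⁻¹ ^ 4 =
    9 / 8 * (7 / 24) := by
  have h0 : (0 : ℝ) ∉ uIcc (1 : ℝ) 2 := by
    rw [uIcc_of_le one_le_two]; exact fun h => absurd h.1 (by norm_num)
  have hn : ∀ n : ℕ, ∫ x in (1 : ℝ)..2, x⁻¹ ^ n = ∫ x in (1 : ℝ)..2, x ^ (-(n : ℤ)) := by
    intro n
    refine intervalIntegral.integral_congr fun x _ => ?_
    rw [_root_.zpow_neg, inv_pow, zpow_natCast]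
  have h3 : ∫ y in (1 : ℝ)..2, (y - y⁻¹ ^ 3) = 9 / 8 := by
    rw [intervalIntegral.integral_sub (f := fun y : ℝ => y) (continuous_id.intervalIntegrable 1 2), hn, integral_id,
      integral_zpow (Or.inr ⟨by norm_num, h0⟩)]
    · norm_num
    · refine ContinuousOn.intervalIntegrable ((continuousOn_inv₀.mono ?_).pow 3)
      intro x hx
      exact fun h => h0 (h ▸ hx)
  simp only [intervalIntegral.integral_mul_const, intervalIntegral.integral_const_mul, h3, hn]
  rw [integral_zpow (Or.inr ⟨by norm_num, h0⟩)]
  norm_num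

/-- The invariant measure on functions of `x = √det Y` and `t = tr(SY)`. -/
theorem lintegral_invariantFn {f : BForm} (hc : f.c = 1) (hD : 0 < f.D)
    {ν : Measure (BesselQuot f)} (hν : IsInvariantMeasure f ν) {Ψ : ℝ → ℝ → ℝ≥0∞}
    (hΨ : Measurable (Function.uncurry Ψ)) :
    ∫⁻ z, invariantFn f Ψ z.rep ∂ν = ENNReal.ofReal (Real.pi / Real.sqrt f.D) *
      ∫⁻ x in Ioi (0 : ℝ), ∫⁻ t in Ioi (Real.sqrt f.D * x), ENNReal.ofReal (x⁻¹ ^ 5) * Ψ x t := by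
  obtain ⟨C, hC⟩ := exists_lintegral_invariantFn hc hD hν
  have hs := Real.sqrt_pos.2 hD
  rw [hC Ψ hΨ]
  congr 1
  set Φ : ℝ → ℝ → ℝ≥0∞ := fun x t =>
    if x ∈ Icc (1 : ℝ) 2 ∧ t ∈ Icc (Real.sqrt f.D * x) (17 / 8 * Real.sqrt f.D * x) then 1 else 0 with hΦ
  have hΦm : Measurable (Function.uncurry Φ) := by
    refine Measurable.ite ?_ measurable_const measurable_const
    exact (measurable_fst measurableSet_Icc).inter ((measurableSet_le (by fun_prop) measurable_snd).inter
      (measurableSet_le measurable_snd (by fun_prop)))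
  have h1 : ∀ z : BesselQuot f, invariantFn f Φ z.rep = (unitBox f).indicator 1 z := by
    intro z
    by_cases hz : z ∈ unitBox f
    · obtain ⟨h1, h2⟩ := (mem_unitBox_iff hc hD z).1 hz
      rw [indicator_of_mem hz, invariantFn, if_pos h1, hΦ]
      exact if_pos h2
    · rw [indicator_of_notMem hz, invariantFn]
      split_ifs with h1
      · exact if_neg fun h2 => hz ((mem_unitBox_iff hc hD z).2 ⟨h1, h2⟩)
      · rfl
  have hm : MeasurableSet (unitBox f) := by
    have e : unitBox f = (fun z : BesselQuot f => invariantFn f Φ z.rep) ⁻¹' {1} := by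
      ext z
      rw [mem_preimage, h1, mem_singleton_iff]
      by_cases hz : z ∈ unitBox f <;> simp [hz]
    rw [e]
    exact measurable_invariantFn_rep hc hD hΦm (measurableSet_singleton 1)
  have h2 := hC Φ hΦm
  simp only [h1] at h2
  rw [lintegral_indicator_one hm, hν.normalized, integral_normalization,
    lintegral_invariantFn_unitBox hD] at h2
  have h3 : ENNReal.ofReal (Real.sqrt f.D * (9 / 8) * (7 / 24)) ≠ 0 := by
    rw [Ne, ENNReal.ofReal_eq_zero, not_le]; positivity
  rw [← ENNReal.mul_left_inj h3 ENNReal.ofReal_ne_top, ← h2, ← ENNReal.ofReal_mul (by positivity)]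
  congr 1
  field_simp

end

/-! ### Product coordinates -/

section

open Filter Topology Set
open scoped ENNReal

/-- The measure `v⁻⁵ dv` on `(0, b)`. -/
def lowMeasure (b : ℝ) : Measure ℝ :=
  (volume.restrict (Ioo 0 b)).withDensity fun v => ENNReal.ofReal (v⁻¹ ^ 5)

/-- The measure `t⁻⁴ dt` on `(0, ∞)`. -/
def heightMeasure : Measure ℝ :=
  (volume.restrict (Ioi 0)).withDensity fun t => ENNReal.ofReal (t⁻¹ ^ 4)

instance (b : ℝ) : SigmaFinite (lowMeasure b) := SigmaFinite.withDensity_ofReal _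

instance : SigmaFinite heightMeasure := SigmaFinite.withDensity_ofReal _

theorem lintegral_lowMeasure (b : ℝ) {F : ℝ → ℝ≥0∞} (hF : Measurable F) :
    ∫⁻ v, F v ∂lowMeasure b = ∫⁻ v in Ioo 0 b, ENNReal.ofReal (v⁻¹ ^ 5) * F v :=
  lintegral_withDensity_eq_lintegral_mul _ (by fun_prop) hF

theorem lintegral_heightMeasure {F : ℝ → ℝ≥0∞} (hF : Measurable F) :
    ∫⁻ t, F t ∂heightMeasure = ∫⁻ t in Ioi 0, ENNReal.ofReal (t⁻¹ ^ 4) * F t :=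
  lintegral_withDensity_eq_lintegral_mul _ (by fun_prop) hF

/-- In the coordinates `v = x / t` and `t` the measure `x⁻⁵ dx dt` on `0 < δ x < t` is a product. -/
theorem lintegral_cone {δ : ℝ} (hδ : 0 < δ) {Ψ : ℝ → ℝ → ℝ≥0∞} (hΨ : Measurable (Function.uncurry Ψ)) :
    ∫⁻ x in Ioi (0 : ℝ), ∫⁻ t in Ioi (δ * x), ENNReal.ofReal (x⁻¹ ^ 5) * Ψ (x / t) t =
      ∫⁻ p, Ψ p.1 p.2 ∂(lowMeasure δ⁻¹).prod heightMeasure := by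
  have hΨ' : Measurable fun p : ℝ × ℝ => Ψ p.1 p.2 := hΨ
  have hΨ2 : ∀ t, Measurable fun v => Ψ v t := fun t => hΨ.comp measurable_prodMk_right
  have hm : Measurable fun p : ℝ × ℝ => ENNReal.ofReal (p.1⁻¹ ^ 5) * Ψ (p.1 / p.2) p.2 := by
    have h1 : Measurable fun p : ℝ × ℝ => Ψ (p.1 / p.2) p.2 :=
      hΨ'.comp ((measurable_fst.div measurable_snd).prodMk measurable_snd)
    fun_prop
  have hS : MeasurableSet {p : ℝ × ℝ | 0 < p.1 ∧ δ * p.1 < p.2} :=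
    (measurableSet_lt measurable_const measurable_fst).inter
      (measurableSet_lt (measurable_fst.const_mul δ) measurable_snd)
  -- the integrand, extended by zero
  set G : ℝ × ℝ → ℝ≥0∞ := {p : ℝ × ℝ | 0 < p.1 ∧ δ * p.1 < p.2}.indicator
    fun p => ENNReal.ofReal (p.1⁻¹ ^ 5) * Ψ (p.1 / p.2) p.2 with hG
  have hGm : Measurable G := hm.indicator hS
  have e1 : ∫⁻ x in Ioi (0 : ℝ), ∫⁻ t in Ioi (δ * x), ENNReal.ofReal (x⁻¹ ^ 5) * Ψ (x / t) t =
      ∫⁻ x, ∫⁻ t, G (x, t) := by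
    rw [← lintegral_indicator measurableSet_Ioi]
    refine lintegral_congr fun x => ?_
    by_cases hx : x ∈ Ioi (0 : ℝ)
    · rw [indicator_of_mem hx, ← lintegral_indicator measurableSet_Ioi]
      refine lintegral_congr fun t => ?_
      have hx' : 0 < x := hx
      simp only [hG, indicator, mem_Ioi, mem_ofPred_eq, hx', true_and]
    · rw [indicator_of_notMem hx]
      have hx' : ¬ 0 < x := hx
      simp [hG, hx']
  rw [e1, lintegral_lintegral_swap (f := fun x t => G (x, t)) hGm.aemeasurable,
    lintegral_prod_symm _ hΨ'.aemeasurable, lintegral_heightMeasure (hΨ'.lintegral_prod_left'),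
    ← lintegral_indicator measurableSet_Ioi]
  refine lintegral_congr fun t => ?_
  by_cases ht : t ∈ Ioi (0 : ℝ)
  · have ht' : 0 < t := ht
    rw [indicator_of_mem ht, lintegral_lowMeasure _ (hΨ2 t)]
    have hm1 : Measurable fun v => ENNReal.ofReal (v⁻¹ ^ 5) * Ψ v t := by
      have := hΨ2 t
      fun_prop
    have h1 := lintegral_comp_mul (f := fun x => G (x, t)) (hGm.comp measurable_prodMk_right) ht'
    have h2 : ∀ v, G (t * v, t) = ENNReal.ofReal (t⁻¹ ^ 5) *
        (Ioo 0 δ⁻¹).indicator (fun v => ENNReal.ofReal (v⁻¹ ^ 5) * Ψ v t) v := by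
      intro v
      have e2 : (t * v, t) ∈ {p : ℝ × ℝ | 0 < p.1 ∧ δ * p.1 < p.2} ↔ v ∈ Ioo 0 δ⁻¹ := by
        rw [mem_ofPred_eq, mem_Ioo, mul_pos_iff_of_pos_left ht', mul_left_comm,
          mul_lt_iff_lt_one_right ht', ← lt_div_iff₀' hδ, one_div]
      by_cases hv : v ∈ Ioo 0 δ⁻¹
      · rw [hG, indicator_of_mem (e2.2 hv), indicator_of_mem hv]
        dsimp only
        rw [mul_div_cancel_left₀ v ht'.ne', mul_inv, mul_pow, ENNReal.ofReal_mul (by positivity), mul_assoc]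
      · rw [hG, indicator_of_notMem (fun h => hv (e2.1 h)), indicator_of_notMem hv, mul_zero]
    simp only [h2] at h1
    rw [lintegral_const_mul _ (hm1.indicator measurableSet_Ioo), lintegral_indicator measurableSet_Ioo] at h1
    have h3 : ENNReal.ofReal t * ENNReal.ofReal t⁻¹ = 1 := by
      rw [← ENNReal.ofReal_mul ht'.le, mul_inv_cancel₀ ht'.ne', ENNReal.ofReal_one]
    have h4 : ENNReal.ofReal t * ENNReal.ofReal (t⁻¹ ^ 5) = ENNReal.ofReal (t⁻¹ ^ 4) := by
      rw [← ENNReal.ofReal_mul ht'.le]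
      congr 1
      field_simp
    calc _ = (ENNReal.ofReal t * ENNReal.ofReal t⁻¹) * ∫⁻ x, G (x, t) := by rw [h3, one_mul]
      _ = _ := by rw [mul_assoc, ← h1, ← mul_assoc, h4]
  · rw [indicator_of_notMem ht, lintegral_eq_zero_iff (f := fun x => G (x, t))
      (hGm.comp measurable_prodMk_right)]
    filter_upwards with x
    rw [hG, Pi.zero_apply]
    refine indicator_of_notMem ?_ _
    rintro ⟨h1, h2⟩
    exact ht ((mul_pos hδ h1).trans h2)

/-- The cosets of positive multiplier. -/
def positiveCosets (f : BForm) : Set (BesselQuot f) := {z | 0 < mult (mat z.rep)}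

/-- The coordinates `√det Y / tr(SY)` and `tr(SY)` of a coset. -/
def cosetCoord (f : BForm) (z : BesselQuot f) : ℝ × ℝ :=
  (Real.sqrt (ptIm z.rep).det / f.tr (ptIm z.rep), f.tr (ptIm z.rep))

theorem measurableSet_positiveCosets {f : BForm} (hc : f.c = 1) (hD : 0 < f.D) :
    MeasurableSet (positiveCosets f) := by
  have e : positiveCosets f = (fun z : BesselQuot f => invariantFn f (fun _ _ => 1) z.rep) ⁻¹' {1} := by
    ext z
    simp [positiveCosets, invariantFn]
  rw [e]
  exact measurable_invariantFn_rep hc hD measurable_const (measurableSet_singleton 1)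

theorem measurable_cosetCoord {f : BForm} (hc : f.c = 1) (hD : 0 < f.D) : Measurable (cosetCoord f) := by
  refine measurable_of_comp_mk ?_
  have e : ∀ h, cosetCoord f (BesselQuot.mk f h) =
      (Real.sqrt (ptIm h).det / f.tr (ptIm h), f.tr (ptIm h)) := by
    intro h
    obtain ⟨r, hr, e⟩ := mk_eq_mk.1 (mk_rep (BesselQuot.mk f h))
    rw [cosetCoord, e, det_ptIm_besselR hc hD hr, tr_ptIm_besselR hc hD hr]
  simp only [e]
  have h1 := (continuous_tr_ptIm f).measurable
  exact ((continuous_det_ptIm.measurable.sqrt).div h1).prodMk h1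

/-- In suitable coordinates the invariant measure is a product measure. -/
theorem map_cosetCoord {f : BForm} (hc : f.c = 1) (hD : 0 < f.D) {ν : Measure (BesselQuot f)}
    (hν : IsInvariantMeasure f ν) :
    (ν.restrict (positiveCosets f)).map (cosetCoord f) = ENNReal.ofReal (Real.pi / Real.sqrt f.D) •
      (lowMeasure (Real.sqrt f.D)⁻¹).prod heightMeasure := by
  refine Measure.ext_of_lintegral _ fun F hF => ?_
  have hΨ : Measurable (Function.uncurry fun v t => F (v, t)) := hF
  have hΨ' : Measurable (Function.uncurry fun x t : ℝ => F (x / t, t)) :=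
    hF.comp ((measurable_fst.div measurable_snd).prodMk measurable_snd)
  rw [lintegral_map hF (measurable_cosetCoord hc hD), lintegral_smul_measure, smul_eq_mul,
    ← lintegral_cone (Ψ := fun v t => F (v, t)) (Real.sqrt_pos.2 hD) hΨ,
    ← lintegral_invariantFn (Ψ := fun x t => F (x / t, t)) hc hD hν hΨ',
    ← lintegral_indicator (measurableSet_positiveCosets hc hD)]
  refine lintegral_congr fun z => ?_
  by_cases hz : 0 < mult (mat z.rep)
  · rw [indicator_of_mem (s := positiveCosets f) hz, invariantFn, if_pos hz]
    rfl
  · rw [indicator_of_notMem (s := positiveCosets f) hz, invariantFn, if_neg hz]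

/-- The elementary factor `∫ v^{α-5} dv` over `0 < v < δ⁻¹` of the zeta integral. -/
theorem lowMeasure_cpow {δ : ℝ} (hδ : 0 < δ) {α : ℂ} (hα : 4 < α.re) :
    Integrable (fun v : ℝ => (v : ℂ) ^ α) (lowMeasure δ⁻¹) ∧
      ∫ v, (v : ℂ) ^ α ∂lowMeasure δ⁻¹ = (δ : ℂ) ^ (4 - α) / (α - 4) := by
  have hr : -1 < (α - 5).re := by simp; linarith
  have e : EqOn (fun v : ℝ => (ENNReal.ofReal (v⁻¹ ^ 5)).toReal • (v : ℂ) ^ α)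
      (fun v : ℝ => (v : ℂ) ^ (α - 5)) (Ioo 0 δ⁻¹) := by
    intro v hv
    have hv0 : (v : ℂ) ≠ 0 := by exact_mod_cast hv.1.ne'
    have hv1 : 0 ≤ v⁻¹ ^ 5 := pow_nonneg (inv_nonneg.2 hv.1.le) 5
    dsimp only
    rw [ENNReal.toReal_ofReal hv1, Complex.cpow_sub _ _ hv0, Complex.real_smul]
    have h5 : (v : ℂ) ^ (5 : ℂ) = (v : ℂ) ^ 5 := by exact_mod_cast Complex.cpow_natCast (v : ℂ) 5
    rw [h5]
    push_cast
    field_simp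
  have hi : IntervalIntegrable (fun x : ℝ => (x : ℂ) ^ (α - 5)) volume 0 δ⁻¹ :=
    intervalIntegral.intervalIntegrable_cpow' hr
  have hδ' : (0 : ℝ) ≤ δ⁻¹ := (inv_pos.2 hδ).le
  constructor
  · rw [lowMeasure, integrable_withDensity_iff_integrable_smul' (by fun_prop) (by simp)]
    change IntegrableOn _ _ _
    rw [integrableOn_congr_fun e measurableSet_Ioo, ← integrableOn_Ioc_iff_integrableOn_Ioo]
    exact (intervalIntegrable_iff_integrableOn_Ioc_of_le hδ').1 hi
  · rw [lowMeasure, integral_withDensity_eq_integral_toReal_smul (by fun_prop) (by simp),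
      setIntegral_congr_fun measurableSet_Ioo e, ← integral_Ioc_eq_integral_Ioo,
      ← intervalIntegral.integral_of_le hδ', integral_cpow (Or.inl hr)]
    have h0 : α - 5 + 1 ≠ 0 := by
      intro h
      have := congrArg Complex.re h
      simp at this hr
      linarith
    rw [Complex.ofReal_zero, Complex.zero_cpow h0, sub_zero, show α - 5 + 1 = α - 4 by ring,
      Complex.ofReal_inv, Complex.inv_cpow _ _ (by
        rw [Complex.arg_ofReal_of_nonneg hδ.le]; exact Real.pi_pos.ne), ← Complex.cpow_neg, neg_sub]

/-- The Mellin transform of the Whittaker function in the variable `t`. -/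
theorem heightMeasure_whittaker {h w w' : ℝ → ℂ} {k m a q β : ℂ} (hw : WhittakerPair k m w w')
    (hh : ∀ t : ℝ, 0 < t → h t = a * ((4 * Real.pi * t : ℝ) : ℂ) ^ (q / 2) * w (4 * Real.pi * t))
    (h1 : 0 < (1 / 2 + m + (β - 3 + q / 2)).re) (h2 : 0 < (1 / 2 - m + (β - 3 + q / 2)).re) :
    Integrable (fun t : ℝ => (t : ℂ) ^ β * Complex.exp (-(2 * Real.pi * t)) * h t) heightMeasure ∧
      ∫ t, (t : ℂ) ^ β * Complex.exp (-(2 * Real.pi * t)) * h t ∂heightMeasure =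
        a * ((4 * Real.pi : ℝ) : ℂ) ^ (3 - β) * (Complex.Gamma (1 / 2 + m + (β - 3 + q / 2)) *
          Complex.Gamma (1 / 2 - m + (β - 3 + q / 2)) / Complex.Gamma (β - 3 + q / 2 - k + 1)) := by
  have hp : 0 < 4 * Real.pi := by positivity
  set p : ℝ := 4 * Real.pi with hpdef
  have hpc : (p : ℂ) ≠ 0 := by exact_mod_cast hp.ne'
  set g : ℝ → ℂ := fun x => Complex.exp (-(x : ℂ) / 2) * (x : ℂ) ^ (β - 3 + q / 2 - 1) * w x with hg
  have e : EqOn (fun t : ℝ => (ENNReal.ofReal (t⁻¹ ^ 4)).toReal •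
      ((t : ℂ) ^ β * Complex.exp (-(2 * Real.pi * t)) * h t))
      (fun t : ℝ => (a * (p : ℂ) ^ (4 - β)) * g (p * t)) (Ioi 0) := by
    intro t ht
    have ht0 : 0 < t := ht
    have htc : (t : ℂ) ≠ 0 := by exact_mod_cast ht0.ne'
    have h4 : (t : ℂ) ^ (4 : ℂ) = (t : ℂ) ^ 4 := by exact_mod_cast Complex.cpow_natCast (t : ℂ) 4
    have e1 : ((p * t : ℝ) : ℂ) ^ (β - 3 + q / 2 - 1) = (p : ℂ) ^ (β - 4) *
        ((t : ℂ) ^ β / (t : ℂ) ^ 4) * ((p * t : ℝ) : ℂ) ^ (q / 2) := by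
      rw [show β - 3 + q / 2 - 1 = (β - 4) + q / 2 by ring, Complex.cpow_add _ _ (by
        exact_mod_cast (mul_pos hp ht0).ne'), ← h4, ← Complex.cpow_sub _ _ htc, Complex.ofReal_mul p t,
        Complex.mul_cpow_ofReal_nonneg hp.le ht0.le (β - 4)]
    have e2 : (p : ℂ) ^ (4 - β) * (p : ℂ) ^ (β - 4) = 1 := by
      rw [← Complex.cpow_add _ _ hpc, show 4 - β + (β - 4) = 0 by ring, Complex.cpow_zero]
    dsimp only
    rw [hh t ht0, ENNReal.toReal_ofReal (by positivity), Complex.real_smul, hg]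
    dsimp only
    rw [e1, show -((p * t : ℝ) : ℂ) / 2 = -(2 * Real.pi * t) by rw [hpdef]; push_cast; ring]
    push_cast
    linear_combination (-((a * ((p : ℂ) * t) ^ (q / 2) * w (p * t)) * ((t : ℂ) ^ β / (t : ℂ) ^ 4) *
      Complex.exp (-(2 * Real.pi * t)))) * e2
  have hi := hw.integrable _ h1 h2
  have hgi : IntegrableOn (fun t => g (p * t)) (Ioi 0) := by
    rw [integrableOn_Ioi_comp_mul_left_iff g 0 hp, mul_zero]
    exact hi
  constructor
  · rw [heightMeasure, integrable_withDensity_iff_integrable_smul' (by fun_prop) (by simp)]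
    change IntegrableOn _ _ _
    rw [integrableOn_congr_fun e measurableSet_Ioi]
    exact hgi.const_mul _
  · rw [heightMeasure, integral_withDensity_eq_integral_toReal_smul (by fun_prop) (by simp),
      setIntegral_congr_fun measurableSet_Ioi e, integral_const_mul, integral_comp_mul_left_Ioi g 0 hp,
      mul_zero, hw.mellin _ h1 h2, Complex.real_smul, show 4 - β = (3 - β) + 1 by ring,
      Complex.cpow_add _ _ hpc, Complex.cpow_one]
    push_cast
    field_simp

end

/-! ### Evaluation of the zeta integral -/

section

open Filter Topology Set
open scoped ENNReal

theorem ofReal_sqrt_cpow {x : ℝ} (hx : 0 < x) (q : ℂ) :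
    ((Real.sqrt x : ℝ) : ℂ) ^ q = (x : ℂ) ^ (q / 2) := by
  have hs := Real.sqrt_pos.2 hx
  rw [Complex.cpow_def_of_ne_zero (by exact_mod_cast hs.ne'),
    Complex.cpow_def_of_ne_zero (by exact_mod_cast hx.ne'), ← Complex.ofReal_log hs.le,
    ← Complex.ofReal_log hx.le, Real.log_sqrt hx.le]
  push_cast
  congr 1
  ring

theorem charAt_sqrt {ω : ℝˣ →* ℂˣ} {q : ℂ} (hq : ∀ y : ℝˣ, 0 < (y : ℝ) → (ω y : ℂ) = ((y : ℝ) : ℂ) ^ q)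
    {x : ℝ} (hx : 0 < x) : charAt ω (Real.sqrt x) = (x : ℂ) ^ (q / 2) := by
  have hs := Real.sqrt_pos.2 hx
  rw [charAt, dif_pos hs.ne', hq _ hs]
  exact ofReal_sqrt_cpow hx q

/-- In the coordinates `v = x / t` and `t` the kernel is a product `v^α · t^β e^{-2πt} W(diag(t, 1))`, so
the zeta integral is an elementary integral over `v` times the Mellin transform of `e^{-x/2}` times a
Whittaker function. -/
theorem zeta_evaluation {f : BForm} (hc : f.c = 1) (hD : 0 < f.D) {ν : Measure (BesselQuot f)}
    (hν : IsInvariantMeasure f ν) {l : ℕ} {W : GL2 → ℂ} {χ₀ : ℂˣ →* ℂˣ} {q r s a : ℂ}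
    (hE : ∀ h : GSp4, integrand f l W χ₀ s h = if 0 < mult (mat h) then
      zetaKernel l W q s (Real.sqrt (ptIm h).det) (f.tr (ptIm h)) else 0)
    (hW : ∀ t : ℝ, 0 < t → W (diagOne t) = a * ((4 * Real.pi * t : ℝ) : ℂ) ^ (q / 2) *
      whittakerW ((l / 2 : ℝ) : ℂ) (Complex.I * r / 2) (4 * Real.pi * t))
    (h1 : 1 < (6 * s + l - q).re)
    (h2 : 0 < (3 * s + l - 1 + Complex.I * r / 2 - q / 2).re)
    (h3 : 0 < (3 * s + l - 1 - Complex.I * r / 2 - q / 2).re) :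
    Converges f l W χ₀ ν s ∧ zetaIntegral f l W χ₀ ν s =
      a / 2 * Real.pi * (f.D : ℂ) ^ (-3 * s - (l : ℂ) / 2 + q / 2) *
        ((4 * Real.pi : ℝ) : ℂ) ^ (-3 * s + 3 / 2 - (l : ℂ) + q) *
        (Complex.Gamma (3 * s + l - 1 + Complex.I * r / 2 - q / 2) *
          Complex.Gamma (3 * s + l - 1 - Complex.I * r / 2 - q / 2) /
          Complex.Gamma (3 * s + (l + 1 - q) / 2)) := by
  obtain ⟨w, w', hw, hwW⟩ := exists_whittakerPair_eq (l / 2) (Complex.I * r / 2)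
  have hpi : 0 < 4 * Real.pi := by positivity
  set α : ℂ := 6 * s + 3 + l - q with hα
  set β : ℂ := α - (3 * s + 3 / 2) with hβ
  have hs := Real.sqrt_pos.2 hD
  have hα4 : 4 < α.re := by
    have e : α = (6 * s + l - q) + ((3 : ℝ) : ℂ) := by rw [hα]; push_cast; ring
    rw [e, Complex.add_re, Complex.ofReal_re]; linarith
  have ep : 1 / 2 + Complex.I * r / 2 + (β - 3 + q / 2) = 3 * s + l - 1 + Complex.I * r / 2 - q / 2 := by
    rw [hβ, hα]; ring
  have em : 1 / 2 - Complex.I * r / 2 + (β - 3 + q / 2) = 3 * s + l - 1 - Complex.I * r / 2 - q / 2 := by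
    rw [hβ, hα]; ring
  obtain ⟨i1, v1⟩ := lowMeasure_cpow hs hα4
  obtain ⟨i2, v2⟩ := heightMeasure_whittaker (h := fun t => W (diagOne t)) (q := q) (β := β) hw
    (fun t ht => by rw [hW t ht, hwW _ (mul_pos hpi ht)]) (ep ▸ h2) (em ▸ h3)
  rw [ep, em] at v2
  set F₁ : ℝ → ℂ := fun v => (v : ℂ) ^ α with hF₁
  set F₂ : ℝ → ℂ := fun t => (t : ℂ) ^ β * Complex.exp (-(2 * Real.pi * t)) * W (diagOne t) with hF₂
  have hmap := map_cosetCoord hc hD hν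
  have hint : Integrable (fun p : ℝ × ℝ => F₁ p.1 * F₂ p.2)
      ((ν.restrict (positiveCosets f)).map (cosetCoord f)) := by
    rw [hmap]
    exact (i1.mul_prod i2).smul_measure ENNReal.ofReal_ne_top
  -- the integrand in the two coordinates
  have hEz : ∀ z : BesselQuot f, integrand f l W χ₀ s z.rep = (positiveCosets f).indicator
      (fun z => F₁ (cosetCoord f z).1 * F₂ (cosetCoord f z).2) z := by
    intro z
    rw [hE]
    by_cases hz : 0 < mult (mat z.rep)
    · rw [if_pos hz, indicator_of_mem (s := positiveCosets f) hz]
      have hd := Real.sqrt_pos.2 (det_ptIm_pos z.rep hz)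
      have ht : 0 < f.tr (ptIm z.rep) := by
        obtain ⟨-, e⟩ := coord_spec hc z.rep hz
        rw [e]; positivity
      simp only [cosetCoord, hF₁, hF₂, zetaKernel]
      set x := Real.sqrt (ptIm z.rep).det
      set t := f.tr (ptIm z.rep)
      have htc : (t : ℂ) ≠ 0 := by exact_mod_cast ht.ne'
      have e1 : ((x / t : ℝ) : ℂ) ^ α * (t : ℂ) ^ α = (x : ℂ) ^ α := by
        rw [← Complex.mul_cpow_ofReal_nonneg (div_pos hd ht).le ht.le, ← Complex.ofReal_mul,
          div_mul_cancel₀ x ht.ne']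
      have e2 : (t : ℂ) ^ β = (t : ℂ) ^ α * (t : ℂ) ^ (-(3 * s + 3 / 2)) := by
        rw [hβ, sub_eq_add_neg, Complex.cpow_add _ _ htc]
      rw [e2, ← hα, ← e1]
      ring
    · rw [if_neg hz, indicator_of_notMem (s := positiveCosets f) hz]
  have hm := measurableSet_positiveCosets hc hD
  have hφ := measurable_cosetCoord hc hD
  rw [Converges, zetaIntegral]
  simp only [hEz]
  refine ⟨(integrable_indicator_iff hm).2
    ((integrable_map_measure hint.aestronglyMeasurable hφ.aemeasurable).1 hint), ?_⟩
  rw [integral_indicator hm, ← integral_map (f := fun p : ℝ × ℝ => F₁ p.1 * F₂ p.2) hφ.aemeasurable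
    hint.aestronglyMeasurable, hmap, integral_smul_measure, integral_prod_mul, v1, v2,
    ENNReal.toReal_ofReal (by positivity), Complex.real_smul]
  -- the recursion of the Gamma function for the last factor
  set z : ℂ := 3 * s + (l - 1 - q) / 2 with hz
  have hzα : α - 4 = 2 * z := by rw [hα, hz]; ring
  have hz0 : z ≠ 0 := by
    intro h0
    rw [h0, mul_zero] at hzα
    have : α.re = 4 := by rw [sub_eq_zero.1 hzα]; simp
    linarith
  have hG1 : β - 3 + q / 2 - ((l / 2 : ℝ) : ℂ) + 1 = z := by
    rw [hβ, hα, hz]; push_cast; ring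
  have hG2 : 3 * s + ((l : ℂ) + 1 - q) / 2 = z + 1 := by rw [hz]; ring
  rw [hG1, hG2, Complex.Gamma_add_one _ hz0, hzα]
  have hDpow : ((Real.sqrt f.D : ℝ) : ℂ) ^ (4 - α) / ((Real.sqrt f.D : ℝ) : ℂ) =
      (f.D : ℂ) ^ (-3 * s - (l : ℂ) / 2 + q / 2) := by
    have hsc : ((Real.sqrt f.D : ℝ) : ℂ) ≠ 0 := by exact_mod_cast hs.ne'
    have e : ((Real.sqrt f.D : ℝ) : ℂ) ^ (4 - α - 1) =
        (f.D : ℂ) ^ (-3 * s - (l : ℂ) / 2 + q / 2) := by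
      rw [ofReal_sqrt_cpow hD]
      congr 1
      rw [hα]; ring
    rw [← e, Complex.cpow_sub (4 - α) 1 hsc, Complex.cpow_one]
  have hexp : 3 - β = -3 * s + 3 / 2 - (l : ℂ) + q := by rw [hβ, hα]; ring
  rw [hexp, ← hDpow]
  push_cast
  rcases eq_or_ne (Complex.Gamma z) 0 with hg | hg
  · simp [hg]
  · have hsc : ((Real.sqrt f.D : ℝ) : ℂ) ≠ 0 := by exact_mod_cast hs.ne'
    field_simp

theorem meromorphicOn_zetaFactor_mul {D : ℕ} (hD : 0 < D) (a : ℂ) (l : ℕ) (q m : ℂ) :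
    MeromorphicOn (fun s : ℂ => zetaFactor a D l q s *
      (Complex.Gamma (3 * s + l - 1 + m - q / 2) * Complex.Gamma (3 * s + l - 1 - m - q / 2) /
        Complex.Gamma (3 * s + (l + 1 - q) / 2))) univ := by
  have hDc : (D : ℂ) ≠ 0 := by exact_mod_cast hD.ne'
  have hpi : ((4 * Real.pi : ℝ) : ℂ) ≠ 0 := by exact_mod_cast (by positivity : 4 * Real.pi ≠ 0)
  have hΓ : ∀ {g : ℂ → ℂ} (s : ℂ), Differentiable ℂ g → MeromorphicAt (fun s => Complex.Gamma (g s)) s :=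
    fun s hg => (Meromorphic.Gamma _).comp_analyticAt (hg.analyticAt s)
  have hF : zetaFactor a D l q = fun s => a / 2 * Real.pi *
      Complex.exp (Complex.log D * (-3 * s - (l : ℂ) / 2 + q / 2)) *
      Complex.exp (Complex.log ((4 * Real.pi : ℝ) : ℂ) * (-3 * s + 3 / 2 - (l : ℂ) + q)) := by
    funext s
    rw [zetaFactor, Complex.cpow_def_of_ne_zero hDc, Complex.cpow_def_of_ne_zero hpi]
  intro s _
  rw [hF]
  refine MeromorphicAt.mul (AnalyticAt.meromorphicAt ?_)
    (((hΓ s (by fun_prop)).mul (hΓ s (by fun_prop))).div (hΓ s (by fun_prop)))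
  exact Differentiable.analyticAt (by fun_prop) s

end

end BesselZeta

end

open BesselZeta in
theorem theorem4
    (D l : ℕ) (hD : 0 < D) (hl : 0 < l) (hD4 : D % 4 = 0 ∨ D % 4 = 3)
    -- the Whittaker model of `τ`, its central character and its Laplace eigenvalue
    (V : Submodule ℂ (GL2 → ℂ)) (hV : IsWhittakerModel (formOf D).c V)
    (ω : ℝˣ →* ℂˣ) (hω : IsCentralChar V ω)
    (q : ℂ) (hq : ∀ y : ℝˣ, 0 < (y : ℝ) → (ω y : ℂ) = ((y : ℝ) : ℂ) ^ q)
    (r : ℂ) (hr : ∀ W ∈ V, ∀ g, casimir W g = -(1 / 4 + (r / 2) ^ 2) * W g)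
    -- the vector of weight `l`
    (W₀ : GL2 → ℂ) (hW₀ : W₀ ∈ V) (hW₀l : W₀ ∈ weightSpace l)
    -- the character `χ₀` of `ℂˣ`
    (χ₀ : ℂˣ →* ℂˣ)
    (hχω : ∀ x : ℝˣ, χ₀ (Units.map (Complex.ofRealHom : ℝ →* ℂ) x) = ω x)
    (hχl : ∀ z : ℂˣ, ‖(z : ℂ)‖ = 1 → χ₀ z = z ^ (-(l : ℤ)))
    -- the invariant measure
    (ν : MeasureTheory.Measure (BesselQuot (formOf D)))
    (hν : IsInvariantMeasure (formOf D) ν) :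
    -- the integrand is a function on `R(ℝ) \ H(ℝ)`
    (∀ (s : ℂ), ∀ t ∈ besselR (formOf D), ∀ h : GSp4,
      integrand (formOf D) l W₀ χ₀ s (t * h) = integrand (formOf D) l W₀ χ₀ s h) ∧
    ∃ a_pos a_neg : ℂ,
      -- the constants `a⁺` and `a⁻`
      (∀ t : ℝˣ, 0 < (t : ℝ) → W₀ (upper t 1 0) =
        a_pos * charAt ω (Real.sqrt (4 * Real.pi * (formOf D).c * t)) *
          whittakerW ((l : ℂ) / 2) (Complex.I * r / 2) (4 * Real.pi * (formOf D).c * t)) ∧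
      (∀ t : ℝˣ, (t : ℝ) < 0 → W₀ (upper t 1 0) =
        a_neg * charAt ω (Real.sqrt (-(4 * Real.pi * (formOf D).c * t))) *
          whittakerW (-((l : ℂ) / 2)) (Complex.I * r / 2) (-(4 * Real.pi * (formOf D).c * t))) ∧
      -- the evaluation of the integral where it converges
      (∀ s : ℂ, 1 < (6 * s + l - q).re →
        0 < (3 * s + l - 1 + Complex.I * r / 2 - q / 2).re →
        0 < (3 * s + l - 1 - Complex.I * r / 2 - q / 2).re →
        Converges (formOf D) l W₀ χ₀ ν s ∧
        zetaIntegral (formOf D) l W₀ χ₀ ν s = zetaFactor a_pos D l q s *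
          (Complex.Gamma (3 * s + l - 1 + Complex.I * r / 2 - q / 2) *
            Complex.Gamma (3 * s + l - 1 - Complex.I * r / 2 - q / 2) /
            Complex.Gamma (3 * s + (l + 1 - q) / 2))) ∧
      -- the formula gives the meromorphic continuation to all `s`
      MeromorphicOn (fun s : ℂ => zetaFactor a_pos D l q s *
          (Complex.Gamma (3 * s + l - 1 + Complex.I * r / 2 - q / 2) *
            Complex.Gamma (3 * s + l - 1 - Complex.I * r / 2 - q / 2) /
            Complex.Gamma (3 * s + (l + 1 - q) / 2))) Set.univ ∧
      -- the case of a principal series representation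
      (∀ (ε₁ ε₂ : Fin 2) (s₁ s₂ : ℂ),
        IsGKIso V (principalSeries (quasiChar ε₁ s₁) (quasiChar ε₂ s₂)) →
        ∀ s : ℂ, 1 < (6 * s + l - s₁ - s₂).re →
          0 < (3 * s + l - 1 - s₁).re → 0 < (3 * s + l - 1 - s₂).re →
          Converges (formOf D) l W₀ χ₀ ν s ∧
          zetaIntegral (formOf D) l W₀ χ₀ ν s = zetaFactor a_pos D l (s₁ + s₂) s *
            (Complex.Gamma (3 * s + l - 1 - s₁) * Complex.Gamma (3 * s + l - 1 - s₂) /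
              Complex.Gamma (3 * s + (l + 1 - s₁ - s₂) / 2))) ∧
      -- the case of a discrete series representation
      (∀ l₁ : ℕ, 0 < l₁ → IsDiscreteSeries l₁ V →
        ∀ s : ℂ, 1 < (6 * s + l - q).re →
          0 < (3 * s + l - 1 - ((l₁ : ℂ) - 1) / 2 - q / 2).re →
          Converges (formOf D) l W₀ χ₀ ν s ∧
          zetaIntegral (formOf D) l W₀ χ₀ ν s = zetaFactor a_pos D l q s *
            (Complex.Gamma (3 * s + l - 1 + ((l₁ : ℂ) - 1) / 2 - q / 2) *
              Complex.Gamma (3 * s + l - 1 - ((l₁ : ℂ) - 1) / 2 - q / 2) /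
              Complex.Gamma (3 * s + (l + 1 - q) / 2))) := by
  have hc := formOf_c D
  have hDr : 0 < (formOf D).D := by rw [formOf_D]; exact_mod_cast hD
  have hN := hV.whittaker W₀ hW₀
  have hω₀ := hω W₀ hW₀
  have hE := integrand_eq (formOf D) hc hDr hN hω₀ hW₀l hq hχω hχl
  have hcharAt : ∀ x : ℝ, 0 < x → charAt ω (Real.sqrt x) = (x : ℂ) ^ (q / 2) := fun x hx =>
    charAt_sqrt hq hx
  -- the signs `1` and `-1` give the values at positive and at negative `t`
  obtain ⟨a_pos, ha_pos⟩ := exists_whittaker_eq (hc ▸ zero_lt_one) hV hω hq hr hW₀ hW₀l (one_pow 2)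
  obtain ⟨a_neg, ha_neg⟩ := exists_whittaker_eq (hc ▸ zero_lt_one) hV hω hq hr hW₀ hW₀l
    (show (-1 : ℝ) ^ 2 = 1 by norm_num)
  have hpi : 0 < 4 * Real.pi := by positivity
  have hpos : ∀ t : ℝ, 0 < t → W₀ (diagOne t) = a_pos * ((4 * Real.pi * t : ℝ) : ℂ) ^ (q / 2) *
      whittakerW ((l / 2 : ℝ) : ℂ) (Complex.I * r / 2) (4 * Real.pi * t) := by
    intro t ht
    have h := ha_pos (4 * Real.pi * t) (mul_pos hpi ht)
    rw [hc, mul_one, one_mul, one_mul, mul_div_cancel_left₀ t hpi.ne', Int.cast_natCast] at h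
    exact h
  have hmain : ∀ s : ℂ, 1 < (6 * s + l - q).re →
      0 < (3 * s + l - 1 + Complex.I * r / 2 - q / 2).re →
      0 < (3 * s + l - 1 - Complex.I * r / 2 - q / 2).re →
      Converges (formOf D) l W₀ χ₀ ν s ∧
      zetaIntegral (formOf D) l W₀ χ₀ ν s = zetaFactor a_pos D l q s *
        (Complex.Gamma (3 * s + l - 1 + Complex.I * r / 2 - q / 2) *
          Complex.Gamma (3 * s + l - 1 - Complex.I * r / 2 - q / 2) /
          Complex.Gamma (3 * s + (l + 1 - q) / 2)) := by
    intro s h1 h2 h3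
    have := zeta_evaluation hc hDr hν (hE s) hpos h1 h2 h3
    rw [formOf_D, Complex.ofReal_natCast] at this
    exact this
  refine ⟨fun s t ht h => ?_, a_pos, a_neg, fun t ht => ?_, fun t ht => ?_, hmain, ?_, ?_, ?_⟩
  · simp only [hE, mult_besselR_mul_pos hc hDr ht, det_ptIm_besselR hc hDr ht, tr_ptIm_besselR hc hDr ht]
  · rw [hc, mul_one, hcharAt _ (mul_pos hpi ht), upper_eq_diagOne, hpos t ht]
    push_cast
    rfl
  · have h0 : 0 < -(4 * Real.pi * (t : ℝ)) := by
      rw [← mul_neg]; exact mul_pos hpi (neg_pos.2 ht)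
    have h := ha_neg _ h0
    rw [hc, mul_one, neg_one_mul, neg_neg, mul_div_cancel_left₀ _ hpi.ne'] at h
    rw [hc, mul_one, hcharAt _ h0, upper_eq_diagOne, h]
    congr 2
    push_cast
    ring
  · exact meromorphicOn_zetaFactor_mul hD a_pos l q _
  · intro ε₁ ε₂ s₁ s₂ hiso s h1 h2 h3
    obtain ⟨rfl, hsq⟩ := principalSeries_parameters hV hω hq hr hiso
    have e0 : 6 * s + (l : ℂ) - s₁ - s₂ = 6 * s + l - (s₁ + s₂) := by ring
    have e3 : (l : ℂ) + 1 - s₁ - s₂ = l + 1 - (s₁ + s₂) := by ring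
    rw [e0] at h1
    rw [e3]
    rcases eq_or_eq_neg_of_I_mul_sq hsq with he | he
    · have ep : 3 * s + (l : ℂ) - 1 + Complex.I * r / 2 - (s₁ + s₂) / 2 = 3 * s + l - 1 - s₂ := by
        rw [he]; ring
      have em : 3 * s + (l : ℂ) - 1 - Complex.I * r / 2 - (s₁ + s₂) / 2 = 3 * s + l - 1 - s₁ := by
        rw [he]; ring
      have h := hmain s h1 (ep ▸ h3) (em ▸ h2)
      rwa [ep, em, mul_comm (Complex.Gamma (3 * s + l - 1 - s₂))] at h
    · have ep : 3 * s + (l : ℂ) - 1 + Complex.I * r / 2 - (s₁ + s₂) / 2 = 3 * s + l - 1 - s₁ := by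
        rw [he]; ring
      have em : 3 * s + (l : ℂ) - 1 - Complex.I * r / 2 - (s₁ + s₂) / 2 = 3 * s + l - 1 - s₂ := by
        rw [he]; ring
      have h := hmain s h1 (ep ▸ h2) (em ▸ h3)
      rwa [ep, em] at h
  · intro l₁ hl₁ hds s h1 h2
    -- the other argument has the larger real part
    have h3 : 0 < (3 * s + (l : ℂ) - 1 + ((l₁ : ℂ) - 1) / 2 - q / 2).re := by
      have hle : (0 : ℝ) ≤ (l₁ : ℝ) - 1 := sub_nonneg.2 (by exact_mod_cast hl₁)
      have e : 3 * s + (l : ℂ) - 1 + ((l₁ : ℂ) - 1) / 2 - q / 2 =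
          (3 * s + (l : ℂ) - 1 - ((l₁ : ℂ) - 1) / 2 - q / 2) + (((l₁ : ℝ) - 1 : ℝ) : ℂ) := by
        push_cast; ring
      rw [e, Complex.add_re, Complex.ofReal_re]
      linarith
    rcases eq_or_eq_neg_of_I_mul_sq (hds.eigenvalue hV.smooth hr) with he | he
    · have h := hmain s h1 (by rw [he]; exact h3) (by rw [he]; exact h2)
      rwa [he] at h
    · have ep : 3 * s + (l : ℂ) - 1 + Complex.I * r / 2 - q / 2 =
          3 * s + l - 1 - ((l₁ : ℂ) - 1) / 2 - q / 2 := by rw [he]; ring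
      have em : 3 * s + (l : ℂ) - 1 - Complex.I * r / 2 - q / 2 =
          3 * s + l - 1 + ((l₁ : ℂ) - 1) / 2 - q / 2 := by rw [he]; ring
      have h := hmain s h1 (ep ▸ h2) (em ▸ h3)
      rwa [ep, em, mul_comm (Complex.Gamma (3 * s + l - 1 - ((l₁ : ℂ) - 1) / 2 - q / 2))] at h
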